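/- **Setting.** Let $S_1=B_{r_1}(c_1)$ and $S_2=B_{r_2}(c_2)$ be open disks in $\mathbb R^2$ with $r_1\ge r_2>0$ and disjoint interiors, let $d=|c_1-c_2|-r_1-r_2\ge 0$ be their distance, and put $S=S_1\cup S_2$. For a measurable set $E$, $|E|$ is its area and $P(E)$ its (De Giorgi) perimeter, with $P(E)=+\infty$ if $\chi_E\notin BV(\mathbb R^2)$; $\mathrm{co}$ denotes the convex hull. For $r>0$ let $\mathrm{Open}_r(X)$ be the union of the open balls of radius $r$ contained in $X$ and $\mathrm{Close}_r(X)=(\mathrm{Open}_r(X^c))^c$; put $\mathrm{Close}_0(X)=X$ and understand $\mathrm{Close}_{\lambda/0}(X)$ as $\mathrm{co}(X)$. Let $R_c(S)$ be the infimum of the $r>0$ for which $\mathrm{Close}_r(S)$ is connected. For $\lambda>0$ and $s\in[0,1]$ let $$\mathcal F_{s,\lambda}(X)=P(X)+\frac s\lambda|X\setminus S|-\frac{1-s}\lambda|X\cap S| .$$ Let $Y^0_{s,\lambda}=\mathrm{Close}_{\lambda/s}(S)$, $Y^{k}_{s,\lambda}=\mathrm{Close}_{\lambda/s}\big(\mathrm{Open}_{\lambda/(1-s)}(Y^{k-1}_{s,\lambda})\cap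 S\big)$ for $k\ge1$, and $\Gamma_{s,\lambda}(S)=\bigcap_k Y^k_{s,\lambda}$. Put $\Phi(r)=P(\mathrm{Close}_r S)+\frac1r|\mathrm{Close}_r S\setminus S|$ for $r>0$ and $\Phi(0)=P(S)$. **Proposition.** Assume $P(S)>P(\mathrm{co}(S))$. (a) There is a unique $R_1\in[R_c(S),\infty)$ with $\Phi(R_1)=P(S)$. Put $s_2(\lambda)=1-\lambda\frac{P(S_2)}{|S_2|}$ and $\lambda_1=\frac{R_1|S_2|}{R_1P(S_2)+|S_2|}$. Then $\lambda_1\in\big[0,\frac{|S_2|}{P(S_2)}\big]$, $s_2(\lambda_1)>0$, and $\lambda_1$ is the only solution of $\frac{\lambda}{s_2(\lambda)}=R_1$. For $0<\lambda\le\frac{|S_2|}{P(S_2)}$ (that is, $s=s_2(\lambda)\ge0$): * if $\lambda<\lambda_1$, then $\mathcal F_{s,\lambda}(\mathrm{Close}_{\lambda/s}S)\ge\mathcal F_{s,\lambda}(S)$, with strict inequality when $\lambda/s>d/2$; * if $\lambda=\lambda_1$, then $\mathcal F_{s,\lambda}(\mathrm{Close}_{\lambda/s}S)=\mathcal F_{s,\lambda}(S)$;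 * if $\lambda>\lambda_1$, then $\mathcal F_{s,\lambda}(\mathrm{Close}_{\lambda/s}S)<\mathcal F_{s,\lambda}(S)$. Moreover $\lambda_1=0\iff R_1=0\iff R_c(S)=0\iff d=0$ (the disks touch), and if $R_c(S)>0$ then $R_1>R_c(S)$. (b)(i) Suppose $\frac{|S_1|}{P(S_1)}<\frac{|S|}{P(\mathrm{co}(S))}$. There is a unique $R_2\in[R_c(S),\infty)$ with $\Phi(R_2)=P(S_1)\frac{|S|}{|S_1|}$. Put $s_1(\lambda)=1-\lambda\frac{P(S_1)}{|S_1|}$ and $\lambda_2=\frac{R_2|S_1|}{R_2P(S_1)+|S_1|}$. Then $\lambda_2\in\big[\lambda_1,\frac{|S_1|}{P(S_1)}\big]$, $s_1(\lambda_2)>0$ and $\frac{\lambda_2}{s_1(\lambda_2)}=R_2$. For $0<\lambda\le\frac{|S_1|}{P(S_1)}$ and $s=s_1(\lambda)$: * if $\lambda<\lambda_2$, then $\mathcal F_{s,\lambda}(\mathrm{Close}_{\lambda/s}S)\ge\mathcal F_{s,\lambda}(S_1)$, with strict inequality when $r_1>r_2$ or $\lambda/s>d/2$; * if $\lambda=\lambda_2$,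 then $\mathcal F_{s,\lambda}(\mathrm{Close}_{\lambda/s}S)=\mathcal F_{s,\lambda}(S_1)$; * if $\lambda>\lambda_2$, then $\mathcal F_{s,\lambda}(\mathrm{Close}_{\lambda/s}S)<\mathcal F_{s,\lambda}(S_1)$. Moreover $R_1=R_2\iff\frac{P(S_1)}{|S_1|}=\frac{P(S_2)}{|S_2|}\iff\lambda_1=\lambda_2$. Finally, $R_2=0$ if and only if $R_c(S)=0$ and $\frac{P(S_1)}{|S_1|}=\frac{P(S_2)}{|S_2|}$, and in that case $R_1=0$ and $\lambda_1=\lambda_2=0$. (b)(ii) Suppose $\frac{|S|}{P(\mathrm{co}(S))}\le\frac{|S_1|}{P(S_1)}$. Then there is a least $\lambda>0$ with $\mathcal F_{0,\lambda}(\Gamma_{0,\lambda}(S))=\mathcal F_{0,\lambda}(S_1)$; call it $\lambda_2$. The equation $$\lambda=\frac{|\Gamma_{0,\lambda}(S)\cap S_2|}{P(\Gamma_{0,\lambda}(S))-P(S_1)}$$ has no solution $\lambda>0$ (with nonzero denominator) other than $\lambda_2$, and if $d>0$ or $r_1<8r_2$ then $P(\Gamma_{0,\lambda_2}(S))>P(S_1)$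 and $\lambda_2$ is a solution of it. If $\frac{|S_2|}{P(\mathrm{co}(S))-P(S_1)}\le r_2$, then $\lambda_2=\frac{|S_2|}{P(\mathrm{co}(S))-P(S_1)}$. (c) Put $\lambda_3=\max\big\{\frac{|S_1|}{P(S_1)},\frac{|S|}{P(\mathrm{co}(S))}\big\}$. Then $\lambda_1\le\lambda_2\le\lambda_3$. -/

import Mathlib

open MeasureTheory Set
open scoped ENNReal ContDiff

/-- The Euclidean plane. -/
abbrev Plane : Type := EuclideanSpace ℝ (Fin 2)

/-- The divergence of a vector field on the plane. -/
noncomputable def divergence (z : Plane → Plane) (x : Plane) : ℝ :=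
  ∑ i : Fin 2, fderiv ℝ z x (EuclideanSpace.single i 1) i

/-- The total variation of the distributional gradient of the indicator function of `E`: the
supremum of `∫_E div z` over the smooth compactly supported fields `z` with `|z| ≤ 1`. -/
noncomputable def variationIndicator (E : Set Plane) : ℝ≥0∞ :=
  ⨆ (z : Plane → Plane) (_ : ContDiff ℝ ∞ z) (_ : HasCompactSupport z) (_ : ∀ x, ‖z x‖ ≤ 1),
    ENNReal.ofReal (∫ x in E, divergence z x)

open Classical in
/-- The perimeter `P(E)`; it is `+∞` when the indicator function of `E` is not in `BV`
(in particular when it is not integrable). -/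
noncomputable def perimeter (E : Set Plane) : ℝ≥0∞ :=
  if NullMeasurableSet E (volume : Measure Plane) ∧ volume E < ⊤ then variationIndicator E else ⊤

/-- The perimeter as a real number (used for sets of finite perimeter). -/
noncomputable def per (E : Set Plane) : ℝ := (perimeter E).toReal

/-- The area as a real number (used for sets of finite area). -/
noncomputable def area (E : Set Plane) : ℝ := (volume E).toReal

/-- The opening of `X`: the union of the open balls of radius `r` contained in `X`. -/
def opening (r : ℝ) (X : Set Plane) : Set Plane :=
  ⋃ x ∈ {x : Plane | Metric.ball x r ⊆ X}, Metric.ball x r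

/-- The closing of `X` with radius `r > 0`: the complement of the opening of the complement.
The closing with radius `0` is `X` itself. -/
noncomputable def closing (r : ℝ) (X : Set Plane) : Set Plane :=
  if 0 < r then (opening r Xᶜ)ᶜ else X

/-- The closing with radius `l / s`, where the closing with radius `l / 0` is understood to be
the convex hull. -/
noncomputable def closingQuot (l s : ℝ) (X : Set Plane) : Set Plane :=
  if s = 0 then convexHull ℝ X else closing (l / s) X

/-- The critical radius `R_c(S)`: the smallest radius `r` for which the closing is connected, as an
infimum over `r > 0` (so that it is `0` for two tangent disks). -/
noncomputable def criticalRadius (S : Set Plane) : ℝ :=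
  sInf {r : ℝ | 0 < r ∧ IsConnected (closing r S)}

/-- `P(Close_r S) + |Close_r S \ S| / r`. For `r = 0` the quotient is `0 / 0 = 0`, and the value
is `P(S)`. -/
noncomputable def closingEnergy (S : Set Plane) (r : ℝ) : ℝ≥0∞ :=
  perimeter (closing r S) + volume (closing r S \ S) / ENNReal.ofReal r

/-- The functional `F_{s,l}(X) = P(X) + (s/l) |X \ S| - ((1-s)/l) |X ∩ S|`. -/
noncomputable def energy (S : Set Plane) (s l : ℝ) (X : Set Plane) : EReal :=
  ((perimeter X : ℝ≥0∞) : EReal) + ((s / l : ℝ) : EReal) * ((volume (X \ S) : ℝ≥0∞) : EReal)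
    - (((1 - s) / l : ℝ) : EReal) * ((volume (X ∩ S) : ℝ≥0∞) : EReal)

/-- The sets `Y^k`: `Y^0 = Close_{l/s}(S)`, `X^{k+1} = Open_{l/(1-s)}(Y^k)` and
`Y^{k+1} = Close_{l/s}(X^{k+1} ∩ S)`. -/
noncomputable def gammaSeq (S : Set Plane) (s l : ℝ) : ℕ → Set Plane
  | 0 => closingQuot l s S
  | k + 1 => closingQuot l s (opening (l / (1 - s)) (gammaSeq S s l k) ∩ S)

/-- The set `Γ_{s,l}(S)`, the intersection of all the `Y^k`. -/
noncomputable def gammaSet (S : Set Plane) (s l : ℝ) : Set Plane :=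
  ⋂ k : ℕ, gammaSeq S s l k

/-! A rigid motion puts the centres at `(0, 0)` and `(D, 0)`. Every set whose perimeter matters is
then, up to a null set, the region between the graphs of `-f` and `f` for a piecewise elementary `f
≥ 0`. Gauss–Green together with a density argument gives its De Giorgi perimeter as twice the length
of the graph of `f` over `{f > 0}` (`variationIndicator_profile`). Everything else is planar
geometry and one-variable calculus.

Positive `s`. If `D < r₁ + r₂ + 2r`, there are two disks of radius `r` touching both given disks,
with centres `(p, ±h)`. The closing `Close_r S` is bounded by arcs of the given disks and of the
touching disks. It is connected exactly when `D ≤ gapLen r₁ r + gapLen r₂ r`, the point where the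
touching disks no longer cut through the axis; this determines `R_c`. Up to `R_c` the perimeter of
the closing is at least `P(S)` (`lt_closing_perimeter`, `closing_ae_eq_of_le`). From `R_c` on,
perimeter `P` and added area `G` are explicit in the angles of the triangle with sides `r₁ + r`, `r₂
+ r`, `D`, and the free arcs of curvature `1/r` give `G' = -r P'`. Hence `Φ = P + G/r` has
derivative `-G/r² < 0`, and it decreases to `P(co S)` at infinity (`hasDerivAt_closeVal`,
`tendsto_closeVal`). Every level `T` with `P(co S) < T ≤ P(S)` therefore determines one radius
(`exists_closing_radius`). The level `P(S)` gives `R₁`, the level `P(S₁)|S|/|S₁|` gives `R₂`. On a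
line `s = 1 - λ P(S_i)/|S_i|` the quotient `λ/s` increases with `λ`, and the energy difference to be
compared is `Φ(λ/s)` minus the level, so the sign statements follow (`ClosingRadius.compare`).

Case `s = 0`. Here the iteration opens with radius `λ`, intersects with `S` and takes convex hulls.
For `λ ≤ r₂` it stays at `co S`. For larger `λ` it is controlled by the wedges bounded by two
symmetric tangents of the first disk with normal angle `θ`. Let `hitRad θ` be the radius of the disk
inscribed in the wedge that touches its sides where they enter the second disk. A compactness and
connectedness argument pushes the iterates through all wedges with `hitRad < λ`
(`exists_gammaSeq_subset_wedge`). At the first `θ` with `hitRad θ = λ` they stop, and `Γ` is, up to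
a null set, the hull of the first disk and the inscribed disk (`excessData_gammaSet_of_hit`). If
there is no such `θ` and `r₂ < λ ≤ r₁`, then `Γ` is the first disk up to a null set.

Let `P` and `A` be the excess perimeter and the area gained in the second disk at a hit. Then `A' =
hitRad · P'` and `A' < 0`. For a fixed radius the equation `hitRad θ = c` is a cubic in `sin θ`,
which leaves at most two solutions, so `hitRad` is strictly increasing up to every record. It
follows that `hitRad · P - A` is strictly increasing along the hits (`hitEnergy_strictMonoOn`), so
at most one hit balances the energy. A balanced hit exists if `hitRad` attains its maximum, because
the energy is nonnegative there (`hitEnergy_nonneg_of_max`). The maximum can only be missed for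
tangent disks with `r₁ ≥ 8 r₂`; if then no hit is balanced, `λ₂` is the limiting radius, for which
`Γ` is already the first disk up to a null set.

The bound `λ₂ ≤ r₁/2` in this case rests on a numerical estimate showing that the energy is
nonnegative when `hitRad = r₁/2` (`hitEnergy_nonneg_of_half`). -/

open Filter Topology

/-! ### Coordinates, symmetric profiles and the Gauss–Green formula -/

/-- The point of the plane with given coordinates. -/
noncomputable def pt (x y : ℝ) : Plane := !₂[x, y]

@[simp] lemma pt_zero (x y : ℝ) : pt x y 0 = x := rfl
@[simp] lemma pt_one (x y : ℝ) : pt x y 1 = y := rfl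

lemma pt_eta (w : Plane) : pt (w 0) (w 1) = w := by
  ext i; fin_cases i <;> rfl

/-- The region between the graphs of `-f` and `f`. -/
def profile (f : ℝ → ℝ) : Set Plane := {w | |w 1| < f (w 0)}

/-- Coordinates as a measurable equivalence. -/
noncomputable def coordEquiv : ℝ × ℝ ≃ᵐ Plane :=
  MeasurableEquiv.finTwoArrow.symm.trans (MeasurableEquiv.toLp 2 (Fin 2 → ℝ))

lemma coordEquiv_apply (p : ℝ × ℝ) : coordEquiv p = pt p.1 p.2 := by
  ext i; fin_cases i <;> rfl

lemma measurePreserving_coordEquiv : MeasurePreserving coordEquiv volume volume := by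
  have h1 := (volume_preserving_finTwoArrow ℝ).symm
  have h2 := PiLp.volume_preserving_toLp (Fin 2)
  exact h2.comp h1

lemma continuous_pt {X : Type*} [TopologicalSpace X] {u v : X → ℝ} (hu : Continuous u)
    (hv : Continuous v) : Continuous fun t => pt (u t) (v t) := by
  unfold pt
  fun_prop

lemma measurableSet_profile {f : ℝ → ℝ} (hf : Measurable f) : MeasurableSet (profile f) := by
  have h0 : Measurable fun w : Plane => w 0 := by fun_prop
  have h1 : Measurable fun w : Plane => |w 1| := by fun_prop
  exact measurableSet_lt h1 (hf.comp h0)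

lemma setIntegral_profile {f : ℝ → ℝ} (hf : Measurable f) (h0 : ∀ x, 0 ≤ f x) {g : Plane → ℝ}
    (hg : Integrable g) :
    Integrable (fun x => ∫ y in (-f x)..(f x), g (pt x y)) ∧
    ∫ w in profile f, g w = ∫ x, ∫ y in (-f x)..(f x), g (pt x y) := by
  have hm := measurableSet_profile hf
  have e1 : ∀ x : ℝ, (∫ y in (-f x)..(f x), g (pt x y))
      = ∫ y, ((profile f).indicator g) (pt x y) := by
    intro x
    rw [intervalIntegral.integral_of_le (by linarith [h0 x]), integral_Ioc_eq_integral_Ioo,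
      ← integral_indicator measurableSet_Ioo]
    congr 1
    ext y
    simp only [indicator, profile, mem_ofPred_eq, pt_one, pt_zero, mem_Ioo, abs_lt]
  have hi : Integrable ((profile f).indicator g) := hg.indicator hm
  have hi' : Integrable (fun p : ℝ × ℝ => ((profile f).indicator g) (pt p.1 p.2)) := by
    have := (measurePreserving_coordEquiv.integrable_comp_emb
      coordEquiv.measurableEmbedding).2 hi
    exact this
  simp_rw [e1]
  refine ⟨hi'.integral_prod_left, ?_⟩
  rw [← integral_indicator hm,
    ← measurePreserving_coordEquiv.integral_comp coordEquiv.measurableEmbedding]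
  exact integral_prod _ hi'

lemma hasDerivAt_pt_left (x y : ℝ) :
    HasDerivAt (fun t => pt t y) (EuclideanSpace.single 0 1 : Plane) x := by
  have h := ((hasDerivAt_id x).smul_const (EuclideanSpace.single 0 1 : Plane)).add_const (pt 0 y)
  simp only [one_smul] at h
  refine h.congr_of_eventuallyEq (Eventually.of_forall fun t => ?_)
  ext i; fin_cases i <;> simp [pt]

lemma hasDerivAt_pt_right (x y : ℝ) :
    HasDerivAt (fun t => pt x t) (EuclideanSpace.single 1 1 : Plane) y := by
  have h := ((hasDerivAt_id y).smul_const (EuclideanSpace.single 1 1 : Plane)).add_const (pt x 0)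
  simp only [one_smul] at h
  refine h.congr_of_eventuallyEq (Eventually.of_forall fun t => ?_)
  ext i; fin_cases i <;> simp [pt]

lemma hasDerivAt_comp_pt_left {z : Plane → Plane} (hz : ContDiff ℝ ∞ z) (i : Fin 2) (x y : ℝ) :
    HasDerivAt (fun t => z (pt t y) i) (fderiv ℝ z (pt x y) (EuclideanSpace.single 0 1) i) x := by
  have h := (hz.differentiable (by simp) (pt x y)).hasFDerivAt.comp_hasDerivAt x
    (hasDerivAt_pt_left x y)
  exact (EuclideanSpace.proj (𝕜 := ℝ) i).hasFDerivAt.comp_hasDerivAt _ h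

lemma hasDerivAt_comp_pt_right {z : Plane → Plane} (hz : ContDiff ℝ ∞ z) (i : Fin 2) (x y : ℝ) :
    HasDerivAt (fun t => z (pt x t) i) (fderiv ℝ z (pt x y) (EuclideanSpace.single 1 1) i) y := by
  have h := (hz.differentiable (by simp) (pt x y)).hasFDerivAt.comp_hasDerivAt y
    (hasDerivAt_pt_right x y)
  exact (EuclideanSpace.proj (𝕜 := ℝ) i).hasFDerivAt.comp_hasDerivAt _ h

lemma continuous_fderiv_apply {z : Plane → Plane} (hz : ContDiff ℝ ∞ z) (v : Plane) (i : Fin 2) :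
    Continuous fun w => fderiv ℝ z w v i := by
  have h := (hz.continuous_fderiv (by simp)).clm_apply (continuous_const (y := v))
  exact (by fun_prop : Continuous fun w : Plane => w i).comp h

/-- A bound for the partial derivatives of a compactly supported smooth field. -/
lemma exists_fderiv_apply_bound {z : Plane → Plane} (hz : ContDiff ℝ ∞ z)
    (hc : HasCompactSupport z) (v : Plane) (i : Fin 2) :
    ∃ C, ∀ w, |fderiv ℝ z w v i| ≤ C := by
  have h1 := continuous_fderiv_apply hz v i
  have h2 : HasCompactSupport fun w => fderiv ℝ z w v i := by
    refine (hc.fderiv (𝕜 := ℝ)).comp_left (g := fun L : Plane →L[ℝ] Plane => L v i) ?_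
    simp
  obtain ⟨C, hC⟩ := h2.exists_bound_of_continuous h1
  exact ⟨C, fun w => by simpa using hC w⟩

/-- The derivative of an integral over a vertical chord with moving end point. -/
lemma hasDerivAt_integral_upper {z : Plane → Plane} (hz : ContDiff ℝ ∞ z)
    (hc : HasCompactSupport z) (i : Fin 2) {f : ℝ → ℝ} {f' x₀ : ℝ} (hf : HasDerivAt f f' x₀) :
    HasDerivAt (fun x => ∫ y in (0 : ℝ)..(f x), z (pt x y) i)
      ((∫ y in (0 : ℝ)..(f x₀), fderiv ℝ z (pt x₀ y) (EuclideanSpace.single 0 1) i)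
        + z (pt x₀ (f x₀)) i * f') x₀ := by
  obtain ⟨C, hC⟩ := exists_fderiv_apply_bound hz hc (EuclideanSpace.single 0 1) i
  have hzc : Continuous fun w => z w i :=
    (by fun_prop : Continuous fun w : Plane => w i).comp hz.continuous
  have hcy : ∀ x, Continuous fun y => z (pt x y) i := fun x =>
    hzc.comp (continuous_pt continuous_const continuous_id)
  have hii : ∀ x u v, IntervalIntegrable (fun y => z (pt x y) i) volume u v := fun x u v =>
    (hcy x).intervalIntegrable u v
  -- The increment is split into three parts: the integrand varies over a fixed interval (`h1`), the
  -- end point varies with the integrand frozen at `x₀` (`h2`), and a mixed remainder (`h3`), which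
  -- is bounded by a constant times `|x - x₀| |f x - f x₀|` and is therefore of smaller order.
  have h1 : HasDerivAt (fun x => ∫ y in (0 : ℝ)..(f x₀), z (pt x y) i)
      (∫ y in (0 : ℝ)..(f x₀), fderiv ℝ z (pt x₀ y) (EuclideanSpace.single 0 1) i) x₀ := by
    refine (intervalIntegral.hasDerivAt_integral_of_dominated_loc_of_deriv_le
      (F := fun x y => z (pt x y) i)
      (F' := fun x y => fderiv ℝ z (pt x y) (EuclideanSpace.single 0 1) i)
      (s := univ) (bound := fun _ => C) univ_mem ?_ (hii _ _ _) ?_ ?_ ?_ ?_).2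
    · exact Eventually.of_forall fun x => (hcy x).aestronglyMeasurable
    · exact ((continuous_fderiv_apply hz _ i).comp
        (continuous_pt continuous_const continuous_id)).aestronglyMeasurable
    · exact Eventually.of_forall fun y _ x _ => by simpa using hC (pt x y)
    · exact intervalIntegrable_const
    · exact Eventually.of_forall fun y _ x _ => hasDerivAt_comp_pt_left hz i x y
  have h2 : HasDerivAt (fun x => ∫ y in (f x₀)..(f x), z (pt x₀ y) i)
      (z (pt x₀ (f x₀)) i * f') x₀ := by
    have := intervalIntegral.integral_hasDerivAt_right (hii x₀ (f x₀) (f x₀))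
      ((hcy x₀).stronglyMeasurableAtFilter _ _) (hcy x₀).continuousAt
    exact this.comp x₀ hf
  have h3 : HasDerivAt (fun x => ∫ y in (f x₀)..(f x), (z (pt x y) i - z (pt x₀ y) i)) 0 x₀ := by
    have hlip : ∀ x y, |z (pt x y) i - z (pt x₀ y) i| ≤ C * |x - x₀| := by
      intro x y
      have := Convex.norm_image_sub_le_of_norm_hasDerivWithin_le
        (f := fun t => z (pt t y) i) (C := C) (s := univ) (x := x₀) (y := x)
        (fun t _ => (hasDerivAt_comp_pt_left hz i t y).hasDerivWithinAt)
        (fun t _ => by simpa using hC (pt t y)) convex_univ (mem_univ _) (mem_univ _)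
      simpa using this
    have hb : ∀ x, ‖∫ y in (f x₀)..(f x), (z (pt x y) i - z (pt x₀ y) i)‖
        ≤ C * ‖(x - x₀) * (f x - f x₀)‖ := by
      intro x
      have := intervalIntegral.norm_integral_le_of_norm_le_const (a := f x₀) (b := f x)
        (f := fun y => z (pt x y) i - z (pt x₀ y) i) (C := C * |x - x₀|)
        (fun y _ => by simpa using hlip x y)
      rw [norm_mul, Real.norm_eq_abs, Real.norm_eq_abs, ← mul_assoc]
      exact this
    rw [hasDerivAt_iff_isLittleO]
    simp only [intervalIntegral.integral_same, sub_zero, smul_zero]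
    have h4 : (fun x => (x - x₀) * (f x - f x₀)) =o[𝓝 x₀] fun x => x - x₀ := by
      have h5 : (fun x => f x - f x₀) =o[𝓝 x₀] fun _ => (1 : ℝ) := by
        rw [Asymptotics.isLittleO_one_iff]
        have := hf.continuousAt.tendsto.sub_const (f x₀)
        simpa using this
      have := (Asymptotics.isBigO_refl (fun x => x - x₀) (𝓝 x₀)).mul_isLittleO h5
      simpa using this
    exact (Asymptotics.IsBigO.of_bound C (Eventually.of_forall hb)).trans_isLittleO h4
  have h := (h1.add h2).add h3
  rw [add_zero] at h
  refine h.congr_of_eventuallyEq (Eventually.of_forall fun x => ?_)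
  simp only [Pi.add_apply]
  rw [intervalIntegral.integral_sub (hii _ _ _) (hii _ _ _), add_assoc, add_sub_cancel,
    intervalIntegral.integral_add_adjacent_intervals (hii _ _ _) (hii _ _ _)]

/-- The derivative of an integral over a symmetric vertical chord. -/
lemma hasDerivAt_integral_chord {z : Plane → Plane} (hz : ContDiff ℝ ∞ z)
    (hc : HasCompactSupport z) (i : Fin 2) {f : ℝ → ℝ} {f' x₀ : ℝ} (hf : HasDerivAt f f' x₀) :
    HasDerivAt (fun x => ∫ y in (-f x)..(f x), z (pt x y) i)
      ((∫ y in (-f x₀)..(f x₀), fderiv ℝ z (pt x₀ y) (EuclideanSpace.single 0 1) i)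
        + f' * (z (pt x₀ (f x₀)) i + z (pt x₀ (-f x₀)) i)) x₀ := by
  have h := (hasDerivAt_integral_upper hz hc i hf).sub (hasDerivAt_integral_upper hz hc i hf.neg)
  have hzc : Continuous fun w => z w i :=
    (by fun_prop : Continuous fun w : Plane => w i).comp hz.continuous
  have hii : ∀ x u v, IntervalIntegrable (fun y => z (pt x y) i) volume u v := fun x u v =>
    (hzc.comp (continuous_pt continuous_const continuous_id)).intervalIntegrable u v
  have hii' : ∀ u v, IntervalIntegrable
      (fun y => fderiv ℝ z (pt x₀ y) (EuclideanSpace.single 0 1) i) volume u v := fun u v =>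
    ((continuous_fderiv_apply hz _ i).comp
      (continuous_pt continuous_const continuous_id)).intervalIntegrable u v
  refine (h.congr_of_eventuallyEq (Eventually.of_forall fun x => ?_)).congr_deriv ?_
  · simp only [Pi.sub_apply, Pi.neg_apply]
    rw [intervalIntegral.integral_interval_sub_left (hii _ _ _) (hii _ _ _)]
  · simp only [Pi.neg_apply]
    rw [← intervalIntegral.integral_interval_sub_left (hii' 0 (f x₀)) (hii' 0 (-f x₀))]
    ring

lemma divergence_eq (z : Plane → Plane) (w : Plane) :
    divergence z w = fderiv ℝ z w (EuclideanSpace.single 0 1) 0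
      + fderiv ℝ z w (EuclideanSpace.single 1 1) 1 := by
  simp [divergence, Fin.sum_univ_two]

lemma integrable_divergence {z : Plane → Plane} (hz : ContDiff ℝ ∞ z)
    (hc : HasCompactSupport z) : Integrable (divergence z) := by
  have h : ∀ (v : Plane) (i : Fin 2), Integrable fun w => fderiv ℝ z w v i := by
    intro v i
    refine (continuous_fderiv_apply hz v i).integrable_of_hasCompactSupport ?_
    refine (hc.fderiv (𝕜 := ℝ)).comp_left (g := fun L : Plane →L[ℝ] Plane => L v i) ?_
    simp
  have := (h (EuclideanSpace.single 0 1) 0).add (h (EuclideanSpace.single 1 1) 1)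
  exact this.congr (Eventually.of_forall fun w => (divergence_eq z w).symm)

/-- Gauss–Green formula for a region between graphs. -/
theorem integral_divergence_profile {z : Plane → Plane} (hz : ContDiff ℝ ∞ z)
    (hc : HasCompactSupport z) {f f' : ℝ → ℝ} {a b : ℝ} (hab : a ≤ b) (hf : Continuous f)
    (h0 : ∀ x, 0 ≤ f x) (hs : ∀ x, x ∉ Ioo a b → f x = 0) {s : Set ℝ} (hsc : s.Countable)
    (hd : ∀ x ∈ Ioo a b \ s, HasDerivAt f (f' x) x) (hi : IntervalIntegrable f' volume a b) :
    ∫ w in profile f, divergence z w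
      = ∫ x in a..b, ((z (pt x (f x)) 1 - f' x * z (pt x (f x)) 0)
          - (z (pt x (-f x)) 1 + f' x * z (pt x (-f x)) 0)) := by
  obtain ⟨hI, hE⟩ := setIntegral_profile hf.measurable h0 (integrable_divergence hz hc)
  have hzc : ∀ i, Continuous fun w => z w i := fun i =>
    (by fun_prop : Continuous fun w : Plane => w i).comp hz.continuous
  have hcd : ∀ v i x, Continuous fun y => fderiv ℝ z (pt x y) v i := fun v i x =>
    (continuous_fderiv_apply hz v i).comp (continuous_pt continuous_const continuous_id)
  set A : ℝ → ℝ := fun x => ∫ y in (-f x)..(f x),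
    fderiv ℝ z (pt x y) (EuclideanSpace.single 0 1) 0 with hA
  have hin : ∀ x, (∫ y in (-f x)..(f x), divergence z (pt x y))
      = A x + (z (pt x (f x)) 1 - z (pt x (-f x)) 1) := by
    intro x
    simp_rw [divergence_eq]
    rw [intervalIntegral.integral_add ((hcd _ _ x).intervalIntegrable _ _)
      ((hcd _ _ x).intervalIntegrable _ _)]
    congr 1
    exact intervalIntegral.integral_eq_sub_of_hasDerivAt
      (fun y _ => hasDerivAt_comp_pt_right hz 1 x y) ((hcd _ _ x).intervalIntegrable _ _)
  have hcu : ∀ i, Continuous fun x => z (pt x (f x)) i := fun i =>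
    (hzc i).comp (continuous_pt continuous_id hf)
  have hcl : ∀ i, Continuous fun x => z (pt x (-f x)) i := fun i =>
    (hzc i).comp (continuous_pt continuous_id hf.neg)
  have hAi : IntervalIntegrable A volume a b := by
    have h1 := hI.intervalIntegrable (a := a) (b := b)
    have h2 : IntervalIntegrable (fun x => z (pt x (f x)) 1 - z (pt x (-f x)) 1) volume a b :=
      ((hcu 1).sub (hcl 1)).intervalIntegrable _ _
    refine (h1.sub h2).congr ?_
    exact fun x _ => by simp only; rw [hin]; ring
  have hBi : IntervalIntegrable (fun x => f' x * (z (pt x (f x)) 0 + z (pt x (-f x)) 0))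
      volume a b := hi.mul_continuousOn ((hcu 0).add (hcl 0)).continuousOn
  -- The chord integral of the horizontal component vanishes at `a` and `b`, where the chord is a
  -- point, so its derivative has integral zero. Subtracting this zero turns the interior term into
  -- boundary values.
  have hG : ∫ x in a..b, (A x + f' x * (z (pt x (f x)) 0 + z (pt x (-f x)) 0)) = 0 := by
    have hGc : Continuous fun x => ∫ y in (-f x)..(f x), z (pt x y) 0 := by
      have hc2 : Continuous (Function.uncurry fun x y => z (pt x y) 0) :=
        (hzc 0).comp (continuous_pt continuous_fst continuous_snd)
      have h1 : Continuous fun x => ∫ y in (0 : ℝ)..(f x), z (pt x y) 0 :=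
        intervalIntegral.continuous_parametric_intervalIntegral_of_continuous hc2 hf
      have h2 : Continuous fun x => ∫ y in (0 : ℝ)..(-f x), z (pt x y) 0 :=
        intervalIntegral.continuous_parametric_intervalIntegral_of_continuous hc2 hf.neg
      refine (h1.sub h2).congr fun x => ?_
      exact intervalIntegral.integral_interval_sub_left
        (((hzc 0).comp (continuous_pt continuous_const continuous_id)).intervalIntegrable _ _)
        (((hzc 0).comp (continuous_pt continuous_const continuous_id)).intervalIntegrable _ _)
    rw [integral_eq_of_hasDerivAt_off_countable_of_le
      (fun x => ∫ y in (-f x)..(f x), z (pt x y) 0) _ hab hsc hGc.continuousOn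
      (fun x hx => hasDerivAt_integral_chord hz hc 0 (hd x hx)) (hAi.add hBi)]
    simp [hs a (by simp), hs b (by simp)]
  rw [hE]
  have h3 : ∫ x, (∫ y in (-f x)..(f x), divergence z (pt x y))
      = ∫ x in a..b, (∫ y in (-f x)..(f x), divergence z (pt x y)) := by
    rw [intervalIntegral.integral_of_le hab, setIntegral_eq_integral_of_forall_compl_eq_zero]
    intro x hx
    have : f x = 0 := hs x fun h => hx ⟨h.1, h.2.le⟩
    simp [this]
  rw [h3, ← sub_zero (∫ x in a..b, _), ← hG, ← intervalIntegral.integral_sub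
    hI.intervalIntegrable (hAi.add hBi)]
  congr 1
  ext x
  rw [hin]
  ring

/-! ### The perimeter of a profile by duality -/

lemma plane_norm_sq (w : Plane) : ‖w‖ ^ 2 = w 0 ^ 2 + w 1 ^ 2 := by
  rw [EuclideanSpace.norm_sq_eq]; simp [Fin.sum_univ_two]

lemma norm_pt_sq (x y : ℝ) : ‖pt x y‖ ^ 2 = x ^ 2 + y ^ 2 := plane_norm_sq _

/-- A vector shortened to norm below one. -/
noncomputable def softUnit (δ : ℝ) (k : Plane) : Plane := (1 / Real.sqrt (‖k‖ ^ 2 + δ ^ 2)) • k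

lemma norm_softUnit_le {δ : ℝ} (hδ : 0 < δ) (k : Plane) : ‖softUnit δ k‖ ≤ 1 := by
  have hq : 0 < ‖k‖ ^ 2 + δ ^ 2 := by positivity
  rw [softUnit, norm_smul, Real.norm_eq_abs, abs_of_nonneg (by positivity), one_div,
    inv_mul_le_iff₀ (Real.sqrt_pos.2 hq), mul_one]
  exact Real.le_sqrt_of_sq_le (by nlinarith [sq_nonneg δ])

/-- With `t = ‖k‖` the claim is `(t - δ) √(t² + δ²) ≤ t²`. This is clear for `t ≤ δ`; otherwise
`√(t² + δ²) ≤ t + δ` bounds the left side by `t² - δ²`. -/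
lemma le_inner_softUnit_self {δ : ℝ} (hδ : 0 < δ) (k : Plane) :
    ‖k‖ - δ ≤ inner ℝ (softUnit δ k) k := by
  have hq : 0 < ‖k‖ ^ 2 + δ ^ 2 := by positivity
  rw [softUnit, real_inner_smul_left, real_inner_self_eq_norm_sq,
    one_div, ← div_eq_inv_mul, le_div_iff₀ (Real.sqrt_pos.2 hq)]
  have hk := norm_nonneg k
  generalize ‖k‖ = t at *
  have hs1 : Real.sqrt (t ^ 2 + δ ^ 2) ≤ t + δ := by
    rw [Real.sqrt_le_left (by positivity)]
    nlinarith
  have hs3 : t ≤ Real.sqrt (t ^ 2 + δ ^ 2) := Real.le_sqrt_of_sq_le (by nlinarith)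
  generalize Real.sqrt (t ^ 2 + δ ^ 2) = S at *
  rcases le_total t δ with h | h
  · nlinarith [mul_nonneg (sub_nonneg.2 h) (hk.trans hs3), sq_nonneg t]
  · nlinarith [mul_le_mul_of_nonneg_left hs1 (sub_nonneg.2 h)]

/-- The vector is adapted to `k`; pairing it with another vector `g` costs at most `‖g - k‖`,
because its norm is at most one. -/
lemma le_inner_softUnit {δ : ℝ} (hδ : 0 < δ) (k g : Plane) :
    ‖k‖ - δ - ‖g - k‖ ≤ inner ℝ (softUnit δ k) g := by
  have e1 : inner ℝ (softUnit δ k) g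
      = inner ℝ (softUnit δ k) k + inner ℝ (softUnit δ k) (g - k) := by
    rw [← inner_add_right, add_sub_cancel]
  have h1 := abs_real_inner_le_norm (softUnit δ k) (g - k)
  have h2 : ‖softUnit δ k‖ * ‖g - k‖ ≤ 1 * ‖g - k‖ :=
    mul_le_mul_of_nonneg_right (norm_softUnit_le hδ k) (norm_nonneg _)
  have h3 := le_inner_softUnit_self hδ k
  linarith [(abs_le.1 h1).1]

lemma contDiff_softUnit {δ : ℝ} (hδ : 0 < δ) {k : ℝ → Plane} (hk : ContDiff ℝ ∞ k) :
    ContDiff ℝ ∞ fun x => softUnit δ (k x) := by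
  have hq : ∀ x, 0 < ‖k x‖ ^ 2 + δ ^ 2 := fun x => by positivity
  have h1 : ContDiff ℝ ∞ fun x => ‖k x‖ ^ 2 + δ ^ 2 := (hk.norm_sq ℝ).add contDiff_const
  have h2 : ContDiff ℝ ∞ fun x => Real.sqrt (‖k x‖ ^ 2 + δ ^ 2) := h1.sqrt fun x => (hq x).ne'
  have h3 : ContDiff ℝ ∞ fun x => 1 / Real.sqrt (‖k x‖ ^ 2 + δ ^ 2) :=
    contDiff_const.div h2 fun x => (Real.sqrt_pos.2 (hq x)).ne'
  exact h3.smul hk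

lemma integrable_inner_of_norm_le_one {v g : ℝ → Plane} (hg : Integrable g) (hv : Continuous v)
    (hv1 : ∀ x, ‖v x‖ ≤ 1) : Integrable fun x => inner ℝ (v x) (g x) := by
  refine hg.norm.mono' (hv.aestronglyMeasurable.inner hg.aestronglyMeasurable)
    (Eventually.of_forall fun x => ?_)
  refine (norm_inner_le_norm _ _).trans ?_
  exact mul_le_of_le_one_left (norm_nonneg _) (hv1 x)

/-- The `L¹` norm is attained approximately against smooth compactly supported fields of norm
at most one. -/
lemma exists_smooth_dual {g : ℝ → Plane} (hg : Integrable g) {ε : ℝ} (hε : 0 < ε) :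
    ∃ n : ℝ → Plane, ContDiff ℝ ∞ n ∧ HasCompactSupport n ∧ (∀ x, ‖n x‖ ≤ 1) ∧
      (∫ x, ‖g x‖) - ε ≤ ∫ x, inner ℝ (n x) (g x) := by
  -- The dual field is the softened direction of a smooth `k` that is `L¹`-close to `g`. The
  -- distance `ε / 4` is paid twice, once in the norm and once in the pairing; the softening costs a
  -- third `ε / 4`.
  obtain ⟨k, hkc, hks, hk⟩ := (memLp_one_iff_integrable.2 hg).exist_eLpNorm_sub_le
    ENNReal.one_ne_top le_rfl (ε := ε / 4) (by positivity)
  have hki : Integrable k := hks.continuous.integrable_of_hasCompactSupport hkc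
  have hdi : Integrable fun x => ‖g x - k x‖ := (hg.sub hki).norm
  have hdiff : ∫ x, ‖g x - k x‖ ≤ ε / 4 := by
    have e := integral_norm_eq_lintegral_enorm (hg.sub hki).aestronglyMeasurable
    simp only [Pi.sub_apply] at e
    rw [e]
    rw [eLpNorm_one_eq_lintegral_enorm] at hk
    exact ENNReal.toReal_le_of_le_ofReal (by positivity) hk
  have hKc : IsCompact (tsupport k) := hkc
  obtain ⟨V, hV⟩ : ∃ V, V = (volume (tsupport k)).toReal := ⟨_, rfl⟩
  have hVfin : volume (tsupport k) ≠ ⊤ := hKc.measure_lt_top.ne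
  have hV0 : 0 ≤ V := hV ▸ ENNReal.toReal_nonneg
  -- The softening loses `δ` at each point of the support of `k`, in total `V * δ ≤ ε / 4`. The
  -- summand `1` covers a support of measure zero.
  obtain ⟨δ, hδ⟩ : ∃ δ, δ = ε / (4 * (V + 1)) := ⟨_, rfl⟩
  have hδ0 : 0 < δ := by rw [hδ]; positivity
  have hns := contDiff_softUnit hδ0 hks
  refine ⟨fun x => softUnit δ (k x), hns, ?_, fun x => norm_softUnit_le hδ0 _, ?_⟩
  · exact hkc.comp_left (g := softUnit δ) (by simp [softUnit])
  have hpt : ∀ x, ‖k x‖ - (tsupport k).indicator (fun _ => δ) x - ‖g x - k x‖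
      ≤ inner ℝ (softUnit δ (k x)) (g x) := by
    intro x
    by_cases hx : x ∈ tsupport k
    · rw [indicator_of_mem hx]
      exact le_inner_softUnit hδ0 _ _
    · rw [indicator_of_notMem hx, image_eq_zero_of_notMem_tsupport hx]
      simp [softUnit]
  have hin := integrable_inner_of_norm_le_one hg hns.continuous
    fun x => norm_softUnit_le hδ0 (k x)
  have hKi : Integrable ((tsupport k).indicator fun _ => δ) :=
    (integrable_indicator_iff hKc.measurableSet).2 (integrableOn_const hVfin)
  have hA : Integrable fun x => ‖k x‖ - (tsupport k).indicator (fun _ => δ) x := hki.norm.sub hKi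
  have hI := integral_mono (hA.sub hdi) hin hpt
  have e0 : ∫ x, ((fun x => ‖k x‖ - (tsupport k).indicator (fun _ => δ) x) - fun x => ‖g x - k x‖) x
      = (∫ x, ‖k x‖ - (tsupport k).indicator (fun _ => δ) x) - ∫ x, ‖g x - k x‖ :=
    integral_sub hA hdi
  have e1 : ∫ x, (‖k x‖ - (tsupport k).indicator (fun _ => δ) x)
      = (∫ x, ‖k x‖) - V * δ := by
    rw [integral_sub hki.norm hKi, integral_indicator hKc.measurableSet, setIntegral_const,
      Measure.real, ← hV, smul_eq_mul]
  have h1 : ∫ x, ‖g x‖ ≤ (∫ x, ‖k x‖) + ∫ x, ‖g x - k x‖ := by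
    rw [← integral_add hki.norm hdi]
    refine integral_mono hg.norm (hki.norm.add hdi) fun x => ?_
    have := norm_add_le (k x) (g x - k x)
    simpa using this
  have h2 : V * δ ≤ ε / 4 := by
    rw [hδ, mul_div_assoc', div_le_iff₀ (by positivity)]
    nlinarith
  rw [e0, e1] at hI
  linarith

/-- The perimeter of the region between the graphs of `-f` and `f`. -/
theorem variationIndicator_profile {f f' : ℝ → ℝ} {a b : ℝ} (hab : a ≤ b) (hf : Continuous f)
    (h0 : ∀ x, 0 ≤ f x) (hs : ∀ x, x ∉ Ioo a b → f x = 0) {s : Set ℝ} (hsc : s.Countable)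
    (hd : ∀ x ∈ Ioo a b \ s, HasDerivAt f (f' x) x) (hi : IntervalIntegrable f' volume a b) :
    variationIndicator (profile f)
      = ENNReal.ofReal (2 * ∫ x in a..b, if 0 < f x then Real.sqrt (1 + f' x ^ 2) else 0) := by
  have hio : IntegrableOn f' (Ioc a b) := (intervalIntegrable_iff_integrableOn_Ioc_of_le hab).1 hi
  have hpos : MeasurableSet {x | 0 < f x} := (isOpen_lt continuous_const hf).measurableSet
  set P : Set ℝ := Ioc a b ∩ {x | 0 < f x} with hP
  have hPm : MeasurableSet P := measurableSet_Ioc.inter hpos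
  have hPfin : volume P ≠ ⊤ := by
    refine ne_of_lt (lt_of_le_of_lt (measure_mono inter_subset_left) ?_)
    simp
  have hiP : IntegrableOn f' P := hio.mono_set inter_subset_left
  -- the field `(-f', 1)` on the part where `f` is positive
  set g : ℝ → Plane := P.indicator fun x => pt (-f' x) 1 with hg
  have hpte : ∀ x, pt (-f' x) 1 = (-f' x) • EuclideanSpace.single 0 (1 : ℝ)
      + EuclideanSpace.single 1 (1 : ℝ) := by
    intro x; ext i; fin_cases i <;> simp [pt]
  have hgi : Integrable g := by
    rw [hg, integrable_indicator_iff hPm]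
    simp_rw [hpte]
    exact (hiP.neg.smul_const _).add (integrableOn_const hPfin)
  have hgn : ∀ x, ‖g x‖ = P.indicator (fun x => Real.sqrt (1 + f' x ^ 2)) x := by
    intro x
    by_cases hx : x ∈ P
    · rw [hg, indicator_of_mem hx, indicator_of_mem hx]
      rw [← Real.sqrt_sq (norm_nonneg _), norm_pt_sq]
      congr 1; ring
    · rw [hg, indicator_of_notMem hx, indicator_of_notMem hx, norm_zero]
  have hlen : ∫ x, ‖g x‖ = ∫ x in a..b, if 0 < f x then Real.sqrt (1 + f' x ^ 2) else 0 := by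
    simp_rw [hgn]
    rw [integral_indicator hPm, intervalIntegral.integral_of_le hab, hP, ← setIntegral_indicator hpos]
    congr 1
  rw [← hlen]
  -- reduction of the Gauss–Green integrand to the pairing with `g`
  have hzero : ∀ x ∈ Ioo a b \ s, ¬ 0 < f x → f' x = 0 := by
    intro x hx hfx
    have hfx0 : f x = 0 := le_antisymm (not_lt.1 hfx) (h0 x)
    -- A zero of `f ≥ 0` is a minimum, so `f'` vanishes there. The boundary terms of the two graphs
    -- then cancel, which is why the zeros of `f` contribute no length.
    have : IsLocalMin f x := Eventually.of_forall fun y => by rw [hfx0]; exact h0 y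
    exact this.hasDerivAt_eq_zero (hd x hx)
  have hred : ∀ z : Plane → Plane, ContDiff ℝ ∞ z → HasCompactSupport z →
      ∫ w in profile f, divergence z w
        = ∫ x, (inner ℝ (z (pt x (f x))) (g x)
          + inner ℝ (pt (z (pt x (-f x)) 0) (-z (pt x (-f x)) 1)) (g x)) := by
    intro z hz hc
    rw [integral_divergence_profile hz hc hab hf h0 hs hsc hd hi,
      intervalIntegral.integral_of_le hab]
    have hsup : ∀ x, x ∉ Ioc a b → inner ℝ (z (pt x (f x))) (g x)
        + inner ℝ (pt (z (pt x (-f x)) 0) (-z (pt x (-f x)) 1)) (g x) = 0 := by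
      intro x hx
      have : g x = 0 := indicator_of_notMem (fun h => hx h.1) _
      simp [this]
    rw [← setIntegral_eq_integral_of_forall_compl_eq_zero hsup, integral_Ioc_eq_integral_Ioo,
      integral_Ioc_eq_integral_Ioo]
    refine setIntegral_congr_ae measurableSet_Ioo ?_
    filter_upwards [hsc.ae_notMem volume] with x hxs hx
    by_cases hfx : 0 < f x
    · have hxP : x ∈ P := ⟨⟨hx.1, hx.2.le⟩, hfx⟩
      rw [hg, indicator_of_mem hxP]
      simp only [PiLp.inner_apply, Fin.sum_univ_two, pt_zero, pt_one, RCLike.inner_apply,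
        conj_trivial]
      ring
    · have hxP : x ∉ P := fun h => hfx h.2
      have hfx0 : f x = 0 := le_antisymm (not_lt.1 hfx) (h0 x)
      rw [hg, indicator_of_notMem hxP, hzero x ⟨hx, hxs⟩ hfx, hfx0]
      simp
  have hrefl : ∀ w : Plane, ‖pt (w 0) (-w 1)‖ = ‖w‖ := by
    intro w
    rw [← Real.sqrt_sq (norm_nonneg (pt _ _)), norm_pt_sq, ← Real.sqrt_sq (norm_nonneg w),
      plane_norm_sq]
    congr 1; ring
  have hcz : ∀ z : Plane → Plane, Continuous z → Continuous fun x => z (pt x (f x)) :=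
    fun z hz => hz.comp (continuous_pt continuous_id hf)
  have hcz' : ∀ z : Plane → Plane, Continuous z →
      Continuous fun x => pt (z (pt x (-f x)) 0) (-z (pt x (-f x)) 1) := by
    intro z hz
    have h := hz.comp (continuous_pt continuous_id hf.neg)
    exact continuous_pt ((by fun_prop : Continuous fun w : Plane => w 0).comp h)
      ((by fun_prop : Continuous fun w : Plane => w 1).comp h).neg
  have hip : ∀ v : ℝ → Plane, Continuous v → (∀ x, ‖v x‖ ≤ 1) →
      Integrable fun x => inner ℝ (v x) (g x) :=
    fun v hv hv1 => integrable_inner_of_norm_le_one hgi hv hv1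
  have hCS : ∀ v w : Plane, ‖v‖ ≤ 1 → inner ℝ v w ≤ ‖w‖ := by
    intro v w hv
    refine (real_inner_le_norm v w).trans ?_
    exact mul_le_of_le_one_left (norm_nonneg _) hv
  -- One inequality is Cauchy–Schwarz on each of the two graphs. For the other, an almost optimal
  -- field `n` on the line is extended to the plane.
  apply le_antisymm
  · refine iSup_le fun z => iSup_le fun hz => iSup_le fun hc => iSup_le fun hz1 => ?_
    apply ENNReal.ofReal_le_ofReal
    rw [hred z hz hc, two_mul, ← integral_add hgi.norm hgi.norm]
    refine integral_mono ((hip _ (hcz z hz.continuous) fun x => hz1 _).add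
      (hip _ (hcz' z hz.continuous) fun x => (hrefl _).le.trans (hz1 _)))
      (hgi.norm.add hgi.norm) fun x => ?_
    exact add_le_add (hCS _ _ (hz1 _)) (hCS _ _ ((hrefl _).le.trans (hz1 _)))
  · refine le_of_forall_lt fun c hcl => ?_
    obtain ⟨c', hc1, hc2⟩ := exists_between hcl
    have hc'fin : c' ≠ ⊤ := hc2.ne_top
    set I := ∫ x, ‖g x‖ with hI
    have hc3 : c'.toReal < 2 * I := by
      have := (ENNReal.lt_ofReal_iff_toReal_lt hc'fin).1 hc2
      exact this
    obtain ⟨n, hn, hnc, hn1, hnI⟩ := exists_smooth_dual hgi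
      (ε := (2 * I - c'.toReal) / 4) (by linarith)
    -- bound for `f`
    have hfc : HasCompactSupport f := HasCompactSupport.of_support_subset_isCompact
      (isCompact_Icc (a := a) (b := b)) fun x hx => by
        by_contra h
        exact hx (hs x fun h' => h ⟨h'.1.le, h'.2.le⟩)
    obtain ⟨M, hM⟩ := hfc.exists_bound_of_continuous hf
    have hM' : ∀ x, f x ≤ M := fun x => (le_abs_self _).trans (hM x)
    have hM0 : 0 ≤ M := (h0 a).trans (hM' a)
    -- the cut-off in the vertical variable
    set ζ : ℕ → ℝ → ℝ := fun m y =>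
      Real.smoothTransition ((m : ℝ) * y) * Real.smoothTransition (M + 1 - y) with hζ
    have hζs : ∀ m, ContDiff ℝ ∞ (ζ m) := fun m => by
      have h1 : ContDiff ℝ ∞ fun y : ℝ => (m : ℝ) * y := by fun_prop
      have h2 : ContDiff ℝ ∞ fun y : ℝ => M + 1 - y := by fun_prop
      exact (Real.smoothTransition.contDiff.comp h1).mul (Real.smoothTransition.contDiff.comp h2)
    have hζ0 : ∀ m y, 0 ≤ ζ m y := fun m y =>
      mul_nonneg (Real.smoothTransition.nonneg _) (Real.smoothTransition.nonneg _)
    have hζ1 : ∀ m y, ζ m y ≤ 1 := fun m y =>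
      mul_le_one₀ (Real.smoothTransition.le_one _) (Real.smoothTransition.nonneg _)
        (Real.smoothTransition.le_one _)
    have hζn : ∀ m y, y ≤ 0 → ζ m y = 0 := fun m y hy => by
      simp only [hζ]
      rw [Real.smoothTransition.zero_of_nonpos (mul_nonpos_of_nonneg_of_nonpos (by positivity) hy),
        zero_mul]
    have hζb : ∀ m y, M + 1 ≤ y → ζ m y = 0 := fun m y hy => by
      simp only [hζ]
      rw [Real.smoothTransition.zero_of_nonpos (x := M + 1 - y) (by linarith), mul_zero]
    -- The field is `n`, constant in the vertical direction, on the upper half plane and its mirror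
    -- image on the lower one, damped near the axis and above height `M + 1`. On the graph the
    -- damping factor tends to `1` wherever `f > 0`, so the pairing tends to `2 ∫ ⟨n, g⟩`.
    set z : ℕ → Plane → Plane := fun m w =>
      (ζ m (w 1) + ζ m (-w 1)) • ((n (w 0) 0) • EuclideanSpace.single 0 (1 : ℝ))
        + (ζ m (w 1) - ζ m (-w 1)) • ((n (w 0) 1) • EuclideanSpace.single 1 (1 : ℝ)) with hz
    have hz0 : ∀ m w, z m w 0 = (ζ m (w 1) + ζ m (-w 1)) * n (w 0) 0 := by
      intro m w; simp [hz]
    have hz1 : ∀ m w, z m w 1 = (ζ m (w 1) - ζ m (-w 1)) * n (w 0) 1 := by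
      intro m w; simp [hz]
    have hzs : ∀ m, ContDiff ℝ ∞ (z m) := by
      intro m
      have p0 : ContDiff ℝ ∞ fun w : Plane => w 0 := by fun_prop
      have p1 : ContDiff ℝ ∞ fun w : Plane => w 1 := by fun_prop
      have q : ∀ i, ContDiff ℝ ∞ fun w : Plane => n (w 0) i := fun i =>
        ((by fun_prop : ContDiff ℝ ∞ fun w : Plane => w i).comp hn).comp p0
      have r1 : ContDiff ℝ ∞ fun w : Plane => ζ m (w 1) := (hζs m).comp p1
      have r2 : ContDiff ℝ ∞ fun w : Plane => ζ m (-w 1) := (hζs m).comp p1.neg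
      exact ((r1.add r2).smul ((q 0).smul contDiff_const)).add
        ((r1.sub r2).smul ((q 1).smul contDiff_const))
    have hzle : ∀ m w, ‖z m w‖ ≤ 1 := by
      intro m w
      have hsq : ‖z m w‖ ^ 2 ≤ 1 := by
        have hn2 : n (w 0) 0 ^ 2 + n (w 0) 1 ^ 2 ≤ 1 := by
          rw [← plane_norm_sq]
          exact pow_le_one₀ (norm_nonneg _) (hn1 _)
        rw [plane_norm_sq, hz0, hz1]
        have key : ∀ t : ℝ, 0 ≤ t → t ≤ 1 → t ^ 2 * (n (w 0) 0 ^ 2 + n (w 0) 1 ^ 2) ≤ 1 := by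
          intro t ht0 ht1
          have : t ^ 2 ≤ 1 := pow_le_one₀ ht0 ht1
          nlinarith [sq_nonneg (n (w 0) 0), sq_nonneg (n (w 0) 1), sq_nonneg t]
        rcases le_total (w 1) 0 with h | h
        · rw [hζn m _ h]
          have := key _ (hζ0 m (-w 1)) (hζ1 m (-w 1))
          linarith
        · rw [hζn m (-w 1) (by linarith)]
          have := key _ (hζ0 m (w 1)) (hζ1 m (w 1))
          linarith
      nlinarith [norm_nonneg (z m w)]
    have hzc : ∀ m, HasCompactSupport (z m) := by
      intro m
      obtain ⟨R, hR⟩ := hnc.isCompact.isBounded.subset_closedBall 0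
      have hn0 : ∀ x, R < |x| → n x = 0 := by
        intro x hx
        refine image_eq_zero_of_notMem_tsupport fun h => ?_
        have := hR h
        simp at this
        linarith
      refine HasCompactSupport.of_support_subset_isCompact
        (isCompact_closedBall (0 : Plane) (|R| + M + 1)) fun w hw => ?_
      by_contra hcon
      apply hw
      rw [mem_closedBall_zero_iff, not_le] at hcon
      have hcases : |R| < |w 0| ∨ M + 1 < |w 1| := by
        by_contra hno
        push Not at hno
        have h1 : ‖w‖ ^ 2 ≤ (|R| + M + 1) ^ 2 := by
          rw [plane_norm_sq, ← sq_abs (w 0), ← sq_abs (w 1)]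
          nlinarith [abs_nonneg (w 0), abs_nonneg (w 1), abs_nonneg R]
        have := abs_nonneg R
        nlinarith [norm_nonneg w]
      rcases hcases with h | h
      · have := hn0 (w 0) ((le_abs_self R).trans_lt h)
        simp [hz, this]
      · have h1 : ζ m (w 1) = 0 ∧ ζ m (-w 1) = 0 := by
          rcases le_total (w 1) 0 with h2 | h2
          · rw [abs_of_nonpos h2] at h
            exact ⟨hζn m _ h2, hζb m _ h.le⟩
          · rw [abs_of_nonneg h2] at h
            exact ⟨hζb m _ h.le, hζn m _ (by linarith)⟩
        simp [hz, h1]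
    have hval : ∀ m, ∫ w in profile f, divergence (z m) w
        = ∫ x, 2 * (ζ m (f x) * inner ℝ (n x) (g x)) := by
      intro m
      rw [hred _ (hzs m) (hzc m)]
      congr 1
      ext x
      have h1 : ζ m (-f x) = 0 := hζn m _ (by linarith [h0 x])
      simp only [PiLp.inner_apply, Fin.sum_univ_two, pt_zero, pt_one, RCLike.inner_apply,
        conj_trivial, hz0, hz1, neg_neg, h1]
      ring
    have hlim : Tendsto (fun m : ℕ => ∫ x, 2 * (ζ m (f x) * inner ℝ (n x) (g x))) atTop
        (𝓝 (∫ x, 2 * inner ℝ (n x) (g x))) := by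
      refine tendsto_integral_of_dominated_convergence (fun x => 2 * ‖g x‖) ?_
        (hgi.norm.const_mul 2) ?_ ?_
      · intro m
        exact (((hζs m).continuous.comp hf).aestronglyMeasurable.mul
          (hip n hn.continuous hn1).aestronglyMeasurable).const_mul 2
      · intro m
        refine Eventually.of_forall fun x => ?_
        rw [norm_mul, norm_mul, Real.norm_eq_abs, Real.norm_eq_abs, abs_of_nonneg (hζ0 m _),
          abs_two]
        have h1 := (norm_inner_le_norm (𝕜 := ℝ) (n x) (g x)).trans
          (mul_le_of_le_one_left (norm_nonneg _) (hn1 x))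
        have h2 := hζ1 m (f x)
        have h3 := hζ0 m (f x)
        have h4 := norm_nonneg (inner ℝ (n x) (g x))
        nlinarith
      · refine Eventually.of_forall fun x => ?_
        by_cases hx : x ∈ P
        · have hfx : 0 < f x := hx.2
          obtain ⟨m0, hm0⟩ := exists_nat_ge (1 / f x)
          refine tendsto_const_nhds.congr' ?_
          filter_upwards [eventually_ge_atTop m0] with m hm
          have h1 : ζ m (f x) = 1 := by
            simp only [hζ]
            have hmm : (1 : ℝ) ≤ (m : ℝ) * f x := by
              have : (m0 : ℝ) ≤ m := by exact_mod_cast hm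
              have h2 : 1 / f x ≤ m := hm0.trans this
              rwa [div_le_iff₀ hfx] at h2
            rw [Real.smoothTransition.one_of_one_le hmm,
              Real.smoothTransition.one_of_one_le (by linarith [hM' x]), mul_one]
          rw [h1, one_mul]
        · have : g x = 0 := indicator_of_notMem hx _
          simp [this]
    have hlt : c'.toReal < ∫ x, 2 * inner ℝ (n x) (g x) := by
      rw [integral_const_mul]
      linarith
    obtain ⟨m, hm⟩ := (hlim.eventually (lt_mem_nhds hlt)).exists
    rw [← hval m] at hm
    refine hc1.trans_le ?_
    have h5 : c' ≤ ENNReal.ofReal (∫ w in profile f, divergence (z m) w) :=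
      ENNReal.le_ofReal_iff_toReal_le hc'fin (ENNReal.toReal_nonneg.trans hm.le) |>.2 hm.le
    refine h5.trans ?_
    exact le_iSup_of_le (z m) (le_iSup_of_le (hzs m) (le_iSup_of_le (hzc m)
      (le_iSup_of_le (hzle m) le_rfl)))

lemma variationIndicator_congr {E F : Set Plane} (h : E =ᵐ[volume] F) :
    variationIndicator E = variationIndicator F := by
  simp only [variationIndicator, setIntegral_congr_set h]

lemma perimeter_congr {E F : Set Plane} (h : E =ᵐ[volume] F) : perimeter E = perimeter F := by
  have h1 : NullMeasurableSet E (volume : Measure Plane) ↔ NullMeasurableSet F volume :=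
    ⟨fun H => H.congr h, fun H => H.congr h.symm⟩
  rw [perimeter, perimeter, variationIndicator_congr h, measure_congr h, propext h1]

/-! ### Assembling length and area from pieces of a graph -/

/-- The graph of `f` over `[a, b]` has length `ℓ` (counted where `f > 0`) and there is area `A`
below it. -/
structure Piece (f : ℝ → ℝ) (a b ℓ A : ℝ) : Prop where
  le : a ≤ b
  cont : ContinuousOn f (Icc a b)
  area : ∫ x in a..b, f x = A
  length : ∃ (f' : ℝ → ℝ) (s : Set ℝ), s.Countable ∧ (∀ x ∈ Ioo a b \ s, HasDerivAt f (f' x) x) ∧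
    IntervalIntegrable f' volume a b ∧
    IntervalIntegrable (fun x => if 0 < f x then Real.sqrt (1 + f' x ^ 2) else 0) volume a b ∧
    ∫ x in a..b, (if 0 < f x then Real.sqrt (1 + f' x ^ 2) else 0) = ℓ

lemma Piece.congr {f g : ℝ → ℝ} {a b ℓ A : ℝ} (h : Piece f a b ℓ A)
    (hfg : ∀ x ∈ Icc a b, g x = f x) : Piece g a b ℓ A := by
  obtain ⟨hle, hc, hA, f', s, hs, hd, hi, hi2, hl⟩ := h
  have hu : uIcc a b = Icc a b := uIcc_of_le hle
  have hcongr : ∀ x ∈ uIcc a b, (if 0 < g x then Real.sqrt (1 + f' x ^ 2) else 0)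
      = if 0 < f x then Real.sqrt (1 + f' x ^ 2) else 0 := by
    intro x hx
    rw [hfg x (hu ▸ hx)]
  refine ⟨hle, hc.congr hfg, ?_, f', s, hs, ?_, hi, ?_, ?_⟩
  · rw [← hA]
    exact intervalIntegral.integral_congr fun x hx => hfg x (hu ▸ hx)
  · intro x hx
    refine (hd x hx).congr_of_eventuallyEq ?_
    filter_upwards [Icc_mem_nhds hx.1.1 hx.1.2] with y hy using hfg y hy
  · exact hi2.congr fun x hx => (hcongr x (uIoc_subset_uIcc hx)).symm
  · rw [← hl]
    exact intervalIntegral.integral_congr hcongr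

lemma Piece.append {f : ℝ → ℝ} {a b c ℓ A ℓ' A' : ℝ} (h : Piece f a b ℓ A)
    (h' : Piece f b c ℓ' A') : Piece f a c (ℓ + ℓ') (A + A') := by
  obtain ⟨hle, hc, hA, f', s, hs, hd, hi, hi2, hl⟩ := h
  obtain ⟨hle', hc', hA', g', s', hs', hd', hi', hi2', hl'⟩ := h'
  have hfi : IntervalIntegrable f volume a b :=
    ContinuousOn.intervalIntegrable (by rwa [uIcc_of_le hle])
  have hfi' : IntervalIntegrable f volume b c :=
    ContinuousOn.intervalIntegrable (by rwa [uIcc_of_le hle'])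
  set k : ℝ → ℝ := fun x => if x ≤ b then f' x else g' x with hk
  have e1 : ∀ x ∈ uIoc a b, k x = f' x := fun x hx => by
    rw [uIoc_of_le hle] at hx
    simp [hk, hx.2]
  have e2 : ∀ x ∈ uIoc b c, k x = g' x := fun x hx => by
    rw [uIoc_of_le hle'] at hx
    simp [hk, not_le.2 hx.1]
  have j1 : ∀ x ∈ uIoc a b, (if 0 < f x then Real.sqrt (1 + f' x ^ 2) else 0)
      = if 0 < f x then Real.sqrt (1 + k x ^ 2) else 0 := fun x hx => by rw [e1 x hx]
  have j2 : ∀ x ∈ uIoc b c, (if 0 < f x then Real.sqrt (1 + g' x ^ 2) else 0)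
      = if 0 < f x then Real.sqrt (1 + k x ^ 2) else 0 := fun x hx => by rw [e2 x hx]
  -- The junction `b` is added to the exceptional set, since the one-sided derivatives may differ
  -- there.
  refine ⟨hle.trans hle', ?_, ?_, k, s ∪ s' ∪ {b}, (hs.union hs').union (countable_singleton b),
    ?_, ?_, ?_, ?_⟩
  · rw [← Icc_union_Icc_eq_Icc hle hle']
    exact hc.union_of_isClosed hc' isClosed_Icc isClosed_Icc
  · rw [← intervalIntegral.integral_add_adjacent_intervals hfi hfi', hA, hA']
  · rintro x ⟨hx, hxs⟩
    simp only [mem_union, mem_singleton_iff, not_or] at hxs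
    rcases lt_or_gt_of_ne hxs.2 with hlt | hlt
    · simp only [hk, if_pos hlt.le]
      exact hd x ⟨⟨hx.1, hlt⟩, hxs.1.1⟩
    · simp only [hk, if_neg (not_le.2 hlt)]
      exact hd' x ⟨⟨hlt, hx.2⟩, hxs.1.2⟩
  · exact (hi.congr fun x hx => (e1 x hx).symm).trans (hi'.congr fun x hx => (e2 x hx).symm)
  · exact (hi2.congr j1).trans (hi2'.congr j2)
  · rw [← intervalIntegral.integral_add_adjacent_intervals (hi2.congr j1) (hi2'.congr j2), ← hl,
      ← hl']
    congr 1
    · exact intervalIntegral.integral_congr_ae (Eventually.of_forall fun x hx => (j1 x hx).symm)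
    · exact intervalIntegral.integral_congr_ae (Eventually.of_forall fun x hx => (j2 x hx).symm)

lemma volume_profile {f : ℝ → ℝ} (hf : Continuous f) (h0 : ∀ x, 0 ≤ f x) {a b : ℝ} (hab : a ≤ b)
    (hs : ∀ x, x ∉ Ioo a b → f x = 0) :
    volume (profile f) = ENNReal.ofReal (2 * ∫ x in a..b, f x) := by
  have hfc : HasCompactSupport f := HasCompactSupport.of_support_subset_isCompact
    (isCompact_Icc (a := a) (b := b)) fun x hx => by
      by_contra h
      exact hx (hs x fun h' => h ⟨h'.1.le, h'.2.le⟩)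
  have hfi : Integrable f := hf.integrable_of_hasCompactSupport hfc
  have h1 : volume (profile f) = volume (regionBetween (-f) f univ) := by
    rw [← measurePreserving_coordEquiv.measure_preimage
      (measurableSet_profile hf.measurable).nullMeasurableSet]
    congr 1
    ext p
    simp [profile, regionBetween, coordEquiv_apply, abs_lt]
  rw [h1, Measure.volume_eq_prod, volume_regionBetween_eq_integral hfi.neg.integrableOn
    hfi.integrableOn MeasurableSet.univ fun x _ => (neg_nonpos.2 (h0 x)).trans (h0 x)]
  congr 1
  rw [setIntegral_univ, intervalIntegral.integral_of_le hab, integral_Ioc_eq_integral_Ioo,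
    setIntegral_eq_integral_of_forall_compl_eq_zero hs, ← integral_const_mul]
  congr 1
  ext x
  simp only [Pi.sub_apply, Pi.neg_apply]
  ring

lemma Piece.continuous {f : ℝ → ℝ} {a b ℓ A : ℝ} (h : Piece f a b ℓ A)
    (hs : ∀ x, x ∉ Ioo a b → f x = 0) : Continuous f := by
  have h1 : ContinuousOn f (Iic a ∪ Icc a b ∪ Ici b) := by
    refine ContinuousOn.union_of_isClosed (ContinuousOn.union_of_isClosed ?_ h.cont isClosed_Iic
      isClosed_Icc) ?_ (isClosed_Iic.union isClosed_Icc) isClosed_Ici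
    · exact continuousOn_const.congr (f := fun _ => 0) fun x hx => hs x fun h' =>
        absurd h'.1 (not_lt.2 hx)
    · exact continuousOn_const.congr (f := fun _ => 0) fun x hx => hs x fun h' =>
        absurd h'.2 (not_lt.2 hx)
  rw [Iic_union_Icc_eq_Iic h.le, Iic_union_Ici] at h1
  exact continuousOn_univ.1 h1

theorem Piece.perimeter_eq {f : ℝ → ℝ} {a b ℓ A : ℝ} (h : Piece f a b ℓ A) (h0 : ∀ x, 0 ≤ f x)
    (hs : ∀ x, x ∉ Ioo a b → f x = 0) :
    perimeter (profile f) = ENNReal.ofReal (2 * ℓ) ∧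
      volume (profile f) = ENNReal.ofReal (2 * A) := by
  have hc := h.continuous hs
  have hv := volume_profile hc h0 h.le hs
  obtain ⟨hle, -, hA, f', s, hsc, hd, hi, -, hl⟩ := h
  rw [hA] at hv
  refine ⟨?_, hv⟩
  rw [perimeter, if_pos ⟨(measurableSet_profile hc.measurable).nullMeasurableSet,
    hv ▸ ENNReal.ofReal_lt_top⟩, variationIndicator_profile hle hc h0 hs hsc hd hi, hl]

/-- The graph of a continuous function has measure zero. -/
lemma profile_ae_eq_closed {f : ℝ → ℝ} (hf : Continuous f) :
    profile f =ᵐ[volume] {w : Plane | |w 1| ≤ f (w 0)} := by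
  have hcon : ∀ g : ℝ → ℝ, Continuous g → volume {w : Plane | w 1 = g (w 0)} = 0 := by
    intro g hg
    have hm : MeasurableSet {w : Plane | w 1 = g (w 0)} :=
      measurableSet_eq_fun (by fun_prop) (hg.measurable.comp (by fun_prop))
    rw [← measurePreserving_coordEquiv.measure_preimage hm.nullMeasurableSet,
      Measure.volume_eq_prod, Measure.prod_apply (coordEquiv.measurable hm)]
    have : ∀ x : ℝ, Prod.mk x ⁻¹' (coordEquiv ⁻¹' {w : Plane | w 1 = g (w 0)}) = {g x} := by
      intro x; ext y; simp [coordEquiv_apply]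
    simp only [this, Real.volume_singleton, lintegral_zero]
  refine ae_eq_set.2 ⟨?_, ?_⟩
  · have : profile f \ {w : Plane | |w 1| ≤ f (w 0)} = ∅ := by
      rw [Set.sdiff_eq_empty]
      intro w hw
      simp only [profile, mem_ofPred_eq] at hw ⊢
      exact hw.le
    rw [this, measure_empty]
  · refine measure_mono_null (t := {w : Plane | w 1 = f (w 0)} ∪ {w : Plane | w 1 = -f (w 0)}) ?_
      (measure_union_null (hcon f hf) (hcon _ hf.neg))
    rintro w ⟨h1, h2⟩
    simp only [profile, mem_ofPred_eq, not_lt] at h1 h2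
    have h3 := le_antisymm h1 h2
    rcases abs_choice (w 1) with h4 | h4
    · left; simp only [mem_ofPred_eq]; linarith
    · right; simp only [mem_ofPred_eq]; linarith

lemma Piece.zero {a b : ℝ} (h : a ≤ b) : Piece (fun _ => 0) a b 0 0 := by
  refine ⟨h, continuousOn_const, by simp, fun _ => 0, ∅, countable_empty, ?_, by simp, by simp,
    by simp⟩
  exact fun x _ => hasDerivAt_const x 0

lemma Piece.line {a b m k : ℝ} (h : a ≤ b) (hpos : ∀ x ∈ Ioo a b, 0 < m * x + k) :
    Piece (fun x => m * x + k) a b (Real.sqrt (1 + m ^ 2) * (b - a))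
      (m * (b ^ 2 - a ^ 2) / 2 + k * (b - a)) := by
  have hl : ∀ x ∈ Ioo a b, (if 0 < m * x + k then Real.sqrt (1 + m ^ 2) else 0)
      = Real.sqrt (1 + m ^ 2) := fun x hx => by rw [if_pos (hpos x hx)]
  refine ⟨h, by fun_prop, ?_, fun _ => m, ∅, countable_empty, ?_, by simp, ?_, ?_⟩
  · rw [intervalIntegral.integral_add
      ((by fun_prop : Continuous fun x : ℝ => m * x).intervalIntegrable _ _)
      intervalIntegrable_const, intervalIntegral.integral_const_mul, integral_id, intervalIntegral.integral_const, smul_eq_mul]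
    ring
  · intro x _
    simpa using ((hasDerivAt_id x).const_mul m).add_const k
  · rw [intervalIntegrable_iff_integrableOn_Ioo_of_le h]
    exact (integrableOn_congr_fun hl measurableSet_Ioo).2 (by simp)
  · rw [intervalIntegral.integral_of_le h, integral_Ioc_eq_integral_Ioo,
      setIntegral_congr_fun measurableSet_Ioo hl, ← integral_Ioc_eq_integral_Ioo,
      ← intervalIntegral.integral_of_le h, intervalIntegral.integral_const, smul_eq_mul]
    ring

section Arc

variable {R c x : ℝ}

lemma arc_radicand_pos (hx : x ∈ Ioo (c - R) (c + R)) : 0 < R ^ 2 - (x - c) ^ 2 := by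
  nlinarith [hx.1, hx.2]

lemma hasDerivAt_arc (hx : x ∈ Ioo (c - R) (c + R)) :
    HasDerivAt (fun x => Real.sqrt (R ^ 2 - (x - c) ^ 2))
      (-(x - c) / Real.sqrt (R ^ 2 - (x - c) ^ 2)) x := by
  have h1 : HasDerivAt (fun x => R ^ 2 - (x - c) ^ 2) (-(2 * (x - c))) x := by
    have := (((hasDerivAt_id x).sub_const c).pow 2).const_sub (R ^ 2)
    simpa using this
  convert h1.sqrt (arc_radicand_pos hx).ne' using 1
  have := (Real.sqrt_pos.2 (arc_radicand_pos hx)).ne'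
  field_simp

lemma hasDerivAt_arcsin_div (hx : x ∈ Ioo (c - R) (c + R)) :
    HasDerivAt (fun x => Real.arcsin ((x - c) / R)) (1 / Real.sqrt (R ^ 2 - (x - c) ^ 2)) x := by
  have hR : 0 < R := by linarith [hx.1, hx.2]
  have h1 : HasDerivAt (fun x => (x - c) / R) (1 / R) x :=
    ((hasDerivAt_id x).sub_const c).div_const R
  have hlt : |(x - c) / R| < 1 := by
    rw [abs_div, abs_of_pos hR, div_lt_one hR, abs_lt]
    constructor <;> linarith [hx.1, hx.2]
  have h2 := (Real.hasDerivAt_arcsin (x := (x - c) / R) (by linarith [(abs_lt.1 hlt).1])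
    (by linarith [(abs_lt.1 hlt).2])).comp x h1
  refine h2.congr_deriv ?_
  have : 1 - ((x - c) / R) ^ 2 = (R ^ 2 - (x - c) ^ 2) / R ^ 2 := by field_simp
  rw [this, Real.sqrt_div (arc_radicand_pos hx).le, Real.sqrt_sq hR.le]
  have := (Real.sqrt_pos.2 (arc_radicand_pos hx)).ne'
  field_simp

/-- The sign `σ = 1` gives an upper arc and `σ = -1` a lower arc of a circle centred at height `y₀`;
the latter is needed for the touching disks. The length density `R / √(R² - (x - c)²)` may be
unbounded at the ends, so its integrability comes from its being the nonnegative derivative of the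
continuous function `R arcsin ((x - c) / R)`. The slope is dominated by this density. -/
lemma Piece.arc {R c y₀ σ a b : ℝ} (hσ : σ ^ 2 = 1) (hR : 0 < R) (ha : c - R ≤ a) (hab : a ≤ b)
    (hb : b ≤ c + R)
    (hpos : ∀ x ∈ Ioo a b, 0 < y₀ + σ * Real.sqrt (R ^ 2 - (x - c) ^ 2)) :
    Piece (fun x => y₀ + σ * Real.sqrt (R ^ 2 - (x - c) ^ 2)) a b
      (R * (Real.arcsin ((b - c) / R) - Real.arcsin ((a - c) / R)))
      (y₀ * (b - a) + σ / 2 * ((b - c) * Real.sqrt (R ^ 2 - (b - c) ^ 2)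
        - (a - c) * Real.sqrt (R ^ 2 - (a - c) ^ 2)
        + R ^ 2 * (Real.arcsin ((b - c) / R) - Real.arcsin ((a - c) / R)))) := by
  have hsub : Ioo a b ⊆ Ioo (c - R) (c + R) := Ioo_subset_Ioo ha hb
  have hS : Continuous fun x => Real.sqrt (R ^ 2 - (x - c) ^ 2) := by fun_prop
  have hasin : Continuous fun x => R * Real.arcsin ((x - c) / R) :=
    continuous_const.mul (Real.continuous_arcsin.comp (by fun_prop))
  have hderiv : ∀ x ∈ Ioo a b, HasDerivAt (fun x => R * Real.arcsin ((x - c) / R))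
      (R / Real.sqrt (R ^ 2 - (x - c) ^ 2)) x := by
    intro x hx
    have := (hasDerivAt_arcsin_div (hsub hx)).const_mul R
    exact this.congr_deriv (by ring)
  have hint : IntervalIntegrable (fun x => R / Real.sqrt (R ^ 2 - (x - c) ^ 2)) volume a b := by
    rw [intervalIntegrable_iff_integrableOn_Ioc_of_le hab]
    exact intervalIntegral.integrableOn_deriv_of_nonneg hasin.continuousOn hderiv
      fun x _ => by positivity
  have hsq : ∀ x ∈ Ioo a b, Real.sqrt (1 + (σ * (-(x - c) / Real.sqrt (R ^ 2 - (x - c) ^ 2))) ^ 2)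
      = R / Real.sqrt (R ^ 2 - (x - c) ^ 2) := by
    intro x hx
    have hp := arc_radicand_pos (hsub hx)
    have hp' := Real.sqrt_pos.2 hp
    rw [Real.sqrt_eq_iff_mul_self_eq (by positivity) (by positivity), mul_pow, hσ, div_pow,
      ← pow_two, div_pow, Real.sq_sqrt hp.le]
    field_simp
    ring
  have hif : ∀ x ∈ Ioo a b, (if 0 < y₀ + σ * Real.sqrt (R ^ 2 - (x - c) ^ 2) then
      Real.sqrt (1 + (σ * (-(x - c) / Real.sqrt (R ^ 2 - (x - c) ^ 2))) ^ 2) else 0)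
      = R / Real.sqrt (R ^ 2 - (x - c) ^ 2) := fun x hx => by rw [if_pos (hpos x hx), hsq x hx]
  have hint' := (intervalIntegrable_iff_integrableOn_Ioo_of_le hab).1 hint
  refine ⟨hab, by fun_prop, ?_,
    fun x => σ * (-(x - c) / Real.sqrt (R ^ 2 - (x - c) ^ 2)), ∅, countable_empty, ?_, ?_, ?_, ?_⟩
  · rw [intervalIntegral.integral_add (by simp) ((hS.const_mul σ).intervalIntegrable _ _),
      intervalIntegral.integral_const, intervalIntegral.integral_const_mul]
    have hprim : ∫ x in a..b, Real.sqrt (R ^ 2 - (x - c) ^ 2)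
        = (((b - c) * Real.sqrt (R ^ 2 - (b - c) ^ 2) + R ^ 2 * Real.arcsin ((b - c) / R)) / 2)
          - ((a - c) * Real.sqrt (R ^ 2 - (a - c) ^ 2) + R ^ 2 * Real.arcsin ((a - c) / R)) / 2 := by
      refine intervalIntegral.integral_eq_sub_of_hasDerivAt_of_le hab
        (f := fun x => ((x - c) * Real.sqrt (R ^ 2 - (x - c) ^ 2)
          + R ^ 2 * Real.arcsin ((x - c) / R)) / 2) ?_ ?_ (hS.intervalIntegrable _ _)
      · have := Real.continuous_arcsin.comp (by fun_prop : Continuous fun x => (x - c) / R)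
        simp only [Function.comp_def] at this
        exact Continuous.continuousOn (by fun_prop)
      · intro x hx
        have hp := arc_radicand_pos (hsub hx)
        have hp' := Real.sqrt_pos.2 hp
        have h1 := ((((hasDerivAt_id x).sub_const c).mul (hasDerivAt_arc (hsub hx))).add
          ((hasDerivAt_arcsin_div (hsub hx)).const_mul (R ^ 2))).div_const 2
        refine h1.congr_deriv ?_
        simp only [id]
        have h2 := Real.sq_sqrt hp.le
        field_simp
        linarith
    rw [hprim, smul_eq_mul]
    ring
  · intro x hx
    exact ((hasDerivAt_arc (hsub hx.1)).const_mul σ).const_add y₀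
  · rw [intervalIntegrable_iff_integrableOn_Ioo_of_le hab]
    refine hint'.mono' ?_ ?_
    · refine (ContinuousOn.aestronglyMeasurable ?_ measurableSet_Ioo)
      refine continuousOn_const.mul (ContinuousOn.div (by fun_prop) hS.continuousOn ?_)
      exact fun x hx => (Real.sqrt_pos.2 (arc_radicand_pos (hsub hx))).ne'
    · refine (ae_restrict_iff' measurableSet_Ioo).2 (Eventually.of_forall fun x hx => ?_)
      rw [← hsq x hx]
      refine Real.abs_le_sqrt ?_
      linarith
  · rw [intervalIntegrable_iff_integrableOn_Ioo_of_le hab]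
    exact (integrableOn_congr_fun hif measurableSet_Ioo).2 hint'
  · rw [intervalIntegral.integral_of_le hab, integral_Ioc_eq_integral_Ioo,
      setIntegral_congr_fun measurableSet_Ioo hif, ← integral_Ioc_eq_integral_Ioo,
      ← intervalIntegral.integral_of_le hab,
      intervalIntegral.integral_eq_sub_of_hasDerivAt_of_le hab hasin.continuousOn hderiv hint]
    ring

end Arc

/-! ### Disks as profiles -/

lemma plane_dist_sq (v w : Plane) : dist v w ^ 2 = (v 0 - w 0) ^ 2 + (v 1 - w 1) ^ 2 := by
  rw [dist_eq_norm, plane_norm_sq]; rfl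

lemma dist_pt_sq (v : Plane) (a b : ℝ) : dist v (pt a b) ^ 2 = (v 0 - a) ^ 2 + (v 1 - b) ^ 2 :=
  plane_dist_sq _ _

lemma dist_lt_iff_sq {v w : Plane} {r : ℝ} (hr : 0 ≤ r) :
    dist v w < r ↔ (v 0 - w 0) ^ 2 + (v 1 - w 1) ^ 2 < r ^ 2 := by
  rw [← plane_dist_sq, sq_lt_sq₀ dist_nonneg hr]

lemma le_dist_iff_sq {v w : Plane} {r : ℝ} (hr : 0 ≤ r) :
    r ≤ dist v w ↔ r ^ 2 ≤ (v 0 - w 0) ^ 2 + (v 1 - w 1) ^ 2 := by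
  rw [← plane_dist_sq, sq_le_sq₀ hr dist_nonneg]

lemma mem_ball_pt {w : Plane} {a b r : ℝ} (hr : 0 ≤ r) :
    w ∈ Metric.ball (pt a b) r ↔ (w 0 - a) ^ 2 + (w 1 - b) ^ 2 < r ^ 2 := by
  rw [Metric.mem_ball, dist_lt_iff_sq hr]; rfl

/-- The upper half circle of radius `r` around `(c, 0)` as a graph. -/
noncomputable def arcFun (r c x : ℝ) : ℝ := Real.sqrt (r ^ 2 - (x - c) ^ 2)

lemma arcFun_nonneg (r c x : ℝ) : 0 ≤ arcFun r c x := Real.sqrt_nonneg _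

lemma continuous_arcFun (r c : ℝ) : Continuous (arcFun r c) := by
  unfold arcFun; fun_prop

lemma abs_lt_arcFun {r c x y : ℝ} : |y| < arcFun r c x ↔ (x - c) ^ 2 + y ^ 2 < r ^ 2 := by
  rw [arcFun, Real.lt_sqrt (abs_nonneg y), sq_abs]
  constructor <;> intro h <;> linarith

lemma arcFun_eq_zero {r c x : ℝ} (hr : 0 < r) (hx : x ∉ Ioo (c - r) (c + r)) :
    arcFun r c x = 0 := by
  refine Real.sqrt_eq_zero_of_nonpos ?_
  have hx' : x ≤ c - r ∨ c + r ≤ x := by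
    by_contra h
    push Not at h
    exact hx h
  rcases hx' with h | h <;> nlinarith

lemma arcFun_pos {r c x : ℝ} (hx : x ∈ Ioo (c - r) (c + r)) : 0 < arcFun r c x :=
  Real.sqrt_pos.2 (arc_radicand_pos hx)

lemma ball_eq_profile {r c : ℝ} (hr : 0 < r) : Metric.ball (pt c 0) r = profile (arcFun r c) := by
  ext w
  rw [mem_ball_pt hr.le]
  simp only [profile, mem_ofPred_eq, abs_lt_arcFun, sub_zero]

lemma Piece.arcFun {R c a b : ℝ} (hR : 0 < R) (ha : c - R ≤ a) (hab : a ≤ b) (hb : b ≤ c + R) :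
    Piece (arcFun R c) a b
      (R * (Real.arcsin ((b - c) / R) - Real.arcsin ((a - c) / R)))
      (1 / 2 * ((b - c) * _root_.arcFun R c b - (a - c) * _root_.arcFun R c a
        + R ^ 2 * (Real.arcsin ((b - c) / R) - Real.arcsin ((a - c) / R)))) := by
  have h := Piece.arc (σ := 1) (y₀ := 0) (by norm_num) hR ha hab hb fun x hx => by
    have := arcFun_pos (Ioo_subset_Ioo ha hb hx)
    simpa [_root_.arcFun] using this
  refine (by simpa [_root_.arcFun] using h : Piece (fun x => √(R ^ 2 - (x - c) ^ 2)) _ _ _ _).congr ?_ |> fun h => by simpa [_root_.arcFun] using h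
  exact fun x _ => rfl

lemma Piece.arcFun_full {R c : ℝ} (hR : 0 < R) :
    Piece (_root_.arcFun R c) (c - R) (c + R) (Real.pi * R) (Real.pi * R ^ 2 / 2) := by
  have h := Piece.arcFun (c := c) hR le_rfl (by linarith) le_rfl
  have e1 : (c + R - c) / R = 1 := by field_simp; ring
  have e2 : (c - R - c) / R = -1 := by field_simp; ring
  rw [arcFun_eq_zero hR (by simp), arcFun_eq_zero hR (by simp), e1, e2, Real.arcsin_neg,
    Real.arcsin_one] at h
  convert h using 1 <;> ring

/-- Perimeter and area of a disk. -/
theorem ball_pt_perimeter {r c : ℝ} (hr : 0 < r) :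
    perimeter (Metric.ball (pt c 0) r) = ENNReal.ofReal (2 * (Real.pi * r)) ∧
      volume (Metric.ball (pt c 0) r) = ENNReal.ofReal (Real.pi * r ^ 2) := by
  rw [ball_eq_profile hr]
  have h := (Piece.arcFun_full (c := c) hr).perimeter_eq (arcFun_nonneg r c)
    fun x hx => arcFun_eq_zero hr hx
  refine ⟨h.1, ?_⟩
  rw [h.2]
  congr 1
  ring

section TwoDisks

variable {r₁ r₂ D : ℝ}

/-- The two disks lie over disjoint intervals, so at every abscissa at most one of the arc functions
is nonzero and their sum does the work of their maximum. -/
lemma union_ball_eq_profile (h1 : 0 < r₁) (h2 : 0 < r₂) (hD : r₁ + r₂ ≤ D) :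
    Metric.ball (pt 0 0) r₁ ∪ Metric.ball (pt D 0) r₂
      = profile fun x => arcFun r₁ 0 x + arcFun r₂ D x := by
  rw [ball_eq_profile h1, ball_eq_profile h2]
  ext w
  simp only [profile, mem_union, mem_ofPred_eq]
  by_cases hw : w 0 < r₁
  · rw [arcFun_eq_zero h2 (x := w 0) fun h => by linarith [h.1], add_zero]
    refine or_iff_left fun h => ?_
    linarith [abs_nonneg (w 1)]
  · rw [arcFun_eq_zero h1 (x := w 0) fun h => hw (by linarith [h.2]), zero_add]
    refine or_iff_right fun h => ?_
    linarith [abs_nonneg (w 1)]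

lemma two_arcs_eq_zero (h1 : 0 < r₁) (h2 : 0 < r₂) (hD : r₁ + r₂ ≤ D) {x : ℝ}
    (hx : x ∉ Ioo (-r₁) (D + r₂)) : arcFun r₁ 0 x + arcFun r₂ D x = 0 := by
  rw [arcFun_eq_zero h1 fun h => hx ⟨by linarith [h.1], by linarith [h.2]⟩,
    arcFun_eq_zero h2 fun h => hx ⟨by linarith [h.1], by linarith [h.2]⟩, add_zero]

/-- Perimeter and area of the union of two disjoint disks. -/
theorem union_ball_perimeter (h1 : 0 < r₁) (h2 : 0 < r₂) (hD : r₁ + r₂ ≤ D) :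
    perimeter (Metric.ball (pt 0 0) r₁ ∪ Metric.ball (pt D 0) r₂)
        = ENNReal.ofReal (2 * (Real.pi * (r₁ + r₂))) ∧
      volume (Metric.ball (pt 0 0) r₁ ∪ Metric.ball (pt D 0) r₂)
        = ENNReal.ofReal (Real.pi * (r₁ ^ 2 + r₂ ^ 2)) := by
  rw [union_ball_eq_profile h1 h2 hD]
  have p1 : Piece (fun x => arcFun r₁ 0 x + arcFun r₂ D x) (-r₁) r₁ (Real.pi * r₁)
      (Real.pi * r₁ ^ 2 / 2) := by
    have := Piece.arcFun_full (c := 0) h1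
    rw [zero_sub, zero_add] at this
    refine this.congr fun x hx => ?_
    rw [arcFun_eq_zero h2 fun h => by linarith [h.1, hx.2], add_zero]
  have p2 : Piece (fun x => arcFun r₁ 0 x + arcFun r₂ D x) r₁ (D - r₂) 0 0 := by
    refine (Piece.zero (by linarith)).congr fun x hx => ?_
    rw [arcFun_eq_zero h1 fun h => by linarith [h.2, hx.1],
      arcFun_eq_zero h2 fun h => by linarith [h.1, hx.2], add_zero]
  have p3 : Piece (fun x => arcFun r₁ 0 x + arcFun r₂ D x) (D - r₂) (D + r₂) (Real.pi * r₂)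
      (Real.pi * r₂ ^ 2 / 2) := by
    refine (Piece.arcFun_full (c := D) h2).congr fun x hx => ?_
    rw [arcFun_eq_zero h1 fun h => by linarith [h.2, hx.1], zero_add]
  have h := ((p1.append p2).append p3).perimeter_eq
    (fun x => add_nonneg (arcFun_nonneg _ _ _) (arcFun_nonneg _ _ _))
    fun x hx => two_arcs_eq_zero h1 h2 hD hx
  refine ⟨?_, ?_⟩
  · rw [h.1]; congr 1; ring
  · rw [h.2]; congr 1; ring

end TwoDisks

/-! ### Openings -/

lemma opening_mono {l : ℝ} {X Y : Set Plane} (h : X ⊆ Y) : opening l X ⊆ opening l Y :=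
  biUnion_subset_biUnion_left fun _ hx => Subset.trans hx h

lemma opening_subset (l : ℝ) (X : Set Plane) : opening l X ⊆ X := iUnion₂_subset fun _ hx => hx

lemma mem_opening {l : ℝ} {X : Set Plane} {w : Plane} :
    w ∈ opening l X ↔ ∃ x, Metric.ball x l ⊆ X ∧ dist w x < l := by
  simp [opening]

/-- The homothety with centre `w` and ratio `l / R ≤ 1` maps the ball around `p` into itself. Its
image is a ball of radius `l` that still contains `w`. -/
lemma ball_subset_opening {l R : ℝ} {p : Plane} {X : Set Plane} (h0 : 0 < l) (hl : l ≤ R)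
    (hX : Metric.ball p R ⊆ X) : Metric.ball p R ⊆ opening l X := by
  intro w hw
  have hR : 0 < R := h0.trans_le hl
  rw [Metric.mem_ball] at hw
  have hq : 0 ≤ 1 - l / R := by rw [sub_nonneg, div_le_one hR]; exact hl
  have hq' : 0 < l / R := div_pos h0 hR
  refine mem_opening.2 ⟨p + (1 - l / R) • (w - p), fun v hv => hX ?_, ?_⟩
  · rw [Metric.mem_ball] at hv ⊢
    have h1 : dist (p + (1 - l / R) • (w - p)) p = (1 - l / R) * dist w p := by
      rw [dist_eq_norm, add_sub_cancel_left, norm_smul, Real.norm_of_nonneg hq, dist_eq_norm]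
    have h2 := dist_triangle v (p + (1 - l / R) • (w - p)) p
    rw [h1] at h2
    have h3 : (1 - l / R) * dist w p ≤ (1 - l / R) * R := mul_le_mul_of_nonneg_left hw.le hq
    have h4 : (1 - l / R) * R = R - l := by field_simp
    linarith
  · have h1 : w - (p + (1 - l / R) • (w - p)) = (l / R) • (w - p) := by module
    rw [dist_eq_norm, h1, norm_smul, Real.norm_of_nonneg hq'.le, ← dist_eq_norm]
    calc l / R * dist w p < l / R * R := mul_lt_mul_of_pos_left hw hq'
      _ = l := by field_simp

/-! ### The convex hull of two disks -/

section Hull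

variable {r a ρ s c : ℝ}

/-- The upper boundary of the convex hull of the disks `B((0,0), r)` and `B((a,0), ρ)`, whose
common tangent has unit normal `(s, c)`. -/
noncomputable def hullFun (r a ρ s c x : ℝ) : ℝ :=
  if x ≤ r * s then arcFun r 0 x else if x ≤ a + ρ * s then (r - x * s) / c else arcFun ρ a x

/-- Centre and radius of the interpolating ball are affine in `t`, and the norm is convex. The set
bounds the convex hull of the two disks from above. -/
lemma convex_setOf_mem_ball_segment (r a ρ : ℝ) : Convex ℝ
    {w : Plane | ∃ t ∈ Icc (0 : ℝ) 1, dist w (pt (t * a) 0) < r - t * (r - ρ)} := by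
  rintro v ⟨t, ht, hv⟩ w ⟨t', ht', hw⟩ p q hp hq hpq
  refine ⟨p * t + q * t', ?_, ?_⟩
  · have := convex_Icc (0 : ℝ) 1 ht ht' hp hq hpq
    simpa using this
  · have e : p • v + q • w - pt ((p * t + q * t') * a) 0
        = p • (v - pt (t * a) 0) + q • (w - pt (t' * a) 0) := by
      ext i; fin_cases i <;> simp [pt]; ring
    rw [dist_eq_norm] at hv hw ⊢
    rw [e]
    refine (norm_add_le _ _).trans_lt ?_
    rw [norm_smul, norm_smul, Real.norm_of_nonneg hp, Real.norm_of_nonneg hq]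
    have e2 : r - (p * t + q * t') * (r - ρ) = p * (r - t * (r - ρ)) + q * (r - t' * (r - ρ)) := by
      linear_combination (-r) * hpq
    rw [e2]
    rcases hp.eq_or_lt with h0 | h0
    · have hq1 : q = 1 := by linarith
      rw [← h0, hq1]; linarith
    · have := mul_lt_mul_of_pos_left hv h0
      have := mul_le_mul_of_nonneg_left hw.le hq
      linarith

/-- The disks `B((0,0), r)` and `B((a,0), ρ)` have a common outer tangent with unit normal
`(s, c)`. -/
structure HullData (r a ρ s c : ℝ) : Prop where
  ρ_pos : 0 < ρ
  ρ_le : ρ ≤ r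
  a_pos : 0 < a
  s_nonneg : 0 ≤ s
  c_pos : 0 < c
  unit : s ^ 2 + c ^ 2 = 1
  rel : a * s = r - ρ

namespace HullData

variable (h : HullData r a ρ s c)
include h

lemma r_pos : 0 < r := h.ρ_pos.trans_le h.ρ_le

lemma s_lt_one : s < 1 := by nlinarith [h.unit, h.c_pos, h.s_nonneg]

lemma knot_lt : r * s < a + ρ * s := by
  have h1 := h.rel
  have h2 := h.unit
  have h3 := h.c_pos
  have h4 := h.a_pos
  have : a + ρ * s - r * s = a * c ^ 2 := by
    have : r = a * s + ρ := by linarith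
    rw [this]
    linear_combination (-a) * h2
  nlinarith [mul_pos h4 (pow_pos h3 2)]

lemma arcFun_left : arcFun r 0 (r * s) = r * c := by
  rw [arcFun, Real.sqrt_eq_iff_mul_self_eq _ (mul_pos h.r_pos h.c_pos).le]
  · linear_combination (-r ^ 2) * h.unit
  · have := h.unit
    nlinarith [sq_nonneg (r * c)]

lemma arcFun_right : arcFun ρ a (a + ρ * s) = ρ * c := by
  rw [arcFun, Real.sqrt_eq_iff_mul_self_eq _ (mul_pos h.ρ_pos h.c_pos).le]
  · linear_combination (-ρ ^ 2) * h.unit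
  · have := h.unit
    nlinarith [sq_nonneg (ρ * c)]

lemma line_left : (r - r * s * s) / c = r * c := by
  rw [div_eq_iff h.c_pos.ne']
  linear_combination (-r) * h.unit

lemma line_right : (r - (a + ρ * s) * s) / c = ρ * c := by
  rw [div_eq_iff h.c_pos.ne']
  linear_combination (-ρ) * h.unit - h.rel

lemma line_pos {x : ℝ} (hx : x ≤ a + ρ * s) : 0 < (r - x * s) / c := by
  have h1 : (r - (a + ρ * s) * s) / c ≤ (r - x * s) / c := by
    have := h.s_nonneg
    have := h.c_pos
    gcongr
  rw [h.line_right] at h1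
  exact (mul_pos h.ρ_pos h.c_pos).trans_le h1

lemma hullFun_nonneg (x : ℝ) : 0 ≤ hullFun r a ρ s c x := by
  unfold hullFun
  split_ifs with h1 h2
  · exact arcFun_nonneg _ _ _
  · exact (h.line_pos h2).le
  · exact arcFun_nonneg _ _ _

lemma hullFun_eq_zero {x : ℝ} (hx : x ∉ Ioo (-r) (a + ρ)) : hullFun r a ρ s c x = 0 := by
  have h1 := h.knot_lt
  have h2 := h.s_lt_one
  have h3 := h.s_nonneg
  have h4 := h.ρ_pos
  have h5 := h.r_pos
  have h6 : -r < r * s := by nlinarith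
  have h7 : a + ρ * s < a + ρ := by nlinarith
  rcases not_and_or.1 hx with h8 | h8
  · rw [hullFun, if_pos (by linarith), arcFun_eq_zero h5 fun h => by linarith [h.1]]
  · rw [hullFun, if_neg (by linarith), if_neg (by linarith),
      arcFun_eq_zero h4 fun h => by linarith [h.2]]

/-- The boundary consists of an arc, a tangent segment of length `a * c` and another arc. The area
is left unspecified, since only its finiteness is needed. -/
lemma piece_hullFun : ∃ A, Piece (hullFun r a ρ s c) (-r) (a + ρ)
    (r * (Real.pi / 2 + Real.arcsin s) + a * c + ρ * (Real.pi / 2 - Real.arcsin s)) A := by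
  have hk := h.knot_lt
  have hs1 := h.s_lt_one
  have hs0 := h.s_nonneg
  have hρ := h.ρ_pos
  have hr := h.r_pos
  have hc := h.c_pos
  have p1 := Piece.arcFun (R := r) (c := 0) (a := -r) (b := r * s) hr (by linarith) (by nlinarith)
    (by nlinarith)
  have e1 : (r * s - 0) / r = s := by field_simp; ring
  have e2 : (-r - 0) / r = -1 := by field_simp; ring
  rw [e1, e2, Real.arcsin_neg, Real.arcsin_one] at p1
  have p2 := Piece.line (a := r * s) (b := a + ρ * s) (m := -s / c) (k := r / c) hk.le
    fun x hx => by
      have := h.line_pos hx.2.le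
      have e : -s / c * x + r / c = (r - x * s) / c := by field_simp; ring
      rwa [e]
  have e3 : Real.sqrt (1 + (-s / c) ^ 2) * (a + ρ * s - r * s) = a * c := by
    have : 1 + (-s / c) ^ 2 = (1 / c) ^ 2 := by
      field_simp
      linarith [h.unit]
    rw [this, Real.sqrt_sq (by positivity)]
    field_simp
    have : r = a * s + ρ := by linarith [h.rel]
    rw [this]
    linear_combination (-a) * h.unit
  have p3 := Piece.arcFun (R := ρ) (c := a) (a := a + ρ * s) (b := a + ρ) hρ (by nlinarith)
    (by nlinarith) le_rfl
  have e4 : (a + ρ - a) / ρ = 1 := by field_simp; ring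
  have e5 : (a + ρ * s - a) / ρ = s := by field_simp; ring
  rw [e4, e5, Real.arcsin_one] at p3
  have q1 := p1.congr (g := hullFun r a ρ s c) fun x hx => by rw [hullFun, if_pos hx.2]
  have q2 := p2.congr (g := hullFun r a ρ s c) fun x hx => by
    rcases eq_or_lt_of_le hx.1 with h1 | h1
    · rw [← h1, hullFun, if_pos le_rfl, h.arcFun_left, ← h.line_left]
      field_simp
      ring
    · rw [hullFun, if_neg (not_le.2 h1), if_pos hx.2]
      field_simp
      ring
  have q3 := p3.congr (g := hullFun r a ρ s c) fun x hx => by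
    rcases eq_or_lt_of_le hx.1 with h1 | h1
    · rw [← h1, hullFun, if_neg (not_le.2 hk), if_pos le_rfl, h.arcFun_right, h.line_right]
    · rw [hullFun, if_neg (not_le.2 (hk.trans h1)), if_neg (not_le.2 h1)]
  rw [e3] at q2
  have q := (q1.append q2).append q3
  rw [show r * (Real.arcsin s - -(Real.pi / 2)) + a * c + ρ * (Real.pi / 2 - Real.arcsin s)
    = r * (Real.pi / 2 + Real.arcsin s) + a * c + ρ * (Real.pi / 2 - Real.arcsin s) by ring] at q
  exact ⟨_, q⟩

/-- Perimeter of the region under `hullFun`. -/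
lemma profile_perimeter : perimeter (profile (hullFun r a ρ s c))
    = ENNReal.ofReal (2 * (r * (Real.pi / 2 + Real.arcsin s) + a * c
        + ρ * (Real.pi / 2 - Real.arcsin s))) ∧ volume (profile (hullFun r a ρ s c)) < ⊤ := by
  obtain ⟨A, hA⟩ := h.piece_hullFun
  have := hA.perimeter_eq h.hullFun_nonneg fun x hx => h.hullFun_eq_zero hx
  exact ⟨this.1, this.2 ▸ ENNReal.ofReal_lt_top⟩

lemma mem_profile_iff {w : Plane} : w ∈ profile (hullFun r a ρ s c) ↔
    (w 0 ≤ r * s → w 0 ^ 2 + w 1 ^ 2 < r ^ 2) ∧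
    (r * s < w 0 → w 0 ≤ a + ρ * s → w 0 * s + |w 1| * c < r) ∧
    (a + ρ * s < w 0 → (w 0 - a) ^ 2 + w 1 ^ 2 < ρ ^ 2) := by
  have hk := h.knot_lt
  simp only [profile, mem_ofPred_eq, hullFun]
  split_ifs with h1 h2
  · rw [abs_lt_arcFun, sub_zero]
    constructor
    · exact fun H => ⟨fun _ => H, fun h3 => absurd h1 (not_le.2 h3), fun h3 => by linarith⟩
    · exact fun H => H.1 h1
  · rw [lt_div_iff₀ h.c_pos]
    push Not at h1
    constructor
    · exact fun H => ⟨fun h3 => by linarith, fun _ _ => by linarith, fun h3 => by linarith⟩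
    · exact fun H => by linarith [H.2.1 h1 h2]
  · rw [abs_lt_arcFun]
    push Not at h1 h2
    constructor
    · exact fun H => ⟨fun h3 => by linarith, fun _ h3 => by linarith, fun _ => H⟩
    · exact fun H => H.2.2 h2

/-- Cauchy–Schwarz with the unit normal `(s, c)`; all the interpolating balls touch the same line,
because `a * s = r - ρ`. -/
lemma mem_wedge_of_mem_ball {w : Plane} {t : ℝ}
    (hw : dist w (pt (t * a) 0) < r - t * (r - ρ)) : w 0 * s + |w 1| * c < r := by
  have h1 : (w 0 - t * a) * s + |w 1| * c ≤ dist w (pt (t * a) 0) := by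
    refine le_of_sq_le_sq ?_ dist_nonneg
    rw [dist_pt_sq, sub_zero, ← sq_abs (w 1)]
    nlinarith [sq_nonneg ((w 0 - t * a) * c - |w 1| * s), h.unit]
  have h2 : t * a * s = t * (r - ρ) := by rw [mul_assoc, h.rel]
  linarith

/-- Between the two points of tangency only the tangent matters. Beyond such a point the power with
respect to the end disk is negative once the power with respect to the interpolating disk is, as
expanding the squares shows. -/
lemma ball_subset_profile {w : Plane} {t : ℝ} (ht : t ∈ Icc (0 : ℝ) 1)
    (hw : dist w (pt (t * a) 0) < r - t * (r - ρ)) : w ∈ profile (hullFun r a ρ s c) := by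
  have hs := h.s_nonneg
  have hrel := h.rel
  have hu := h.unit
  have hR : 0 ≤ r - t * (r - ρ) := dist_nonneg.trans hw.le
  have hsq := (dist_lt_iff_sq hR).1 hw
  simp only [pt_zero, pt_one, sub_zero] at hsq
  have hta : 0 ≤ t * a := mul_nonneg ht.1 h.a_pos.le
  have hta' : 0 ≤ (1 - t) * a := mul_nonneg (by linarith [ht.2]) h.a_pos.le
  have hs2 : s ^ 2 ≤ 1 := by nlinarith [sq_nonneg c]
  rw [h.mem_profile_iff]
  refine ⟨fun h1 => ?_, fun _ _ => h.mem_wedge_of_mem_ball hw, fun h1 => ?_⟩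
  · have e : r - t * (r - ρ) = r - t * a * s := by rw [← hrel]; ring
    rw [e] at hsq
    have := mul_le_mul_of_nonneg_left h1 hta
    nlinarith [mul_nonneg (sq_nonneg (t * a)) (sub_nonneg.2 hs2)]
  · have e : r - t * (r - ρ) = ρ + (1 - t) * a * s := by linear_combination (-(1 - t)) * hrel
    rw [e] at hsq
    have := mul_le_mul_of_nonneg_left h1.le hta'
    nlinarith [mul_nonneg (sq_nonneg ((1 - t) * a)) (sub_nonneg.2 hs2)]

/-- A point between the knots lies on the segment joining two points above the knots, all three at
the same fraction `κ` of the height of the tangent line. Only the caps of the disks beyond the knots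
are required to lie in `X`; for the set `Γ` this is all that is available at the tip. -/
lemma profile_subset {X : Set Plane} (hX : Convex ℝ X)
    (h1 : ∀ w : Plane, w 0 ≤ r * s → w 0 ^ 2 + w 1 ^ 2 < r ^ 2 → w ∈ X)
    (h2 : ∀ w : Plane, a + ρ * s ≤ w 0 → (w 0 - a) ^ 2 + w 1 ^ 2 < ρ ^ 2 → w ∈ X) :
    profile (hullFun r a ρ s c) ⊆ X := by
  intro w hw
  rw [h.mem_profile_iff] at hw
  have hk := h.knot_lt
  have hc := h.c_pos
  rcases le_or_gt (w 0) (r * s) with h3 | h3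
  · exact h1 w h3 (hw.1 h3)
  rcases lt_or_ge (a + ρ * s) (w 0) with h4 | h4
  · exact h2 w h4.le (hw.2.2 h4)
  have hw' := hw.2.1 h3 h4
  have hL : 0 < r - w 0 * s := by
    have := h.line_pos h4
    rw [lt_div_iff₀ hc] at this
    linarith
  obtain ⟨κ, hκ⟩ : ∃ κ, κ = w 1 * c / (r - w 0 * s) := ⟨_, rfl⟩
  have hκ1 : |κ| < 1 := by
    rw [hκ, abs_div, abs_mul, abs_of_pos hc, abs_of_pos hL, div_lt_one hL]
    linarith
  have hκ2 : κ ^ 2 < 1 := by rw [← sq_abs]; nlinarith [abs_nonneg κ]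
  have hw1 : w 1 * c = κ * (r - w 0 * s) := by rw [hκ]; field_simp
  have hu := h.unit
  have m1 : pt (r * s) (κ * (r * c)) ∈ X := by
    refine h1 _ le_rfl ?_
    simp only [pt_zero, pt_one]
    nlinarith [mul_pos (pow_pos h.r_pos 2) (pow_pos hc 2),
      mul_lt_mul_of_pos_right hκ2 (mul_pos (pow_pos h.r_pos 2) (pow_pos hc 2))]
  have m2 : pt (a + ρ * s) (κ * (ρ * c)) ∈ X := by
    refine h2 _ le_rfl ?_
    simp only [pt_zero, pt_one]
    nlinarith [mul_pos (pow_pos h.ρ_pos 2) (pow_pos hc 2),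
      mul_lt_mul_of_pos_right hκ2 (mul_pos (pow_pos h.ρ_pos 2) (pow_pos hc 2))]
  obtain ⟨L, hL'⟩ : ∃ L, L = a + ρ * s - r * s := ⟨_, rfl⟩
  have hLpos : 0 < L := by linarith
  obtain ⟨t, ht⟩ : ∃ t, t = (w 0 - r * s) / L := ⟨_, rfl⟩
  have htL : t * L = w 0 - r * s := by rw [ht]; field_simp
  have ht0 : 0 ≤ t := by rw [ht]; exact div_nonneg (by linarith) hLpos.le
  have ht1 : t ≤ 1 := by rw [ht, div_le_one hLpos]; linarith
  have := hX m1 m2 (sub_nonneg.2 ht1) ht0 (by ring)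
  convert this using 1
  ext i
  fin_cases i
  · simp only [Fin.zero_eta, PiLp.add_apply, PiLp.smul_apply, pt_zero, smul_eq_mul]
    rw [hL'] at htL
    linarith
  · simp only [Fin.mk_one, PiLp.add_apply, PiLp.smul_apply, pt_one, smul_eq_mul]
    apply mul_right_cancel₀ hc.ne'
    rw [hw1]
    have e1 : r * c * c = r - r * s * s := by linear_combination r * hu
    have e2 : ρ * c * c = r - (a + ρ * s) * s := by linear_combination ρ * hu + h.rel
    calc κ * (r - w 0 * s) = κ * ((1 - t) * (r - r * s * s) + t * (r - (a + ρ * s) * s)) := by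
          rw [hL'] at htL
          linear_combination (κ * s) * htL
      _ = _ := by rw [← e1, ← e2]; ring

/-- The convex hull of two disks. -/
theorem convexHull_eq : convexHull ℝ (Metric.ball (pt 0 0) r ∪ Metric.ball (pt a 0) ρ)
    = profile (hullFun r a ρ s c) := by
  apply subset_antisymm
  · refine (convexHull_min ?_ (convex_setOf_mem_ball_segment r a ρ)).trans ?_
    · refine union_subset (fun w hw => ⟨0, by simp, ?_⟩) (fun w hw => ⟨1, by simp, ?_⟩)
      · simpa using hw
      · simpa using hw
    · rintro w ⟨t, ht, hw⟩
      exact h.ball_subset_profile ht hw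
  · refine h.profile_subset (convex_convexHull ℝ _) (fun w _ hw => ?_) (fun w _ hw => ?_)
    · exact subset_convexHull ℝ _ (Or.inl ((mem_ball_pt h.r_pos.le).2 (by simpa using hw)))
    · exact subset_convexHull ℝ _ (Or.inr ((mem_ball_pt h.ρ_pos.le).2 (by simpa using hw)))

lemma convex_profile : Convex ℝ (profile (hullFun r a ρ s c)) :=
  h.convexHull_eq ▸ convex_convexHull ℝ _

lemma exists_ball_of_mem {w : Plane} (hw : w ∈ profile (hullFun r a ρ s c)) :
    ∃ t ∈ Icc (0 : ℝ) 1, dist w (pt (t * a) 0) < r - t * (r - ρ) := by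
  rw [← h.convexHull_eq] at hw
  refine convexHull_min ?_ (convex_setOf_mem_ball_segment r a ρ) hw
  refine union_subset (fun w hw => ⟨0, by simp, ?_⟩) (fun w hw => ⟨1, by simp, ?_⟩)
  · simpa using hw
  · simpa using hw

/-- The opening of the convex hull of two disks with a radius at most `ρ`. -/
lemma subset_opening {l : ℝ} (h0 : 0 < l) (hl : l ≤ ρ) :
    profile (hullFun r a ρ s c) ⊆ opening l (profile (hullFun r a ρ s c)) := by
  intro w hw
  obtain ⟨t, ht, hwt⟩ := h.exists_ball_of_mem hw
  have hR : l ≤ r - t * (r - ρ) := by nlinarith [ht.1, ht.2, h.ρ_le]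
  exact ball_subset_opening h0 hR (fun v hv => h.ball_subset_profile ht hv) hwt

end HullData

end Hull

/-! ### The closing of two disks and its connectedness -/

/-- Two disks with centers `(0,0)` and `(D,0)`. -/
def twoDisks (r₁ r₂ D : ℝ) : Set Plane := Metric.ball (pt 0 0) r₁ ∪ Metric.ball (pt D 0) r₂

/-- A point is in the sandwich between an open and a closed profile, up to vertical lines. -/
lemma ae_eq_profile {f : ℝ → ℝ} (hf : Continuous f) {X : Set Plane} {N : Set ℝ} (hN : N.Countable)
    (h1 : profile f ⊆ X) (h2 : ∀ w ∈ X, w 0 ∉ N → |w 1| ≤ f (w 0)) :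
    X =ᵐ[volume] profile f := by
  have hline : volume {w : Plane | w 0 ∈ N} = 0 := by
    have hm : MeasurableSet {w : Plane | w 0 ∈ N} :=
      hN.measurableSet.preimage (by fun_prop : Measurable fun w : Plane => w 0)
    rw [← measurePreserving_coordEquiv.measure_preimage hm.nullMeasurableSet]
    have : coordEquiv ⁻¹' {w : Plane | w 0 ∈ N} = N ×ˢ univ := by
      ext p; simp [coordEquiv_apply]
    rw [this, Measure.volume_eq_prod, Measure.prod_prod, hN.measure_zero, zero_mul]
  have h3 := profile_ae_eq_closed hf
  have h4 : volume ({w : Plane | |w 1| ≤ f (w 0)} \ profile f) = 0 :=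
    (ae_eq_set.1 h3).2
  refine ae_eq_set.2 ⟨measure_mono_null (fun w hw => ?_) (measure_union_null hline h4), ?_⟩
  · by_cases hwN : w 0 ∈ N
    · exact Or.inl hwN
    · exact Or.inr ⟨h2 w hw.1 hwN, hw.2⟩
  · rw [Set.sdiff_eq_empty.2 h1, measure_empty]

section Closing

variable {r₁ r₂ D r : ℝ}

/-- A ball of radius `r` misses a disk of radius `r_i` exactly when the centres are at distance at
least `r_i + r`. This turns membership into a condition on the distance to all admissible centres.
-/
lemma mem_closing_twoDisks (h1 : 0 < r₁) (h2 : 0 < r₂) (hr : 0 < r) {w : Plane} :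
    w ∈ closing r (twoDisks r₁ r₂ D) ↔ ∀ x y : ℝ, (r₁ + r) ^ 2 ≤ x ^ 2 + y ^ 2 →
      (r₂ + r) ^ 2 ≤ (x - D) ^ 2 + y ^ 2 → r ^ 2 ≤ (w 0 - x) ^ 2 + (w 1 - y) ^ 2 := by
  have key : ∀ x : Plane, Metric.ball x r ⊆ (twoDisks r₁ r₂ D)ᶜ ↔
      (r₁ + r) ^ 2 ≤ x 0 ^ 2 + x 1 ^ 2 ∧ (r₂ + r) ^ 2 ≤ (x 0 - D) ^ 2 + x 1 ^ 2 := by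
    intro x
    rw [subset_compl_iff_disjoint_right, twoDisks, disjoint_union_right,
      disjoint_ball_ball_iff hr h1, disjoint_ball_ball_iff hr h2, le_dist_iff_sq (by positivity),
      le_dist_iff_sq (by positivity), add_comm r, add_comm r]
    simp
  rw [closing, if_pos hr, mem_compl_iff, mem_opening]
  push Not
  constructor
  · intro H x y hx hy
    exact (le_dist_iff_sq hr.le).1 (H (pt x y) ((key _).2 ⟨hx, hy⟩))
  · intro H x hx
    have := (key x).1 hx
    exact (le_dist_iff_sq hr.le).2 (H _ _ this.1 this.2)

/-- A point above an admissible ball is not in the closing. -/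
lemma notMem_closing_of_column (h1 : 0 < r₁) (h2 : 0 < r₂) (hr : 0 < r) {w : Plane} {x y : ℝ}
    (hy : 0 ≤ y) (hx1 : (r₁ + r) ^ 2 ≤ x ^ 2 + y ^ 2) (hx2 : (r₂ + r) ^ 2 ≤ (x - D) ^ 2 + y ^ 2)
    (hlt : |w 0 - x| < r) (habove : y - Real.sqrt (r ^ 2 - (w 0 - x) ^ 2) < |w 1|) :
    w ∉ closing r (twoDisks r₁ r₂ D) := by
  intro hw
  rw [mem_closing_twoDisks h1 h2 hr] at hw
  have hp : 0 < r ^ 2 - (w 0 - x) ^ 2 := by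
    rw [← sq_abs (w 0 - x)]; nlinarith [abs_nonneg (w 0 - x)]
  have hs := Real.sq_sqrt hp.le
  have hs0 := Real.sqrt_pos.2 hp
  obtain ⟨ε, hε1, hε2⟩ : ∃ ε : ℝ, ε ^ 2 = 1 ∧ w 1 = ε * |w 1| := by
    rcases le_total 0 (w 1) with h | h
    · exact ⟨1, by norm_num, by rw [abs_of_nonneg h]; ring⟩
    · exact ⟨-1, by norm_num, by rw [abs_of_nonpos h]; ring⟩
  -- Moving an admissible centre away from the axis keeps it admissible, so its height can be raised
  -- to that of `w`, on the side where `w` lies.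
  set Y := max y |w 1| with hY
  have hYy : y ≤ Y := le_max_left _ _
  have hYsq : (ε * Y) ^ 2 = Y ^ 2 := by rw [mul_pow, hε1, one_mul]
  have := hw x (ε * Y) (by rw [hYsq]; nlinarith) (by rw [hYsq]; nlinarith)
  rw [hε2, ← mul_sub, mul_pow, hε1, one_mul] at this
  rcases le_total y |w 1| with h | h
  · rw [hY, max_eq_right h] at this
    nlinarith
  · rw [hY, max_eq_left h] at this
    nlinarith

lemma twoDisks_subset_closing (hr : 0 < r) :
    twoDisks r₁ r₂ D ⊆ closing r (twoDisks r₁ r₂ D) := by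
  rw [closing, if_pos hr]
  exact subset_compl_comm.1 (opening_subset _ _)

/-- The closing lies over `[-r₁, D + r₂]`. -/
lemma closing_abscissa (h1 : 0 < r₁) (h2 : 0 < r₂) (hD : r₁ + r₂ ≤ D) (hr : 0 < r) {w : Plane}
    (hw : w ∈ closing r (twoDisks r₁ r₂ D)) : w 0 ∈ Icc (-r₁) (D + r₂) := by
  by_contra hcon
  rcases not_and_or.1 hcon with h | h
  · push Not at h
    have hm := min_le_left (w 0) (-r₁ - r)
    have hm' := min_le_right (w 0) (-r₁ - r)
    have habs : |w 0 - min (w 0) (-r₁ - r)| < r := by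
      rw [abs_of_nonneg (by linarith), sub_lt_comm, lt_min_iff]
      constructor <;> linarith
    refine notMem_closing_of_column h1 h2 hr (x := min (w 0) (-r₁ - r)) le_rfl ?_ ?_ habs ?_ hw
    · nlinarith
    · nlinarith
    · have : 0 < Real.sqrt (r ^ 2 - (w 0 - min (w 0) (-r₁ - r)) ^ 2) := by
        rw [Real.sqrt_pos, ← sq_abs (_ - _)]
        nlinarith [abs_nonneg (w 0 - min (w 0) (-r₁ - r))]
      linarith [abs_nonneg (w 1)]
  · push Not at h
    have hm := le_max_left (w 0) (D + r₂ + r)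
    have hm' := le_max_right (w 0) (D + r₂ + r)
    have habs : |w 0 - max (w 0) (D + r₂ + r)| < r := by
      rw [abs_of_nonpos (by linarith), neg_sub, sub_lt_iff_lt_add, max_lt_iff]
      constructor <;> linarith
    refine notMem_closing_of_column h1 h2 hr (x := max (w 0) (D + r₂ + r)) le_rfl ?_ ?_ habs ?_ hw
    · nlinarith
    · nlinarith
    · have : 0 < Real.sqrt (r ^ 2 - (w 0 - max (w 0) (D + r₂ + r)) ^ 2) := by
        rw [Real.sqrt_pos, ← sq_abs (_ - _)]
        nlinarith [abs_nonneg (w 0 - max (w 0) (D + r₂ + r))]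
      linarith [abs_nonneg (w 1)]

/-- Half the length of the chord cut out of the axis by the gap, on the side of the disk of
radius `R`. -/
noncomputable def gapLen (R r : ℝ) : ℝ := Real.sqrt (R ^ 2 + 2 * R * r)

/-- The value is `(R + r)² - r²`: `gapLen R r` is the horizontal distance between the centre of a
disk of radius `R` on the axis and the centre of a disk of radius `r` that touches both this disk
and the axis. -/
lemma gapLen_sq {R r : ℝ} (hR : 0 < R) (hr : 0 ≤ r) : gapLen R r ^ 2 = R ^ 2 + 2 * R * r :=
  Real.sq_sqrt (by positivity)

lemma gapLen_pos {R r : ℝ} (hR : 0 < R) (hr : 0 ≤ r) : 0 < gapLen R r :=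
  Real.sqrt_pos.2 (by positivity)

lemma gapLen_lt {R r : ℝ} (hR : 0 < R) (hr : 0 < r) : gapLen R r < R + r := by
  have := gapLen_sq hR hr.le
  nlinarith [gapLen_pos hR hr.le, sq_nonneg r, mul_pos hr hr]

/-- Below the critical radius the closing is disconnected. -/
theorem not_isConnected_closing (h1 : 0 < r₁) (h2 : 0 < r₂) (hr : 0 < r)
    (hgap : gapLen r₁ r + gapLen r₂ r < D) : ¬ IsConnected (closing r (twoDisks r₁ r₂ D)) := by
  intro hcon
  have hg1 := gapLen_pos h1 hr.le
  have hg2 := gapLen_pos h2 hr.le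
  have hs1 := gapLen_sq h1 hr.le
  have hs2 := gapLen_sq h2 hr.le
  obtain ⟨x₀, hx1, hx2⟩ : ∃ x₀, gapLen r₁ r < x₀ ∧ x₀ < D - gapLen r₂ r :=
    exists_between (by linarith)
  have hpos1 : r ^ 2 > (r₁ + r) ^ 2 - x₀ ^ 2 := by nlinarith
  have hpos2 : r ^ 2 > (r₂ + r) ^ 2 - (D - x₀) ^ 2 := by nlinarith
  -- Over an abscissa `x₀` inside the gap there is an admissible centre at a height `ρ < r`. Its
  -- ball crosses the axis, so no point of the closing lies over `x₀`.
  obtain ⟨ρ, hρ0, hρr, hρ1, hρ2⟩ : ∃ ρ, 0 ≤ ρ ∧ ρ < r ∧ (r₁ + r) ^ 2 - x₀ ^ 2 ≤ ρ ^ 2 ∧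
      (r₂ + r) ^ 2 - (D - x₀) ^ 2 ≤ ρ ^ 2 := by
    set m := max 0 (max ((r₁ + r) ^ 2 - x₀ ^ 2) ((r₂ + r) ^ 2 - (D - x₀) ^ 2)) with hm
    have hm0 : 0 ≤ m := le_max_left _ _
    refine ⟨Real.sqrt m, Real.sqrt_nonneg _, ?_, ?_, ?_⟩
    · rw [Real.sqrt_lt' hr, hm]
      exact max_lt (by positivity) (max_lt hpos1 hpos2)
    · rw [Real.sq_sqrt hm0]
      exact (le_max_left _ _).trans (le_max_right _ _)
    · rw [Real.sq_sqrt hm0]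
      exact (le_max_right _ _).trans (le_max_right _ _)
  have hmiss : ∀ w ∈ closing r (twoDisks r₁ r₂ D), w 0 ≠ x₀ := by
    intro w hw hw0
    refine notMem_closing_of_column h1 h2 hr (x := x₀) (y := ρ) hρ0 (by linarith) ?_ ?_ ?_ hw
    · nlinarith
    · rw [hw0, sub_self, abs_zero]; exact hr
    · rw [hw0, sub_self]
      norm_num
      rw [Real.sqrt_sq hr.le]
      linarith [abs_nonneg (w 1)]
  have hpre := hcon.isPreconnected.image (fun w : Plane => w 0)
    (by fun_prop : Continuous fun w : Plane => w 0).continuousOn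
  have hsub := twoDisks_subset_closing (r₁ := r₁) (r₂ := r₂) (D := D) hr
  have m1 : (0 : ℝ) ∈ (fun w : Plane => w 0) '' closing r (twoDisks r₁ r₂ D) :=
    ⟨pt 0 0, hsub (Or.inl (Metric.mem_ball_self h1)), rfl⟩
  have m2 : D ∈ (fun w : Plane => w 0) '' closing r (twoDisks r₁ r₂ D) :=
    ⟨pt D 0, hsub (Or.inr (Metric.mem_ball_self h2)), rfl⟩
  obtain ⟨w, hw, hw0⟩ := hpre.Icc_subset m1 m2 (⟨by linarith, by linarith⟩ : x₀ ∈ Icc 0 D)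
  exact hmiss w hw hw0

/-- Above the critical radius the closing contains the axis of the configuration. -/
lemma axis_mem_closing (h1 : 0 < r₁) (h2 : 0 < r₂) (hr : 0 < r)
    (hgap : D ≤ gapLen r₁ r + gapLen r₂ r) {x : ℝ} (hx : x ∈ Icc (-r₁) (D + r₂)) :
    pt x 0 ∈ closing r (twoDisks r₁ r₂ D) := by
  rw [mem_closing_twoDisks h1 h2 hr]
  intro u v hu hv
  simp only [pt_zero, pt_one]
  have hg1 := gapLen_pos h1 hr.le
  have hg2 := gapLen_pos h2 hr.le
  have hs1 := gapLen_sq h1 hr.le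
  have hs2 := gapLen_sq h2 hr.le
  by_contra hlt
  push Not at hlt
  have hv2 : v ^ 2 < r ^ 2 := by nlinarith [sq_nonneg (x - u)]
  have hu1 : gapLen r₁ r ^ 2 < u ^ 2 := by nlinarith
  have hu2 : gapLen r₂ r ^ 2 < (D - u) ^ 2 := by nlinarith
  have hux : |x - u| < r := abs_lt_of_sq_lt_sq (by nlinarith [sq_nonneg v]) hr.le
  rw [abs_lt] at hux
  -- This treats an admissible centre lying to the left of both disk centres or to the right of
  -- both: `t` is its horizontal distance to the closer disk centre and `s` the one to the point on
  -- the axis.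
  have hstep : ∀ R t : ℝ, 0 < R → (R + r) ^ 2 ≤ t ^ 2 + v ^ 2 → 0 ≤ t → ∀ s : ℝ, t - R ≤ s →
      s ≤ r → r ^ 2 ≤ s ^ 2 + v ^ 2 := by
    intro R t hR ht ht0 s hs hsr
    rcases le_total 0 s with h0 | h0
    · nlinarith
    · nlinarith
  rcases lt_or_ge u 0 with h3 | h3
  · have := hstep r₁ (-u) h1 (by linarith) (by linarith) (x - u) (by linarith [hx.1]) hux.2.le
    nlinarith
  rcases lt_or_ge D u with h4 | h4
  · have := hstep r₂ (u - D) h2 hv (by linarith) (u - x) (by linarith [hx.2]) (by linarith)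
    nlinarith
  have h5 : gapLen r₁ r < u := by nlinarith
  have h6 : gapLen r₂ r < D - u := by nlinarith
  linarith

/-- The closing is symmetric and contains vertical segments down to the axis. -/
lemma closing_vertical (h1 : 0 < r₁) (h2 : 0 < r₂) (hr : 0 < r) {w : Plane}
    (hw : w ∈ closing r (twoDisks r₁ r₂ D)) {y : ℝ} (hy : |y| ≤ |w 1|) :
    pt (w 0) y ∈ closing r (twoDisks r₁ r₂ D) := by
  by_contra hcon
  rw [mem_closing_twoDisks h1 h2 hr] at hcon
  push Not at hcon
  obtain ⟨u, v, hu, hv, hlt⟩ := hcon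
  simp only [pt_zero, pt_one] at hlt
  have hlt2 : (w 0 - u) ^ 2 + (|y| - |v|) ^ 2 < r ^ 2 := by
    have : (|y| - |v|) ^ 2 ≤ (y - v) ^ 2 := by
      nlinarith [sq_abs y, sq_abs v, le_abs_self (y * v), abs_mul y v]
    linarith
  refine notMem_closing_of_column h1 h2 hr (x := u) (abs_nonneg v) (by rwa [sq_abs])
    (by rwa [sq_abs]) (abs_lt_of_sq_lt_sq (by nlinarith [sq_nonneg (|y| - |v|)]) hr.le) ?_ hw
  have h3 : |v| - |y| < Real.sqrt (r ^ 2 - (w 0 - u) ^ 2) := by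
    refine lt_of_le_of_lt (le_abs_self _) ?_
    rw [Real.lt_sqrt (abs_nonneg _), sq_abs]
    linarith [sub_sq_comm |v| |y|]
  linarith

/-- Above the critical radius the closing is connected. -/
theorem isConnected_closing (h1 : 0 < r₁) (h2 : 0 < r₂) (hD : r₁ + r₂ ≤ D) (hr : 0 < r)
    (hgap : D ≤ gapLen r₁ r + gapLen r₂ r) : IsConnected (closing r (twoDisks r₁ r₂ D)) := by
  have haxis := fun {x} => axis_mem_closing (x := x) h1 h2 hr hgap
  have h0 : pt 0 0 ∈ closing r (twoDisks r₁ r₂ D) := haxis ⟨by linarith, by linarith⟩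
  refine ⟨⟨_, h0⟩, isPreconnected_of_forall (pt 0 0) fun w hw => ?_⟩
  have hw0 := closing_abscissa h1 h2 hD hr hw
  refine ⟨(fun y => pt (w 0) y) '' uIcc (w 1) 0 ∪ (fun x => pt x 0) '' uIcc (w 0) 0, ?_, ?_, ?_, ?_⟩
  · rintro _ (⟨y, hy, rfl⟩ | ⟨x, hx, rfl⟩)
    · refine closing_vertical h1 h2 hr hw ?_
      have := abs_sub_right_of_mem_uIcc hy
      simpa using this
    · refine haxis ?_
      have hsub : uIcc (w 0) 0 ⊆ Icc (-r₁) (D + r₂) :=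
        uIcc_subset_Icc hw0 ⟨by linarith, by linarith⟩
      exact hsub hx
  · exact Or.inr ⟨0, right_mem_uIcc, rfl⟩
  · exact Or.inl ⟨w 1, left_mem_uIcc, pt_eta w⟩
  · refine IsPreconnected.union (pt (w 0) 0) ⟨0, right_mem_uIcc, rfl⟩ ⟨w 0, left_mem_uIcc, rfl⟩ ?_ ?_
    · exact isPreconnected_uIcc.image _ (continuous_pt continuous_const continuous_id).continuousOn
    · exact isPreconnected_uIcc.image _ (continuous_pt continuous_id continuous_const).continuousOn

/-- For small radii the closing adds nothing. -/
theorem closing_ae_eq_of_le (h1 : 0 < r₁) (h2 : 0 < r₂) (hr : 0 < r)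
    (hgap : r₁ + r₂ + 2 * r ≤ D) :
    closing r (twoDisks r₁ r₂ D) =ᵐ[volume] twoDisks r₁ r₂ D := by
  have hD : r₁ + r₂ ≤ D := by linarith
  have hpr := union_ball_eq_profile h1 h2 hD
  have hc : Continuous fun x => arcFun r₁ 0 x + arcFun r₂ D x :=
    (continuous_arcFun _ _).add (continuous_arcFun _ _)
  rw [twoDisks, hpr]
  refine ae_eq_profile hc countable_empty ?_ fun w hw _ => ?_
  · rw [← hpr]; exact twoDisks_subset_closing hr
  rw [← hpr] at hw
  by_contra hcon
  push Not at hcon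
  have ha1 := arcFun_nonneg r₁ 0 (w 0)
  have ha2 := arcFun_nonneg r₂ D (w 0)
  have hn : ∀ R c : ℝ, arcFun R c (w 0) < |w 1| → R ^ 2 < (w 0 - c) ^ 2 + w 1 ^ 2 := by
    intro R c hlt
    have h3 := (Real.sqrt_lt' ((arcFun_nonneg R c (w 0)).trans_lt hlt)).1 hlt
    rw [sq_abs] at h3
    linarith
  have n1 := hn r₁ 0 (by linarith)
  have n2 := hn r₂ D (by linarith)
  rw [sub_zero] at n1
  have hw' := hw
  rw [← twoDisks, mem_closing_twoDisks h1 h2 hr] at hw'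
  -- move the point radially to the admissible distance from a center
  have hrad : ∀ R c R' c' : ℝ, 0 < R → 0 < R' → R + R' + 2 * r ≤ |c' - c| →
      R ^ 2 < (w 0 - c) ^ 2 + w 1 ^ 2 → (w 0 - c) ^ 2 + w 1 ^ 2 < (R + r) ^ 2 →
      ∃ x y : ℝ, (R + r) ^ 2 ≤ (x - c) ^ 2 + y ^ 2 ∧ (R' + r) ^ 2 ≤ (x - c') ^ 2 + y ^ 2 ∧
        (w 0 - x) ^ 2 + (w 1 - y) ^ 2 < r ^ 2 := by
    intro R c R' c' hR hR' hsep hlow hup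
    obtain ⟨ρ, hρ⟩ : ∃ ρ, ρ = Real.sqrt ((w 0 - c) ^ 2 + w 1 ^ 2) := ⟨_, rfl⟩
    have hρ2 : ρ ^ 2 = (w 0 - c) ^ 2 + w 1 ^ 2 := by rw [hρ, Real.sq_sqrt (by positivity)]
    have hρ0 : 0 ≤ ρ := hρ ▸ Real.sqrt_nonneg _
    have hρR : R < ρ := by nlinarith
    have hρRr : ρ < R + r := by nlinarith
    have hρpos : 0 < ρ := hR.trans hρR
    obtain ⟨k, hk⟩ : ∃ k, k = (R + r) / ρ := ⟨_, rfl⟩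
    have hkρ : k * ρ = R + r := by rw [hk]; field_simp
    have e1 : (c + k * (w 0 - c) - c) ^ 2 + (k * w 1) ^ 2 = (R + r) ^ 2 := by
      rw [← hkρ, mul_pow k ρ, hρ2]; ring
    refine ⟨c + k * (w 0 - c), k * w 1, e1.ge, ?_, ?_⟩
    · have hx : |c + k * (w 0 - c) - c| ≤ R + r :=
        abs_le_of_sq_le_sq (by nlinarith [sq_nonneg (k * w 1)]) (by positivity)
      obtain ⟨X, hX⟩ : ∃ X, X = c + k * (w 0 - c) := ⟨_, rfl⟩
      rw [← hX] at hx ⊢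
      have h5 : R' + r ≤ |X - c'| := by
        have h6 := abs_sub_abs_le_abs_sub (c' - c) (X - c)
        have h7 : |c' - c - (X - c)| = |X - c'| := by rw [abs_sub_comm]; congr 1; ring
        linarith
      rw [← sq_abs (X - c')]
      nlinarith [sq_nonneg (k * w 1)]
    · have e2 : (w 0 - (c + k * (w 0 - c))) ^ 2 + (w 1 - k * w 1) ^ 2 = ((k - 1) * ρ) ^ 2 := by
        rw [mul_pow (k - 1), hρ2]; ring
      rw [e2]
      have : (k - 1) * ρ = R + r - ρ := by rw [sub_mul, hkρ]; ring
      rw [this]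
      nlinarith
  rcases lt_or_ge (w 0 ^ 2 + w 1 ^ 2) ((r₁ + r) ^ 2) with h3 | h3
  · obtain ⟨x, y, hx, hy, hlt⟩ := hrad r₁ 0 r₂ D h1 h2
      (by rw [sub_zero, abs_of_nonneg (by linarith)]; linarith) (by simpa using n1) (by simpa using h3)
    have := hw' x y (by simpa using hx) hy
    linarith
  rcases lt_or_ge ((w 0 - D) ^ 2 + w 1 ^ 2) ((r₂ + r) ^ 2) with h4 | h4
  · obtain ⟨x, y, hx, hy, hlt⟩ := hrad r₂ D r₁ 0 h2 h1
      (by rw [zero_sub, abs_neg, abs_of_nonneg (by linarith)]; linarith) n2 h4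
    have := hw' x y (by simpa using hy) hx
    linarith
  have := hw' (w 0) (w 1) h3 h4
  simp at this
  nlinarith

end Closing

/-! ### The touching disks and the shape of the closing -/

/-- The configuration of two disks of radii `r₁ ≥ r₂` with centers `(0,0)`, `(D,0)` and of the disks
of radius `r` with centers `(p, ± h)` touching both. -/
structure BridgeData (r₁ r₂ D r p h : ℝ) : Prop where
  r₂_pos : 0 < r₂
  le : r₂ ≤ r₁
  sep : r₁ + r₂ ≤ D
  r_pos : 0 < r
  h_pos : 0 < h
  e₁ : p ^ 2 + h ^ 2 = (r₁ + r) ^ 2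
  e₂ : (D - p) ^ 2 + h ^ 2 = (r₂ + r) ^ 2

/-- The abscissa of the point at distances `r₁ + r` and `r₂ + r` from the two centers. -/
noncomputable def apexX (r₁ r₂ D r : ℝ) : ℝ := (D ^ 2 + (r₁ + r) ^ 2 - (r₂ + r) ^ 2) / (2 * D)

/-- The ordinate of the point at distances `r₁ + r` and `r₂ + r` from the two centers. -/
noncomputable def apexY (r₁ r₂ D r : ℝ) : ℝ := Real.sqrt ((r₁ + r) ^ 2 - apexX r₁ r₂ D r ^ 2)

/-- The overlap condition is the strict triangle inequality for the sides `r₁ + r`, `r₂ + r` and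
`D`; the other triangle inequalities follow from the separation of the disks. -/
lemma apex_radicand_pos {r₁ r₂ D r : ℝ} (h2 : 0 < r₂) (hle : r₂ ≤ r₁) (hD : r₁ + r₂ ≤ D)
    (hr : 0 < r) (hov : D < r₁ + r₂ + 2 * r) : 0 < (r₁ + r) ^ 2 - apexX r₁ r₂ D r ^ 2 := by
  have hD0 : 0 < D := by linarith
  have hp : apexX r₁ r₂ D r * (2 * D) = D ^ 2 + (r₁ + r) ^ 2 - (r₂ + r) ^ 2 := by
    rw [apexX]; field_simp
  have h1 : apexX r₁ r₂ D r < r₁ + r := by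
    rw [apexX, div_lt_iff₀ (by positivity)]
    have : (D - (r₁ + r)) ^ 2 < (r₂ + r) ^ 2 := by
      apply sq_lt_sq'
      · linarith
      · linarith
    linarith [sub_sq D (r₁ + r)]
  have h3 : 0 < apexX r₁ r₂ D r := by
    have : (r₂ + r) ^ 2 ≤ (r₁ + r) ^ 2 := pow_le_pow_left₀ (by positivity) (by linarith) 2
    have : 0 < D ^ 2 := by positivity
    exact div_pos (by linarith) (by positivity)
  nlinarith

lemma bridgeData_apex {r₁ r₂ D r : ℝ} (h2 : 0 < r₂) (hle : r₂ ≤ r₁) (hD : r₁ + r₂ ≤ D)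
    (hr : 0 < r) (hov : D < r₁ + r₂ + 2 * r) :
    BridgeData r₁ r₂ D r (apexX r₁ r₂ D r) (apexY r₁ r₂ D r) := by
  have hpos := apex_radicand_pos h2 hle hD hr hov
  have hD0 : 0 < D := by linarith
  have hp : apexX r₁ r₂ D r * (2 * D) = D ^ 2 + (r₁ + r) ^ 2 - (r₂ + r) ^ 2 := by
    rw [apexX]; field_simp
  have hsq : apexY r₁ r₂ D r ^ 2 = (r₁ + r) ^ 2 - apexX r₁ r₂ D r ^ 2 := Real.sq_sqrt hpos.le
  refine ⟨h2, hle, hD, hr, Real.sqrt_pos.2 hpos, by rw [hsq]; ring, ?_⟩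
  rw [hsq]
  linear_combination -hp

/-- The upper boundary of the closing of two disks. -/
noncomputable def closeFun (r₁ r₂ D r p h x : ℝ) : ℝ :=
  if x ≤ p * r₁ / (r₁ + r) then arcFun r₁ 0 x
  else if x ≤ D - (D - p) * r₂ / (r₂ + r) then max 0 (h - arcFun r p x)
  else arcFun r₂ D x

/-- The disk of radius `r` touching the disk of radius `R` from outside at `(X, Y)` has its centre
at `(R + r) / R` times that point, and its lower arc over `X` passes through the point of contact.
-/
lemma scaled_arc {R r X Y : ℝ} (hR : 0 < R) (hr : 0 < r) (hX : X ^ 2 ≤ R ^ 2)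
    (hY : Y = Real.sqrt (R ^ 2 - X ^ 2)) :
    (R + r) / R * Y - Real.sqrt (r ^ 2 - (X - (R + r) / R * X) ^ 2) = Y := by
  have hY2 : Y ^ 2 = R ^ 2 - X ^ 2 := by rw [hY, Real.sq_sqrt (by linarith)]
  have hY0 : 0 ≤ Y := hY ▸ Real.sqrt_nonneg _
  have : r ^ 2 - (X - (R + r) / R * X) ^ 2 = (r / R * Y) ^ 2 := by
    rw [mul_pow, hY2]; field_simp; ring
  rw [this, Real.sqrt_sq (by positivity)]
  field_simp
  ring

section

variable {r₁ r₂ D r p h : ℝ}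

lemma closeFun_nonneg (x : ℝ) : 0 ≤ closeFun r₁ r₂ D r p h x := by
  unfold closeFun
  split_ifs
  · exact arcFun_nonneg _ _ _
  · exact le_max_left _ _
  · exact arcFun_nonneg _ _ _

lemma closeFun_left {x : ℝ} (hx : x ≤ p * r₁ / (r₁ + r)) :
    closeFun r₁ r₂ D r p h x = arcFun r₁ 0 x := if_pos hx

end

namespace BridgeData

variable {r₁ r₂ D r p h : ℝ} (H : BridgeData r₁ r₂ D r p h)
include H

lemma r₁_pos : 0 < r₁ := H.r₂_pos.trans_le H.le

lemma D_pos : 0 < D := by linarith [H.r₁_pos, H.r₂_pos, H.sep]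

lemma p_pos : 0 < p := by
  have h1 : p * (2 * D) = D ^ 2 + ((r₁ + r) ^ 2 - (r₂ + r) ^ 2) := by
    linear_combination H.e₁ - H.e₂
  have h2 : (r₂ + r) ^ 2 ≤ (r₁ + r) ^ 2 :=
    pow_le_pow_left₀ (by linarith [H.r₂_pos, H.r_pos]) (by linarith [H.le]) 2
  have h3 := pow_pos H.D_pos 2
  by_contra hcon
  have := mul_nonpos_of_nonpos_of_nonneg (not_lt.1 hcon) (by linarith [H.D_pos] : 0 ≤ 2 * D)
  linarith

lemma s₁_pos : 0 < r₁ + r := by linarith [H.r₁_pos, H.r_pos]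

lemma s₂_pos : 0 < r₂ + r := by linarith [H.r₂_pos, H.r_pos]

lemma p_lt : p < r₁ + r := lt_of_pow_lt_pow_left₀ 2 H.s₁_pos.le (by nlinarith [H.e₁, H.h_pos])

lemma abs_q_lt : |D - p| < r₂ + r := abs_lt_of_sq_lt_sq (by nlinarith [H.e₂, H.h_pos]) H.s₂_pos.le

/-- Direction cosines at the two centers. -/
lemma exists_cos : ∃ u v : ℝ, p = (r₁ + r) * u ∧ D - p = (r₂ + r) * v ∧ 0 < u ∧ u < 1 ∧
    -1 < v ∧ v < 1 ∧ p * r₁ / (r₁ + r) = r₁ * u ∧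
    D - (D - p) * r₂ / (r₂ + r) = D - r₂ * v ∧ r₁ * u - p = -(r * u) ∧ D - r₂ * v - p = r * v := by
  have h1 := H.s₁_pos
  have h2 := H.s₂_pos
  have h3 := H.abs_q_lt
  rw [abs_lt] at h3
  refine ⟨p / (r₁ + r), (D - p) / (r₂ + r), by field_simp, by field_simp, div_pos H.p_pos h1,
    (div_lt_one h1).2 H.p_lt, ?_, (div_lt_one h2).2 h3.2, by field_simp, by field_simp, by
      field_simp; ring, by field_simp; ring⟩
  rw [lt_div_iff₀ h2]; linarith

/-- With the direction cosines `u`, `v` the distance between the two points of contact is `r * (u +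
v)` along the axis. If `u + v ≤ 0`, then `v² ≥ u²`, and writing `h` in terms of both sines forces
`r₁ = r₂`; but then `D = (r₂ + r) * (u + v)` is not positive. -/
lemma knot_lt : p * r₁ / (r₁ + r) < D - (D - p) * r₂ / (r₂ + r) := by
  obtain ⟨u, v, hp, hq, hu, hu1, hv, hv1, k1, k2, k3, k4⟩ := H.exists_cos
  rw [k1, k2]
  have hr := H.r_pos
  have key : 0 < u + v := by
    by_contra hcon
    have hv' : v ≤ -u := by linarith
    have h1 := H.e₁
    have h2 := H.e₂
    have hD := H.D_pos
    have hle := H.le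
    rw [hp] at h1
    rw [hq] at h2
    have hh := pow_pos H.h_pos 2
    have hs1 := H.s₁_pos
    have hs2 := H.s₂_pos
    have hv2 : u ^ 2 ≤ v ^ 2 := by nlinarith
    have h5 : h ^ 2 = (r₁ + r) ^ 2 * (1 - u ^ 2) := by linarith
    have h6 : h ^ 2 = (r₂ + r) ^ 2 * (1 - v ^ 2) := by linarith
    have h7 : (1 - v ^ 2) ≤ 1 - u ^ 2 := by linarith
    have h8 : 0 < 1 - u ^ 2 := by nlinarith
    have h9 : (r₁ + r) ^ 2 * (1 - u ^ 2) ≤ (r₂ + r) ^ 2 * (1 - u ^ 2) := by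
      rw [← h5, h6]; exact mul_le_mul_of_nonneg_left h7 (by positivity)
    have h10 : (r₁ + r) ^ 2 ≤ (r₂ + r) ^ 2 := le_of_mul_le_mul_right h9 h8
    have h11 : r₁ + r ≤ r₂ + r := le_of_sq_le_sq h10 hs2.le
    have h12 : r₁ = r₂ := by linarith
    have h13 : D = (r₂ + r) * (u + v) := by rw [h12] at hp; linarith
    nlinarith
  nlinarith [k3, k4]

lemma arcFun_left : arcFun r₁ 0 (p * r₁ / (r₁ + r)) = r₁ * h / (r₁ + r) := by
  have h1 := H.s₁_pos
  have h2 := H.r₁_pos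
  have h3 := H.h_pos
  rw [arcFun, show r₁ ^ 2 - (p * r₁ / (r₁ + r) - 0) ^ 2 = (r₁ * h / (r₁ + r)) ^ 2 by
    field_simp; linear_combination (-r₁^2)*H.e₁]
  exact Real.sqrt_sq (by positivity)

lemma arcFun_p_left : arcFun r p (p * r₁ / (r₁ + r)) = r * h / (r₁ + r) := by
  have h1 := H.s₁_pos
  have h2 := H.r_pos
  have h3 := H.h_pos
  rw [arcFun, show r ^ 2 - (p * r₁ / (r₁ + r) - p) ^ 2 = (r * h / (r₁ + r)) ^ 2 by
    field_simp; linear_combination (-r^2)*H.e₁]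
  exact Real.sqrt_sq (by positivity)

lemma arcFun_right : arcFun r₂ D (D - (D - p) * r₂ / (r₂ + r)) = r₂ * h / (r₂ + r) := by
  have h1 := H.s₂_pos
  have h2 := H.r₂_pos
  have h3 := H.h_pos
  rw [arcFun, show r₂ ^ 2 - (D - (D - p) * r₂ / (r₂ + r) - D) ^ 2 = (r₂ * h / (r₂ + r)) ^ 2 by
    field_simp; linear_combination (-r₂^2)*H.e₂]
  exact Real.sqrt_sq (by positivity)

lemma arcFun_p_right : arcFun r p (D - (D - p) * r₂ / (r₂ + r)) = r * h / (r₂ + r) := by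
  have h1 := H.s₂_pos
  have h2 := H.r_pos
  have h3 := H.h_pos
  rw [arcFun, show r ^ 2 - (D - (D - p) * r₂ / (r₂ + r) - p) ^ 2 = (r * h / (r₂ + r)) ^ 2 by
    field_simp; linear_combination (-r^2)*H.e₂]
  exact Real.sqrt_sq (by positivity)

lemma knot_bounds : -r₁ < p * r₁ / (r₁ + r) ∧ p * r₁ / (r₁ + r) < r₁ ∧
    D - r₂ < D - (D - p) * r₂ / (r₂ + r) ∧ D - (D - p) * r₂ / (r₂ + r) < D + r₂ := by
  obtain ⟨u, v, hp, hq, hu, hu1, hv, hv1, k1, k2, k3, k4⟩ := H.exists_cos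
  have h1 := H.r₁_pos
  have h2 := H.r₂_pos
  rw [k1, k2]
  refine ⟨by nlinarith, by nlinarith, by nlinarith, by nlinarith⟩

lemma closeFun_eq_zero {x : ℝ} (hx : x ∉ Ioo (-r₁) (D + r₂)) :
    closeFun r₁ r₂ D r p h x = 0 := by
  obtain ⟨b1, b2, b3, b4⟩ := H.knot_bounds
  have hk := H.knot_lt
  rcases not_and_or.1 hx with h8 | h8
  · rw [closeFun, if_pos (by linarith), arcFun_eq_zero H.r₁_pos fun h => by linarith [h.1]]
  · rw [closeFun, if_neg (by linarith), if_neg (by linarith),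
      arcFun_eq_zero H.r₂_pos fun h => by linarith [h.2]]

lemma closeFun_middle {x : ℝ} (hx : x ∈ Icc (p * r₁ / (r₁ + r)) (D - (D - p) * r₂ / (r₂ + r))) :
    closeFun r₁ r₂ D r p h x = max 0 (h - arcFun r p x) := by
  rcases eq_or_lt_of_le hx.1 with h1 | h1
  · rw [← h1, closeFun, if_pos le_rfl, H.arcFun_left, H.arcFun_p_left]
    have e : h - r * h / (r₁ + r) = r₁ * h / (r₁ + r) := by
      have := H.s₁_pos
      field_simp; ring
    have h2 := H.r₁_pos
    have h3 := H.h_pos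
    have h4 := H.s₁_pos
    rw [e, max_eq_right (by positivity)]
  · rw [closeFun, if_neg (not_le.2 h1), if_pos hx.2]

lemma closeFun_right {x : ℝ} (hx : D - (D - p) * r₂ / (r₂ + r) ≤ x) :
    closeFun r₁ r₂ D r p h x = arcFun r₂ D x := by
  rcases eq_or_lt_of_le hx with h1 | h1
  · rw [← h1, H.closeFun_middle ⟨H.knot_lt.le, le_rfl⟩, H.arcFun_right, H.arcFun_p_right]
    have e : h - r * h / (r₂ + r) = r₂ * h / (r₂ + r) := by
      have := H.s₂_pos
      field_simp; ring
    have h2 := H.r₂_pos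
    have h3 := H.h_pos
    have h4 := H.s₂_pos
    rw [e, max_eq_right (by positivity)]
  · rw [closeFun, if_neg (not_le.2 (H.knot_lt.trans h1)), if_neg (not_le.2 h1)]

/-- Left part of the closing. -/
lemma abs_le_left {w : Plane} (hw : w ∈ closing r (twoDisks r₁ r₂ D)) (hxl : -r₁ < w 0)
    (h3 : w 0 ≤ p * r₁ / (r₁ + r)) : |w 1| ≤ arcFun r₁ 0 (w 0) := by
  have h1 := H.r₁_pos
  have h2 := H.r₂_pos
  have hr := H.r_pos
  have hs1 := H.s₁_pos
  by_contra hcon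
  push Not at hcon
  have hxr1 : w 0 < r₁ := h3.trans_lt H.knot_bounds.2.1
  have hX : (w 0) ^ 2 ≤ r₁ ^ 2 := sq_le_sq' hxl.le hxr1.le
  obtain ⟨Y, hY⟩ : ∃ Y, Y = arcFun r₁ 0 (w 0) := ⟨_, rfl⟩
  have hY' : Y = Real.sqrt (r₁ ^ 2 - (w 0) ^ 2) := by rw [hY, arcFun, sub_zero]
  have hY2 : Y ^ 2 = r₁ ^ 2 - w 0 ^ 2 := by rw [hY', Real.sq_sqrt (by linarith)]
  have hY0 : 0 ≤ Y := hY ▸ arcFun_nonneg _ _ _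
  have e1 : ((r₁ + r) / r₁ * w 0) ^ 2 + ((r₁ + r) / r₁ * Y) ^ 2 = (r₁ + r) ^ 2 := by
    rw [mul_pow, mul_pow, hY2]; field_simp; ring
  -- The ball touching the first disk at the boundary point above `w 0` has its centre no further
  -- right than the apex. It is therefore at least as far from the second centre as the apex is,
  -- hence admissible.
  have e3 : (r₁ + r) / r₁ * w 0 ≤ p := by
    rw [div_mul_eq_mul_div, div_le_iff₀ h1]
    rw [le_div_iff₀ hs1] at h3
    linarith
  refine notMem_closing_of_column h1 h2 hr (x := (r₁ + r) / r₁ * w 0) (y := (r₁ + r) / r₁ * Y)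
    (by positivity) e1.ge ?_ ?_ ?_ hw
  · obtain ⟨X, hX⟩ : ∃ X, X = (r₁ + r) / r₁ * w 0 := ⟨_, rfl⟩
    rw [← hX] at e1 e3 ⊢
    linarith [mul_le_mul_of_nonneg_left e3 H.D_pos.le, H.e₁, H.e₂, sub_sq X D, sub_sq D p]
  · have : w 0 - (r₁ + r) / r₁ * w 0 = -(r / r₁ * w 0) := by field_simp; ring
    rw [this, abs_neg, abs_mul, abs_of_pos (by positivity), div_mul_eq_mul_div, div_lt_iff₀ h1]
    exact mul_lt_mul_of_pos_left (abs_lt.2 ⟨hxl, hxr1⟩) hr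
  · rw [scaled_arc h1 hr hX hY']
    exact hY ▸ hcon

/-- Right part of the closing. -/
lemma abs_le_right {w : Plane} (hw : w ∈ closing r (twoDisks r₁ r₂ D)) (hxr : w 0 < D + r₂)
    (h4 : D - (D - p) * r₂ / (r₂ + r) ≤ w 0) : |w 1| ≤ arcFun r₂ D (w 0) := by
  have h1 := H.r₁_pos
  have h2 := H.r₂_pos
  have hr := H.r_pos
  have hs2 := H.s₂_pos
  by_contra hcon
  push Not at hcon
  have hxl2 : -r₂ < w 0 - D := by linarith [H.knot_bounds.2.2.1]
  have hxr2 : w 0 - D < r₂ := by linarith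
  have hX : (w 0 - D) ^ 2 ≤ r₂ ^ 2 := sq_le_sq' hxl2.le hxr2.le
  obtain ⟨Y, hY⟩ : ∃ Y, Y = arcFun r₂ D (w 0) := ⟨_, rfl⟩
  have hY' : Y = Real.sqrt (r₂ ^ 2 - (w 0 - D) ^ 2) := by rw [hY, arcFun]
  have hY2 : Y ^ 2 = r₂ ^ 2 - (w 0 - D) ^ 2 := by rw [hY', Real.sq_sqrt (by linarith)]
  have hY0 : 0 ≤ Y := hY ▸ arcFun_nonneg _ _ _
  have e1 : ((r₂ + r) / r₂ * (w 0 - D)) ^ 2 + ((r₂ + r) / r₂ * Y) ^ 2 = (r₂ + r) ^ 2 := by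
    rw [mul_pow, mul_pow, hY2]; field_simp; ring
  have e3 : p - D ≤ (r₂ + r) / r₂ * (w 0 - D) := by
    rw [div_mul_eq_mul_div, le_div_iff₀ h2]
    have h4' : D - w 0 ≤ (D - p) * r₂ / (r₂ + r) := by linarith
    rw [le_div_iff₀ hs2] at h4'
    linarith
  refine notMem_closing_of_column h1 h2 hr (x := D + (r₂ + r) / r₂ * (w 0 - D))
    (y := (r₂ + r) / r₂ * Y) (by positivity) ?_ ?_ ?_ ?_ hw
  · obtain ⟨X, hX⟩ : ∃ X, X = (r₂ + r) / r₂ * (w 0 - D) := ⟨_, rfl⟩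
    rw [← hX] at e1 e3 ⊢
    linarith [mul_le_mul_of_nonneg_left e3 H.D_pos.le, H.e₁, H.e₂, add_sq D X, sub_sq D p]
  · rw [add_sub_cancel_left]; exact e1.ge
  · have : w 0 - (D + (r₂ + r) / r₂ * (w 0 - D)) = -(r / r₂ * (w 0 - D)) := by field_simp; ring
    rw [this, abs_neg, abs_mul, abs_of_pos (by positivity), div_mul_eq_mul_div, div_lt_iff₀ h2]
    exact mul_lt_mul_of_pos_left (abs_lt.2 ⟨hxl2, hxr2⟩) hr
  · have e4 : w 0 - (D + (r₂ + r) / r₂ * (w 0 - D))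
        = (w 0 - D) - (r₂ + r) / r₂ * (w 0 - D) := by ring
    rw [e4, scaled_arc h2 hr hX hY']
    exact hY ▸ hcon

/-- Points of the closing lie below the graph. -/
lemma abs_le_closeFun {w : Plane} (hw : w ∈ closing r (twoDisks r₁ r₂ D))
    (hN : w 0 ∉ ({-r₁, D + r₂} : Set ℝ)) : |w 1| ≤ closeFun r₁ r₂ D r p h (w 0) := by
  obtain ⟨u, v, hp, hq, hu, hu1, hv, hv1, k1, k2, k3, k4⟩ := H.exists_cos
  have hr := H.r_pos
  have hx := closing_abscissa H.r₁_pos H.r₂_pos H.sep hr hw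
  simp only [mem_insert_iff, mem_singleton_iff, not_or] at hN
  have hxl : -r₁ < w 0 := lt_of_le_of_ne hx.1 (Ne.symm hN.1)
  have hxr : w 0 < D + r₂ := lt_of_le_of_ne hx.2 hN.2
  rcases le_total (w 0) (p * r₁ / (r₁ + r)) with h3 | h3
  · rw [closeFun_left h3]
    exact H.abs_le_left hw hxl h3
  rcases le_total (D - (D - p) * r₂ / (r₂ + r)) (w 0) with h4 | h4
  · rw [H.closeFun_right h4]
    exact H.abs_le_right hw hxr h4
  rw [H.closeFun_middle ⟨h3, h4⟩]
  by_contra hcon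
  push Not at hcon
  refine notMem_closing_of_column H.r₁_pos H.r₂_pos hr (x := p) (y := h) H.h_pos.le H.e₁.ge
    ?_ ?_ ?_ hw
  · linarith [sub_sq_comm p D, H.e₂]
  · rw [k1] at h3
    rw [k2] at h4
    have t1 : r * u < r := mul_lt_of_lt_one_right hr hu1
    have t2 : r * v < r := mul_lt_of_lt_one_right hr hv1
    rw [abs_lt]
    constructor <;> linarith
  · exact (le_max_right _ _).trans_lt hcon

/-- A point of the triangle spanned by the centers that is outside the touching disk cannot be
reached by an admissible ball. -/
lemma mem_closing_of_barycentric {w : Plane} {b g : ℝ} (hb : 0 ≤ b) (hg : 0 ≤ g) (hbg : b + g ≤ 1)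
    {ε : ℝ} (hε : ε ^ 2 = 1) (hx : w 0 = b * D + g * p) (hy : w 1 = g * (ε * h))
    (hout : r ^ 2 ≤ (w 0 - p) ^ 2 + (w 1 - ε * h) ^ 2) :
    w ∈ closing r (twoDisks r₁ r₂ D) := by
  rw [mem_closing_twoDisks H.r₁_pos H.r₂_pos H.r_pos]
  intro x y h1 h2
  have k1 : (ε * h) ^ 2 = h ^ 2 := by rw [mul_pow, hε, one_mul]
  -- Leibniz's formula: the point `w` has barycentric weights `1 - b - g`, `b`, `g` with respect to
  -- the two centres and the apex. The weighted sum of squared distances to these vertices, taken at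
  -- `(x, y)` and at the apex, differs by the same amount as the squared distance to `w`.
  have id1 : (w 0 - x) ^ 2 + (w 1 - y) ^ 2 - ((w 0 - p) ^ 2 + (w 1 - ε * h) ^ 2)
      = (1 - b - g) * (x ^ 2 + y ^ 2 - (r₁ + r) ^ 2) + b * ((x - D) ^ 2 + y ^ 2 - (r₂ + r) ^ 2)
        + g * ((x - p) ^ 2 + (y - ε * h) ^ 2) := by
    rw [hx, hy]
    linear_combination (g - 1) * k1 - (1 - b - g) * H.e₁ - b * H.e₂
  have t1 := mul_nonneg (by linarith : 0 ≤ 1 - b - g) (sub_nonneg.2 h1)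
  have t2 := mul_nonneg hb (sub_nonneg.2 h2)
  have t3 := mul_nonneg hg (add_nonneg (sq_nonneg (x - p)) (sq_nonneg (y - ε * h)))
  linarith

/-- The lower arc of the touching disk runs below the line from a center to the apex. -/
lemma arc_below_line {R q X y : ℝ} (hR : 0 < R) (hq : q ^ 2 + h ^ 2 = (R + r) ^ 2)
    (hX : q * R / (R + r) ≤ X) (hy : y < h - Real.sqrt (r ^ 2 - (X - q) ^ 2))
    (hq0 : 0 < q) : y * q ≤ X * h := by
  have hh := H.h_pos
  have hr := H.r_pos
  have hs0 := Real.sqrt_nonneg (r ^ 2 - (X - q) ^ 2)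
  rcases le_total q X with h1 | h1
  · nlinarith
  · have hRr : 0 < R + r := by linarith
    have h2 : (q - X) * (R + r) ≤ r * q := by
      rw [div_le_iff₀ hRr] at hX
      linarith
    have h3 : ((q - X) * (R + r)) ^ 2 ≤ (r * q) ^ 2 :=
      pow_le_pow_left₀ (mul_nonneg (by linarith) hRr.le) h2 2
    have h4 : (q - X) * h ≤ q * Real.sqrt (r ^ 2 - (X - q) ^ 2) := by
      have h5 : (q - X) * h / q ≤ Real.sqrt (r ^ 2 - (X - q) ^ 2) := by
        refine Real.le_sqrt_of_sq_le ?_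
        rw [div_pow, div_le_iff₀ (by positivity)]
        rw [mul_pow, ← hq] at h3
        linarith [mul_pow (q - X) h 2, mul_pow r q 2, sub_sq_comm q X]
      rw [div_le_iff₀ hq0] at h5
      linarith
    nlinarith

/-- Left and right of the knots the points lie in the disks. Between them, a point below the
touching arc lies outside the touching disk, and it usually lies in the triangle of the two centres
and the apex, where the barycentric argument applies. If it falls outside the triangle, then `p ≥ D`
and the point lies in the second disk. -/
lemma profile_subset_closing :
    profile (closeFun r₁ r₂ D r p h) ⊆ closing r (twoDisks r₁ r₂ D) := by
  intro w hw
  have h1 := H.r₁_pos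
  have h2 := H.r₂_pos
  have hr := H.r_pos
  have hh := H.h_pos
  have hD := H.D_pos
  have hs2 := H.s₂_pos
  have hsub := twoDisks_subset_closing (r₁ := r₁) (r₂ := r₂) (D := D) hr
  simp only [profile, mem_ofPred_eq] at hw
  rcases le_total (w 0) (p * r₁ / (r₁ + r)) with h3 | h3
  · rw [closeFun_left h3, abs_lt_arcFun] at hw
    exact hsub (Or.inl ((mem_ball_pt h1.le).2 (by simpa using hw)))
  rcases le_total (D - (D - p) * r₂ / (r₂ + r)) (w 0) with h4 | h4
  · rw [H.closeFun_right h4, abs_lt_arcFun] at hw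
    exact hsub (Or.inr ((mem_ball_pt h2.le).2 (by simpa using hw)))
  rw [H.closeFun_middle ⟨h3, h4⟩] at hw
  have hlt : |w 1| < h - arcFun r p (w 0) := by
    rcases lt_max_iff.1 hw with h5 | h5
    · exact absurd h5 (not_lt.2 (abs_nonneg _))
    · exact h5
  have hy0 := abs_nonneg (w 1)
  have ha0 := arcFun_nonneg r p (w 0)
  obtain ⟨ε, hε, hwε⟩ : ∃ ε : ℝ, ε ^ 2 = 1 ∧ w 1 = ε * |w 1| := by
    rcases le_total 0 (w 1) with h | h
    · exact ⟨1, by norm_num, by rw [abs_of_nonneg h]; ring⟩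
    · exact ⟨-1, by norm_num, by rw [abs_of_nonpos h]; ring⟩
  obtain ⟨g, hg⟩ : ∃ g, g = |w 1| / h := ⟨_, rfl⟩
  have hgh : |w 1| = g * h := by rw [hg]; field_simp
  have hg0 : 0 ≤ g := by rw [hg]; positivity
  obtain ⟨b, hb⟩ : ∃ b, b = (w 0 - g * p) / D := ⟨_, rfl⟩
  have hbD : w 0 = b * D + g * p := by rw [hb]; field_simp; ring
  have hout : r ^ 2 ≤ (w 0 - p) ^ 2 + (w 1 - ε * h) ^ 2 := by
    have e1 : (w 1 - ε * h) ^ 2 = (h - |w 1|) ^ 2 := by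
      have h8 : w 1 - ε * h = ε * (|w 1| - h) := by linear_combination hwε
      rw [h8, mul_pow, hε, one_mul, sub_sq_comm]
    rw [e1]
    have h6 : arcFun r p (w 0) < h - |w 1| := by linarith
    rw [arcFun, Real.sqrt_lt' (by linarith)] at h6
    linarith
  have hb0 : 0 ≤ b := by
    have := H.arc_below_line h1 H.e₁ h3 hlt H.p_pos
    rw [hgh] at this
    have h7 : g * p ≤ w 0 := by
      have : g * p * h ≤ w 0 * h := by linarith
      exact le_of_mul_le_mul_right this hh
    rw [hb]
    exact div_nonneg (by linarith) hD.le
  by_cases hbg : b + g ≤ 1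
  · refine H.mem_closing_of_barycentric hb0 hg0 hbg hε hbD ?_ hout
    linear_combination hwε + ε * hgh
  · push Not at hbg
    have hbg' : g * (p - D) < w 0 - D := by
      have : D < (b + g) * D := by nlinarith
      rw [hbD]
      linarith
    rcases lt_or_ge p D with h5 | h5
    · exfalso
      have h6 := H.arc_below_line (q := D - p) (X := D - w 0) (y := |w 1|) h2 H.e₂
        (by linarith) (by
          have : (D - w 0 - (D - p)) ^ 2 = (w 0 - p) ^ 2 := by ring
          rw [this]; exact hlt) (by linarith)
      rw [hgh] at h6
      have h7 : g * (D - p) ≤ D - w 0 := by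
        have : g * (D - p) * h ≤ (D - w 0) * h := by linarith
        exact le_of_mul_le_mul_right this hh
      linarith
    · refine hsub (Or.inr ((mem_ball_pt h2.le).2 ?_))
      rw [sub_zero, ← sq_abs (w 1), hgh]
      obtain ⟨κ, hκ⟩ : ∃ κ, κ = r₂ / (r₂ + r) := ⟨_, rfl⟩
      have hκ0 : 0 < κ := by rw [hκ]; positivity
      have hκr : κ * (r₂ + r) = r₂ := by rw [hκ]; field_simp
      have h6 : w 0 - D ≤ κ * (p - D) := by
        have : (D - p) * r₂ / (r₂ + r) = -(κ * (p - D)) := by rw [hκ]; field_simp; ring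
        rw [this] at h4
        linarith
      have h7 : 0 ≤ w 0 - D := by nlinarith
      have h8 : g < κ := by
        have : g * (p - D) < κ * (p - D) := by linarith
        exact lt_of_mul_lt_mul_right this (by linarith)
      have h9 : (w 0 - D) ^ 2 ≤ (κ * (p - D)) ^ 2 := pow_le_pow_left₀ h7 h6 2
      have h10 : (g * h) ^ 2 < (κ * h) ^ 2 :=
        pow_lt_pow_left₀ (mul_lt_mul_of_pos_right h8 hh) (by positivity) (by norm_num)
      have h11 : r₂ ^ 2 = (κ * (p - D)) ^ 2 + (κ * h) ^ 2 := by
        rw [mul_pow, mul_pow, ← mul_add, sub_sq_comm p D, H.e₂, ← mul_pow, hκr]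
      linarith

end BridgeData

/-- The function `arcsin x / x` is strictly increasing. -/
lemma mul_arcsin_div_lt {r s h : ℝ} (hr : 0 < r) (hrs : r < s) (hh : 0 < h) (hhr : h ≤ r) :
    s * Real.arcsin (h / s) < r * Real.arcsin (h / r) := by
  have hs : 0 < s := hr.trans hrs
  have h1 : h / r ≤ 1 := (div_le_one hr).2 hhr
  have h0 : 0 < h / r := div_pos hh hr
  obtain ⟨α, hα⟩ : ∃ α, α = Real.arcsin (h / r) := ⟨_, rfl⟩
  have hα0 : 0 < α := hα ▸ Real.arcsin_pos.2 h0
  have hα1 : α ≤ Real.pi / 2 := hα ▸ Real.arcsin_le_pi_div_two _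
  have hsin : Real.sin α = h / r := by rw [hα, Real.sin_arcsin (by linarith) h1]
  have hκ0 : 0 < r / s := div_pos hr hs
  have hκ1 : r / s < 1 := (div_lt_one hs).2 hrs
  have hpi := Real.pi_pos
  -- Strict concavity of the sine on the segment from `0` to `α` gives `(r / s) sin α < sin ((r / s)
  -- α)`.
  have hconc := strictConcaveOn_sin_Icc.2 (⟨le_rfl, hpi.le⟩ : (0 : ℝ) ∈ Icc 0 Real.pi)
    (⟨hα0.le, by linarith⟩ : α ∈ Icc 0 Real.pi) hα0.ne
    (by linarith : 0 < 1 - r / s) hκ0 (by ring)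
  simp only [smul_eq_mul, Real.sin_zero, mul_zero, zero_add, hsin] at hconc
  have h2 : r / s * (h / r) = h / s := by field_simp
  rw [h2] at hconc
  have h3 : Real.arcsin (h / s) < r / s * α := by
    have hm : r / s * α < α := mul_lt_of_lt_one_left hα0 hκ1
    rw [← Real.arcsin_sin (x := r / s * α) (by have := mul_pos hκ0 hα0; linarith) (by linarith)]
    refine Real.arcsin_lt_arcsin ?_ hconc (Real.sin_le_one _)
    have := div_pos hh hs
    linarith
  rw [← hα]
  calc s * Real.arcsin (h / s) < s * (r / s * α) := mul_lt_mul_of_pos_left h3 hs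
    _ = r * α := by field_simp

namespace BridgeData

variable {r₁ r₂ D r p h : ℝ} (H : BridgeData r₁ r₂ D r p h)
include H

lemma continuous_closeFun : Continuous (closeFun r₁ r₂ D r p h) := by
  have h1 : Continuous fun x => if x ≤ D - (D - p) * r₂ / (r₂ + r) then max 0 (h - arcFun r p x)
      else arcFun r₂ D x := by
    refine Continuous.if_le (continuous_const.max (continuous_const.sub (continuous_arcFun _ _)))
      (continuous_arcFun _ _) continuous_id continuous_const ?_
    rintro x rfl
    rw [← H.closeFun_middle ⟨H.knot_lt.le, le_rfl⟩, H.closeFun_right le_rfl]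
  refine Continuous.if_le (continuous_arcFun _ _) h1 continuous_id continuous_const ?_
  rintro x rfl
  rw [if_pos H.knot_lt.le, ← H.closeFun_middle ⟨le_rfl, H.knot_lt.le⟩, closeFun_left le_rfl]

lemma closing_ae_eq :
    closing r (twoDisks r₁ r₂ D) =ᵐ[volume] profile (closeFun r₁ r₂ D r p h) :=
  ae_eq_profile H.continuous_closeFun ((countable_singleton _).insert _) H.profile_subset_closing
    fun _ hw hN => H.abs_le_closeFun hw hN

lemma div_left : (p * r₁ / (r₁ + r) - 0) / r₁ = p / (r₁ + r) := by
  have := H.r₁_pos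
  have := H.s₁_pos
  field_simp
  ring

lemma div_right : (D - (D - p) * r₂ / (r₂ + r) - D) / r₂ = -((D - p) / (r₂ + r)) := by
  have := H.r₂_pos
  have := H.s₂_pos
  field_simp
  ring

lemma div_p_left : (p * r₁ / (r₁ + r) - p) / r = -(p / (r₁ + r)) := by
  have := H.r_pos
  have := H.s₁_pos
  field_simp
  ring

lemma div_p_right : (D - (D - p) * r₂ / (r₂ + r) - p) / r = (D - p) / (r₂ + r) := by
  have := H.r_pos
  have := H.s₂_pos
  field_simp
  ring

lemma piece_left : Piece (closeFun r₁ r₂ D r p h) (-r₁) (p * r₁ / (r₁ + r))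
    (r₁ * (Real.pi - Real.arccos (p / (r₁ + r))))
    (1 / 2 * (p * r₁ / (r₁ + r) * (r₁ * h / (r₁ + r))
      + r₁ ^ 2 * (Real.pi - Real.arccos (p / (r₁ + r))))) := by
  have hk := H.knot_bounds
  have h1 := Piece.arcFun (R := r₁) (c := 0) (a := -r₁) (b := p * r₁ / (r₁ + r)) H.r₁_pos
    (by linarith) hk.1.le (by linarith [hk.2.1])
  have e : (-r₁ - 0) / r₁ = -1 := by rw [sub_zero, neg_div, div_self H.r₁_pos.ne']
  rw [H.div_left, e, H.arcFun_left, Real.arcsin_neg_one,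
    arcFun_eq_zero (x := -r₁) H.r₁_pos (by simp)] at h1
  convert h1.congr (g := closeFun r₁ r₂ D r p h) (fun x hx => closeFun_left hx.2) using 1
  · rw [Real.arccos]; ring
  · rw [Real.arccos]; ring

lemma piece_right : Piece (closeFun r₁ r₂ D r p h) (D - (D - p) * r₂ / (r₂ + r)) (D + r₂)
    (r₂ * (Real.pi - Real.arccos ((D - p) / (r₂ + r))))
    (1 / 2 * ((D - p) * r₂ / (r₂ + r) * (r₂ * h / (r₂ + r))
      + r₂ ^ 2 * (Real.pi - Real.arccos ((D - p) / (r₂ + r))))) := by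
  have hk := H.knot_bounds
  have h1 := Piece.arcFun (R := r₂) (c := D) (a := D - (D - p) * r₂ / (r₂ + r)) (b := D + r₂)
    H.r₂_pos hk.2.2.1.le hk.2.2.2.le le_rfl
  have e : (D + r₂ - D) / r₂ = 1 := by rw [add_sub_cancel_left, div_self H.r₂_pos.ne']
  rw [H.div_right, e, H.arcFun_right, Real.arcsin_one, Real.arcsin_neg,
    arcFun_eq_zero (x := D + r₂) H.r₂_pos (by simp)] at h1
  convert h1.congr (g := closeFun r₁ r₂ D r p h) (fun x hx => H.closeFun_right hx.1) using 1
  · rw [Real.arccos]; ring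
  · rw [Real.arccos]; ring

/-- A piece of the boundary of the touching disk. -/
lemma piece_middle {a b : ℝ} (ha : p * r₁ / (r₁ + r) ≤ a) (hab : a ≤ b)
    (hb : b ≤ D - (D - p) * r₂ / (r₂ + r)) (hle : ∀ x ∈ Icc a b, arcFun r p x ≤ h)
    (hpos : ∀ x ∈ Ioo a b, arcFun r p x < h) :
    Piece (closeFun r₁ r₂ D r p h) a b
      (r * (Real.arcsin ((b - p) / r) - Real.arcsin ((a - p) / r)))
      (h * (b - a) - 1 / 2 * ((b - p) * arcFun r p b - (a - p) * arcFun r p a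
        + r ^ 2 * (Real.arcsin ((b - p) / r) - Real.arcsin ((a - p) / r)))) := by
  obtain ⟨u, v, hp, hq, hu, hu1, hv, hv1, k1, k2, k3, k4⟩ := H.exists_cos
  have hr := H.r_pos
  have t1 : r * u < r := mul_lt_of_lt_one_right hr hu1
  have t2 : r * v < r := mul_lt_of_lt_one_right hr hv1
  have h1 := Piece.arc (σ := -1) (R := r) (c := p) (y₀ := h) (a := a) (b := b) (by norm_num) hr
    (by linarith) hab (by linarith) (fun x hx => by have := hpos x hx; rw [arcFun] at this; linarith)
  convert h1.congr (g := closeFun r₁ r₂ D r p h) (fun x hx => ?_) using 1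
  · rw [arcFun, arcFun]; ring
  · rw [H.closeFun_middle ⟨ha.trans hx.1, hx.2.trans hb⟩,
      max_eq_right (by linarith [hle x hx]), arcFun]
    ring

lemma p_mem : p * r₁ / (r₁ + r) < p := by
  rw [div_lt_iff₀ H.s₁_pos]
  exact mul_lt_mul_of_pos_left (by linarith [H.r_pos]) H.p_pos

/-- The two touching disks do not overlap when the gaps are long enough. -/
lemma radius_le_of_gap (hB : D ≤ gapLen r₁ r + gapLen r₂ r) (hp : p ≤ D) : r ≤ h := by
  by_contra hcon
  push Not at hcon
  have hh := H.h_pos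
  have hlt : h ^ 2 < r ^ 2 := pow_lt_pow_left₀ hcon hh.le (by norm_num)
  have g1 := gapLen_sq H.r₁_pos H.r_pos.le
  have g2 := gapLen_sq H.r₂_pos H.r_pos.le
  have h1 : gapLen r₁ r < p := lt_of_pow_lt_pow_left₀ 2 H.p_pos.le (by linarith [H.e₁])
  have h2 : gapLen r₂ r < D - p := lt_of_pow_lt_pow_left₀ 2 (by linarith) (by linarith [H.e₂])
  linarith

/-- The touching disks overlap when the gaps are too short. -/
lemma le_radius_of_gap (hA : gapLen r₁ r + gapLen r₂ r ≤ D) : h ≤ r ∧ p ≤ D := by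
  have g1 := gapLen_sq H.r₁_pos H.r_pos.le
  have g2 := gapLen_sq H.r₂_pos H.r_pos.le
  have n1 := gapLen_pos H.r₁_pos H.r_pos.le
  have n2 := gapLen_pos H.r₂_pos H.r_pos.le
  have hr := H.r_pos
  have hle : h ≤ r := by
    by_contra hcon
    push Not at hcon
    have hlt : r ^ 2 < h ^ 2 := pow_lt_pow_left₀ hcon hr.le (by norm_num)
    have h1 : p < gapLen r₁ r := lt_of_pow_lt_pow_left₀ 2 n1.le (by linarith [H.e₁])
    have h2 : D - p < gapLen r₂ r := lt_of_pow_lt_pow_left₀ 2 n2.le (by linarith [H.e₂])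
    linarith
  refine ⟨hle, ?_⟩
  by_contra hcon
  push Not at hcon
  have hle2 : h ^ 2 ≤ r ^ 2 := pow_le_pow_left₀ H.h_pos.le hle 2
  have h2 : gapLen r₂ r ≤ p - D := le_of_sq_le_sq (by linarith [H.e₂, sub_sq_comm p D]) (by linarith)
  have h3 : D * (2 * p - D) = gapLen r₁ r ^ 2 - gapLen r₂ r ^ 2 := by
    linear_combination H.e₁ - H.e₂ - g1 + g2
  have h4 : (gapLen r₁ r + gapLen r₂ r) * (gapLen r₁ r + 3 * gapLen r₂ r) ≤ D * (2 * p - D) :=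
    mul_le_mul hA (by linarith) (by linarith) (by linarith)
  have h5 := mul_pos n1 n2
  have h6 := pow_pos n2 2
  linarith

/-- For `p ≤ D` the gap condition gives `r ≤ h`, so the touching disk stays above the axis. For `p >
D` only a part of its lower arc to the left of `p` is used; there the arc function is largest at the
right knot, where it equals `r * h / (r₂ + r) < h`. -/
lemma arcFun_le_of_gap (hB : D ≤ gapLen r₁ r + gapLen r₂ r) {x : ℝ}
    (hx : x ≤ D - (D - p) * r₂ / (r₂ + r)) : arcFun r p x ≤ h ∧ (x ≠ p → arcFun r p x < h) := by
  have hr := H.r_pos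
  have hh := H.h_pos
  rcases le_or_gt p D with hp | hp
  · have hrh := H.radius_le_of_gap hB hp
    constructor
    · exact (Real.sqrt_le_left hr.le).2 (by linarith [sq_nonneg (x - p)]) |>.trans hrh
    · intro hne
      refine lt_of_lt_of_le ((Real.sqrt_lt' hr).2 ?_) hrh
      have : 0 < (x - p) ^ 2 := by have := sub_ne_zero.2 hne; positivity
      linarith
  · have hlt : arcFun r p x < h := by
      have h1 : r * h / (r₂ + r) < h := by
        rw [div_lt_iff₀ H.s₂_pos]
        have := mul_pos H.r₂_pos hh
        linarith
      refine lt_of_le_of_lt ?_ h1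
      rw [← H.arcFun_p_right]
      refine Real.sqrt_le_sqrt (by
        have h2 : D - (D - p) * r₂ / (r₂ + r) ≤ p := by
          have e : D - (D - p) * r₂ / (r₂ + r) - p = (D - p) * r / (r₂ + r) := by
            have := H.s₂_pos
            field_simp
            ring
          have : (D - p) * r / (r₂ + r) ≤ 0 :=
            div_nonpos_of_nonpos_of_nonneg
              (mul_nonpos_of_nonpos_of_nonneg (by linarith) hr.le) H.s₂_pos.le
          linarith
        have := sq_le_sq' (a := p - (D - (D - p) * r₂ / (r₂ + r))) (b := p - x)
          (by linarith) (by linarith)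
        linarith [sub_sq_comm p x, sub_sq_comm p (D - (D - p) * r₂ / (r₂ + r))])
    exact ⟨hlt.le, fun _ => hlt⟩

/-- The algebraic terms of the area add up to the area of the kite formed by the two centres and the
two apexes, with diagonals `D` and `2 * h`. -/
lemma volume_identity : p * r₁ / (r₁ + r) * (r₁ * h / (r₁ + r))
    + (D - p) * r₂ / (r₂ + r) * (r₂ * h / (r₂ + r))
    + 2 * h * (D - (D - p) * r₂ / (r₂ + r) - p * r₁ / (r₁ + r))
    - ((D - (D - p) * r₂ / (r₂ + r) - p) * (r * h / (r₂ + r))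
      - (p * r₁ / (r₁ + r) - p) * (r * h / (r₁ + r))) = D * h := by
  have h1 := H.s₁_pos
  have h2 := H.s₂_pos
  field_simp
  ring

/-- Perimeter and area of the closing of two disks when it is connected. -/
theorem closing_perimeter (hB : D ≤ gapLen r₁ r + gapLen r₂ r) :
    perimeter (closing r (twoDisks r₁ r₂ D)) = ENNReal.ofReal (2 * (Real.pi * (r₁ + r₂)
      - r₁ * Real.arccos (p / (r₁ + r)) - r₂ * Real.arccos ((D - p) / (r₂ + r))
      + r * (Real.pi - Real.arccos (p / (r₁ + r)) - Real.arccos ((D - p) / (r₂ + r))))) ∧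
    volume (closing r (twoDisks r₁ r₂ D)) = ENNReal.ofReal (Real.pi * (r₁ ^ 2 + r₂ ^ 2) + D * h
      - r₁ ^ 2 * Real.arccos (p / (r₁ + r)) - r₂ ^ 2 * Real.arccos ((D - p) / (r₂ + r))
      - r ^ 2 * (Real.pi - Real.arccos (p / (r₁ + r)) - Real.arccos ((D - p) / (r₂ + r)))) := by
  -- The touching arc is split at its lowest point `p`: if `h = r`, it meets the axis there and the
  -- graph is positive only off this point.
  obtain ⟨m, hm⟩ : ∃ m, m = min p (D - (D - p) * r₂ / (r₂ + r)) := ⟨_, rfl⟩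
  have hm1 : p * r₁ / (r₁ + r) ≤ m := hm ▸ le_min H.p_mem.le H.knot_lt.le
  have hm2 : m ≤ D - (D - p) * r₂ / (r₂ + r) := hm ▸ min_le_right _ _
  have q1 := H.piece_middle le_rfl hm1 hm2
    (fun x hx => (H.arcFun_le_of_gap hB (hx.2.trans hm2)).1)
    (fun x hx => (H.arcFun_le_of_gap hB (hx.2.le.trans hm2)).2
      (ne_of_lt (hx.2.trans_le (hm ▸ min_le_left _ _))))
  have q2 := H.piece_middle hm1 hm2 le_rfl
    (fun x hx => (H.arcFun_le_of_gap hB hx.2).1)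
    (fun x hx => (H.arcFun_le_of_gap hB hx.2.le).2 (by
      rintro rfl
      rw [hm, min_eq_left hx.2.le] at hx
      exact lt_irrefl _ hx.1))
  have hP := (((H.piece_left.append q1).append q2).append H.piece_right).perimeter_eq
    closeFun_nonneg fun x hx => H.closeFun_eq_zero hx
  have hv := H.volume_identity
  rw [perimeter_congr H.closing_ae_eq, measure_congr H.closing_ae_eq, hP.1, hP.2,
    H.arcFun_p_left, H.arcFun_p_right, H.div_p_left, H.div_p_right, Real.arcsin_neg]
  constructor
  · congr 1
    simp only [Real.arccos]
    ring
  · congr 1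
    simp only [Real.arccos]
    linear_combination hv

/-- The perimeter increases when the closing is not connected. -/
theorem lt_closing_perimeter (hA : gapLen r₁ r + gapLen r₂ r ≤ D) :
    ENNReal.ofReal (2 * (Real.pi * (r₁ + r₂))) < perimeter (closing r (twoDisks r₁ r₂ D)) ∧
      perimeter (closing r (twoDisks r₁ r₂ D)) ≠ ⊤ ∧ volume (closing r (twoDisks r₁ r₂ D)) ≠ ⊤ := by
  obtain ⟨hhr, hpD⟩ := H.le_radius_of_gap hA
  have hr := H.r_pos
  have hh := H.h_pos
  -- Over `[p - τ, p + τ]` the touching disk reaches below the axis and the closing has measure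
  -- zero.
  obtain ⟨τ, hτ⟩ : ∃ τ, τ = Real.sqrt (r ^ 2 - h ^ 2) := ⟨_, rfl⟩
  have hτ0 : 0 ≤ τ := hτ ▸ Real.sqrt_nonneg _
  have hτ2 : τ ^ 2 = r ^ 2 - h ^ 2 := by
    rw [hτ, Real.sq_sqrt (by linarith [pow_le_pow_left₀ hh.le hhr 2])]
  have hle : ∀ x, τ ≤ |x - p| → arcFun r p x ≤ h := fun x hx => by
    have := pow_le_pow_left₀ hτ0 hx 2
    rw [sq_abs] at this
    exact (Real.sqrt_le_left hh.le).2 (by linarith)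
  have hlt : ∀ x, τ < |x - p| → arcFun r p x < h := fun x hx => by
    have := pow_lt_pow_left₀ hx hτ0 (two_ne_zero)
    rw [sq_abs] at this
    exact (Real.sqrt_lt' hh).2 (by linarith)
  have hge : ∀ x, |x - p| ≤ τ → h ≤ arcFun r p x := fun x hx => by
    have := pow_le_pow_left₀ (abs_nonneg _) hx 2
    rw [sq_abs] at this
    exact Real.le_sqrt_of_sq_le (by linarith)
  have hw1 : p * r₁ / (r₁ + r) ≤ p - τ := by
    by_contra hcon
    push Not at hcon
    have h1 := hge (p * r₁ / (r₁ + r)) (abs_le.2 ⟨by linarith, by linarith [H.p_mem]⟩)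
    rw [H.arcFun_p_left, le_div_iff₀ H.s₁_pos] at h1
    linarith [mul_pos H.r₁_pos hh]
  have hw2 : p + τ ≤ D - (D - p) * r₂ / (r₂ + r) := by
    by_contra hcon
    push Not at hcon
    have h0 : p ≤ D - (D - p) * r₂ / (r₂ + r) := by
      have : (D - p) * r₂ / (r₂ + r) ≤ D - p := by
        rw [div_le_iff₀ H.s₂_pos]
        exact mul_le_mul_of_nonneg_left (by linarith) (by linarith)
      linarith
    have h1 := hge (D - (D - p) * r₂ / (r₂ + r)) (abs_le.2 ⟨by linarith, by linarith⟩)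
    rw [H.arcFun_p_right, le_div_iff₀ H.s₂_pos] at h1
    linarith [mul_pos H.r₂_pos hh]
  have a1 : ∀ x, x ≤ p - τ → τ ≤ |x - p| := fun x hx => le_abs.2 (Or.inr (by linarith))
  have a2 : ∀ x, p + τ ≤ x → τ ≤ |x - p| := fun x hx => le_abs.2 (Or.inl (by linarith))
  have q1 := H.piece_middle le_rfl hw1 (by linarith) (fun x hx => hle x (a1 x hx.2))
    (fun x hx => hlt x (lt_abs.2 (Or.inr (by linarith [hx.2]))))
  have q2 : Piece (closeFun r₁ r₂ D r p h) (p - τ) (p + τ) 0 0 :=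
    (Piece.zero (by linarith)).congr fun x hx => by
      rw [H.closeFun_middle ⟨hw1.trans hx.1, hx.2.trans hw2⟩, max_eq_left]
      have := hge x (abs_le.2 ⟨by linarith [hx.1], by linarith [hx.2]⟩)
      linarith
  have q3 := H.piece_middle (by linarith) hw2 le_rfl (fun x hx => hle x (a2 x hx.1))
    (fun x hx => hlt x (lt_abs.2 (Or.inl (by linarith [hx.1]))))
  have hP := ((((H.piece_left.append q1).append q2).append q3).append H.piece_right).perimeter_eq
    closeFun_nonneg fun x hx => H.closeFun_eq_zero hx
  rw [perimeter_congr H.closing_ae_eq, measure_congr H.closing_ae_eq, hP.1, hP.2]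
  refine ⟨?_, ENNReal.ofReal_ne_top, ENNReal.ofReal_ne_top⟩
  rw [H.div_p_left, H.div_p_right, Real.arcsin_neg]
  have f1 : ∀ R, 0 < R → ∀ q, q ^ 2 + h ^ 2 = (R + r) ^ 2 → 0 ≤ q →
      Real.pi / 2 - Real.arccos (q / (R + r)) = Real.pi / 2 - Real.arcsin (h / (R + r)) := by
    intro R hR q hq hq0
    have hs : 0 < R + r := by linarith
    rw [Real.arccos_eq_arcsin (by positivity)]
    congr 3
    rw [show 1 - (q / (R + r)) ^ 2 = (h / (R + r)) ^ 2 by field_simp; linarith]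
    exact Real.sqrt_sq (by positivity)
  have f2 := f1 r₁ H.r₁_pos p H.e₁ H.p_pos.le
  have f3 := f1 r₂ H.r₂_pos (D - p) H.e₂ (by linarith)
  have f4 : Real.arcsin (τ / r) = Real.pi / 2 - Real.arcsin (h / r) := by
    have : Real.arcsin (h / r) = Real.arccos (τ / r) := by
      rw [Real.arccos_eq_arcsin (by positivity)]
      congr 1
      rw [show 1 - (τ / r) ^ 2 = (h / r) ^ 2 by field_simp; linarith]
      exact (Real.sqrt_sq (by positivity)).symm
    rw [this, Real.arccos]
    ring
  -- Half of the perimeter minus `π (r₁ + r₂)` is the sum over both disks of `r arcsin (h / r) -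
  -- (r_i + r) arcsin (h / (r_i + r))`, and each summand is positive because `arcsin x / x`
  -- increases.
  have g1 := mul_arcsin_div_lt hr (by linarith [H.r₁_pos] : r < r₁ + r) hh hhr
  have g2 := mul_arcsin_div_lt hr (by linarith [H.r₂_pos] : r < r₂ + r) hh hhr
  have e1 : (p - τ - p) / r = -(τ / r) := by ring
  have e2 : (p + τ - p) / r = τ / r := by ring
  rw [e1, e2, Real.arcsin_neg, f4]
  have hα1 : Real.arccos (p / (r₁ + r)) = Real.arcsin (h / (r₁ + r)) := by linarith
  have hα2 : Real.arccos ((D - p) / (r₂ + r)) = Real.arcsin (h / (r₂ + r)) := by linarith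
  have hα3 : Real.arcsin (p / (r₁ + r)) = Real.pi / 2 - Real.arcsin (h / (r₁ + r)) := by
    rw [← hα1, Real.arccos]; ring
  have hα4 : Real.arcsin ((D - p) / (r₂ + r)) = Real.pi / 2 - Real.arcsin (h / (r₂ + r)) := by
    rw [← hα2, Real.arccos]; ring
  rw [hα1, hα2, hα3, hα4]
  have hpi := Real.pi_pos
  have hpos := mul_pos hpi (add_pos H.r₁_pos H.r₂_pos)
  rw [ENNReal.ofReal_lt_ofReal_iff_of_nonneg (by positivity)]
  linarith

end BridgeData

/-! ### Perimeter and added area of the closing as functions of the radius -/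

section ClosingEnergy

/-- The angle at the first center of the triangle formed by the centers and the apex. -/
noncomputable def angleLeft (r₁ r₂ D r : ℝ) : ℝ := Real.arccos (apexX r₁ r₂ D r / (r₁ + r))

/-- The angle at the second center of the triangle formed by the centers and the apex. -/
noncomputable def angleRight (r₁ r₂ D r : ℝ) : ℝ := Real.arccos ((D - apexX r₁ r₂ D r) / (r₂ + r))

/-- The angle at the apex of the triangle formed by the centers and the apex. -/
noncomputable def angleApex (r₁ r₂ D r : ℝ) : ℝ :=
  Real.pi - angleLeft r₁ r₂ D r - angleRight r₁ r₂ D r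

/-- The perimeter of a connected closing of two disks. -/
noncomputable def closePer (r₁ r₂ D r : ℝ) : ℝ :=
  2 * (Real.pi * (r₁ + r₂) - r₁ * angleLeft r₁ r₂ D r - r₂ * angleRight r₁ r₂ D r
    + r * angleApex r₁ r₂ D r)

/-- The area added by a connected closing of two disks. -/
noncomputable def closeGap (r₁ r₂ D r : ℝ) : ℝ :=
  D * apexY r₁ r₂ D r - r₁ ^ 2 * angleLeft r₁ r₂ D r - r₂ ^ 2 * angleRight r₁ r₂ D r
    - r ^ 2 * angleApex r₁ r₂ D r

/-- The half of the perimeter-like functional of a connected closing of two disks. -/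
noncomputable def closeVal (r₁ r₂ D r : ℝ) : ℝ := closePer r₁ r₂ D r + closeGap r₁ r₂ D r / r

variable {r₁ r₂ D r : ℝ}

lemma apexX_mul (h2 : 0 < r₂) (hle : r₂ ≤ r₁) (hD : r₁ + r₂ ≤ D) (r : ℝ) :
    apexX r₁ r₂ D r * (2 * D) = D ^ 2 + (r₁ - r₂) * (r₁ + r₂ + 2 * r) := by
  have : 0 < D := by linarith
  rw [apexX]
  field_simp
  ring

lemma sin_angleLeft (h2 : 0 < r₂) (hle : r₂ ≤ r₁) (hD : r₁ + r₂ ≤ D) (hr : 0 < r)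
    (hov : D < r₁ + r₂ + 2 * r) :
    Real.sqrt (1 - (apexX r₁ r₂ D r / (r₁ + r)) ^ 2) = apexY r₁ r₂ D r / (r₁ + r) := by
  have H := bridgeData_apex h2 hle hD hr hov
  have h1 := H.s₁_pos
  have h3 := H.h_pos
  rw [show 1 - (apexX r₁ r₂ D r / (r₁ + r)) ^ 2 = (apexY r₁ r₂ D r / (r₁ + r)) ^ 2 by
    field_simp; linarith [H.e₁]]
  exact Real.sqrt_sq (by positivity)

lemma sin_angleRight (h2 : 0 < r₂) (hle : r₂ ≤ r₁) (hD : r₁ + r₂ ≤ D) (hr : 0 < r)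
    (hov : D < r₁ + r₂ + 2 * r) :
    Real.sqrt (1 - ((D - apexX r₁ r₂ D r) / (r₂ + r)) ^ 2) = apexY r₁ r₂ D r / (r₂ + r) := by
  have H := bridgeData_apex h2 hle hD hr hov
  have h1 := H.s₂_pos
  have h3 := H.h_pos
  rw [show 1 - ((D - apexX r₁ r₂ D r) / (r₂ + r)) ^ 2 = (apexY r₁ r₂ D r / (r₂ + r)) ^ 2 by
    field_simp; linarith [H.e₂]]
  exact Real.sqrt_sq (by positivity)

lemma cos_left_mem (h2 : 0 < r₂) (hle : r₂ ≤ r₁) (hD : r₁ + r₂ ≤ D) (hr : 0 < r)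
    (hov : D < r₁ + r₂ + 2 * r) : apexX r₁ r₂ D r / (r₁ + r) ∈ Ioo (-1 : ℝ) 1 ∧
      (D - apexX r₁ r₂ D r) / (r₂ + r) ∈ Ioo (-1 : ℝ) 1 := by
  have H := bridgeData_apex h2 hle hD hr hov
  have h1 := H.s₁_pos
  have h3 := H.s₂_pos
  have h4 := H.p_pos
  have h5 := abs_lt.1 H.abs_q_lt
  have h6 := div_pos h4 h1
  exact ⟨⟨by linarith, (div_lt_one h1).2 H.p_lt⟩, by rw [lt_div_iff₀ h3]; linarith,
    (div_lt_one h3).2 h5.2⟩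

/-- Both sides are twice the area of the triangle formed by the centres and the apex. -/
lemma sin_angleApex (h2 : 0 < r₂) (hle : r₂ ≤ r₁) (hD : r₁ + r₂ ≤ D) (hr : 0 < r)
    (hov : D < r₁ + r₂ + 2 * r) : Real.sin (angleApex r₁ r₂ D r) * ((r₁ + r) * (r₂ + r))
      = D * apexY r₁ r₂ D r := by
  have H := bridgeData_apex h2 hle hD hr hov
  have h1 := H.s₁_pos
  have h3 := H.s₂_pos
  have hc := cos_left_mem h2 hle hD hr hov
  rw [angleApex, sub_sub, Real.sin_pi_sub, Real.sin_add, angleLeft, angleRight, Real.sin_arccos,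
    Real.sin_arccos, Real.cos_arccos hc.1.1.le hc.1.2.le, Real.cos_arccos hc.2.1.le hc.2.2.le,
    sin_angleLeft h2 hle hD hr hov, sin_angleRight h2 hle hD hr hov]
  field_simp
  ring

/-- The law of cosines at the apex. -/
lemma cos_angleApex (h2 : 0 < r₂) (hle : r₂ ≤ r₁) (hD : r₁ + r₂ ≤ D) (hr : 0 < r)
    (hov : D < r₁ + r₂ + 2 * r) :
    2 * ((r₁ + r) * (r₂ + r)) * (1 - Real.cos (angleApex r₁ r₂ D r))
      = D ^ 2 - (r₁ - r₂) ^ 2 := by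
  have H := bridgeData_apex h2 hle hD hr hov
  have h1 := H.s₁_pos
  have h3 := H.s₂_pos
  have hc := cos_left_mem h2 hle hD hr hov
  rw [angleApex, sub_sub, Real.cos_pi_sub, Real.cos_add, angleLeft, angleRight, Real.sin_arccos,
    Real.sin_arccos, Real.cos_arccos hc.1.1.le hc.1.2.le, Real.cos_arccos hc.2.1.le hc.2.2.le,
    sin_angleLeft h2 hle hD hr hov, sin_angleRight h2 hle hD hr hov]
  have e : 2 * ((r₁ + r) * (r₂ + r)) * (1 - -(apexX r₁ r₂ D r / (r₁ + r)
      * ((D - apexX r₁ r₂ D r) / (r₂ + r)) - apexY r₁ r₂ D r / (r₁ + r)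
      * (apexY r₁ r₂ D r / (r₂ + r)))) = 2 * ((r₁ + r) * (r₂ + r))
        + 2 * (apexX r₁ r₂ D r * (D - apexX r₁ r₂ D r)) - 2 * apexY r₁ r₂ D r ^ 2 := by
    field_simp
    ring
  rw [e]
  linear_combination -H.e₁ - H.e₂

lemma angleApex_mem (h2 : 0 < r₂) (hle : r₂ ≤ r₁) (hD : r₁ + r₂ ≤ D) (hr : 0 < r)
    (hov : D < r₁ + r₂ + 2 * r) : angleApex r₁ r₂ D r ∈ Ioo 0 Real.pi := by
  have H := bridgeData_apex h2 hle hD hr hov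
  have hc := cos_left_mem h2 hle hD hr hov
  have hpos : 0 < Real.sin (angleApex r₁ r₂ D r) := by
    have := sin_angleApex h2 hle hD hr hov
    by_contra hcon
    have h1 := mul_nonpos_of_nonpos_of_nonneg (not_lt.1 hcon) (mul_pos H.s₁_pos H.s₂_pos).le
    have h3 := mul_pos H.D_pos H.h_pos
    linarith
  have a1 : 0 < angleLeft r₁ r₂ D r := Real.arccos_pos.2 hc.1.2
  have a2 : 0 < angleRight r₁ r₂ D r := Real.arccos_pos.2 hc.2.2
  have a3 : angleLeft r₁ r₂ D r ≤ Real.pi := Real.arccos_le_pi _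
  have a4 : angleRight r₁ r₂ D r ≤ Real.pi := Real.arccos_le_pi _
  have hlt : angleApex r₁ r₂ D r < Real.pi := by rw [angleApex]; linarith
  refine ⟨?_, hlt⟩
  by_contra hcon
  have := Real.sin_nonpos_of_nonpos_of_neg_pi_le (not_lt.1 hcon) (by rw [angleApex]; linarith)
  linarith

/-- The tangent inequality at the apex. -/
lemma angleApex_lt (h2 : 0 < r₂) (hle : r₂ ≤ r₁) (hD : r₁ + r₂ ≤ D) (hr : 0 < r)
    (hov : D < r₁ + r₂ + 2 * r) :
    angleApex r₁ r₂ D r < (D ^ 2 - (r₁ - r₂) ^ 2) / (D * apexY r₁ r₂ D r) := by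
  have H := bridgeData_apex h2 hle hD hr hov
  have hm := angleApex_mem h2 hle hD hr hov
  obtain ⟨x, hx⟩ : ∃ x, angleApex r₁ r₂ D r = 2 * x := ⟨angleApex r₁ r₂ D r / 2, by ring⟩
  have hs := sin_angleApex h2 hle hD hr hov
  have hc := cos_angleApex h2 hle hD hr hov
  have hx0 : 0 < x := by linarith [hm.1]
  have hx1 : x < Real.pi / 2 := by linarith [hm.2]
  have ht := Real.lt_tan hx0 hx1
  have hcos : 0 < Real.cos x := Real.cos_pos_of_mem_Ioo ⟨by linarith, hx1⟩
  have hsin : 0 < Real.sin x := Real.sin_pos_of_pos_of_lt_pi hx0 (by linarith [Real.pi_pos])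
  have h1 := H.s₁_pos
  have h3 := H.s₂_pos
  -- By the two previous identities the right side is `2 (1 - cos γ) / sin γ = 2 tan (γ / 2)` for
  -- the apex angle `γ`.
  rw [← hs, ← hc, hx, Real.cos_two_mul, Real.sin_two_mul]
  rw [Real.tan_eq_sin_div_cos] at ht
  have e : 2 * ((r₁ + r) * (r₂ + r)) * (1 - (2 * Real.cos x ^ 2 - 1))
      / (2 * Real.sin x * Real.cos x * ((r₁ + r) * (r₂ + r))) = 2 * (Real.sin x / Real.cos x) := by
    have : 1 - (2 * Real.cos x ^ 2 - 1) = 2 * Real.sin x ^ 2 := by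
      linear_combination (-2) * Real.sin_sq_add_cos_sq x
    rw [this]
    field_simp
  rw [e]
  linarith

lemma hasDerivAt_apexX (h2 : 0 < r₂) (hle : r₂ ≤ r₁) (hD : r₁ + r₂ ≤ D) (r : ℝ) :
    HasDerivAt (apexX r₁ r₂ D) ((r₁ - r₂) / D) r := by
  have hD0 : 0 < D := by linarith
  have h := (((hasDerivAt_id r).const_mul 2).const_add (r₁ + r₂)).const_mul (r₁ - r₂)
  have h3 := (h.const_add (D ^ 2)).div_const (2 * D)
  have e : apexX r₁ r₂ D
      = fun x => (D ^ 2 + (r₁ - r₂) * (r₁ + r₂ + 2 * id x)) / (2 * D) := by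
    funext x
    simp only [apexX, id]
    ring
  rw [e]
  refine h3.congr_deriv ?_
  field_simp

lemma hasDerivAt_apexY (h2 : 0 < r₂) (hle : r₂ ≤ r₁) (hD : r₁ + r₂ ≤ D) (hr : 0 < r)
    (hov : D < r₁ + r₂ + 2 * r) : HasDerivAt (apexY r₁ r₂ D)
      ((r₁ + r - apexX r₁ r₂ D r * ((r₁ - r₂) / D)) / apexY r₁ r₂ D r) r := by
  have hpos := apex_radicand_pos h2 hle hD hr hov
  have h1 := (((hasDerivAt_id r).const_add r₁).pow 2).sub
    ((hasDerivAt_apexX h2 hle hD r).pow 2)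
  have h3 := h1.sqrt hpos.ne'
  refine (h3 : HasDerivAt (apexY r₁ r₂ D) _ r).congr_deriv ?_
  have hy : 0 < apexY r₁ r₂ D r := Real.sqrt_pos.2 hpos
  have : Real.sqrt (((fun x => r₁ + id x) ^ 2 - apexX r₁ r₂ D ^ 2) r) = apexY r₁ r₂ D r := by
    simp [apexY]
  rw [this]
  simp only [id]
  field_simp
  ring

lemma hasDerivAt_angleLeft (h2 : 0 < r₂) (hle : r₂ ≤ r₁) (hD : r₁ + r₂ ≤ D) (hr : 0 < r)
    (hov : D < r₁ + r₂ + 2 * r) : HasDerivAt (angleLeft r₁ r₂ D)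
      ((apexX r₁ r₂ D r - (r₁ - r₂) / D * (r₁ + r)) / (apexY r₁ r₂ D r * (r₁ + r))) r := by
  have H := bridgeData_apex h2 hle hD hr hov
  have hc := (cos_left_mem h2 hle hD hr hov).1
  have h1 := (hasDerivAt_apexX h2 hle hD r).div ((hasDerivAt_id r).const_add r₁) H.s₁_pos.ne'
  have h3 := (Real.hasDerivAt_arccos hc.1.ne' hc.2.ne).comp r h1
  refine (h3 : HasDerivAt (angleLeft r₁ r₂ D) _ r).congr_deriv ?_
  rw [sin_angleLeft h2 hle hD hr hov]
  have := H.s₁_pos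
  have := H.h_pos
  simp only [id]
  field_simp
  ring

lemma hasDerivAt_angleRight (h2 : 0 < r₂) (hle : r₂ ≤ r₁) (hD : r₁ + r₂ ≤ D) (hr : 0 < r)
    (hov : D < r₁ + r₂ + 2 * r) : HasDerivAt (angleRight r₁ r₂ D)
      ((D - apexX r₁ r₂ D r + (r₁ - r₂) / D * (r₂ + r)) / (apexY r₁ r₂ D r * (r₂ + r))) r := by
  have H := bridgeData_apex h2 hle hD hr hov
  have hc := (cos_left_mem h2 hle hD hr hov).2
  have h1 := ((hasDerivAt_apexX h2 hle hD r).const_sub D).div ((hasDerivAt_id r).const_add r₂)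
    H.s₂_pos.ne'
  have h3 := (Real.hasDerivAt_arccos hc.1.ne' hc.2.ne).comp r h1
  refine (h3 : HasDerivAt (angleRight r₁ r₂ D) _ r).congr_deriv ?_
  rw [sin_angleRight h2 hle hD hr hov]
  have := H.s₂_pos
  have := H.h_pos
  simp only [id]
  field_simp
  ring

lemma hasDerivAt_closePer (h2 : 0 < r₂) (hle : r₂ ≤ r₁) (hD : r₁ + r₂ ≤ D) (hr : 0 < r)
    (hov : D < r₁ + r₂ + 2 * r) : HasDerivAt (closePer r₁ r₂ D)
      (2 * (angleApex r₁ r₂ D r - (D ^ 2 - (r₁ - r₂) ^ 2) / (D * apexY r₁ r₂ D r))) r := by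
  have H := bridgeData_apex h2 hle hD hr hov
  have h1 := hasDerivAt_angleLeft h2 hle hD hr hov
  have h3 := hasDerivAt_angleRight h2 hle hD hr hov
  have h4 := (((h1.const_mul r₁).const_sub (Real.pi * (r₁ + r₂))).sub (h3.const_mul r₂)).add
    ((hasDerivAt_id r).mul ((h1.const_sub Real.pi).sub h3))
  refine (h4.const_mul 2 : HasDerivAt (closePer r₁ r₂ D) _ r).congr_deriv ?_
  have := H.s₁_pos
  have := H.s₂_pos
  have := H.h_pos
  have := H.D_pos
  simp only [id, angleApex, Pi.sub_apply]
  field_simp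
  ring

/-- The derivative is `-r` times that of `closePer`: the free arcs have curvature `1 / r`, so the
closing is critical for the perimeter plus `1 / r` times the added area when the weight `1 / r` is
frozen. -/
lemma hasDerivAt_closeGap (h2 : 0 < r₂) (hle : r₂ ≤ r₁) (hD : r₁ + r₂ ≤ D) (hr : 0 < r)
    (hov : D < r₁ + r₂ + 2 * r) : HasDerivAt (closeGap r₁ r₂ D)
      (-r * (2 * (angleApex r₁ r₂ D r - (D ^ 2 - (r₁ - r₂) ^ 2) / (D * apexY r₁ r₂ D r)))) r := by
  have H := bridgeData_apex h2 hle hD hr hov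
  have h1 := hasDerivAt_angleLeft h2 hle hD hr hov
  have h3 := hasDerivAt_angleRight h2 hle hD hr hov
  have h4 := ((((hasDerivAt_apexY h2 hle hD hr hov).const_mul D).sub (h1.const_mul (r₁ ^ 2))).sub
    (h3.const_mul (r₂ ^ 2))).sub
    (((hasDerivAt_id r).pow 2).mul ((h1.const_sub Real.pi).sub h3))
  refine (h4 : HasDerivAt (closeGap r₁ r₂ D) _ r).congr_deriv ?_
  have k1 := H.s₁_pos
  have k2 := H.s₂_pos
  have k3 := H.h_pos
  have k4 := H.D_pos
  have K := apexX_mul h2 hle hD r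
  obtain ⟨p, hp⟩ : ∃ p, p = apexX r₁ r₂ D r := ⟨_, rfl⟩
  obtain ⟨h, hh⟩ : ∃ h, h = apexY r₁ r₂ D r := ⟨_, rfl⟩
  rw [← hp] at K
  simp only [id, angleApex, Pi.sub_apply, Pi.pow_apply, ← hp, ← hh] at k3 ⊢
  field_simp
  linear_combination (-(r₁ - r₂) * (r₁ + r) * (r₂ + r)) * K

lemma deriv_closePer_neg (h2 : 0 < r₂) (hle : r₂ ≤ r₁) (hD : r₁ + r₂ ≤ D) (hr : 0 < r)
    (hov : D < r₁ + r₂ + 2 * r) : deriv (closePer r₁ r₂ D) r < 0 := by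
  rw [(hasDerivAt_closePer h2 hle hD hr hov).deriv]
  linarith [angleApex_lt h2 hle hD hr hov]

lemma deriv_closeGap_pos (h2 : 0 < r₂) (hle : r₂ ≤ r₁) (hD : r₁ + r₂ ≤ D) (hr : 0 < r)
    (hov : D < r₁ + r₂ + 2 * r) : 0 < deriv (closeGap r₁ r₂ D) r := by
  have h1 := deriv_closePer_neg h2 hle hD hr hov
  rw [(hasDerivAt_closePer h2 hle hD hr hov).deriv] at h1
  rw [(hasDerivAt_closeGap h2 hle hD hr hov).deriv]
  exact mul_pos_of_neg_of_neg (by linarith) h1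

/-- The derivatives of `closePer` and of `closeGap`, the latter with the frozen weight `1 / r`,
cancel. Only the derivative of the weight itself remains. -/
lemma hasDerivAt_closeVal (h2 : 0 < r₂) (hle : r₂ ≤ r₁) (hD : r₁ + r₂ ≤ D) (hr : 0 < r)
    (hov : D < r₁ + r₂ + 2 * r) :
    HasDerivAt (closeVal r₁ r₂ D) (-(closeGap r₁ r₂ D r / r ^ 2)) r := by
  have h1 := (hasDerivAt_closePer h2 hle hD hr hov).add
    ((hasDerivAt_closeGap h2 hle hD hr hov).div (hasDerivAt_id r) hr.ne')
  refine (h1 : HasDerivAt (closeVal r₁ r₂ D) _ r).congr_deriv ?_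
  simp only [id]
  field_simp
  ring

lemma continuousOn_angleLeft (h1 : 0 < r₁) : ContinuousOn (angleLeft r₁ r₂ D) (Ici 0) := by
  unfold angleLeft apexX
  refine Real.continuous_arccos.comp_continuousOn (ContinuousOn.div (by fun_prop) (by fun_prop) ?_)
  intro x hx
  have : (0 : ℝ) ≤ x := hx
  positivity

lemma continuousOn_angleRight (h2 : 0 < r₂) : ContinuousOn (angleRight r₁ r₂ D) (Ici 0) := by
  unfold angleRight apexX
  refine Real.continuous_arccos.comp_continuousOn (ContinuousOn.div (by fun_prop) (by fun_prop) ?_)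
  intro x hx
  have : (0 : ℝ) ≤ x := hx
  positivity

lemma continuousOn_closePer (h1 : 0 < r₁) (h2 : 0 < r₂) :
    ContinuousOn (closePer r₁ r₂ D) (Ici 0) := by
  have c1 := continuousOn_angleLeft (r₂ := r₂) (D := D) h1
  have c2 := continuousOn_angleRight (r₁ := r₁) (D := D) h2
  unfold closePer angleApex
  fun_prop

lemma continuousOn_closeGap (h1 : 0 < r₁) (h2 : 0 < r₂) :
    ContinuousOn (closeGap r₁ r₂ D) (Ici 0) := by
  have c1 := continuousOn_angleLeft (r₂ := r₂) (D := D) h1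
  have c2 := continuousOn_angleRight (r₁ := r₁) (D := D) h2
  have c3 : ContinuousOn (apexY r₁ r₂ D) (Ici 0) := by
    unfold apexY apexX
    fun_prop
  unfold closeGap angleApex
  fun_prop

lemma continuousOn_closeVal (h1 : 0 < r₁) (h2 : 0 < r₂) :
    ContinuousOn (closeVal r₁ r₂ D) (Ioi 0) :=
  ((continuousOn_closePer h1 h2).mono Ioi_subset_Ici_self).add
    (((continuousOn_closeGap h1 h2).mono Ioi_subset_Ici_self).div continuousOn_id
      fun _ hx => (ne_of_gt hx))

/-- That the added area is nonnegative is read off from the inclusion of the disks in the closing by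
comparing volumes, not from the formula. -/
lemma closing_measures (h2 : 0 < r₂) (hle : r₂ ≤ r₁) (hD : r₁ + r₂ ≤ D) (hr : 0 < r)
    (hB : D ≤ gapLen r₁ r + gapLen r₂ r) :
    perimeter (closing r (twoDisks r₁ r₂ D)) = ENNReal.ofReal (closePer r₁ r₂ D r) ∧
    volume (closing r (twoDisks r₁ r₂ D) \ twoDisks r₁ r₂ D)
      = ENNReal.ofReal (closeGap r₁ r₂ D r) ∧
    0 < closePer r₁ r₂ D r ∧ 0 ≤ closeGap r₁ r₂ D r := by
  have h1 : 0 < r₁ := h2.trans_le hle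
  have hov : D < r₁ + r₂ + 2 * r := by linarith [gapLen_lt h1 hr, gapLen_lt h2 hr]
  have H := bridgeData_apex h2 hle hD hr hov
  have hP := H.closing_perimeter hB
  have hg := angleApex_mem h2 hle hD hr hov
  have hS := union_ball_perimeter h1 h2 hD
  have hpi := Real.pi_pos
  have e : volume (closing r (twoDisks r₁ r₂ D))
      = ENNReal.ofReal (Real.pi * (r₁ ^ 2 + r₂ ^ 2) + closeGap r₁ r₂ D r) := by
    rw [hP.2]
    congr 1
    rw [closeGap, angleApex, angleLeft, angleRight]
    ring
  have hsub := twoDisks_subset_closing (r₁ := r₁) (r₂ := r₂) (D := D) hr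
  have hle' := measure_mono (μ := volume) hsub
  have hSpos : 0 < Real.pi * (r₁ ^ 2 + r₂ ^ 2) := by positivity
  have hgap : 0 ≤ closeGap r₁ r₂ D r := by
    rw [e, twoDisks, hS.2] at hle'
    by_contra hcon
    push Not at hcon
    exact absurd hle' (not_le.2 ((ENNReal.ofReal_lt_ofReal_iff hSpos).2 (by linarith)))
  refine ⟨hP.1, ?_, ?_, hgap⟩
  · rw [measure_sdiff hsub ((Metric.isOpen_ball.union
      Metric.isOpen_ball).measurableSet.nullMeasurableSet) (by
        rw [twoDisks, hS.2]; exact ENNReal.ofReal_ne_top), e, twoDisks, hS.2,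
      ← ENNReal.ofReal_sub _ hSpos.le]
    congr 1
    ring
  · have a3 : angleLeft r₁ r₂ D r ≤ Real.pi := Real.arccos_le_pi _
    have a4 : angleRight r₁ r₂ D r ≤ Real.pi := Real.arccos_le_pi _
    have t1 := mul_nonneg h1.le (sub_nonneg.2 a3)
    have t2 := mul_nonneg h2.le (sub_nonneg.2 a4)
    have t3 := mul_pos hr hg.1
    rw [closePer]
    linarith

lemma closingEnergy_eq (h2 : 0 < r₂) (hle : r₂ ≤ r₁) (hD : r₁ + r₂ ≤ D) (hr : 0 < r)
    (hB : D ≤ gapLen r₁ r + gapLen r₂ r) :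
    closingEnergy (twoDisks r₁ r₂ D) r = ENNReal.ofReal (closeVal r₁ r₂ D r) ∧
      0 < closeVal r₁ r₂ D r := by
  obtain ⟨m1, m2, m3, m4⟩ := closing_measures h2 hle hD hr hB
  have h0 : 0 ≤ closeGap r₁ r₂ D r / r := div_nonneg m4 hr.le
  refine ⟨?_, by rw [closeVal]; linarith⟩
  rw [closingEnergy, m1, m2, closeVal, ENNReal.ofReal_add m3.le h0, ENNReal.ofReal_div_of_pos hr]

lemma gapLen_strictMono {R : ℝ} (hR : 0 < R) : StrictMonoOn (gapLen R) (Ici 0) := by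
  intro a ha b _ hab
  have : (0 : ℝ) ≤ a := ha
  refine Real.sqrt_lt_sqrt (by positivity) ?_
  have := mul_lt_mul_of_pos_left hab (by positivity : 0 < 2 * R)
  linarith

/-- The sum of the two gap lengths is continuous and strictly increasing, equals `r₁ + r₂` at radius
zero and eventually exceeds `D`. -/
lemma exists_critical (h2 : 0 < r₂) (hle : r₂ ≤ r₁) (hD : r₁ + r₂ ≤ D) :
    ∃ ρ, 0 ≤ ρ ∧ (∀ r, 0 < r → (ρ ≤ r ↔ D ≤ gapLen r₁ r + gapLen r₂ r)) ∧
      gapLen r₁ ρ + gapLen r₂ ρ = D ∧ (ρ = 0 ↔ D = r₁ + r₂) := by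
  have h1 : 0 < r₁ := h2.trans_le hle
  have hmono : StrictMonoOn (fun r => gapLen r₁ r + gapLen r₂ r) (Ici 0) :=
    (gapLen_strictMono h1).add (gapLen_strictMono h2)
  have h0 : gapLen r₁ 0 + gapLen r₂ 0 = r₁ + r₂ := by
    rw [gapLen, gapLen]
    simp only [mul_zero, add_zero]
    rw [Real.sqrt_sq h1.le, Real.sqrt_sq h2.le]
  -- With `2 * r₂ * M = D ^ 2` the gap length at the second disk alone already reaches `D`.
  obtain ⟨M, hM⟩ : ∃ M, M = D ^ 2 / (2 * r₂) := ⟨_, rfl⟩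
  have hM0 : 0 ≤ M := hM ▸ by positivity
  have hMD : D ≤ gapLen r₁ M + gapLen r₂ M := by
    have : D ≤ gapLen r₂ M := by
      refine Real.le_sqrt_of_sq_le ?_
      have : 2 * r₂ * M = D ^ 2 := by rw [hM]; field_simp
      nlinarith
    linarith [gapLen_pos h1 hM0]
  have hcont : Continuous fun r => gapLen r₁ r + gapLen r₂ r := by
    unfold gapLen
    fun_prop
  obtain ⟨ρ, hρ, hρe⟩ := intermediate_value_Icc hM0 hcont.continuousOn
    (⟨by simpa only [h0] using hD, hMD⟩ : D ∈ Icc _ _)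
  simp only at hρe
  refine ⟨ρ, hρ.1, fun r hr => ?_, hρe, ?_⟩
  · conv_rhs => rw [← hρe]
    exact (hmono.le_iff_le (show (0 : ℝ) ≤ ρ from hρ.1) (show (0 : ℝ) ≤ r from hr.le)).symm
  · constructor
    · rintro rfl
      linarith
    · intro he
      exact hmono.injOn (show (0 : ℝ) ≤ ρ from hρ.1) (show (0 : ℝ) ≤ 0 from le_rfl)
        (by rw [hρe, h0, he])

theorem criticalRadius_spec (h2 : 0 < r₂) (hle : r₂ ≤ r₁) (hD : r₁ + r₂ ≤ D) :
    0 ≤ criticalRadius (twoDisks r₁ r₂ D) ∧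
    (∀ r, 0 < r → (criticalRadius (twoDisks r₁ r₂ D) ≤ r ↔ D ≤ gapLen r₁ r + gapLen r₂ r)) ∧
      gapLen r₁ (criticalRadius (twoDisks r₁ r₂ D)) + gapLen r₂ (criticalRadius (twoDisks r₁ r₂ D))
        = D ∧ (criticalRadius (twoDisks r₁ r₂ D) = 0 ↔ D = r₁ + r₂) := by
  have h1 : 0 < r₁ := h2.trans_le hle
  obtain ⟨ρ, hρ⟩ := exists_critical h2 hle hD
  have e : criticalRadius (twoDisks r₁ r₂ D) = ρ := by
    have hset : {r : ℝ | 0 < r ∧ IsConnected (closing r (twoDisks r₁ r₂ D))}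
        = {r | 0 < r ∧ ρ ≤ r} := by
      ext r
      simp only [mem_ofPred_eq]
      refine and_congr_right fun hr => ⟨fun hc => ?_, fun hc => ?_⟩
      · by_contra hcon
        exact not_isConnected_closing h1 h2 hr (not_le.1 fun h => hcon ((hρ.2.1 r hr).2 h)) hc
      · exact isConnected_closing h1 h2 hD hr ((hρ.2.1 r hr).1 hc)
    rw [criticalRadius, hset]
    -- For tangent disks the admissible radii form the open half line, whose infimum `0` is not
    -- attained; otherwise they form a closed half line.
    rcases eq_or_lt_of_le hρ.1 with h0 | h0
    · have : {r : ℝ | 0 < r ∧ ρ ≤ r} = Ioi 0 := by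
        ext r
        simp only [mem_ofPred_eq, mem_Ioi]
        exact ⟨fun h => h.1, fun h => ⟨h, h0 ▸ h.le⟩⟩
      rw [this, csInf_Ioi, h0]
    · have : {r : ℝ | 0 < r ∧ ρ ≤ r} = Ici ρ := by
        ext r
        simp only [mem_ofPred_eq, mem_Ici]
        exact ⟨fun h => h.2, fun h => ⟨h0.trans_le h, h⟩⟩
      rw [this, csInf_Ici]
  rw [e]
  exact hρ

end ClosingEnergy

/-! ### The radius at which the closing functional takes a given value -/

section Radius

/-- The perimeter of the convex hull of two disks. -/
noncomputable def hullPer (r₁ r₂ D : ℝ) : ℝ :=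
  2 * (r₁ * (Real.pi / 2 + Real.arcsin ((r₁ - r₂) / D)) + D * Real.sqrt (1 - ((r₁ - r₂) / D) ^ 2)
    + r₂ * (Real.pi / 2 - Real.arcsin ((r₁ - r₂) / D)))

variable {r₁ r₂ D r : ℝ}

lemma hullData_twoDisks (h2 : 0 < r₂) (hle : r₂ ≤ r₁) (hD : r₁ + r₂ ≤ D) :
    HullData r₁ D r₂ ((r₁ - r₂) / D) (Real.sqrt (1 - ((r₁ - r₂) / D) ^ 2)) := by
  have hD0 : 0 < D := by linarith
  have h0 : 0 ≤ (r₁ - r₂) / D := div_nonneg (by linarith) hD0.le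
  have h1 : (r₁ - r₂) / D < 1 := (div_lt_one hD0).2 (by linarith)
  have hpos : 0 < 1 - ((r₁ - r₂) / D) ^ 2 := by
    have := pow_lt_one₀ h0 h1 two_ne_zero
    linarith
  exact ⟨h2, hle, hD0, h0, Real.sqrt_pos.2 hpos, by rw [Real.sq_sqrt hpos.le]; ring, by
    field_simp⟩

lemma convexHull_twoDisks_perimeter (h2 : 0 < r₂) (hle : r₂ ≤ r₁) (hD : r₁ + r₂ ≤ D) :
    perimeter (convexHull ℝ (twoDisks r₁ r₂ D)) = ENNReal.ofReal (hullPer r₁ r₂ D) := by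
  have h := hullData_twoDisks h2 hle hD
  rw [twoDisks, h.convexHull_eq, h.profile_perimeter.1, hullPer]

lemma twoDisks_perimeter (h2 : 0 < r₂) (hle : r₂ ≤ r₁) (hD : r₁ + r₂ ≤ D) :
    perimeter (twoDisks r₁ r₂ D) = ENNReal.ofReal (2 * (Real.pi * (r₁ + r₂))) :=
  (union_ball_perimeter (h2.trans_le hle) h2 hD).1

/-- The monotonicity of `Close_r S` functional above the critical radius. -/
lemma closeVal_strictAnti (h2 : 0 < r₂) (hle : r₂ ≤ r₁) (hD : r₁ + r₂ ≤ D) {a b : ℝ} (ha : 0 < a)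
    (hab : a < b) (hB : D ≤ gapLen r₁ a + gapLen r₂ a) :
    closeVal r₁ r₂ D b < closeVal r₁ r₂ D a := by
  have h1 : 0 < r₁ := h2.trans_le hle
  have hov : ∀ x, a ≤ x → D < r₁ + r₂ + 2 * x := fun x hx => by
    linarith [gapLen_lt h1 ha, gapLen_lt h2 ha]
  have hgap0 := (closing_measures h2 hle hD ha hB).2.2.2
  -- The added area is nonnegative at `a` and strictly increasing, hence positive beyond `a`. This
  -- makes the derivative of `closeVal` strictly negative there.
  have hmono : StrictMonoOn (closeGap r₁ r₂ D) (Ici a) := by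
    refine strictMonoOn_of_deriv_pos (convex_Ici a)
      ((continuousOn_closeGap h1 h2).mono (Ici_subset_Ici.2 ha.le)) fun x hx => ?_
    rw [interior_Ici] at hx
    exact deriv_closeGap_pos h2 hle hD (ha.trans hx) (hov x (le_of_lt hx))
  have hanti : StrictAntiOn (closeVal r₁ r₂ D) (Ici a) := by
    refine strictAntiOn_of_deriv_neg (convex_Ici a)
      ((continuousOn_closeVal h1 h2).mono fun x hx => ha.trans_le hx) fun x hx => ?_
    rw [interior_Ici] at hx
    have hx0 : 0 < x := ha.trans hx
    rw [(hasDerivAt_closeVal h2 hle hD hx0 (hov x (le_of_lt hx))).deriv]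
    have := hmono self_mem_Ici (le_of_lt hx : a ≤ x) hx
    have : 0 < closeGap r₁ r₂ D x / x ^ 2 := div_pos (by linarith) (by positivity)
    linarith
  exact hanti self_mem_Ici hab.le hab

lemma tendsto_affine_div {a b R : ℝ} :
    Tendsto (fun r : ℝ => (a + b * r) / (R + r)) atTop (𝓝 b) := by
  have h1 : Tendsto (fun r : ℝ => R + r) atTop atTop := tendsto_atTop_add_const_left _ _ tendsto_id
  have h3 : Tendsto (fun r : ℝ => b + (a - b * R) / (R + r)) atTop (𝓝 (b + 0)) :=
    tendsto_const_nhds.add (h1.const_div_atTop _)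
  rw [add_zero] at h3
  refine h3.congr' ?_
  filter_upwards [eventually_gt_atTop (-R)] with r hr
  have : R + r ≠ 0 := by linarith
  field_simp
  ring

/-- As the radius grows, the touching arcs straighten to the common outer tangents. The apex angle
`γ` tends to `0`, while `r * γ` tends to the tangent length `D * c`. In `closeGap / r` the terms `D
* h / r` and `r * γ` have the same limit and cancel. -/
lemma tendsto_closeVal (h2 : 0 < r₂) (hle : r₂ ≤ r₁) (hD : r₁ + r₂ ≤ D) :
    Tendsto (closeVal r₁ r₂ D) atTop (𝓝 (hullPer r₁ r₂ D)) := by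
  have h1 : 0 < r₁ := h2.trans_le hle
  have hD0 : 0 < D := by linarith
  obtain ⟨s, hs⟩ : ∃ s, s = (r₁ - r₂) / D := ⟨_, rfl⟩
  obtain ⟨c, hc⟩ : ∃ c, c = Real.sqrt (1 - s ^ 2) := ⟨_, rfl⟩
  have u1 : Tendsto (fun r => apexX r₁ r₂ D r / (r₁ + r)) atTop (𝓝 s) := by
    refine (tendsto_affine_div (a := (D ^ 2 + (r₁ - r₂) * (r₁ + r₂)) / (2 * D)) (b := s)
      (R := r₁)).congr fun r => ?_
    congr 1
    rw [apexX, hs]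
    field_simp
    ring
  have u2 : Tendsto (fun r => (D - apexX r₁ r₂ D r) / (r₂ + r)) atTop (𝓝 (-s)) := by
    refine (tendsto_affine_div (a := D - (D ^ 2 + (r₁ - r₂) * (r₁ + r₂)) / (2 * D)) (b := -s)
      (R := r₂)).congr fun r => ?_
    congr 1
    rw [apexX, hs]
    field_simp
    ring
  have a1 : Tendsto (angleLeft r₁ r₂ D) atTop (𝓝 (Real.pi / 2 - Real.arcsin s)) :=
    (Real.continuous_arccos.tendsto s).comp u1
  have a2 : Tendsto (angleRight r₁ r₂ D) atTop (𝓝 (Real.pi / 2 + Real.arcsin s)) := by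
    have := (Real.continuous_arccos.tendsto (-s)).comp u2
    rwa [Real.arccos, Real.arcsin_neg, sub_neg_eq_add] at this
  have a3 : Tendsto (angleApex r₁ r₂ D) atTop (𝓝 0) := by
    have := (a1.const_sub Real.pi).sub a2
    rwa [show Real.pi - (Real.pi / 2 - Real.arcsin s) - (Real.pi / 2 + Real.arcsin s) = 0 by
      ring] at this
  have ev : ∀ᶠ r in atTop, 0 < r ∧ D < r₁ + r₂ + 2 * r := by
    filter_upwards [eventually_gt_atTop 0, eventually_gt_atTop D] with r hr hr'
    exact ⟨hr, by linarith⟩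
  have y1 : Tendsto (fun r => apexY r₁ r₂ D r / (r₁ + r)) atTop (𝓝 c) := by
    have : Tendsto (fun r => Real.sqrt (1 - (apexX r₁ r₂ D r / (r₁ + r)) ^ 2)) atTop (𝓝 c) := by
      rw [hc]
      exact ((u1.pow 2).const_sub 1).sqrt
    refine this.congr' ?_
    filter_upwards [ev] with r hr
    exact sin_angleLeft h2 hle hD hr.1 hr.2
  have q1 : Tendsto (fun r : ℝ => r / (r₂ + r)) atTop (𝓝 1) := by
    simpa using tendsto_affine_div (a := 0) (b := 1) (R := r₂)
  have q2 : Tendsto (fun r : ℝ => r / (r₁ + r)) atTop (𝓝 1) := by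
    simpa using tendsto_affine_div (a := 0) (b := 1) (R := r₁)
  have y2 : Tendsto (fun r => apexY r₁ r₂ D r / r) atTop (𝓝 c) := by
    have := y1.div q2 one_ne_zero
    rw [div_one] at this
    refine this.congr' ?_
    filter_upwards [ev] with r hr
    have h3 : 0 < r := hr.1
    simp only [Pi.div_apply]
    field_simp
  -- The area formula for the triangle gives `r * γ = D * (h / (r₁ + r)) * (r / (r₂ + r)) / sinc γ`.
  have y3 : Tendsto (fun r => r * angleApex r₁ r₂ D r) atTop (𝓝 (D * c)) := by
    have t1 : Tendsto (fun r => Real.sinc (angleApex r₁ r₂ D r)) atTop (𝓝 1) := by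
      have := (Real.continuous_sinc.tendsto 0).comp a3
      rwa [Real.sinc_zero] at this
    have t2 := ((y1.mul q1).const_mul D).div t1 one_ne_zero
    rw [mul_one, div_one] at t2
    refine t2.congr' ?_
    filter_upwards [ev] with r hr
    have hs := sin_angleApex h2 hle hD hr.1 hr.2
    have hm := angleApex_mem h2 hle hD hr.1 hr.2
    have h3 := hr.1
    have hsin : 0 < Real.sin (angleApex r₁ r₂ D r) := Real.sin_pos_of_pos_of_lt_pi hm.1 hm.2
    have hm1 := hm.1
    simp only [Pi.div_apply]
    rw [Real.sinc_of_ne_zero hm1.ne']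
    field_simp
    linear_combination -hs
  have z1 : Tendsto (fun r => (r₁ ^ 2 * angleLeft r₁ r₂ D r + r₂ ^ 2 * angleRight r₁ r₂ D r) / r)
      atTop (𝓝 0) := ((a1.const_mul _).add (a2.const_mul _)).div_atTop tendsto_id
  have total := ((((a1.const_mul r₁).const_sub (Real.pi * (r₁ + r₂))).sub
    (a2.const_mul r₂)).add y3).const_mul 2 |>.add (((y2.const_mul D).sub z1).sub y3)
  have hlim : 2 * (Real.pi * (r₁ + r₂) - r₁ * (Real.pi / 2 - Real.arcsin s)
      - r₂ * (Real.pi / 2 + Real.arcsin s) + D * c) + (D * c - 0 - D * c) = hullPer r₁ r₂ D := by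
    rw [hullPer, ← hs, ← hc]
    ring
  rw [hlim] at total
  refine total.congr' ?_
  filter_upwards [ev] with r hr
  have h3 : 0 < r := hr.1
  rw [closeVal, closePer, closeGap]
  field_simp
  ring

/-- For tangent disks the functional stays below the perimeter of the disks. -/
lemma closeVal_lt_of_tangent (h2 : 0 < r₂) (hle : r₂ ≤ r₁) (hr : 0 < r) :
    closeVal r₁ r₂ (r₁ + r₂) r < 2 * (Real.pi * (r₁ + r₂)) := by
  have h1 : 0 < r₁ := h2.trans_le hle
  have hX : apexX r₁ r₂ (r₁ + r₂) 0 = r₁ := by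
    rw [apexX]
    field_simp
    ring
  have hL : angleLeft r₁ r₂ (r₁ + r₂) 0 = 0 := by
    rw [angleLeft, hX, add_zero, div_self h1.ne', Real.arccos_one]
  have hR : angleRight r₁ r₂ (r₁ + r₂) 0 = 0 := by
    rw [angleRight, hX, add_zero, add_sub_cancel_left, div_self h2.ne', Real.arccos_one]
  have hY : apexY r₁ r₂ (r₁ + r₂) 0 = 0 := by
    rw [apexY, hX, add_zero, sub_self, Real.sqrt_zero]
  have hP0 : closePer r₁ r₂ (r₁ + r₂) 0 = 2 * (Real.pi * (r₁ + r₂)) := by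
    rw [closePer, hL, hR]
    ring
  have hG0 : closeGap r₁ r₂ (r₁ + r₂) 0 = 0 := by
    rw [closeGap, hL, hR, hY]
    ring
  have hPanti : StrictAntiOn (closePer r₁ r₂ (r₁ + r₂)) (Ici 0) := by
    refine strictAntiOn_of_deriv_neg (convex_Ici 0) (continuousOn_closePer h1 h2) fun x hx => ?_
    rw [interior_Ici] at hx
    have hx0 : 0 < x := hx
    exact deriv_closePer_neg h2 hle le_rfl hx0 (by linarith)
  -- For tangent disks the formulas extend continuously to radius `0`, with perimeter `P(S)` and no
  -- added area. The function `x P(x) + G(x) - x P(S)` vanishes at `0`, and since `G' = -x P'` its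
  -- derivative is `P(x) - P(S) < 0`.
  have hanti : StrictAntiOn (fun x => x * closePer r₁ r₂ (r₁ + r₂) x + closeGap r₁ r₂ (r₁ + r₂) x
      - x * (2 * (Real.pi * (r₁ + r₂)))) (Ici 0) := by
    refine strictAntiOn_of_deriv_neg (convex_Ici 0) ?_ fun x hx => ?_
    · have := continuousOn_closePer (D := r₁ + r₂) h1 h2
      have := continuousOn_closeGap (D := r₁ + r₂) h1 h2
      fun_prop
    · rw [interior_Ici] at hx
      have hx0 : 0 < x := hx
      have d1 := hasDerivAt_closePer h2 hle le_rfl hx0 (by linarith)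
      have d2 := hasDerivAt_closeGap h2 hle le_rfl hx0 (by linarith)
      have d3 := (((hasDerivAt_id x).mul d1).add d2).sub
        ((hasDerivAt_id x).mul_const (2 * (Real.pi * (r₁ + r₂))))
      have d4 : HasDerivAt (fun x => x * closePer r₁ r₂ (r₁ + r₂) x
          + closeGap r₁ r₂ (r₁ + r₂) x - x * (2 * (Real.pi * (r₁ + r₂))))
          (closePer r₁ r₂ (r₁ + r₂) x - 2 * (Real.pi * (r₁ + r₂))) x := by
        refine HasDerivAt.congr_deriv (show HasDerivAt _ _ x from d3) ?_
        simp only [id]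
        ring
      rw [d4.deriv]
      have := hPanti self_mem_Ici (show (0 : ℝ) ≤ x from hx0.le) hx0
      rw [hP0] at this
      linarith
  have h3 := hanti self_mem_Ici (show (0 : ℝ) ≤ r from hr.le) hr
  simp only [hG0, zero_mul, add_zero, sub_zero] at h3
  have e : closeVal r₁ r₂ (r₁ + r₂) r - 2 * (Real.pi * (r₁ + r₂))
      = (r * closePer r₁ r₂ (r₁ + r₂) r + closeGap r₁ r₂ (r₁ + r₂) r
        - r * (2 * (Real.pi * (r₁ + r₂)))) / r := by
    rw [closeVal]
    field_simp
  have : closeVal r₁ r₂ (r₁ + r₂) r - 2 * (Real.pi * (r₁ + r₂)) < 0 := by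
    rw [e]
    exact div_neg_of_neg_of_pos h3 hr
  linarith

/-- For tangent disks the functional exceeds any smaller value for small radii. -/
lemma exists_lt_closeVal_of_tangent (h2 : 0 < r₂) (hle : r₂ ≤ r₁) {T : ℝ}
    (hT : T < 2 * (Real.pi * (r₁ + r₂))) : ∃ a, 0 < a ∧ T < closeVal r₁ r₂ (r₁ + r₂) a := by
  have h1 : 0 < r₁ := h2.trans_le hle
  have hX : apexX r₁ r₂ (r₁ + r₂) 0 = r₁ := by
    rw [apexX]
    field_simp
    ring
  have hP0 : closePer r₁ r₂ (r₁ + r₂) 0 = 2 * (Real.pi * (r₁ + r₂)) := by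
    rw [closePer, angleLeft, angleRight, hX, add_zero, div_self h1.ne', add_zero,
      add_sub_cancel_left, div_self h2.ne', Real.arccos_one]
    ring
  have hc := (continuousOn_closePer (D := r₁ + r₂) h1 h2 0 self_mem_Ici).mono
    (Ioi_subset_Ici_self (a := (0 : ℝ)))
  have hev := hc.eventually (lt_mem_nhds (hP0 ▸ hT))
  obtain ⟨a, ha1, ha2⟩ := (hev.and self_mem_nhdsWithin).exists
  have ha0 : 0 < a := ha2
  refine ⟨a, ha0, ha1.trans_le ?_⟩
  have hB : r₁ + r₂ ≤ gapLen r₁ a + gapLen r₂ a := by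
    have g : ∀ R, 0 < R → R ≤ gapLen R a := fun R hR =>
      Real.le_sqrt_of_sq_le (by linarith [mul_pos hR ha0])
    linarith [g r₁ h1, g r₂ h2]
  have := (closing_measures h2 hle le_rfl ha0 hB).2.2.2
  rw [closeVal]
  linarith [div_nonneg this ha0.le]

lemma hullPer_pos (h2 : 0 < r₂) (hle : r₂ ≤ r₁) (hD : r₁ + r₂ ≤ D) : 0 < hullPer r₁ r₂ D := by
  have h := hullData_twoDisks h2 hle hD
  have h0 : 0 ≤ Real.arcsin ((r₁ - r₂) / D) := Real.arcsin_nonneg.2 h.s_nonneg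
  have h1 := Real.arcsin_le_pi_div_two ((r₁ - r₂) / D)
  have hpi := Real.pi_pos
  have t1 : 0 < r₁ * (Real.pi / 2 + Real.arcsin ((r₁ - r₂) / D)) :=
    mul_pos (h2.trans_le hle) (by linarith)
  have t2 := mul_pos h.a_pos h.c_pos
  have t3 := mul_nonneg h2.le (sub_nonneg.2 h1)
  rw [hullPer]
  linarith

lemma closingEnergy_of_le (h2 : 0 < r₂) (hle : r₂ ≤ r₁) (hr : 0 < r) (h : r₁ + r₂ + 2 * r ≤ D) :
    closingEnergy (twoDisks r₁ r₂ D) r = ENNReal.ofReal (2 * (Real.pi * (r₁ + r₂))) := by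
  have hae := closing_ae_eq_of_le (h2.trans_le hle) h2 hr h
  rw [closingEnergy, perimeter_congr hae, twoDisks_perimeter h2 hle (by linarith),
    (ae_eq_set.1 hae).1, ENNReal.zero_div, add_zero]

lemma lt_closingEnergy_of_le_critical (h2 : 0 < r₂) (hle : r₂ ≤ r₁) (hD : r₁ + r₂ ≤ D)
    (hr : 0 < r) (hov : D < r₁ + r₂ + 2 * r) (hA : gapLen r₁ r + gapLen r₂ r ≤ D) :
    ENNReal.ofReal (2 * (Real.pi * (r₁ + r₂))) < closingEnergy (twoDisks r₁ r₂ D) r :=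
  ((bridgeData_apex h2 hle hD hr hov).lt_closing_perimeter hA).1.trans_le le_self_add

/-- The radius at which the functional takes a given value. -/
theorem exists_closing_radius (h2 : 0 < r₂) (hle : r₂ ≤ r₁) (hD : r₁ + r₂ ≤ D) {T : ℝ}
    (hT1 : hullPer r₁ r₂ D < T) (hT2 : T ≤ 2 * (Real.pi * (r₁ + r₂))) :
    ∃ R, criticalRadius (twoDisks r₁ r₂ D) ≤ R ∧
      closingEnergy (twoDisks r₁ r₂ D) R = ENNReal.ofReal T ∧
      (∀ r, criticalRadius (twoDisks r₁ r₂ D) ≤ r →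
        closingEnergy (twoDisks r₁ r₂ D) r = ENNReal.ofReal T → r = R) ∧
      (∀ r, R < r → closingEnergy (twoDisks r₁ r₂ D) r < ENNReal.ofReal T) ∧
      (∀ r, 0 < r → r < R → ENNReal.ofReal T ≤ closingEnergy (twoDisks r₁ r₂ D) r ∧
        (T < 2 * (Real.pi * (r₁ + r₂)) ∨ D < r₁ + r₂ + 2 * r →
          ENNReal.ofReal T < closingEnergy (twoDisks r₁ r₂ D) r)) ∧
      (R = 0 ↔ D = r₁ + r₂ ∧ T = 2 * (Real.pi * (r₁ + r₂))) ∧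
      (0 < criticalRadius (twoDisks r₁ r₂ D) → criticalRadius (twoDisks r₁ r₂ D) < R) := by
  have h1 : 0 < r₁ := h2.trans_le hle
  have hco := hullPer_pos h2 hle hD
  have hT0 : 0 < T := hco.trans hT1
  obtain ⟨ρ, hρ⟩ : ∃ ρ, ρ = criticalRadius (twoDisks r₁ r₂ D) := ⟨_, rfl⟩
  have hspec := criticalRadius_spec h2 hle hD
  rw [← hρ] at hspec ⊢
  obtain ⟨hρ0, hρ1, hρ2, hρ3⟩ := hspec
  have hval : ∀ r, 0 < r → ρ ≤ r →
      closingEnergy (twoDisks r₁ r₂ D) r = ENNReal.ofReal (closeVal r₁ r₂ D r) :=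
    fun r hr hr' => (closingEnergy_eq h2 hle hD hr ((hρ1 r hr).1 hr')).1
  have hanti : ∀ a b, 0 < a → ρ ≤ a → a < b → closeVal r₁ r₂ D b < closeVal r₁ r₂ D a :=
    fun a b ha ha' hab => closeVal_strictAnti h2 hle hD ha hab ((hρ1 a ha).1 ha')
  -- Up to the critical radius the closing has at least the perimeter of the two disks, and strictly
  -- more as soon as the touching disks exist.
  have hbelow : ∀ r, 0 < r → r ≤ ρ → ENNReal.ofReal (2 * (Real.pi * (r₁ + r₂)))
      ≤ closingEnergy (twoDisks r₁ r₂ D) r ∧ (D < r₁ + r₂ + 2 * r →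
        ENNReal.ofReal (2 * (Real.pi * (r₁ + r₂))) < closingEnergy (twoDisks r₁ r₂ D) r) := by
    intro r hr hrρ
    have hgap : gapLen r₁ r + gapLen r₂ r ≤ D := by
      rw [← hρ2]
      exact add_le_add ((gapLen_strictMono h1).monotoneOn (show (0 : ℝ) ≤ r from hr.le)
        (show (0 : ℝ) ≤ ρ from hρ0) hrρ) ((gapLen_strictMono h2).monotoneOn
          (show (0 : ℝ) ≤ r from hr.le) (show (0 : ℝ) ≤ ρ from hρ0) hrρ)
    rcases lt_or_ge D (r₁ + r₂ + 2 * r) with h | h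
    · have := lt_closingEnergy_of_le_critical h2 hle hD hr h hgap
      exact ⟨this.le, fun _ => this⟩
    · exact ⟨(closingEnergy_of_le h2 hle hr h).ge, fun h' => absurd h' (not_lt.2 h)⟩
  have hzero : closingEnergy (twoDisks r₁ r₂ D) 0 = ENNReal.ofReal (2 * (Real.pi * (r₁ + r₂))) := by
    rw [closingEnergy, closing, if_neg (lt_irrefl _), twoDisks_perimeter h2 hle hD]
    simp
  -- the degenerate case
  by_cases hdeg : D = r₁ + r₂ ∧ T = 2 * (Real.pi * (r₁ + r₂))
  · obtain ⟨hd, rfl⟩ := hdeg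
    have hρz : ρ = 0 := hρ3.2 hd
    have hlt : ∀ r, 0 < r → closingEnergy (twoDisks r₁ r₂ D) r
        < ENNReal.ofReal (2 * (Real.pi * (r₁ + r₂))) := by
      intro r hr
      rw [hval r hr (hρz ▸ hr.le), ENNReal.ofReal_lt_ofReal_iff hT0, hd]
      exact closeVal_lt_of_tangent h2 hle hr
    refine ⟨0, hρz.le, hzero, fun r hr hr' => ?_, hlt, fun r hr hr' => absurd hr (not_lt.2 hr'.le),
      ⟨fun _ => ⟨hd, rfl⟩, fun _ => rfl⟩, fun h => absurd h (by rw [hρz]; exact lt_irrefl _)⟩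
    rcases eq_or_lt_of_le (hρ0.trans hr) with h | h
    · exact h.symm
    · exact absurd hr' (hlt r h).ne
  -- a radius with a larger value
  have hstart : ∃ a, 0 < a ∧ ρ ≤ a ∧ T < closeVal r₁ r₂ D a := by
    rcases eq_or_lt_of_le hρ0 with h0 | h0
    · have hd : D = r₁ + r₂ := hρ3.1 h0.symm
      have hTlt : T < 2 * (Real.pi * (r₁ + r₂)) := lt_of_le_of_ne hT2 fun h => hdeg ⟨hd, h⟩
      obtain ⟨a, ha, ha'⟩ := exists_lt_closeVal_of_tangent h2 hle hTlt
      exact ⟨a, ha, h0 ▸ ha.le, hd ▸ ha'⟩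
    · refine ⟨ρ, h0, le_rfl, ?_⟩
      have h3 := (hbelow ρ h0 le_rfl).2 (by
        linarith [gapLen_lt h1 h0, gapLen_lt h2 h0])
      rw [hval ρ h0 le_rfl] at h3
      exact hT2.trans_lt ((ENNReal.ofReal_lt_ofReal_iff'.1 h3).1)
  obtain ⟨a, ha0, haρ, haT⟩ := hstart
  have hend : ∃ b, a ≤ b ∧ closeVal r₁ r₂ D b < T := by
    obtain ⟨b, hb⟩ := (((tendsto_closeVal h2 hle hD).eventually (gt_mem_nhds hT1)).and
      (eventually_ge_atTop a)).exists
    exact ⟨b, hb.2, hb.1⟩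
  obtain ⟨b, hab, hbT⟩ := hend
  obtain ⟨R, hR, hRT⟩ := intermediate_value_Icc' hab ((continuousOn_closeVal h1 h2).mono
    fun x hx => ha0.trans_le hx.1) (⟨hbT.le, haT.le⟩ : T ∈ Icc _ _)
  have haR : a < R := lt_of_le_of_ne hR.1 (by rintro rfl; linarith)
  have hR0 : 0 < R := ha0.trans haR
  have hρR : ρ < R := haρ.trans_lt haR
  have hgt : ∀ r, R < r → closingEnergy (twoDisks r₁ r₂ D) r < ENNReal.ofReal T := by
    intro r hr
    rw [hval r (hR0.trans hr) (hρR.trans hr).le, ENNReal.ofReal_lt_ofReal_iff hT0, ← hRT]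
    exact hanti R r hR0 hρR.le hr
  have hlt : ∀ r, 0 < r → r < R → ENNReal.ofReal T ≤ closingEnergy (twoDisks r₁ r₂ D) r ∧
      (T < 2 * (Real.pi * (r₁ + r₂)) ∨ D < r₁ + r₂ + 2 * r →
        ENNReal.ofReal T < closingEnergy (twoDisks r₁ r₂ D) r) := by
    intro r hr hrR
    rcases le_total ρ r with h | h
    · have : ENNReal.ofReal T < closingEnergy (twoDisks r₁ r₂ D) r := by
        rw [hval r hr h]
        have := hanti r R hr h hrR
        exact (ENNReal.ofReal_lt_ofReal_iff (hT0.trans (hRT ▸ this))).2 (hRT ▸ this)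
      exact ⟨this.le, fun _ => this⟩
    · obtain ⟨b1, b2⟩ := hbelow r hr h
      have hle' := ENNReal.ofReal_le_ofReal hT2
      refine ⟨hle'.trans b1, ?_⟩
      rintro (h' | h')
      · exact ((ENNReal.ofReal_lt_ofReal_iff (hT0.trans h')).2 h').trans_le b1
      · exact hle'.trans_lt (b2 h')
  refine ⟨R, hρR.le, by rw [hval R hR0 hρR.le, hRT], fun r hr hr' => ?_, hgt, hlt,
    ⟨fun h => absurd h hR0.ne', fun h => absurd h hdeg⟩, fun _ => hρR⟩
  rcases lt_trichotomy r R with h | h | h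
  · exfalso
    -- The radius `0` competes only if the critical radius is `0`; its value `P(S)` would make `T`
    -- equal to `P(S)`, which is the degenerate case already excluded.
    rcases eq_or_lt_of_le (hρ0.trans hr) with h0 | h0
    · have hd : D = r₁ + r₂ := hρ3.1 (le_antisymm (h0 ▸ hr) hρ0)
      rw [← h0, hzero] at hr'
      have hpos : 0 ≤ 2 * (Real.pi * (r₁ + r₂)) := hT0.le.trans hT2
      exact hdeg ⟨hd, ((ENNReal.ofReal_eq_ofReal_iff hpos hT0.le).1 hr').symm⟩
    · have hov : D < r₁ + r₂ + 2 * r := by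
        have := (hρ1 r h0).1 hr
        linarith [gapLen_lt h1 h0, gapLen_lt h2 h0]
      exact absurd hr' ((hlt r h0 h).2 (Or.inr hov)).ne'
  · exact h
  · exact absurd hr' (hgt r h).ne

end Radius

/-! ### The energies of the competitors -/

section Energy

lemma energy_eq_coe {S X : Set Plane} {s l : ℝ} (hP : perimeter X ≠ ⊤) (hv : volume X ≠ ⊤) :
    energy S s l X
      = ((per X + s / l * area (X \ S) - (1 - s) / l * area (X ∩ S) : ℝ) : EReal) := by
  have h1 : volume (X \ S) ≠ ⊤ := measure_ne_top_of_subset sdiff_subset hv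
  have h2 : volume (X ∩ S) ≠ ⊤ := measure_ne_top_of_subset inter_subset_left hv
  have e : ∀ a : ℝ≥0∞, a ≠ ⊤ → (a : EReal) = ((a.toReal : ℝ) : EReal) := fun a ha => by
    lift a to NNReal using ha
    rfl
  rw [energy, e _ hP, e _ h1, e _ h2, ← EReal.coe_mul, ← EReal.coe_mul, ← EReal.coe_add,
    ← EReal.coe_sub]
  rfl

variable {r₁ r₂ D : ℝ}

lemma closing_finite (h2 : 0 < r₂) (hle : r₂ ≤ r₁) (hD : r₁ + r₂ ≤ D) {r : ℝ} (hr : 0 < r) :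
    perimeter (closing r (twoDisks r₁ r₂ D)) ≠ ⊤ ∧ volume (closing r (twoDisks r₁ r₂ D)) ≠ ⊤ := by
  have h1 : 0 < r₁ := h2.trans_le hle
  rcases lt_or_ge D (r₁ + r₂ + 2 * r) with h | h
  · have H := bridgeData_apex h2 hle hD hr h
    rcases le_total D (gapLen r₁ r + gapLen r₂ r) with hB | hA
    · rw [(H.closing_perimeter hB).1, (H.closing_perimeter hB).2]
      exact ⟨ENNReal.ofReal_ne_top, ENNReal.ofReal_ne_top⟩
    · exact (H.lt_closing_perimeter hA).2
  · have hae := closing_ae_eq_of_le h1 h2 hr h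
    rw [perimeter_congr hae, measure_congr hae, twoDisks_perimeter h2 hle hD, twoDisks,
      (union_ball_perimeter h1 h2 hD).2]
    exact ⟨ENNReal.ofReal_ne_top, ENNReal.ofReal_ne_top⟩

lemma area_twoDisks (h2 : 0 < r₂) (hle : r₂ ≤ r₁) (hD : r₁ + r₂ ≤ D) :
    area (twoDisks r₁ r₂ D) = Real.pi * (r₁ ^ 2 + r₂ ^ 2) := by
  have hpi := Real.pi_pos
  rw [area, twoDisks, (union_ball_perimeter (h2.trans_le hle) h2 hD).2,
    ENNReal.toReal_ofReal (by positivity)]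

lemma per_twoDisks (h2 : 0 < r₂) (hle : r₂ ≤ r₁) (hD : r₁ + r₂ ≤ D) :
    per (twoDisks r₁ r₂ D) = 2 * (Real.pi * (r₁ + r₂)) := by
  have hpi := Real.pi_pos
  rw [per, twoDisks_perimeter h2 hle hD, ENNReal.toReal_ofReal]
  have := mul_pos hpi (by linarith : 0 < r₁ + r₂)
  linarith

lemma per_ball {r c : ℝ} (hr : 0 < r) : per (Metric.ball (pt c 0) r) = 2 * (Real.pi * r) := by
  have hpi := Real.pi_pos
  rw [per, (ball_pt_perimeter hr).1, ENNReal.toReal_ofReal (by positivity)]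

lemma area_ball {r c : ℝ} (hr : 0 < r) : area (Metric.ball (pt c 0) r) = Real.pi * r ^ 2 := by
  have hpi := Real.pi_pos
  rw [area, (ball_pt_perimeter hr).2, ENNReal.toReal_ofReal (by positivity)]

lemma per_convexHull (h2 : 0 < r₂) (hle : r₂ ≤ r₁) (hD : r₁ + r₂ ≤ D) :
    per (convexHull ℝ (twoDisks r₁ r₂ D)) = hullPer r₁ r₂ D := by
  rw [per, convexHull_twoDisks_perimeter h2 hle hD,
    ENNReal.toReal_ofReal (hullPer_pos h2 hle hD).le]

lemma convexHull_finite (h2 : 0 < r₂) (hle : r₂ ≤ r₁) (hD : r₁ + r₂ ≤ D) :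
    perimeter (convexHull ℝ (twoDisks r₁ r₂ D)) ≠ ⊤ ∧
      volume (convexHull ℝ (twoDisks r₁ r₂ D)) ≠ ⊤ := by
  have h := hullData_twoDisks h2 hle hD
  rw [convexHull_twoDisks_perimeter h2 hle hD, twoDisks, h.convexHull_eq]
  exact ⟨ENNReal.ofReal_ne_top, h.profile_perimeter.2.ne⟩

lemma energy_twoDisks (h2 : 0 < r₂) (hle : r₂ ≤ r₁) (hD : r₁ + r₂ ≤ D) (s l : ℝ) :
    energy (twoDisks r₁ r₂ D) s l (twoDisks r₁ r₂ D)
      = ((2 * (Real.pi * (r₁ + r₂)) - (1 - s) / l * (Real.pi * (r₁ ^ 2 + r₂ ^ 2)) : ℝ) : EReal) := by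
  rw [energy_eq_coe, inter_self, sdiff_self, per_twoDisks h2 hle hD, area_twoDisks h2 hle hD]
  · simp [area]
  · rw [twoDisks_perimeter h2 hle hD]
    exact ENNReal.ofReal_ne_top
  · rw [twoDisks, (union_ball_perimeter (h2.trans_le hle) h2 hD).2]
    exact ENNReal.ofReal_ne_top

lemma energy_left (h2 : 0 < r₂) (hle : r₂ ≤ r₁) (s l : ℝ) :
    energy (twoDisks r₁ r₂ D) s l (Metric.ball (pt 0 0) r₁)
      = ((2 * (Real.pi * r₁) - (1 - s) / l * (Real.pi * r₁ ^ 2) : ℝ) : EReal) := by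
  have h1 : 0 < r₁ := h2.trans_le hle
  have hsub : Metric.ball (pt 0 0) r₁ ⊆ twoDisks r₁ r₂ D := subset_union_left
  rw [energy_eq_coe, inter_eq_left.2 hsub, Set.sdiff_eq_empty.2 hsub, per_ball h1, area_ball h1]
  · simp [area]
  · rw [(ball_pt_perimeter h1).1]
    exact ENNReal.ofReal_ne_top
  · rw [(ball_pt_perimeter h1).2]
    exact ENNReal.ofReal_ne_top

/-- The closing contains both disks, so the term for the inner area is the same as for the two
disks. What remains is the closing functional at `l / s`, or the perimeter of the hull when `s = 0`
and the outer area has no weight. -/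
lemma energy_closingQuot (h2 : 0 < r₂) (hle : r₂ ≤ r₁) (hD : r₁ + r₂ ≤ D) {s l : ℝ} (hl : 0 < l)
    (hs : 0 ≤ s) : ∃ V : ℝ, energy (twoDisks r₁ r₂ D) s l (closingQuot l s (twoDisks r₁ r₂ D))
      = ((V - (1 - s) / l * (Real.pi * (r₁ ^ 2 + r₂ ^ 2)) : ℝ) : EReal) ∧ 0 ≤ V ∧
      (s = 0 → V = hullPer r₁ r₂ D) ∧
      (0 < s → closingEnergy (twoDisks r₁ r₂ D) (l / s) = ENNReal.ofReal V) := by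
  have hA := area_twoDisks h2 hle hD
  rcases eq_or_lt_of_le hs with h0 | h0
  · refine ⟨hullPer r₁ r₂ D, ?_, (hullPer_pos h2 hle hD).le, fun _ => rfl,
      fun h => absurd h (by rw [← h0]; exact lt_irrefl _)⟩
    have hfin := convexHull_finite h2 hle hD
    rw [closingQuot, if_pos h0.symm, energy_eq_coe hfin.1 hfin.2, ← h0, per_convexHull h2 hle hD,
      inter_eq_right.2 (subset_convexHull ℝ _), hA]
    simp
  · have hr : 0 < l / s := div_pos hl h0
    have hfin := closing_finite h2 hle hD hr
    have hV0 : 0 ≤ per (closing (l / s) (twoDisks r₁ r₂ D)) + s / l *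
      area (closing (l / s) (twoDisks r₁ r₂ D) \ twoDisks r₁ r₂ D) :=
      add_nonneg ENNReal.toReal_nonneg (mul_nonneg (by positivity) ENNReal.toReal_nonneg)
    refine ⟨_, ?_, hV0, fun h => absurd h h0.ne', fun _ => ?_⟩
    · rw [closingQuot, if_neg h0.ne', energy_eq_coe hfin.1 hfin.2,
        inter_eq_right.2 (twoDisks_subset_closing hr), hA]
    · have h1 : volume (closing (l / s) (twoDisks r₁ r₂ D) \ twoDisks r₁ r₂ D) ≠ ⊤ :=
        measure_ne_top_of_subset sdiff_subset hfin.2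
      rw [per, area, ENNReal.ofReal_add ENNReal.toReal_nonneg
        (mul_nonneg (by positivity) ENNReal.toReal_nonneg), closingEnergy,
        ENNReal.ofReal_toReal hfin.1, ENNReal.ofReal_mul (by positivity),
        ENNReal.ofReal_toReal h1, ENNReal.div_eq_inv_mul, ← ENNReal.ofReal_inv_of_pos hr, inv_div]

/-- The line `s = 1 - l P / A` in terms of the radius `l / s`. -/
lemma threshold_facts {R P A : ℝ} (hR : 0 ≤ R) (hP : 0 < P) (hA : 0 < A) :
    0 ≤ R * A / (R * P + A) ∧ R * A / (R * P + A) < A / P ∧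
    0 < 1 - R * A / (R * P + A) * (P / A) ∧
    (∀ l : ℝ, 1 - l * (P / A) ≠ 0 → (l / (1 - l * (P / A)) = R ↔ l = R * A / (R * P + A))) ∧
    (R * A / (R * P + A) = 0 ↔ R = 0) ∧
    ∀ l s : ℝ, 0 < l → 0 ≤ s → s = 1 - l * (P / A) →
      (l < R * A / (R * P + A) → 0 < s ∧ l / s < R) ∧
      (l = R * A / (R * P + A) → 0 < s ∧ l / s = R) ∧
      (R * A / (R * P + A) < l → s = 0 ∨ 0 < s ∧ R < l / s) := by
  have hden : 0 < R * P + A := by positivity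
  have hlt : R * A / (R * P + A) < A / P := by
    rw [div_lt_div_iff₀ hden hP]
    have := mul_pos hA hA
    linarith
  have hone : 0 < 1 - R * A / (R * P + A) * (P / A) := by
    have : 1 - R * A / (R * P + A) * (P / A) = A / (R * P + A) := by field_simp; ring
    rw [this]
    positivity
  have hk : 0 < P / A := div_pos hP hA
  refine ⟨by positivity, hlt, hone, fun l hl => ?_, ?_, fun l s hl hs hsl => ⟨fun h => ?_,
    fun h => ?_, fun h => ?_⟩⟩
  · rw [div_eq_iff hl, eq_div_iff hden.ne']
    constructor
    · intro h
      have h3 : l * A = R * (A - l * P) := by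
        have e : (1 - l * (P / A)) * A = A - l * P := by field_simp
        rw [← e, ← mul_assoc, ← h]
      linarith
    · intro h
      field_simp
      linarith
  · constructor
    · intro h
      rcases div_eq_zero_iff.1 h with h | h
      · exact (mul_eq_zero.1 h).resolve_right hA.ne'
      · exact absurd h hden.ne'
    · rintro rfl
      simp
  · have hs0 : 0 < s := by
      have := mul_lt_mul_of_pos_right h hk
      linarith
    refine ⟨hs0, ?_⟩
    rw [div_lt_iff₀ hs0, hsl]
    rw [lt_div_iff₀ hden] at h
    have : R * (1 - l * (P / A)) = (R * A - R * l * P) / A := by field_simp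
    rw [this, lt_div_iff₀ hA]
    linarith
  · have hs0 : 0 < s := by rw [hsl, h]; exact hone
    refine ⟨hs0, ?_⟩
    rw [div_eq_iff hs0.ne', hsl]
    rw [eq_div_iff hden.ne'] at h
    field_simp
    linarith
  · rcases eq_or_lt_of_le hs with h0 | h0
    · exact Or.inl h0.symm
    · refine Or.inr ⟨h0, ?_⟩
      rw [lt_div_iff₀ h0, hsl]
      rw [div_lt_iff₀ hden] at h
      have : R * (1 - l * (P / A)) = (R * A - R * l * P) / A := by field_simp
      rw [this, div_lt_iff₀ hA]
      linarith

end Energy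

/-! ### Tangents of the first disk that cut the second disk -/

section Hit

/-- The signed distance from the center of the second disk to the tangent of the first disk with
normal direction `(sin θ, cos θ)`. -/
noncomputable def offs (r₁ D θ : ℝ) : ℝ := r₁ - D * Real.sin θ

/-- Half the length of the chord that the tangent cuts out of the second disk. -/
noncomputable def halfChord (r₁ r₂ D θ : ℝ) : ℝ := Real.sqrt (r₂ ^ 2 - offs r₁ D θ ^ 2)

/-- The radius of the disk centered on the axis that touches the tangent at the point where it
enters the second disk. -/
noncomputable def hitRad (r₁ r₂ D θ : ℝ) : ℝ :=
  offs r₁ D θ + Real.sin θ / Real.cos θ * halfChord r₁ r₂ D θ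

/-- The angle of the arc of the second disk to the left of the entrance point. -/
noncomputable def hitAngle (r₁ r₂ D θ : ℝ) : ℝ := θ + Real.arcsin (offs r₁ D θ / r₂)

/-- The excess of the perimeter of the hull over the perimeter of the first disk. -/
noncomputable def hitPer (r₁ r₂ D θ : ℝ) : ℝ :=
  2 * (r₁ - hitRad r₁ r₂ D θ) * (Real.cos θ / Real.sin θ - (Real.pi / 2 - θ))

/-- The area of the part of the hull in the second disk. -/
noncomputable def hitArea (r₁ r₂ D θ : ℝ) : ℝ :=
  hitRad r₁ r₂ D θ ^ 2 * (Real.pi / 2 - θ - Real.sin θ * Real.cos θ)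
    + r₂ ^ 2 * (hitAngle r₁ r₂ D θ - Real.sin (hitAngle r₁ r₂ D θ) * Real.cos (hitAngle r₁ r₂ D θ))

/-- Dividing by `sin θ` gives the abscissa of the centre of the inscribed touching disk, namely `D -
halfChord / cos θ`. -/
lemma sub_hitRad (r₁ r₂ D θ : ℝ) : r₁ - hitRad r₁ r₂ D θ
    = Real.sin θ * (D - halfChord r₁ r₂ D θ / Real.cos θ) := by
  rw [hitRad, offs]
  ring

lemma hasDerivAt_offs (r₁ D θ : ℝ) : HasDerivAt (offs r₁ D) (-(D * Real.cos θ)) θ :=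
  ((Real.hasDerivAt_sin θ).const_mul D).const_sub r₁

/-- The admissible angles. -/
structure HitData (r₁ r₂ D θ : ℝ) : Prop where
  r₂_pos : 0 < r₂
  lt : r₂ < r₁
  sep : r₁ + r₂ ≤ D
  mem : θ ∈ Ioo (0 : ℝ) (Real.pi / 2)
  lower : r₁ - r₂ < D * Real.sin θ
  upper : (D - r₂) * Real.sin θ < r₁

namespace HitData

variable {r₁ r₂ D θ : ℝ} (H : HitData r₁ r₂ D θ)
include H

lemma sin_pos : 0 < Real.sin θ :=
  Real.sin_pos_of_pos_of_lt_pi H.mem.1 (by linarith [H.mem.2, Real.pi_pos])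

lemma cos_pos : 0 < Real.cos θ := Real.cos_pos_of_mem_Ioo ⟨by linarith [H.mem.1, Real.pi_pos], H.mem.2⟩

lemma sin_lt_one : Real.sin θ < 1 := by
  nlinarith [Real.sin_sq_add_cos_sq θ, H.cos_pos, H.sin_pos]

lemma r₁_pos : 0 < r₁ := H.r₂_pos.trans H.lt

lemma D_pos : 0 < D := by linarith [H.r₁_pos, H.r₂_pos, H.sep]

/-- The condition `lower` says that the tangent cuts the second disk, and `upper` that the leftmost
point of that disk lies on the inner side of the tangent. -/
lemma offs_lt : offs r₁ D θ < r₂ := by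
  rw [offs]
  linarith [H.lower]

lemma lt_offs : -r₂ < offs r₁ D θ := by
  have := H.upper
  have h1 := mul_lt_mul_of_pos_left H.sin_lt_one H.r₂_pos
  rw [offs]
  linarith

lemma radicand_pos : 0 < r₂ ^ 2 - offs r₁ D θ ^ 2 := by
  have := mul_pos (sub_pos.2 H.offs_lt) (sub_pos.2 H.lt_offs)
  linarith

lemma halfChord_pos : 0 < halfChord r₁ r₂ D θ := Real.sqrt_pos.2 H.radicand_pos

lemma halfChord_sq : halfChord r₁ r₂ D θ ^ 2 = r₂ ^ 2 - offs r₁ D θ ^ 2 :=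
  Real.sq_sqrt H.radicand_pos.le

/-- This is what places the centre of the touching disk to the right of the first centre. After
squaring it reads `r₂² - r₁² + 2 r₁ D sin θ < D²`, which follows from `sin θ < 1` and `r₂ ≤ D - r₁`.
-/
lemma halfChord_lt : halfChord r₁ r₂ D θ < D * Real.cos θ := by
  have h1 := mul_pos H.D_pos H.cos_pos
  refine lt_of_pow_lt_pow_left₀ 2 h1.le ?_
  rw [H.halfChord_sq, offs]
  have h2 := mul_lt_mul_of_pos_left H.sin_lt_one (mul_pos H.r₁_pos H.D_pos)
  have h3 : r₂ ^ 2 ≤ (D - r₁) ^ 2 := pow_le_pow_left₀ H.r₂_pos.le (by linarith [H.sep]) 2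
  have h4 := Real.sin_sq_add_cos_sq θ
  have h5 : (D * Real.cos θ) ^ 2 = D ^ 2 - D ^ 2 * Real.sin θ ^ 2 := by
    linear_combination D ^ 2 * h4
  rw [h5]
  linarith

lemma hitRad_lt : hitRad r₁ r₂ D θ < r₁ := by
  have h1 : halfChord r₁ r₂ D θ / Real.cos θ < D := by
    rw [div_lt_iff₀ H.cos_pos]
    exact H.halfChord_lt
  have := mul_pos H.sin_pos (sub_pos.2 h1)
  rw [← sub_hitRad] at this
  linarith

lemma hitRad_mul_cos : hitRad r₁ r₂ D θ * Real.cos θ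
    = offs r₁ D θ * Real.cos θ + Real.sin θ * halfChord r₁ r₂ D θ := by
  have := H.cos_pos
  rw [hitRad]
  field_simp

lemma hitRad_pos : 0 < hitRad r₁ r₂ D θ := by
  have hc := H.cos_pos
  have hs := H.sin_pos
  have hw := H.halfChord_pos
  have key : 0 < offs r₁ D θ * Real.cos θ + Real.sin θ * halfChord r₁ r₂ D θ := by
    rcases le_or_gt 0 (offs r₁ D θ) with h | h
    · have := mul_nonneg h hc.le
      have := mul_pos hs hw
      linarith
    · have hlt : -offs r₁ D θ < r₂ * Real.sin θ := by
        rw [offs]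
        linarith [H.upper]
      have h2 : (-offs r₁ D θ * Real.cos θ) ^ 2 < (Real.sin θ * halfChord r₁ r₂ D θ) ^ 2 := by
        rw [mul_pow, mul_pow, H.halfChord_sq]
        have h3 := pow_lt_pow_left₀ hlt (by linarith) two_ne_zero
        have h4 := Real.sin_sq_add_cos_sq θ
        have h5 : Real.cos θ ^ 2 = 1 - Real.sin θ ^ 2 := by linarith
        rw [h5]
        rw [mul_pow] at h3
        linarith
      have h6 := lt_of_pow_lt_pow_left₀ 2 (by positivity) h2
      linarith
  rw [← H.hitRad_mul_cos] at key
  exact pos_of_mul_pos_left key hc.le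

lemma cos_arcsin_offs : Real.cos (Real.arcsin (offs r₁ D θ / r₂)) = halfChord r₁ r₂ D θ / r₂ := by
  have h2 := H.r₂_pos
  have hw := H.halfChord_pos
  rw [Real.cos_arcsin, show 1 - (offs r₁ D θ / r₂) ^ 2 = (halfChord r₁ r₂ D θ / r₂) ^ 2 by
    rw [div_pow, div_pow, H.halfChord_sq]; field_simp]
  exact Real.sqrt_sq (by positivity)

lemma sin_arcsin_offs : Real.sin (Real.arcsin (offs r₁ D θ / r₂)) = offs r₁ D θ / r₂ := by
  have h2 := H.r₂_pos
  refine Real.sin_arcsin ?_ ?_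
  · rw [le_div_iff₀ h2]
    linarith [H.lt_offs]
  · rw [div_le_one h2]
    exact H.offs_lt.le

/-- Both sides are the ordinate of the point where the tangent enters the second disk, computed from
the centre of that disk and from the centre of the touching disk. -/
lemma sin_hitAngle : r₂ * Real.sin (hitAngle r₁ r₂ D θ) = hitRad r₁ r₂ D θ * Real.cos θ := by
  have h2 := H.r₂_pos
  rw [hitAngle, Real.sin_add, H.cos_arcsin_offs, H.sin_arcsin_offs, H.hitRad_mul_cos]
  field_simp
  ring

lemma cos_hitAngle : r₂ * Real.cos (hitAngle r₁ r₂ D θ)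
    = halfChord r₁ r₂ D θ * Real.cos θ - offs r₁ D θ * Real.sin θ := by
  have h2 := H.r₂_pos
  rw [hitAngle, Real.cos_add, H.cos_arcsin_offs, H.sin_arcsin_offs]
  field_simp

lemma hitAngle_mem : hitAngle r₁ r₂ D θ ∈ Ioo 0 Real.pi := by
  have h1 := Real.arcsin_le_pi_div_two (offs r₁ D θ / r₂)
  have h2 := Real.neg_pi_div_two_le_arcsin (offs r₁ D θ / r₂)
  have hm := H.mem
  have hpos : 0 < Real.sin (hitAngle r₁ r₂ D θ) := by
    have := mul_pos H.hitRad_pos H.cos_pos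
    rw [← H.sin_hitAngle] at this
    exact pos_of_mul_pos_right this H.r₂_pos.le
  have hlt : hitAngle r₁ r₂ D θ < Real.pi := by rw [hitAngle]; linarith [hm.2]
  refine ⟨?_, hlt⟩
  by_contra hcon
  have := Real.sin_nonpos_of_nonpos_of_neg_pi_le (not_lt.1 hcon) (by
    rw [hitAngle]; linarith [hm.1, Real.pi_pos])
  linarith

lemma cot_gt : Real.pi / 2 - θ < Real.cos θ / Real.sin θ := by
  have h := Real.lt_tan (x := Real.pi / 2 - θ) (by linarith [H.mem.2]) (by linarith [H.mem.1])
  rwa [Real.tan_eq_sin_div_cos, Real.sin_pi_div_two_sub, Real.cos_pi_div_two_sub] at h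

lemma hitPer_pos : 0 < hitPer r₁ r₂ D θ := by
  have h1 := sub_pos.2 H.hitRad_lt
  have h2 := sub_pos.2 H.cot_gt
  rw [hitPer]
  positivity

lemma hasDerivAt_halfChord : HasDerivAt (halfChord r₁ r₂ D)
    (offs r₁ D θ * (D * Real.cos θ) / halfChord r₁ r₂ D θ) θ := by
  have h := (((hasDerivAt_offs r₁ D θ).pow 2).const_sub (r₂ ^ 2)).sqrt H.radicand_pos.ne'
  refine (h : HasDerivAt (halfChord r₁ r₂ D) _ θ).congr_deriv ?_
  have e : Real.sqrt (r₂ ^ 2 - (offs r₁ D ^ 2) θ) = halfChord r₁ r₂ D θ := rfl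
  have hw := H.halfChord_pos
  rw [e]
  field_simp
  simp
  ring

/-- The derivative of the touching radius. -/
noncomputable def _root_.hitRadDeriv (r₁ r₂ D θ : ℝ) : ℝ :=
  -(D * Real.cos θ) + halfChord r₁ r₂ D θ / Real.cos θ ^ 2
    + Real.sin θ * offs r₁ D θ * D / halfChord r₁ r₂ D θ

lemma hasDerivAt_hitRad : HasDerivAt (hitRad r₁ r₂ D) (hitRadDeriv r₁ r₂ D θ) θ := by
  have hw := H.halfChord_pos
  have hc := H.cos_pos
  have h := (hasDerivAt_offs r₁ D θ).add ((((Real.hasDerivAt_sin θ).div (Real.hasDerivAt_cos θ)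
    H.cos_pos.ne')).mul H.hasDerivAt_halfChord)
  refine (h : HasDerivAt (hitRad r₁ r₂ D) _ θ).congr_deriv ?_
  rw [hitRadDeriv]
  simp only [Pi.div_apply]
  field_simp
  linear_combination (halfChord r₁ r₂ D θ ^ 2) * Real.sin_sq_add_cos_sq θ

/-- In this form the derivative appears next to `r₁ - hitRad`, the factor of the excess perimeter.
This is what relates the derivative of the area to that of the perimeter and shows its sign. -/
lemma hitRadDeriv_identity : hitRadDeriv r₁ r₂ D θ * (Real.sin θ * Real.cos θ)
    = hitRad r₁ r₂ D θ * Real.sin θ ^ 2 * D * Real.cos θ / halfChord r₁ r₂ D θ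
      - (r₁ - hitRad r₁ r₂ D θ) := by
  have hw := H.halfChord_pos
  have hc := H.cos_pos
  have h4 := Real.sin_sq_add_cos_sq θ
  have h5 : r₁ - hitRad r₁ r₂ D θ = D * Real.sin θ
      - Real.sin θ / Real.cos θ * halfChord r₁ r₂ D θ := by
    rw [hitRad, offs]
    ring
  rw [h5, hitRadDeriv, hitRad]
  field_simp
  linear_combination (-(Real.sin θ * D * Real.cos θ * halfChord r₁ r₂ D θ)) * h4

lemma hasDerivAt_hitAngle : HasDerivAt (hitAngle r₁ r₂ D)
    (1 - D * Real.cos θ / halfChord r₁ r₂ D θ) θ := by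
  have h2 := H.r₂_pos
  have hw := H.halfChord_pos
  have n1 : offs r₁ D θ / r₂ ≠ -1 := by
    rw [Ne, div_eq_iff h2.ne']
    linarith [H.lt_offs]
  have n2 : offs r₁ D θ / r₂ ≠ 1 := by
    rw [Ne, div_eq_iff h2.ne']
    linarith [H.offs_lt]
  have e : Real.sqrt (1 - (offs r₁ D θ / r₂) ^ 2) = halfChord r₁ r₂ D θ / r₂ := by
    rw [← Real.cos_arcsin, H.cos_arcsin_offs]
  have h := (hasDerivAt_id θ).add
    ((Real.hasDerivAt_arcsin n1 n2).comp θ ((hasDerivAt_offs r₁ D θ).div_const r₂))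
  refine (h : HasDerivAt (hitAngle r₁ r₂ D) _ θ).congr_deriv ?_
  rw [e]
  field_simp
  ring

/-- The derivative of the area. -/
noncomputable def _root_.hitAreaDeriv (r₁ r₂ D θ : ℝ) : ℝ :=
  2 * hitRad r₁ r₂ D θ * hitRadDeriv r₁ r₂ D θ * (Real.pi / 2 - θ - Real.sin θ * Real.cos θ)
    - 2 * (hitRad r₁ r₂ D θ * Real.cos θ) ^ 2 * (D * Real.cos θ / halfChord r₁ r₂ D θ)

lemma hasDerivAt_hitArea : HasDerivAt (hitArea r₁ r₂ D) (hitAreaDeriv r₁ r₂ D θ) θ := by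
  have hd := H.hasDerivAt_hitAngle
  have d1 := ((hasDerivAt_id θ).const_sub (Real.pi / 2)).sub
    ((Real.hasDerivAt_sin θ).mul (Real.hasDerivAt_cos θ))
  have d2 := hd.sub (hd.sin.mul hd.cos)
  have h := ((H.hasDerivAt_hitRad.pow 2).mul d1).add (d2.const_mul (r₂ ^ 2))
  refine (h : HasDerivAt (hitArea r₁ r₂ D) _ θ).congr_deriv ?_
  have hy := H.sin_hitAngle
  have h4 := Real.sin_sq_add_cos_sq θ
  have h5 := Real.sin_sq_add_cos_sq (hitAngle r₁ r₂ D θ)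
  rw [hitAreaDeriv]
  simp only [Pi.sub_apply, Pi.mul_apply, Pi.pow_apply, id]
  have e3 : r₂ ^ 2 * Real.sin (hitAngle r₁ r₂ D θ) ^ 2 = (hitRad r₁ r₂ D θ * Real.cos θ) ^ 2 := by
    rw [← hy]
    ring
  obtain ⟨κ, hκ⟩ : ∃ κ, κ = D * Real.cos θ / halfChord r₁ r₂ D θ := ⟨_, rfl⟩
  rw [← hκ]
  push_cast
  linear_combination (2 * (1 - κ)) * e3 + hitRad r₁ r₂ D θ ^ 2 * h4 + r₂ ^ 2 * (κ - 1) * h5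

lemma hasDerivAt_hitPer : HasDerivAt (hitPer r₁ r₂ D)
    (-2 * (hitRadDeriv r₁ r₂ D θ * (Real.cos θ / Real.sin θ - (Real.pi / 2 - θ))
      + (r₁ - hitRad r₁ r₂ D θ) * (Real.cos θ ^ 2 / Real.sin θ ^ 2))) θ := by
  have hs := H.sin_pos
  have d1 := ((Real.hasDerivAt_cos θ).div (Real.hasDerivAt_sin θ) hs.ne').sub
    ((hasDerivAt_id θ).const_sub (Real.pi / 2))
  have h := ((H.hasDerivAt_hitRad.const_sub r₁).const_mul 2).mul d1
  refine (h : HasDerivAt (hitPer r₁ r₂ D) _ θ).congr_deriv ?_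
  simp only [Pi.sub_apply, Pi.div_apply, id]
  field_simp
  ring

/-- The derivative of the area is `hitRad` times the derivative of the perimeter: the tip of the
hull is an arc of radius `hitRad`, so the hull is stationary for the perimeter minus the area in the
second disk divided by that radius. -/
lemma hitAreaDeriv_eq : hitAreaDeriv r₁ r₂ D θ = hitRad r₁ r₂ D θ
    * (-2 * (hitRadDeriv r₁ r₂ D θ * (Real.cos θ / Real.sin θ - (Real.pi / 2 - θ))
      + (r₁ - hitRad r₁ r₂ D θ) * (Real.cos θ ^ 2 / Real.sin θ ^ 2))) := by
  have hw := H.halfChord_pos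
  have hc := H.cos_pos
  have hs := H.sin_pos
  have hid := H.hitRadDeriv_identity
  have h4 := Real.sin_sq_add_cos_sq θ
  have e : r₁ - hitRad r₁ r₂ D θ = hitRad r₁ r₂ D θ * Real.sin θ ^ 2
      * (D * Real.cos θ / halfChord r₁ r₂ D θ)
      - hitRadDeriv r₁ r₂ D θ * (Real.sin θ * Real.cos θ) := by
    rw [hid]
    ring
  rw [e, hitAreaDeriv]
  obtain ⟨κ, hκ⟩ : ∃ κ, κ = D * Real.cos θ / halfChord r₁ r₂ D θ := ⟨_, rfl⟩
  rw [← hκ]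
  field_simp
  linear_combination (-2 * hitRad r₁ r₂ D θ * Real.cos θ * hitRadDeriv r₁ r₂ D θ) * h4

/-- Multiplying by `sin θ cos θ` and eliminating the derivative of the radius leaves two negative
terms: one because `(π/2 - θ) sin θ < cos θ`, the other because `hitRad < r₁` and `sin θ cos θ < π/2
- θ`. -/
lemma hitAreaDeriv_neg : hitAreaDeriv r₁ r₂ D θ < 0 := by
  have hw := H.halfChord_pos
  have hc := H.cos_pos
  have hs := H.sin_pos
  have hl := H.hitRad_pos
  have hD := H.D_pos
  have hid := H.hitRadDeriv_identity
  have h4 := Real.sin_sq_add_cos_sq θ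
  have h5 : Real.sin θ * Real.cos θ < Real.pi / 2 - θ := by
    have h := Real.sin_lt (x := Real.pi / 2 - θ) (by linarith [H.mem.2])
    rw [Real.sin_pi_div_two_sub] at h
    have := mul_lt_mul_of_pos_right H.sin_lt_one hc
    linarith
  have h6 : (Real.pi / 2 - θ) * Real.sin θ < Real.cos θ := by
    have h := H.cot_gt
    rwa [lt_div_iff₀ hs] at h
  have e : hitAreaDeriv r₁ r₂ D θ * (Real.sin θ * Real.cos θ)
      = 2 * hitRad r₁ r₂ D θ ^ 2 * (D * Real.sin θ * Real.cos θ / halfChord r₁ r₂ D θ)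
        * ((Real.pi / 2 - θ) * Real.sin θ - Real.cos θ)
        - 2 * hitRad r₁ r₂ D θ * (r₁ - hitRad r₁ r₂ D θ)
          * (Real.pi / 2 - θ - Real.sin θ * Real.cos θ) := by
    have : hitAreaDeriv r₁ r₂ D θ * (Real.sin θ * Real.cos θ)
        = 2 * hitRad r₁ r₂ D θ * (hitRadDeriv r₁ r₂ D θ * (Real.sin θ * Real.cos θ))
          * (Real.pi / 2 - θ - Real.sin θ * Real.cos θ)
          - 2 * (hitRad r₁ r₂ D θ * Real.cos θ) ^ 2 * (D * Real.cos θ / halfChord r₁ r₂ D θ)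
            * (Real.sin θ * Real.cos θ) := by
      rw [hitAreaDeriv]
      ring
    rw [this, hid]
    field_simp
    linear_combination (-2 * hitRad r₁ r₂ D θ * Real.sin θ * D * Real.cos θ ^ 2) * h4
  have p1 : 0 < 2 * hitRad r₁ r₂ D θ ^ 2
      * (D * Real.sin θ * Real.cos θ / halfChord r₁ r₂ D θ) := by positivity
  have p2 := mul_neg_of_pos_of_neg p1 (sub_neg.2 h6)
  have p3 : 0 < 2 * hitRad r₁ r₂ D θ * (r₁ - hitRad r₁ r₂ D θ)
      * (Real.pi / 2 - θ - Real.sin θ * Real.cos θ) :=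
    mul_pos (mul_pos (by linarith) (sub_pos.2 H.hitRad_lt)) (sub_pos.2 h5)
  have p4 : hitAreaDeriv r₁ r₂ D θ * (Real.sin θ * Real.cos θ) < 0 := by
    rw [e]
    linarith
  exact neg_of_mul_neg_left p4 (by positivity)

end HitData

end Hit

/-! ### Monotonicity of the touching radius up to a record -/

section HitMonotone

/-- The angle of the outer common tangents. -/
noncomputable def angleStart (r₁ r₂ D : ℝ) : ℝ := Real.arcsin ((r₁ - r₂) / D)

/-- The angle at which the tangents of the first disk leave the second disk. -/
noncomputable def angleEnd (r₁ r₂ D : ℝ) : ℝ := Real.arcsin (r₁ / (D - r₂))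

/-- The difference of the energies of the hull and of the first disk, times the radius. -/
noncomputable def hitEnergy (r₁ r₂ D θ : ℝ) : ℝ :=
  hitRad r₁ r₂ D θ * hitPer r₁ r₂ D θ - hitArea r₁ r₂ D θ

variable {r₁ r₂ D : ℝ}

lemma sin_angleStart (h2 : 0 < r₂) (hlt : r₂ < r₁) (hD : r₁ + r₂ ≤ D) :
    D * Real.sin (angleStart r₁ r₂ D) = r₁ - r₂ := by
  have hD0 : 0 < D := by linarith
  rw [angleStart, Real.sin_arcsin]
  · field_simp
  · rw [le_div_iff₀ hD0]; linarith
  · rw [div_le_one hD0]; linarith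

lemma sin_angleEnd (h2 : 0 < r₂) (hlt : r₂ < r₁) (hD : r₁ + r₂ ≤ D) :
    (D - r₂) * Real.sin (angleEnd r₁ r₂ D) = r₁ := by
  have hD0 : 0 < D - r₂ := by linarith
  rw [angleEnd, Real.sin_arcsin]
  · field_simp
  · rw [le_div_iff₀ hD0]; linarith
  · rw [div_le_one hD0]; linarith

lemma angle_bounds (h2 : 0 < r₂) (hlt : r₂ < r₁) (hD : r₁ + r₂ ≤ D) :
    0 < angleStart r₁ r₂ D ∧ angleStart r₁ r₂ D < angleEnd r₁ r₂ D ∧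
      angleEnd r₁ r₂ D ≤ Real.pi / 2 := by
  have hD0 : 0 < D := by linarith
  have hD1 : 0 < D - r₂ := by linarith
  refine ⟨Real.arcsin_pos.2 (div_pos (by linarith) hD0), ?_, Real.arcsin_le_pi_div_two _⟩
  refine Real.arcsin_lt_arcsin ?_ ?_ ?_
  · have := div_pos (by linarith : 0 < r₁ - r₂) hD0
    linarith
  · rw [div_lt_div_iff₀ hD0 hD1]
    nlinarith
  · rw [div_le_one hD1]; linarith

lemma angleEnd_lt (h2 : 0 < r₂) (hlt : r₂ < r₁) (hD : r₁ + r₂ < D) :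
    angleEnd r₁ r₂ D < Real.pi / 2 := by
  refine Real.arcsin_lt_pi_div_two.2 ?_
  rw [div_lt_one (by linarith)]
  linarith

lemma angleEnd_of_tangent (h2 : 0 < r₂) (hlt : r₂ < r₁) :
    angleEnd r₁ r₂ (r₁ + r₂) = Real.pi / 2 := by
  rw [angleEnd, add_sub_cancel_right, div_self (h2.trans hlt).ne', Real.arcsin_one]

lemma hitData_of_mem (h2 : 0 < r₂) (hlt : r₂ < r₁) (hD : r₁ + r₂ ≤ D) {θ : ℝ}
    (hθ : θ ∈ Ioo (angleStart r₁ r₂ D) (angleEnd r₁ r₂ D)) : HitData r₁ r₂ D θ := by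
  obtain ⟨b1, b2, b3⟩ := angle_bounds h2 hlt hD
  have hD0 : 0 < D := by linarith
  have hs := sin_angleStart h2 hlt hD
  have he := sin_angleEnd h2 hlt hD
  have m1 : Real.sin (angleStart r₁ r₂ D) < Real.sin θ :=
    Real.sin_lt_sin_of_lt_of_le_pi_div_two (by linarith [Real.pi_pos]) (by linarith [hθ.2]) hθ.1
  have m2 : Real.sin θ < Real.sin (angleEnd r₁ r₂ D) :=
    Real.sin_lt_sin_of_lt_of_le_pi_div_two (by linarith [Real.pi_pos, hθ.1]) b3 hθ.2
  refine ⟨h2, hlt, hD, ⟨by linarith [hθ.1], by linarith [hθ.2]⟩, ?_, ?_⟩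
  · rw [← hs]
    exact mul_lt_mul_of_pos_left m1 hD0
  · conv_rhs => rw [← he]
    exact mul_lt_mul_of_pos_left m2 (by linarith)

lemma offs_angleStart (h2 : 0 < r₂) (hlt : r₂ < r₁) (hD : r₁ + r₂ ≤ D) :
    offs r₁ D (angleStart r₁ r₂ D) = r₂ := by
  rw [offs, sin_angleStart h2 hlt hD]
  ring

lemma hitRad_angleStart (h2 : 0 < r₂) (hlt : r₂ < r₁) (hD : r₁ + r₂ ≤ D) :
    hitRad r₁ r₂ D (angleStart r₁ r₂ D) = r₂ := by
  rw [hitRad, halfChord, offs_angleStart h2 hlt hD, sub_self, Real.sqrt_zero, mul_zero, add_zero]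

lemma hitPer_angleStart (h2 : 0 < r₂) (hlt : r₂ < r₁) (hD : r₁ + r₂ ≤ D) :
    hitPer r₁ r₂ D (angleStart r₁ r₂ D) = hullPer r₁ r₂ D - 2 * (Real.pi * r₁) := by
  have hs := sin_angleStart h2 hlt hD
  have hD0 : 0 < D := by linarith
  have hcos : Real.cos (angleStart r₁ r₂ D) = Real.sqrt (1 - ((r₁ - r₂) / D) ^ 2) :=
    Real.cos_arcsin _
  have hsin : Real.sin (angleStart r₁ r₂ D) = (r₁ - r₂) / D := by
    rw [← hs]; field_simp
  have hne : r₁ - r₂ ≠ 0 := by linarith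
  rw [hitPer, hitRad_angleStart h2 hlt hD, hullPer, ← hcos, hsin]
  have : Real.arcsin ((r₁ - r₂) / D) = angleStart r₁ r₂ D := rfl
  rw [this]
  field_simp
  ring

lemma hitArea_angleStart (h2 : 0 < r₂) (hlt : r₂ < r₁) (hD : r₁ + r₂ ≤ D) :
    hitArea r₁ r₂ D (angleStart r₁ r₂ D) = Real.pi * r₂ ^ 2 := by
  have hb : hitAngle r₁ r₂ D (angleStart r₁ r₂ D) = angleStart r₁ r₂ D + Real.pi / 2 := by
    rw [hitAngle, offs_angleStart h2 hlt hD, div_self h2.ne', Real.arcsin_one]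
  rw [hitArea, hitRad_angleStart h2 hlt hD, hb, Real.sin_add_pi_div_two, Real.cos_add_pi_div_two]
  ring

lemma continuousOn_hitRad : ContinuousOn (hitRad r₁ r₂ D) (Ioo (-(Real.pi / 2)) (Real.pi / 2)) := by
  unfold hitRad halfChord offs
  have : ∀ x ∈ Ioo (-(Real.pi / 2)) (Real.pi / 2), Real.cos x ≠ 0 := fun x hx =>
    (Real.cos_pos_of_mem_Ioo hx).ne'
  fun_prop (disch := assumption)

lemma continuous_hitAngle : Continuous (hitAngle r₁ r₂ D) := by
  unfold hitAngle offs
  exact continuous_id.add (Real.continuous_arcsin.comp (by fun_prop))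

lemma continuousOn_hitArea :
    ContinuousOn (hitArea r₁ r₂ D) (Ioo (-(Real.pi / 2)) (Real.pi / 2)) := by
  have h1 := continuousOn_hitRad (r₁ := r₁) (r₂ := r₂) (D := D)
  have h2 := continuous_hitAngle (r₁ := r₁) (r₂ := r₂) (D := D)
  unfold hitArea
  fun_prop

lemma continuousOn_hitPer : ContinuousOn (hitPer r₁ r₂ D) (Ioo 0 (Real.pi / 2)) := by
  have h1 := (continuousOn_hitRad (r₁ := r₁) (r₂ := r₂) (D := D)).mono
    (Ioo_subset_Ioo_left (by linarith [Real.pi_pos] : -(Real.pi / 2) ≤ 0))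
  have : ∀ x ∈ Ioo 0 (Real.pi / 2), Real.sin x ≠ 0 := fun x hx =>
    (Real.sin_pos_of_pos_of_lt_pi hx.1 (by linarith [hx.2, Real.pi_pos])).ne'
  unfold hitPer
  fun_prop (disch := assumption)

/-- Lagrange interpolation at `1` for a cubic polynomial with three roots. -/
lemma cubic_three_roots {a b c d x y z : ℝ} (ha : a < 0) (hxy : x < y) (hyz : y < z) (hz : z < 1)
    (h1 : 0 ≤ a + b + c + d) (hx : a * x ^ 3 + b * x ^ 2 + c * x + d = 0)
    (hy : a * y ^ 3 + b * y ^ 2 + c * y + d = 0)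
    (hz' : a * z ^ 3 + b * z ^ 2 + c * z + d = 0) : False := by
  have hV : 0 < (y - x) * (z - x) * (z - y) :=
    mul_pos (mul_pos (by linarith) (by linarith)) (by linarith)
  have hW : 0 < (1 - x) * (1 - y) * (1 - z) :=
    mul_pos (mul_pos (by linarith) (by linarith)) (by linarith)
  have e : (a + b + c + d) * ((y - x) * (z - x) * (z - y))
      = a * ((1 - x) * (1 - y) * (1 - z)) * ((y - x) * (z - x) * (z - y)) := by
    linear_combination (1 - y) * (1 - z) * (z - y) * hx - (1 - x) * (1 - z) * (z - x) * hy
      + (1 - x) * (1 - y) * (y - x) * hz'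
  have h3 := mul_nonneg h1 hV.le
  have h4 := mul_neg_of_neg_of_pos (mul_neg_of_neg_of_pos ha hW) hV
  linarith

/-- The polynomial equation for the level sets of the touching radius. -/
lemma hitRad_level {θ : ℝ} (hc : 0 < Real.cos θ) (hδ : offs r₁ D θ ^ 2 ≤ r₂ ^ 2) :
    (hitRad r₁ r₂ D θ - offs r₁ D θ) ^ 2 - Real.sin θ ^ 2 * (hitRad r₁ r₂ D θ ^ 2
      - 2 * hitRad r₁ r₂ D θ * offs r₁ D θ + r₂ ^ 2) = 0 := by
  have hw : halfChord r₁ r₂ D θ ^ 2 = r₂ ^ 2 - offs r₁ D θ ^ 2 := Real.sq_sqrt (by linarith)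
  have e : (hitRad r₁ r₂ D θ - offs r₁ D θ) * Real.cos θ
      = Real.sin θ * halfChord r₁ r₂ D θ := by
    rw [hitRad]
    field_simp
    ring
  have e2 : (hitRad r₁ r₂ D θ - offs r₁ D θ) ^ 2 * Real.cos θ ^ 2
      = Real.sin θ ^ 2 * (r₂ ^ 2 - offs r₁ D θ ^ 2) := by
    rw [← mul_pow, e, mul_pow, hw]
  linear_combination e2 - (hitRad r₁ r₂ D θ - offs r₁ D θ) ^ 2 * Real.sin_sq_add_cos_sq θ

lemma hit_domain (h2 : 0 < r₂) (hlt : r₂ < r₁) (hD : r₁ + r₂ ≤ D) {θ : ℝ}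
    (hθ : θ ∈ Ico (angleStart r₁ r₂ D) (angleEnd r₁ r₂ D)) :
    0 < Real.cos θ ∧ offs r₁ D θ ^ 2 ≤ r₂ ^ 2 ∧ θ ∈ Ioo 0 (Real.pi / 2) := by
  obtain ⟨b1, b2, b3⟩ := angle_bounds h2 hlt hD
  have hm : θ ∈ Ioo 0 (Real.pi / 2) := ⟨by linarith [hθ.1], by linarith [hθ.2]⟩
  refine ⟨Real.cos_pos_of_mem_Ioo ⟨by linarith [hm.1, Real.pi_pos], hm.2⟩, ?_, hm⟩
  rcases eq_or_lt_of_le hθ.1 with h | h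
  · rw [← h, offs_angleStart h2 hlt hD]
  · linarith [(hitData_of_mem h2 hlt hD ⟨h, hθ.2⟩).radicand_pos]

/-- A level of the touching radius is attained at most twice. -/
lemma hitRad_no_three (h2 : 0 < r₂) (hlt : r₂ < r₁) (hD : r₁ + r₂ ≤ D) {c x y z : ℝ} (hc : 0 < c)
    (hx : angleStart r₁ r₂ D ≤ x) (hxy : x < y) (hyz : y < z) (hz : z < angleEnd r₁ r₂ D)
    (ex : hitRad r₁ r₂ D x = c) (ey : hitRad r₁ r₂ D y = c) (ez : hitRad r₁ r₂ D z = c) :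
    False := by
  have dx := hit_domain h2 hlt hD ⟨hx, (hxy.trans hyz).trans hz⟩
  have dy := hit_domain h2 hlt hD ⟨(hx.trans hxy.le), hyz.trans hz⟩
  have dz := hit_domain h2 hlt hD ⟨(hx.trans (hxy.trans hyz).le), hz⟩
  have hD0 : 0 < D := by linarith
  have lx := hitRad_level dx.1 dx.2.1
  have ly := hitRad_level dy.1 dy.2.1
  have lz := hitRad_level dz.1 dz.2.1
  rw [ex, offs] at lx
  rw [ey, offs] at ly
  rw [ez, offs] at lz
  have sz : Real.sin z < 1 := by
    have := Real.sin_lt_sin_of_lt_of_le_pi_div_two (by linarith [dz.2.2.1, Real.pi_pos]) le_rfl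
      dz.2.2.2
    rwa [Real.sin_pi_div_two] at this
  -- For a fixed radius `c` the level equation is a cubic in `sin θ` with leading coefficient `-2 c
  -- D`. Its value at `1` is `(D - r₁)² - r₂² ≥ 0`, which excludes three roots below `1`.
  refine cubic_three_roots (a := -2 * c * D) (b := D ^ 2 - c ^ 2 + 2 * c * r₁ - r₂ ^ 2)
    (c := 2 * (c - r₁) * D) (d := (c - r₁) ^ 2) (x := Real.sin x) (y := Real.sin y)
    (z := Real.sin z) ?_ ?_ ?_ sz ?_ ?_ ?_ ?_
  · have := mul_pos hc hD0
    linarith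
  · exact Real.sin_lt_sin_of_lt_of_le_pi_div_two (by linarith [dx.2.2.1, Real.pi_pos])
      dy.2.2.2.le hxy
  · exact Real.sin_lt_sin_of_lt_of_le_pi_div_two (by linarith [dy.2.2.1, Real.pi_pos])
      dz.2.2.2.le hyz
  · have : r₂ ^ 2 ≤ (D - r₁) ^ 2 := pow_le_pow_left₀ h2.le (by linarith) 2
    linarith
  · linear_combination lx
  · linear_combination ly
  · linear_combination lz

/-- The touching radius increases at first. -/
lemma exists_lt_hitRad (h2 : 0 < r₂) (hlt : r₂ < r₁) (hD : r₁ + r₂ ≤ D) {b : ℝ}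
    (hb : angleStart r₁ r₂ D < b) :
    ∃ a ∈ Ioo (angleStart r₁ r₂ D) b, r₂ < hitRad r₁ r₂ D a := by
  obtain ⟨b1, b2, b3⟩ := angle_bounds h2 hlt hD
  have hs := sin_angleStart h2 hlt hD
  have hsp : 0 < Real.sin (angleStart r₁ r₂ D) :=
    Real.sin_pos_of_pos_of_lt_pi b1 (by linarith [Real.pi_pos])
  -- With `z = D sin x - (r₁ - r₂)`, which vanishes at the start, squaring reduces `hitRad > r₂` to
  -- `z < 2 r₂ sin² x`.
  have hc : Continuous fun x => 2 * r₂ * Real.sin x ^ 2 - (D * Real.sin x - (r₁ - r₂)) := by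
    fun_prop
  have h0 : 0 < 2 * r₂ * Real.sin (angleStart r₁ r₂ D) ^ 2
      - (D * Real.sin (angleStart r₁ r₂ D) - (r₁ - r₂)) := by
    rw [hs]
    have := mul_pos h2 (pow_pos hsp 2)
    linarith
  have ev := (hc.tendsto (angleStart r₁ r₂ D)).eventually (lt_mem_nhds h0)
  have ev2 := (ev.filter_mono nhdsWithin_le_nhds).and
    (Ioo_mem_nhdsGT (lt_min hb b2) : _ ∈ 𝓝[>] (angleStart r₁ r₂ D))
  obtain ⟨a, ha1, ha2⟩ := ev2.exists
  have hab : a < b := ha2.2.trans_le (min_le_left _ _)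
  have H := hitData_of_mem h2 hlt hD ⟨ha2.1, ha2.2.trans_le (min_le_right _ _)⟩
  refine ⟨a, ⟨ha2.1, hab⟩, ?_⟩
  have hz : 0 < D * Real.sin a - (r₁ - r₂) := by linarith [H.lower]
  have hcos := H.cos_pos
  have hsin := H.sin_pos
  have key : (D * Real.sin a - (r₁ - r₂)) * Real.cos a < Real.sin a * halfChord r₁ r₂ D a := by
    refine lt_of_pow_lt_pow_left₀ 2 (mul_pos hsin H.halfChord_pos).le ?_
    rw [mul_pow, mul_pow, H.halfChord_sq, offs]
    have h4 : Real.cos a ^ 2 = 1 - Real.sin a ^ 2 := by linarith [Real.sin_sq_add_cos_sq a]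
    rw [h4]
    have := mul_pos hz ha1
    linarith
  have : D * Real.sin a - (r₁ - r₂) < Real.sin a / Real.cos a * halfChord r₁ r₂ D a := by
    rw [div_mul_eq_mul_div, lt_div_iff₀ hcos]
    exact key
  rw [hitRad, offs]
  linarith

lemma Icc_subset_hit (h2 : 0 < r₂) (hlt : r₂ < r₁) (hD : r₁ + r₂ ≤ D) {a b : ℝ}
    (ha : angleStart r₁ r₂ D ≤ a) (hb : b < angleEnd r₁ r₂ D) :
    Icc a b ⊆ Ioo 0 (Real.pi / 2) := by
  obtain ⟨b1, b2, b3⟩ := angle_bounds h2 hlt hD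
  exact fun x hx => ⟨by linarith [hx.1], by linarith [hx.2]⟩

lemma continuousOn_hitRad_Icc (h2 : 0 < r₂) (hlt : r₂ < r₁) (hD : r₁ + r₂ ≤ D) {a b : ℝ}
    (ha : angleStart r₁ r₂ D ≤ a) (hb : b < angleEnd r₁ r₂ D) :
    ContinuousOn (hitRad r₁ r₂ D) (Icc a b) :=
  continuousOn_hitRad.mono ((Icc_subset_hit h2 hlt hD ha hb).trans
    (Ioo_subset_Ioo_left (by linarith [Real.pi_pos])))

/-- The touching radius is strictly increasing up to any record. -/
theorem hitRad_strictMonoOn (h2 : 0 < r₂) (hlt : r₂ < r₁) (hD : r₁ + r₂ ≤ D) {t : ℝ}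
    (ht1 : t < angleEnd r₁ r₂ D)
    (hmax : ∀ x ∈ Icc (angleStart r₁ r₂ D) t, hitRad r₁ r₂ D x ≤ hitRad r₁ r₂ D t) :
    StrictMonoOn (hitRad r₁ r₂ D) (Icc (angleStart r₁ r₂ D) t) := by
  have hstart := hitRad_angleStart h2 hlt hD
  have ivt : ∀ {a b c : ℝ}, angleStart r₁ r₂ D ≤ a → a < b → b ≤ t →
      ((hitRad r₁ r₂ D a < c ∧ c < hitRad r₁ r₂ D b) ∨
        (hitRad r₁ r₂ D b < c ∧ c < hitRad r₁ r₂ D a)) →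
      ∃ x ∈ Ioo a b, hitRad r₁ r₂ D x = c := by
    intro a b c ha hab hb hc
    have hcont := continuousOn_hitRad_Icc h2 hlt hD ha (hb.trans_lt ht1)
    rcases hc with hc | hc
    · exact intermediate_value_Ioo hab.le hcont hc
    · exact intermediate_value_Ioo' hab.le hcont hc
  -- no descent from above the initial value
  have hle_of_lt : ∀ a b, angleStart r₁ r₂ D < a → a < b → b ≤ t → r₂ < hitRad r₁ r₂ D a →
      hitRad r₁ r₂ D a ≤ hitRad r₁ r₂ D b := by
    intro a b ha hab hb hra
    by_contra hcon
    push Not at hcon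
    -- If the radius dropped between `a` and `b`, a level `c` just below its value at `a` would be
    -- attained before `a`, between `a` and `b`, and again after `b`, because the value at `t` is
    -- the largest one.
    obtain ⟨c, hc1, hc2⟩ := exists_between (max_lt hcon hra)
    have hc3 := (le_max_left _ _).trans_lt hc1
    have hc4 := (le_max_right _ _).trans_lt hc1
    have hat := hmax a ⟨ha.le, hab.le.trans hb⟩
    obtain ⟨x, hx, ex⟩ := ivt le_rfl ha (hab.le.trans hb) (Or.inl ⟨by rw [hstart]; exact hc4, hc2⟩)
    obtain ⟨y, hy, ey⟩ := ivt ha.le hab hb (Or.inr ⟨hc3, hc2⟩)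
    have hbt : b < t := lt_of_le_of_ne hb (by rintro rfl; linarith)
    obtain ⟨z, hz, ez⟩ := ivt (ha.trans hab).le hbt le_rfl (Or.inl ⟨hc3, hc2.trans_le hat⟩)
    exact hitRad_no_three h2 hlt hD (h2.trans hc4) hx.1.le (hx.2.trans hy.1) (hy.2.trans hz.1)
      (hz.2.trans ht1) ex ey ez
  have hgt_start : ∀ b, angleStart r₁ r₂ D < b → b ≤ t → r₂ < hitRad r₁ r₂ D b := by
    intro b hb hbt
    obtain ⟨a, ha, hra⟩ := exists_lt_hitRad h2 hlt hD hb
    exact hra.trans_le (hle_of_lt a b ha.1 ha.2 hbt hra)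
  intro a ha b hb hab
  have hrb := hgt_start b (ha.1.trans_lt hab) hb.2
  rcases eq_or_lt_of_le ha.1 with h | h
  · rw [← h, hstart]
    exact hrb
  · have hra := hgt_start a h ha.2
    refine lt_of_le_of_ne (hle_of_lt a b h hab hb.2 hra) fun heq => ?_
    -- Equal values at `a` and `b` force the same value in between, hence a third solution.
    obtain ⟨m, hm1, hm2⟩ := exists_between hab
    have hrm := hgt_start m (h.trans hm1) (hm2.le.trans hb.2)
    have e1 := hle_of_lt a m h hm1 (hm2.le.trans hb.2) hra
    have e2 := hle_of_lt m b (h.trans hm1) hm2 hb.2 hrm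
    exact hitRad_no_three h2 hlt hD (h2.trans hra) ha.1 hm1 hm2 (hb.2.trans_lt ht1) rfl
      (le_antisymm (heq ▸ e2) e1) heq.symm

/-- A level above the initial value is first attained at a record. -/
theorem exists_first_hit (h2 : 0 < r₂) (hlt : r₂ < r₁) (hD : r₁ + r₂ ≤ D) {c t : ℝ} (hc : r₂ < c)
    (ht0 : angleStart r₁ r₂ D ≤ t) (ht : t < angleEnd r₁ r₂ D) (hct : c ≤ hitRad r₁ r₂ D t) :
    ∃ x ∈ Ioc (angleStart r₁ r₂ D) t, hitRad r₁ r₂ D x = c ∧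
      ∀ y ∈ Ico (angleStart r₁ r₂ D) x, hitRad r₁ r₂ D y < c := by
  have hstart := hitRad_angleStart h2 hlt hD
  have hcont := continuousOn_hitRad_Icc h2 hlt hD le_rfl ht
  have hcomp : IsCompact (Icc (angleStart r₁ r₂ D) t ∩ hitRad r₁ r₂ D ⁻¹' Ici c) :=
    isCompact_Icc.of_isClosed_subset (hcont.preimage_isClosed_of_isClosed isClosed_Icc isClosed_Ici)
      inter_subset_left
  obtain ⟨x, ⟨hx1, hx2⟩, hleast⟩ := hcomp.exists_isLeast ⟨t, ⟨ht0, le_rfl⟩, hct⟩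
  have hx2' : c ≤ hitRad r₁ r₂ D x := hx2
  have hlt' : ∀ y ∈ Ico (angleStart r₁ r₂ D) x, hitRad r₁ r₂ D y < c := by
    intro y hy
    by_contra hcon
    exact absurd (hleast ⟨⟨hy.1, hy.2.le.trans hx1.2⟩, not_lt.1 hcon⟩) (not_le.2 hy.2)
  have hx0 : angleStart r₁ r₂ D < x := lt_of_le_of_ne hx1.1 (by rintro rfl; linarith)
  refine ⟨x, ⟨hx0, hx1.2⟩, le_antisymm ?_ hx2', hlt'⟩
  by_contra hcon
  push Not at hcon
  obtain ⟨y, hy, ey⟩ := intermediate_value_Ioo hx0.le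
    (hcont.mono (Icc_subset_Icc_right hx1.2)) (⟨by rw [hstart]; exact hc, hcon⟩ : c ∈ Ioo _ _)
  exact absurd ey (hlt' y ⟨hy.1.le, hy.2⟩).ne

end HitMonotone

/-! ### The energy along the hits and the maximum of the touching radius -/

section HitEnergy

variable {r₁ r₂ D : ℝ}

/-- A multiple of the perimeter minus the area. -/
noncomputable def hitLagr (r₁ r₂ D c θ : ℝ) : ℝ := c * hitPer r₁ r₂ D θ - hitArea r₁ r₂ D θ

/-- Since the area decreases and its derivative is `hitRad` times that of the perimeter, the
multiple `c` of the perimeter minus the area has a derivative of the sign of `hitRad - c`. -/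
lemma HitData.hasDerivAt_hitLagr {θ : ℝ} (H : HitData r₁ r₂ D θ) (c : ℝ) :
    HasDerivAt (hitLagr r₁ r₂ D c) ((c - hitRad r₁ r₂ D θ) / hitRad r₁ r₂ D θ
      * hitAreaDeriv r₁ r₂ D θ) θ := by
  refine ((H.hasDerivAt_hitPer.const_mul c).sub H.hasDerivAt_hitArea).congr_deriv ?_
  have hl := H.hitRad_pos
  rw [H.hitAreaDeriv_eq]
  field_simp
  ring

lemma continuousOn_hitLagr (c : ℝ) :
    ContinuousOn (hitLagr r₁ r₂ D c) (Ioo 0 (Real.pi / 2)) :=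
  (continuousOn_hitPer.const_smul c).sub
    (continuousOn_hitArea.mono (Ioo_subset_Ioo_left (by linarith [Real.pi_pos])))

lemma hitLagr_le (h2 : 0 < r₂) (hlt : r₂ < r₁) (hD : r₁ + r₂ ≤ D) {a b c : ℝ}
    (ha : angleStart r₁ r₂ D ≤ a) (hab : a ≤ b) (hb : b < angleEnd r₁ r₂ D)
    (h : ∀ x ∈ Ioo a b, hitRad r₁ r₂ D x ≤ c) :
    hitLagr r₁ r₂ D c b ≤ hitLagr r₁ r₂ D c a := by
  have hd : ∀ x ∈ Ioo a b, HitData r₁ r₂ D x := fun x hx =>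
    hitData_of_mem h2 hlt hD ⟨ha.trans_lt hx.1, hx.2.trans hb⟩
  refine antitoneOn_of_deriv_nonpos (convex_Icc a b)
    ((continuousOn_hitLagr c).mono (Icc_subset_hit h2 hlt hD ha hb)) ?_ ?_
    (left_mem_Icc.2 hab) (right_mem_Icc.2 hab) hab
  · rw [interior_Icc]
    exact fun x hx => ((hd x hx).hasDerivAt_hitLagr c).differentiableAt.differentiableWithinAt
  · rw [interior_Icc]
    intro x hx
    rw [((hd x hx).hasDerivAt_hitLagr c).deriv]
    exact mul_nonpos_of_nonneg_of_nonpos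
      (div_nonneg (sub_nonneg.2 (h x hx)) (hd x hx).hitRad_pos.le) (hd x hx).hitAreaDeriv_neg.le

lemma lt_hitLagr (h2 : 0 < r₂) (hlt : r₂ < r₁) (hD : r₁ + r₂ ≤ D) {a b c : ℝ}
    (ha : angleStart r₁ r₂ D ≤ a) (hab : a < b) (hb : b < angleEnd r₁ r₂ D)
    (h : ∀ x ∈ Ioo a b, c < hitRad r₁ r₂ D x) :
    hitLagr r₁ r₂ D c a < hitLagr r₁ r₂ D c b := by
  have hd : ∀ x ∈ Ioo a b, HitData r₁ r₂ D x := fun x hx =>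
    hitData_of_mem h2 hlt hD ⟨ha.trans_lt hx.1, hx.2.trans hb⟩
  refine strictMonoOn_of_deriv_pos (convex_Icc a b)
    ((continuousOn_hitLagr c).mono (Icc_subset_hit h2 hlt hD ha hb)) ?_
    (left_mem_Icc.2 hab.le) (right_mem_Icc.2 hab.le) hab
  rw [interior_Icc]
  intro x hx
  rw [((hd x hx).hasDerivAt_hitLagr c).deriv]
  exact mul_pos_of_neg_of_neg
    (div_neg_of_neg_of_pos (sub_neg.2 (h x hx)) (hd x hx).hitRad_pos) (hd x hx).hitAreaDeriv_neg

lemma hitPer_pos_of_mem (h2 : 0 < r₂) (hlt : r₂ < r₁) (hD : r₁ + r₂ ≤ D) {θ : ℝ}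
    (hθ : θ ∈ Ico (angleStart r₁ r₂ D) (angleEnd r₁ r₂ D)) : 0 < hitPer r₁ r₂ D θ := by
  rcases eq_or_lt_of_le hθ.1 with h | h
  · have hm := (hit_domain h2 hlt hD hθ).2.2
    have hs := Real.sin_pos_of_pos_of_lt_pi hm.1 (by linarith [hm.2, Real.pi_pos])
    have hc := Real.lt_tan (x := Real.pi / 2 - θ) (by linarith [hm.2]) (by linarith [hm.1])
    rw [Real.tan_eq_sin_div_cos, Real.sin_pi_div_two_sub, Real.cos_pi_div_two_sub] at hc
    rw [hitPer, ← h, hitRad_angleStart h2 hlt hD, h]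
    exact mul_pos (by linarith) (by linarith)
  · exact (hitData_of_mem h2 hlt hD ⟨h, hθ.2⟩).hitPer_pos

/-- The energy is strictly increasing up to any record. -/
theorem hitEnergy_strictMonoOn (h2 : 0 < r₂) (hlt : r₂ < r₁) (hD : r₁ + r₂ ≤ D) {t : ℝ}
    (ht1 : t < angleEnd r₁ r₂ D)
    (hmax : ∀ x ∈ Icc (angleStart r₁ r₂ D) t, hitRad r₁ r₂ D x ≤ hitRad r₁ r₂ D t) :
    StrictMonoOn (hitEnergy r₁ r₂ D) (Icc (angleStart r₁ r₂ D) t) := by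
  have hmono := hitRad_strictMonoOn h2 hlt hD ht1 hmax
  intro a ha b hb hab
  have h1 := lt_hitLagr h2 hlt hD ha.1 hab (hb.2.trans_lt ht1) (c := hitRad r₁ r₂ D a)
    fun x hx => hmono ha ⟨ha.1.trans hx.1.le, hx.2.le.trans hb.2⟩ hx.1
  -- With the multiplier fixed at the radius of `a` the difference already increases from `a` to
  -- `b`; raising the multiplier to the radius of `b` increases it further, the excess perimeter
  -- being positive.
  have h3 := mul_lt_mul_of_pos_right (hmono ha hb hab)
    (hitPer_pos_of_mem h2 hlt hD ⟨hb.1, hb.2.trans_lt ht1⟩)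
  rw [hitLagr, hitLagr] at h1
  rw [hitEnergy, hitEnergy]
  linarith

lemma hitArea_nonneg (θ : ℝ) (h : HitData r₁ r₂ D θ) : 0 ≤ hitArea r₁ r₂ D θ := by
  have hm := h.mem
  have hb := h.hitAngle_mem
  have key : ∀ x : ℝ, 0 ≤ x → 0 ≤ x - Real.sin x * Real.cos x := fun x hx => by
    have h1 := Real.sin_le (by linarith : 0 ≤ 2 * x)
    rw [Real.sin_two_mul] at h1
    linarith
  have h1 := key (Real.pi / 2 - θ) (by linarith [hm.2])
  rw [Real.sin_pi_div_two_sub, Real.cos_pi_div_two_sub] at h1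
  rw [hitArea, mul_comm (Real.sin θ)]
  have := key _ hb.1.le
  positivity

/-- The common ordinate of the entrance point eliminates `hitRad`, whose formula divides by `cos θ`.
The bound stays continuous up to `angleEnd`, even for tangent disks, where this angle is `π / 2`. -/
lemma hitArea_le (θ : ℝ) (h : HitData r₁ r₂ D θ) : hitArea r₁ r₂ D θ
    ≤ r₂ ^ 2 * (Real.sin (hitAngle r₁ r₂ D θ) ^ 2 * (Real.cos θ / Real.sin θ)
      + (hitAngle r₁ r₂ D θ - Real.sin (hitAngle r₁ r₂ D θ) * Real.cos (hitAngle r₁ r₂ D θ))) := by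
  have hs := h.sin_pos
  have hc := h.cos_pos
  have hct := h.cot_gt
  have hsq := Real.sin_sq_add_cos_sq θ
  have h1 : Real.pi / 2 - θ - Real.sin θ * Real.cos θ
      ≤ Real.cos θ ^ 2 * (Real.cos θ / Real.sin θ) := by
    have : Real.cos θ / Real.sin θ - Real.sin θ * Real.cos θ
        = Real.cos θ ^ 2 * (Real.cos θ / Real.sin θ) := by
      field_simp
      linear_combination -hsq
    linarith
  have h3 := mul_le_mul_of_nonneg_left h1 (sq_nonneg (hitRad r₁ r₂ D θ))
  have h4 : hitRad r₁ r₂ D θ ^ 2 * Real.cos θ ^ 2 = r₂ ^ 2 * Real.sin (hitAngle r₁ r₂ D θ) ^ 2 := by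
    rw [← mul_pow, ← h.sin_hitAngle, mul_pow]
  rw [hitArea]
  linear_combination h3 + Real.cos θ / Real.sin θ * h4

lemma hitAngle_angleEnd (h2 : 0 < r₂) (hlt : r₂ < r₁) (hD : r₁ + r₂ ≤ D) :
    hitAngle r₁ r₂ D (angleEnd r₁ r₂ D) = 0 := by
  have he := sin_angleEnd h2 hlt hD
  have hD0 : 0 < D - r₂ := by linarith
  have : offs r₁ D (angleEnd r₁ r₂ D) / r₂ = -(r₁ / (D - r₂)) := by
    have : Real.sin (angleEnd r₁ r₂ D) = r₁ / (D - r₂) := by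
      rw [eq_div_iff hD0.ne', ← he, he]
      linarith
    rw [offs, this]
    field_simp
    ring
  rw [hitAngle, this, Real.arcsin_neg, angleEnd]
  ring

lemma tendsto_hitArea_angleEnd (h2 : 0 < r₂) (hlt : r₂ < r₁) (hD : r₁ + r₂ ≤ D) :
    Tendsto (hitArea r₁ r₂ D) (𝓝[<] angleEnd r₁ r₂ D) (𝓝 0) := by
  obtain ⟨b1, b2, b3⟩ := angle_bounds h2 hlt hD
  have hsin : Real.sin (angleEnd r₁ r₂ D) ≠ 0 :=
    (Real.sin_pos_of_pos_of_lt_pi (b1.trans b2) (by linarith [Real.pi_pos])).ne'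
  have hev : ∀ᶠ θ in 𝓝[<] angleEnd r₁ r₂ D, HitData r₁ r₂ D θ := by
    filter_upwards [Ioo_mem_nhdsLT b2] with θ hθ using hitData_of_mem h2 hlt hD hθ
  have hcont : ContinuousAt (fun θ => r₂ ^ 2 * (Real.sin (hitAngle r₁ r₂ D θ) ^ 2
      * (Real.cos θ / Real.sin θ) + (hitAngle r₁ r₂ D θ
        - Real.sin (hitAngle r₁ r₂ D θ) * Real.cos (hitAngle r₁ r₂ D θ))))
      (angleEnd r₁ r₂ D) := by
    have := (continuous_hitAngle (r₁ := r₁) (r₂ := r₂) (D := D)).continuousAt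
      (x := angleEnd r₁ r₂ D)
    fun_prop (disch := assumption)
  have hlim := hcont.tendsto
  simp only [hitAngle_angleEnd h2 hlt hD, Real.sin_zero, zero_mul, sub_zero, ne_eq,
    OfNat.ofNat_ne_zero, not_false_eq_true, zero_pow, add_zero, mul_zero] at hlim
  exact tendsto_of_tendsto_of_tendsto_of_le_of_le' tendsto_const_nhds
    (hlim.mono_left nhdsWithin_le_nhds) (hev.mono hitArea_nonneg) (hev.mono hitArea_le)

/-- The energy is nonnegative where the touching radius is maximal. -/
theorem hitEnergy_nonneg_of_max (h2 : 0 < r₂) (hlt : r₂ < r₁) (hD : r₁ + r₂ ≤ D) {t : ℝ}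
    (ht : t ∈ Ico (angleStart r₁ r₂ D) (angleEnd r₁ r₂ D))
    (hmax : ∀ x ∈ Ico (angleStart r₁ r₂ D) (angleEnd r₁ r₂ D),
      hitRad r₁ r₂ D x ≤ hitRad r₁ r₂ D t) : 0 ≤ hitEnergy r₁ r₂ D t := by
  have hl : 0 < hitRad r₁ r₂ D t := by
    have := hmax _ ⟨le_rfl, ht.1.trans_lt ht.2⟩
    rw [hitRad_angleStart h2 hlt hD] at this
    linarith
  have hlim := (tendsto_hitArea_angleEnd h2 hlt hD).neg
  rw [neg_zero] at hlim
  -- With the maximal radius as multiplier, the multiplied perimeter minus the area does not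
  -- increase after `t`. Near the end it is at least minus the area there, and that area tends to
  -- zero.
  refine le_of_tendsto hlim ?_
  filter_upwards [Ioo_mem_nhdsLT ht.2] with b hb
  have h1 := hitLagr_le h2 hlt hD ht.1 hb.1.le hb.2 (c := hitRad r₁ r₂ D t)
    fun x hx => hmax x ⟨ht.1.trans hx.1.le, hx.2.trans hb.2⟩
  have h3 := (hitData_of_mem h2 hlt hD ⟨ht.1.trans_lt hb.1, hb.2⟩).hitPer_pos
  have h4 := mul_pos hl h3
  rw [hitLagr, hitLagr] at h1
  rw [hitEnergy]
  linarith

/-- The touching radius attains its maximum if it is eventually below one of its values. -/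
lemma exists_hitRad_max (h2 : 0 < r₂) (hlt : r₂ < r₁) (hD : r₁ + r₂ ≤ D) {a : ℝ}
    (ha : a ∈ Ico (angleStart r₁ r₂ D) (angleEnd r₁ r₂ D))
    (h : ∀ᶠ x in 𝓝[<] angleEnd r₁ r₂ D, hitRad r₁ r₂ D x ≤ hitRad r₁ r₂ D a) :
    ∃ t ∈ Ico (angleStart r₁ r₂ D) (angleEnd r₁ r₂ D),
      ∀ x ∈ Ico (angleStart r₁ r₂ D) (angleEnd r₁ r₂ D),
        hitRad r₁ r₂ D x ≤ hitRad r₁ r₂ D t := by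
  obtain ⟨b, hb, hb'⟩ := (mem_nhdsLT_iff_exists_Ioo_subset' ha.2).1 h
  have hb0 : b < angleEnd r₁ r₂ D := hb
  set m := max a b with hm
  have hmlt : m < angleEnd r₁ r₂ D := max_lt ha.2 hb0
  have ham : a ∈ Icc (angleStart r₁ r₂ D) m := ⟨ha.1, le_max_left _ _⟩
  obtain ⟨t, ht, htm⟩ := isCompact_Icc.exists_isMaxOn ⟨a, ham⟩
    (continuousOn_hitRad_Icc h2 hlt hD le_rfl hmlt)
  refine ⟨t, ⟨ht.1, ht.2.trans_lt hmlt⟩, fun x hx => ?_⟩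
  rcases le_or_gt x m with hxm | hxm
  · exact htm ⟨hx.1, hxm⟩
  · exact (hb' ⟨(le_max_right _ _).trans_lt hxm, hx.2⟩ : _).trans (htm ham)

/-- For separated disks `angleEnd < π / 2`, so the radius is continuous up to the end. Its end value
`0` is below the initial value `r₂`. -/
lemma exists_hitRad_max_of_lt (h2 : 0 < r₂) (hlt : r₂ < r₁) (hD : r₁ + r₂ < D) :
    ∃ t ∈ Ico (angleStart r₁ r₂ D) (angleEnd r₁ r₂ D),
      ∀ x ∈ Ico (angleStart r₁ r₂ D) (angleEnd r₁ r₂ D),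
        hitRad r₁ r₂ D x ≤ hitRad r₁ r₂ D t := by
  obtain ⟨b1, b2, b3⟩ := angle_bounds h2 hlt hD.le
  have hlt' := angleEnd_lt h2 hlt hD
  have hmem : angleEnd r₁ r₂ D ∈ Ioo (-(Real.pi / 2)) (Real.pi / 2) :=
    ⟨by linarith [Real.pi_pos], hlt'⟩
  have hcos := Real.cos_pos_of_mem_Ioo hmem
  have hcont := continuousOn_hitRad (r₁ := r₁) (r₂ := r₂) (D := D) |>.continuousAt
    (Ioo_mem_nhds hmem.1 hmem.2)
  have he := sin_angleEnd h2 hlt hD.le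
  have hval : hitRad r₁ r₂ D (angleEnd r₁ r₂ D) = 0 := by
    have ho : offs r₁ D (angleEnd r₁ r₂ D) = -(r₂ * Real.sin (angleEnd r₁ r₂ D)) := by
      rw [offs]
      linarith
    have hw : halfChord r₁ r₂ D (angleEnd r₁ r₂ D) = r₂ * Real.cos (angleEnd r₁ r₂ D) := by
      rw [halfChord, ho, show r₂ ^ 2 - (-(r₂ * Real.sin (angleEnd r₁ r₂ D))) ^ 2
        = (r₂ * Real.cos (angleEnd r₁ r₂ D)) ^ 2 by
          linear_combination -r₂ ^ 2 * Real.sin_sq_add_cos_sq (angleEnd r₁ r₂ D)]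
      exact Real.sqrt_sq (by positivity)
    rw [hitRad, ho, hw]
    field_simp
    ring
  refine exists_hitRad_max h2 hlt hD.le ⟨le_rfl, b2⟩ ?_
  rw [hitRad_angleStart h2 hlt hD.le]
  have hlim := hcont.tendsto.mono_left (nhdsWithin_le_nhds (s := Iio (angleEnd r₁ r₂ D)))
  rw [hval] at hlim
  exact hlim.eventually_le_const h2

/-- The touching radius of two tangent disks in terms of the sine of the angle. -/
lemma hitRad_tangent {θ : ℝ} (hc : 0 < Real.cos θ) :
    hitRad r₁ r₂ (r₁ + r₂) θ = offs r₁ (r₁ + r₂) θ + Real.sin θ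
      * Real.sqrt ((r₁ + r₂) * ((r₁ + r₂) * Real.sin θ - (r₁ - r₂)) / (1 + Real.sin θ)) := by
  have hsq := Real.sin_sq_add_cos_sq θ
  have hs : 0 < 1 + Real.sin θ := by
    nlinarith [Real.neg_one_le_sin θ, sq_pos_of_pos hc]
  have e : r₂ ^ 2 - offs r₁ (r₁ + r₂) θ ^ 2 = Real.cos θ ^ 2
      * ((r₁ + r₂) * ((r₁ + r₂) * Real.sin θ - (r₁ - r₂)) / (1 + Real.sin θ)) := by
    have : Real.cos θ ^ 2 = (1 - Real.sin θ) * (1 + Real.sin θ) := by linear_combination hsq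
    rw [this, offs]
    field_simp
    ring
  rw [hitRad, halfChord, e, Real.sqrt_mul (sq_nonneg _), Real.sqrt_sq hc.le]
  field_simp

/-- The limit of the touching radius for two tangent disks. -/
noncomputable def limitRad (r₁ r₂ : ℝ) : ℝ := Real.sqrt ((r₁ + r₂) * r₂) - r₂

lemma tendsto_hitRad_tangent (h2 : 0 < r₂) (hlt : r₂ < r₁) :
    Tendsto (hitRad r₁ r₂ (r₁ + r₂)) (𝓝[<] angleEnd r₁ r₂ (r₁ + r₂)) (𝓝 (limitRad r₁ r₂)) := by
  rw [angleEnd_of_tangent h2 hlt]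
  have hcont : ContinuousAt (fun θ => offs r₁ (r₁ + r₂) θ + Real.sin θ
      * Real.sqrt ((r₁ + r₂) * ((r₁ + r₂) * Real.sin θ - (r₁ - r₂)) / (1 + Real.sin θ)))
      (Real.pi / 2) := by
    have : 1 + Real.sin (Real.pi / 2) ≠ 0 := by rw [Real.sin_pi_div_two]; norm_num
    unfold offs
    fun_prop (disch := assumption)
  have hlim := hcont.tendsto
  have hval : offs r₁ (r₁ + r₂) (Real.pi / 2) + Real.sin (Real.pi / 2)
      * Real.sqrt ((r₁ + r₂) * ((r₁ + r₂) * Real.sin (Real.pi / 2) - (r₁ - r₂))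
        / (1 + Real.sin (Real.pi / 2))) = limitRad r₁ r₂ := by
    rw [offs, Real.sin_pi_div_two, limitRad, show (r₁ + r₂) * ((r₁ + r₂) * 1 - (r₁ - r₂)) / (1 + 1)
      = (r₁ + r₂) * r₂ by ring]
    ring
  rw [hval] at hlim
  refine (hlim.mono_left nhdsWithin_le_nhds).congr' ?_
  filter_upwards [Ioo_mem_nhdsLT (show -(Real.pi / 2) < Real.pi / 2 by linarith [Real.pi_pos])]
    with θ hθ
  exact (hitRad_tangent (Real.cos_pos_of_mem_Ioo hθ)).symm

/-- The condition `r₁ < 8 r₂` means that the limit `L` of the radius at `π / 2` is below `2 r₂`. In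
terms of `u = sin θ`, the difference of squares that decides `hitRad > L` factors, and the
inequality holds for `u > L / (2 r₂)`. The radius thus exceeds its limit near the end, and a maximum
is attained. -/
lemma exists_hitRad_max_of_tangent (h2 : 0 < r₂) (hlt : r₂ < r₁) (h8 : r₁ < 8 * r₂) :
    ∃ t ∈ Ico (angleStart r₁ r₂ (r₁ + r₂)) (angleEnd r₁ r₂ (r₁ + r₂)),
      ∀ x ∈ Ico (angleStart r₁ r₂ (r₁ + r₂)) (angleEnd r₁ r₂ (r₁ + r₂)),
        hitRad r₁ r₂ (r₁ + r₂) x ≤ hitRad r₁ r₂ (r₁ + r₂) t := by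
  set L := limitRad r₁ r₂ with hL
  have hD : 0 < r₁ + r₂ := by linarith
  have hq : (L + r₂) ^ 2 = (r₁ + r₂) * r₂ := by
    rw [hL, limitRad, sub_add_cancel, Real.sq_sqrt (by positivity)]
  have hL0 : 0 < L := by
    rw [hL, limitRad, sub_pos]
    refine Real.lt_sqrt_of_sq_lt ?_
    nlinarith
  have hL2 : L < 2 * r₂ := by
    have : Real.sqrt ((r₁ + r₂) * r₂) < 3 * r₂ := by
      rw [Real.sqrt_lt' (by linarith)]
      nlinarith
    rw [hL, limitRad]
    linarith
  obtain ⟨u, hu, hu1⟩ := exists_between (max_lt ((div_lt_one (by linarith)).2 hL2)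
    ((div_lt_one hD).2 (by linarith)) : max (L / (2 * r₂)) ((r₁ - r₂) / (r₁ + r₂)) < 1)
  have hx := (le_max_left _ _).trans_lt hu
  have hu0 := (le_max_right _ _).trans_lt hu
  have hupos : 0 < u := lt_trans (div_pos hL0 (by linarith)) hx
  have hsin : Real.sin (Real.arcsin u) = u := Real.sin_arcsin (by linarith) hu1.le
  have hcos : 0 < Real.cos (Real.arcsin u) := Real.cos_pos_of_mem_Ioo
    ⟨by linarith [Real.arcsin_pos.2 hupos, Real.pi_pos], Real.arcsin_lt_pi_div_two.2 hu1⟩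
  have hmem : Real.arcsin u ∈ Ico (angleStart r₁ r₂ (r₁ + r₂)) (angleEnd r₁ r₂ (r₁ + r₂)) := by
    refine ⟨Real.monotone_arcsin hu0.le, ?_⟩
    rw [angleEnd_of_tangent h2 hlt]
    exact Real.arcsin_lt_pi_div_two.2 hu1
  have hgt : L < hitRad r₁ r₂ (r₁ + r₂) (Real.arcsin u) := by
    rw [hitRad_tangent hcos, offs, hsin]
    have hrad : (L - r₁ + (r₁ + r₂) * u) ^ 2
        < u ^ 2 * ((r₁ + r₂) * ((r₁ + r₂) * u - (r₁ - r₂)) / (1 + u)) := by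
      rw [← mul_div_assoc, lt_div_iff₀ (by linarith)]
      have e : (L - r₁ + (r₁ + r₂) * u) ^ 2 * (1 + u)
          - u ^ 2 * ((r₁ + r₂) * ((r₁ + r₂) * u - (r₁ - r₂)))
          = -(2 * L * (r₁ + r₂) * (1 - u) * (u - L / (2 * r₂))) := by
        have h1 : r₁ = (L ^ 2 + 2 * L * r₂) / r₂ := by
          rw [eq_div_iff h2.ne']
          linear_combination -hq
        rw [h1]
        field_simp
        ring
      have : 0 < 2 * L * (r₁ + r₂) * (1 - u) * (u - L / (2 * r₂)) :=
        mul_pos (mul_pos (by positivity) (by linarith)) (by linarith)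
      linarith
    have hlt2 : L - r₁ + (r₁ + r₂) * u
        < u * Real.sqrt ((r₁ + r₂) * ((r₁ + r₂) * u - (r₁ - r₂)) / (1 + u)) := by
      refine (Real.lt_sqrt_of_sq_lt hrad).trans_eq ?_
      rw [Real.sqrt_mul (sq_nonneg _), Real.sqrt_sq hupos.le]
    linarith
  exact exists_hitRad_max h2 hlt le_rfl hmem
    ((tendsto_hitRad_tangent h2 hlt).eventually_le_const hgt)

/-- If the touching radius has no maximum, then the disks are tangent and it stays below its
limit. -/
lemma hitRad_lt_limitRad (h2 : 0 < r₂) (hlt : r₂ < r₁) (hD : r₁ + r₂ ≤ D)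
    (hno : ¬ ∃ t ∈ Ico (angleStart r₁ r₂ D) (angleEnd r₁ r₂ D),
      ∀ x ∈ Ico (angleStart r₁ r₂ D) (angleEnd r₁ r₂ D),
        hitRad r₁ r₂ D x ≤ hitRad r₁ r₂ D t) :
    D = r₁ + r₂ ∧ 8 * r₂ ≤ r₁ ∧
      ∀ x ∈ Ico (angleStart r₁ r₂ D) (angleEnd r₁ r₂ D), hitRad r₁ r₂ D x < limitRad r₁ r₂ := by
  have hDeq : D = r₁ + r₂ := by
    by_contra h
    exact hno (exists_hitRad_max_of_lt h2 hlt (lt_of_le_of_ne hD (Ne.symm h)))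
  subst hDeq
  refine ⟨rfl, ?_, fun x hx => ?_⟩
  · by_contra h
    exact hno (exists_hitRad_max_of_tangent h2 hlt (not_le.1 h))
  · by_contra hcon
    push Not at hcon
    refine hno ⟨x, hx, fun y hy => ?_⟩
    by_contra hy'
    push Not at hy'
    exact hno (exists_hitRad_max h2 hlt hD hy
      ((tendsto_hitRad_tangent h2 hlt).eventually_le_const (hcon.trans_lt hy')))

end HitEnergy

/-! ### Circular segments and the estimate at half the first radius -/

section SegmentBounds

/-- The difference of the two sides vanishes at `π / 2` and has derivative `2 sin x (1 - sin x) ≥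
0`. -/
lemma segment_le_of_obtuse {b : ℝ} (h1 : Real.pi / 2 ≤ b) (h2 : b ≤ Real.pi) :
    b - Real.sin b * Real.cos b ≤ Real.pi / 2 - 2 * Real.cos b := by
  have hd : ∀ x, HasDerivAt (fun x => -(2 * Real.cos x) - x + Real.sin x * Real.cos x)
      (2 * Real.sin x * (1 - Real.sin x)) x := fun x => by
    refine ((((Real.hasDerivAt_cos x).const_mul 2).neg.sub (hasDerivAt_id x)).add
      ((Real.hasDerivAt_sin x).mul (Real.hasDerivAt_cos x))).congr_deriv ?_
    linear_combination Real.sin_sq_add_cos_sq x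
  have hm : MonotoneOn (fun x => -(2 * Real.cos x) - x + Real.sin x * Real.cos x)
      (Icc (Real.pi / 2) Real.pi) := by
    refine monotoneOn_of_deriv_nonneg (convex_Icc _ _)
      (fun x _ => (hd x).continuousAt.continuousWithinAt)
      (fun x _ => (hd x).differentiableAt.differentiableWithinAt) fun x hx => ?_
    rw [interior_Icc] at hx
    rw [(hd x).deriv]
    have := Real.sin_nonneg_of_nonneg_of_le_pi (by linarith [hx.1, Real.pi_pos]) hx.2.le
    have := Real.sin_le_one x
    exact mul_nonneg (by linarith) (by linarith)
  have := hm ⟨le_rfl, h1.trans h2⟩ ⟨h1, h2⟩ h1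
  simp only [Real.cos_pi_div_two, mul_zero] at this
  linarith

/-- The difference of the two sides has derivative `2 sin x (93/100 - sin x)`: it first increases
and then decreases, so only the end points matter. It vanishes at `π / 2`, and the slope `93/50` is
small enough for it to be positive at `π / 3`. -/
lemma segment_le_of_acute {b : ℝ} (h1 : Real.pi / 3 ≤ b) (h2 : b ≤ Real.pi / 2) :
    b - Real.sin b * Real.cos b ≤ Real.pi / 2 - 93 / 50 * Real.cos b := by
  have hpi := Real.pi_pos
  have hd : ∀ x, HasDerivAt (fun x => -(93 / 50 * Real.cos x) - x + Real.sin x * Real.cos x)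
      (2 * Real.sin x * (93 / 100 - Real.sin x)) x := fun x => by
    refine ((((Real.hasDerivAt_cos x).const_mul (93 / 50)).neg.sub (hasDerivAt_id x)).add
      ((Real.hasDerivAt_sin x).mul (Real.hasDerivAt_cos x))).congr_deriv ?_
    linear_combination Real.sin_sq_add_cos_sq x
  have hs : ∀ x ∈ Icc 0 (Real.pi / 2), 0 ≤ Real.sin x := fun x hx =>
    Real.sin_nonneg_of_nonneg_of_le_pi hx.1 (by linarith [hx.2])
  rcases le_total (Real.sin b) (93 / 100) with h | h
  · have hm : MonotoneOn (fun x => -(93 / 50 * Real.cos x) - x + Real.sin x * Real.cos x)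
        (Icc (Real.pi / 3) b) := by
      refine monotoneOn_of_deriv_nonneg (convex_Icc _ _)
        (fun x _ => (hd x).continuousAt.continuousWithinAt)
        (fun x _ => (hd x).differentiableAt.differentiableWithinAt) fun x hx => ?_
      rw [interior_Icc] at hx
      rw [(hd x).deriv]
      have := hs x ⟨by linarith [hx.1], by linarith [hx.2]⟩
      have := Real.sin_le_sin_of_le_of_le_pi_div_two (by linarith [hx.1]) h2 hx.2.le
      exact mul_nonneg (by linarith) (by linarith)
    have := hm ⟨le_rfl, h1⟩ ⟨h1, le_rfl⟩ h1
    simp only [Real.cos_pi_div_three, Real.sin_pi_div_three] at this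
    have h3 : 173 / 100 ≤ Real.sqrt 3 := Real.le_sqrt_of_sq_le (by norm_num)
    have := Real.pi_gt_d2
    linarith
  · have hm : AntitoneOn (fun x => -(93 / 50 * Real.cos x) - x + Real.sin x * Real.cos x)
        (Icc b (Real.pi / 2)) := by
      refine antitoneOn_of_deriv_nonpos (convex_Icc _ _)
        (fun x _ => (hd x).continuousAt.continuousWithinAt)
        (fun x _ => (hd x).differentiableAt.differentiableWithinAt) fun x hx => ?_
      rw [interior_Icc] at hx
      rw [(hd x).deriv]
      have := hs x ⟨by linarith [hx.1], hx.2.le⟩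
      have := Real.sin_le_sin_of_le_of_le_pi_div_two (by linarith) hx.2.le hx.1.le
      exact mul_nonpos_of_nonneg_of_nonpos (by linarith) (by linarith)
    have := hm ⟨le_rfl, h2⟩ ⟨h2, le_rfl⟩ h2
    simp only [Real.cos_pi_div_two, mul_zero] at this
    linarith

/-- The area of a circular segment of height at least `1 / 2` of a disk of radius at most `1`. -/
lemma segment_area_le {ρ b : ℝ} (hρ : 0 < ρ) (hρ1 : ρ ≤ 1) (hb : b ∈ Icc 0 Real.pi)
    (hs : 1 / 2 ≤ ρ * (1 - Real.cos b)) :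
    ρ ^ 2 * (b - Real.sin b * Real.cos b) ≤ Real.pi / 2 + 2 * (ρ * (1 - Real.cos b) - 1) ∨
    ρ ^ 2 * (b - Real.sin b * Real.cos b)
      ≤ Real.pi / 2 + 93 / 50 * (ρ * (1 - Real.cos b) - 1) := by
  have hpi := Real.pi_gt_d2
  have hpi2 := Real.pi_lt_d2
  have hρ4 : 1 / 4 ≤ ρ := by
    have := mul_le_mul_of_nonneg_left (Real.neg_one_le_cos b) hρ.le
    linarith
  rcases le_total b (Real.pi / 2) with h | h
  · have hc := Real.cos_nonneg_of_mem_Icc (⟨by linarith [hb.1], h⟩ : b ∈ Icc _ _)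
    -- A height of at least `1/2` with radius at most `1` forces `cos b ≤ 1/2`.
    have h3 : Real.pi / 3 ≤ b := by
      by_contra hcon
      push Not at hcon
      have := Real.cos_lt_cos_of_nonneg_of_le_pi_div_two hb.1 (by linarith) hcon
      rw [Real.cos_pi_div_three] at this
      have := mul_le_mul_of_nonneg_right hρ1 (by linarith [Real.cos_le_one b] : 0 ≤ 1 - Real.cos b)
      linarith
    right
    have hF := mul_le_mul_of_nonneg_left (segment_le_of_acute h3 h) (sq_nonneg ρ)
    have key : 0 ≤ (1 - ρ) * (Real.pi / 2 * (1 + ρ) - 93 / 50 - 93 / 50 * (ρ * Real.cos b)) := by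
      refine mul_nonneg (by linarith) ?_
      have h5 : 0 ≤ (93 / 50 - Real.pi / 2) * (1 - ρ) := mul_nonneg (by linarith) (by linarith)
      linarith
    linarith
  · have hF := mul_le_mul_of_nonneg_left (segment_le_of_obtuse h hb.2) (sq_nonneg ρ)
    have hc := Real.cos_nonpos_of_pi_div_two_le_of_le h (by linarith [hb.2])
    have hz : 0 ≤ -(ρ * Real.cos b) := by
      have := mul_nonpos_of_nonneg_of_nonpos hρ.le hc
      linarith
    have hk : 0 ≤ (1 - ρ) * (Real.pi / 2 * (1 + ρ) - 2 * ρ) := by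
      refine mul_nonneg (by linarith) ?_
      have := mul_nonneg (by linarith : 0 ≤ 2 - Real.pi / 2) (by linarith : 0 ≤ 1 - ρ)
      linarith
    rcases le_total 1 (ρ * (1 - Real.cos b)) with h1 | h1
    · left
      have : 0 ≤ (1 - ρ) * (-(ρ * Real.cos b) - (1 - ρ)) := mul_nonneg (by linarith) (by linarith)
      linarith
    · right
      rcases le_total (2 * ρ) (93 / 50) with h4 | h4
      · have k1 : 0 ≤ (1 - ρ) * (Real.pi / 2 * (1 + ρ) - 93 / 50) := by
          refine mul_nonneg (by linarith) ?_
          have := mul_le_mul_of_nonneg_left hρ4 Real.pi_pos.le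
          linarith
        have k2 : 0 ≤ -(ρ * Real.cos b) * (93 / 50 - 2 * ρ) := mul_nonneg hz (by linarith)
        linarith
      · have k2 : 0 ≤ ((1 - ρ) + ρ * Real.cos b) * (2 * ρ - 93 / 50) :=
          mul_nonneg (by linarith) (by linarith)
        linarith

lemma add_cube_le_arcsin {u : ℝ} (h0 : 0 ≤ u) (h1 : u < 1) : u + u ^ 3 / 6 ≤ Real.arcsin u := by
  have hd : ∀ x ∈ Ioo (-1 : ℝ) 1, HasDerivAt (fun x => Real.arcsin x - x - x ^ 3 / 6)
      (1 / Real.sqrt (1 - x ^ 2) - 1 - x ^ 2 / 2) x := fun x hx => by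
    refine (((Real.hasDerivAt_arcsin hx.1.ne' hx.2.ne).sub (hasDerivAt_id x)).sub
      ((hasDerivAt_pow 3 x).div_const 6)).congr_deriv ?_
    push_cast
    ring
  have hm : MonotoneOn (fun x => Real.arcsin x - x - x ^ 3 / 6) (Icc 0 u) := by
    have hsub : ∀ x ∈ Icc 0 u, x ∈ Ioo (-1 : ℝ) 1 := fun x hx =>
      ⟨by linarith [hx.1], by linarith [hx.2]⟩
    refine monotoneOn_of_deriv_nonneg (convex_Icc _ _)
      (fun x hx => (hd x (hsub x hx)).continuousAt.continuousWithinAt)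
      (fun x hx => (hd x (hsub x (interior_subset hx))).differentiableAt.differentiableWithinAt)
      fun x hx => ?_
    have hx' := hsub x (interior_subset hx)
    rw [(hd x hx').deriv]
    have hpos : 0 < 1 - x ^ 2 := by nlinarith [hx'.1, hx'.2]
    have hs : Real.sqrt (1 - x ^ 2) ≤ 1 - x ^ 2 / 2 :=
      Real.sqrt_le_iff.2 ⟨by linarith [sq_nonneg x], by nlinarith [sq_nonneg (x ^ 2)]⟩
    have hle : 1 + x ^ 2 / 2 ≤ 1 / Real.sqrt (1 - x ^ 2) := by
      rw [le_div_iff₀ (Real.sqrt_pos.2 hpos)]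
      have := mul_le_mul_of_nonneg_left hs (by positivity : 0 ≤ 1 + x ^ 2 / 2)
      nlinarith [sq_nonneg (x ^ 2)]
    linarith
  have := hm ⟨le_rfl, h0⟩ ⟨h0, le_rfl⟩ h0
  simp only [Real.arcsin_zero] at this
  norm_num at this
  linarith

/-- The key numerical inequality for the comparison at half the radius of the first disk. -/
lemma half_radius_inequality {u y t s ρ b : ℝ} (hu : 0 < u) (ht : t < Real.pi / 2)
    (ht0 : 0 < t) (hut : u = Real.sin t) (hyt : y = Real.cos t) (hρ : 0 < ρ) (hρ1 : ρ ≤ 1)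
    (hb : b ∈ Icc 0 Real.pi) (hy : y = ρ * Real.sin b) (hsd : s = ρ * (1 - Real.cos b))
    (hs : s * u ≤ (1 - u) ^ 2)
    (hA : Real.pi / 2 - t - u * y + ρ ^ 2 * (b - Real.sin b * Real.cos b) ≤ Real.pi) :
    Real.pi / 2 - t - u * y + ρ ^ 2 * (b - Real.sin b * Real.cos b)
      ≤ 2 * (y / u - (Real.pi / 2 - t)) := by
  have hpi := Real.pi_gt_d4
  have hpi2 := Real.pi_lt_d4
  have hsq : u ^ 2 + y ^ 2 = 1 := by rw [hut, hyt]; exact Real.sin_sq_add_cos_sq t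
  have hy0 : 0 < y := by rw [hyt]; exact Real.cos_pos_of_mem_Ioo ⟨by linarith, ht⟩
  have hu1 : u < 1 := by nlinarith
  have hs0 : 0 ≤ s := by
    rw [hsd]
    exact mul_nonneg hρ.le (by linarith [Real.cos_le_one b])
  have hys : y ^ 2 = s * (2 * ρ - s) := by
    rw [hy, hsd]
    linear_combination ρ ^ 2 * Real.sin_sq_add_cos_sq b
  -- Since `ρ ≤ 1`, the chord satisfies `y² = s (2ρ - s) ≤ s (2 - s)`, that is, `(1 - s)² ≤ 1 - y² =
  -- u²`.
  have hus : 1 - u ≤ s := by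
    have h1 : (1 - s) ^ 2 ≤ u ^ 2 := by
      have := mul_le_mul_of_nonneg_left hρ1 hs0
      nlinarith
    have := abs_le_of_sq_le_sq' h1 hu.le
    linarith [this.2]
  -- Combining `1 - u ≤ s` with `s u ≤ (1 - u)²` gives `u ≤ 1 - u`.
  have hu2 : u ≤ 1 / 2 := by
    have h1 := (mul_le_mul_of_nonneg_right hus hu.le).trans hs
    have h2 : (1 - u) * u ≤ (1 - u) * (1 - u) := by linarith
    have := le_of_mul_le_mul_left h2 (by linarith)
    linarith
  have hut' : u + u ^ 3 / 6 ≤ t := by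
    have h1 := add_cube_le_arcsin hu.le hu1
    rwa [hut, Real.arcsin_sin (by linarith) ht.le, ← hut] at h1
  have huq : u ^ 2 ≤ 1 / 4 := by nlinarith
  have hyl : 1 - u ^ 2 / 2 - u ^ 4 / 6 ≤ y := by
    refine le_of_sq_le_sq ?_ hy0.le
    have h2 : y ^ 2 = 1 - u ^ 2 := by linarith
    rw [h2]
    have h3 : u ^ 4 * (u ^ 2) ≤ u ^ 4 * (1 / 4) := mul_le_mul_of_nonneg_left huq (by positivity)
    have h4 : u ^ 4 * (u ^ 4) ≤ u ^ 4 * 1 :=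
      mul_le_mul_of_nonneg_left (pow_le_one₀ hu.le hu1.le) (by positivity)
    nlinarith
  have hu4 : u ^ 4 ≤ u ^ 2 / 4 := by nlinarith [mul_le_mul_of_nonneg_left huq (sq_nonneg u)]
  -- For `u ≤ 1/3` the cotangent `y / u` is so large that the crude area bound `π` suffices. For
  -- `1/3 < u ≤ 1/2` the height `s ≥ 1 - u` is at least `1/2` and the linear bounds for segments
  -- apply.
  rcases le_or_gt u (1 / 3) with h3 | h3
  · have hu9 : u ^ 2 ≤ 1 / 9 := by nlinarith
    have hu49 : u ^ 4 ≤ u ^ 2 / 9 := by nlinarith [mul_le_mul_of_nonneg_left hu9 (sq_nonneg u)]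
    have h5 : Real.pi - u ≤ y / u := by
      rw [le_div_iff₀ hu]
      have := mul_le_mul_of_nonneg_right hpi2.le hu.le
      nlinarith [sq_nonneg (u - 1 / 3)]
    have : 0 < u ^ 3 := by positivity
    linarith
  · have hsu : 1 / 2 ≤ ρ * (1 - Real.cos b) := by linarith
    have hy2 := mul_le_mul_of_nonneg_right hyl (by positivity : 0 ≤ 2 + u ^ 2)
    have hu6 : u ^ 6 ≤ u ^ 2 / 16 := by
      have : u ^ 6 ≤ u ^ 4 / 4 := by
        nlinarith [mul_le_mul_of_nonneg_left huq (by positivity : 0 ≤ u ^ 4)]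
      linarith
    have hpu := mul_le_mul_of_nonneg_right hpi2.le hu.le
    have htu := mul_le_mul_of_nonneg_left hut' hu.le
    have hC : u * (ρ ^ 2 * (b - Real.sin b * Real.cos b))
        ≤ y * (2 + u ^ 2) - 3 * u * (Real.pi / 2 - t) := by
      rcases segment_area_le hρ hρ1 hb hsu with h | h
      · rw [← hsd] at h
        have h6 := mul_le_mul_of_nonneg_left h hu.le
        have h7 := mul_le_mul_of_nonneg_right h3.le hu.le
        linarith
      · rw [← hsd] at h
        have h6 := mul_le_mul_of_nonneg_left h hu.le
        have h7 := sq_nonneg (u - 1 / 3)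
        linarith
    have e : u * (2 * (y / u - (Real.pi / 2 - t))) = 2 * y - 2 * u * (Real.pi / 2 - t) := by
      field_simp
    refine le_of_mul_le_mul_left ?_ hu
    rw [e]
    linarith

end SegmentBounds

/-- The area decreases with the angle and starts with the full second disk; this is the Lagrangian
comparison with multiplier zero. -/
lemma hitArea_le_disk {r₁ r₂ D θ : ℝ} (h2 : 0 < r₂) (hlt : r₂ < r₁) (hD : r₁ + r₂ ≤ D)
    (hθ : θ ∈ Ioo (angleStart r₁ r₂ D) (angleEnd r₁ r₂ D)) :
    hitArea r₁ r₂ D θ ≤ Real.pi * r₂ ^ 2 := by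
  have h := lt_hitLagr h2 hlt hD le_rfl hθ.1 hθ.2 (c := 0) fun x hx =>
    (hitData_of_mem h2 hlt hD ⟨hx.1, hx.2.trans hθ.2⟩).hitRad_pos
  rw [hitLagr, hitLagr, hitArea_angleStart h2 hlt hD] at h
  linarith

/-- The energy is nonnegative where the touching radius is half the radius of the first disk. -/
theorem hitEnergy_nonneg_of_half {r₁ r₂ D θ : ℝ} (h2 : 0 < r₂) (hlt : r₂ < r₁) (hD : r₁ + r₂ ≤ D)
    (hθ : θ ∈ Ioo (angleStart r₁ r₂ D) (angleEnd r₁ r₂ D)) (hk : hitRad r₁ r₂ D θ = r₁ / 2)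
    (h2k : r₂ < r₁ / 2) : 0 ≤ hitEnergy r₁ r₂ D θ := by
  have H := hitData_of_mem h2 hlt hD hθ
  set k := r₁ / 2 with hkdef
  have hk0 : 0 < k := h2.trans h2k
  have hs := H.sin_pos
  have hc := H.cos_pos
  have hw := H.halfChord_pos
  have hsq := Real.sin_sq_add_cos_sq θ
  have hb := H.hitAngle_mem
  have hsb := H.sin_hitAngle
  have hcb := H.cos_hitAngle
  have harea := hitArea_le_disk h2 hlt hD hθ
  rw [hk] at hsb
  have hr1 : r₁ = 2 * k := by rw [hkdef]; ring
  have hrad : k * Real.cos θ = offs r₁ D θ * Real.cos θ + Real.sin θ * halfChord r₁ r₂ D θ := by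
    rw [← hk]; exact H.hitRad_mul_cos
  set b := hitAngle r₁ r₂ D θ with hbdef
  have hx : r₂ * Real.cos b * Real.sin θ = D * Real.sin θ - k * Real.sin θ ^ 2 - k := by
    have ho : offs r₁ D θ = 2 * k - D * Real.sin θ := by rw [offs, hr1]
    rw [hcb]
    have : halfChord r₁ r₂ D θ * Real.cos θ * Real.sin θ
        = (k - offs r₁ D θ) * Real.cos θ ^ 2 := by
      linear_combination -Real.cos θ * hrad
    rw [ho] at this ⊢
    linear_combination this + (D * Real.sin θ - k) * hsq
  -- Lengths are measured in units of `k = r₁ / 2`; then `ρ = r₂ / k` and `s` is the height of the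
  -- segment cut from the second disk. The hypothesis `s u ≤ (1 - u)²` becomes the separation `r₁ +
  -- r₂ ≤ D`.
  have key := half_radius_inequality (u := Real.sin θ) (y := Real.cos θ) (t := θ)
    (s := r₂ / k * (1 - Real.cos b)) (ρ := r₂ / k) (b := b) hs H.mem.2 H.mem.1 rfl rfl
    (by positivity) (by rw [div_le_one hk0]; exact h2k.le) ⟨hb.1.le, hb.2.le⟩
    (by field_simp; linarith) rfl ?_ ?_
  · have e : hitEnergy r₁ r₂ D θ = k ^ 2 * (2 * (Real.cos θ / Real.sin θ - (Real.pi / 2 - θ)))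
        - k ^ 2 * (Real.pi / 2 - θ - Real.sin θ * Real.cos θ
          + (r₂ / k) ^ 2 * (b - Real.sin b * Real.cos b)) := by
      rw [hitEnergy, hitPer, hitArea, hk, ← hbdef, show r₁ - k = k by linarith]
      field_simp
    rw [e]
    have := mul_le_mul_of_nonneg_left key (sq_nonneg k)
    linarith
  · have hDs := mul_le_mul_of_nonneg_right hD hs.le
    rw [div_mul_eq_mul_div, div_mul_eq_mul_div, div_le_iff₀ hk0]
    rw [hr1] at hDs
    linarith
  · have e : hitArea r₁ r₂ D θ = k ^ 2 * (Real.pi / 2 - θ - Real.sin θ * Real.cos θ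
          + (r₂ / k) ^ 2 * (b - Real.sin b * Real.cos b)) := by
      rw [hitArea, hk, ← hbdef]
      field_simp
    rw [e] at harea
    have h3 : Real.pi * r₂ ^ 2 ≤ k ^ 2 * Real.pi := by
      have := mul_le_mul_of_nonneg_left (pow_le_pow_left₀ h2.le h2k.le 2) Real.pi_pos.le
      linarith
    exact le_of_mul_le_mul_left (harea.trans h3) (by positivity)

/-! ### Sets that survive the iteration -/

section GammaGeneral

variable {S X : Set Plane} {l : ℝ}

lemma gammaSeq_zero_zero : gammaSeq S 0 l 0 = convexHull ℝ S := by simp [gammaSeq, closingQuot]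

lemma gammaSeq_zero_succ (k : ℕ) :
    gammaSeq S 0 l (k + 1) = convexHull ℝ (opening l (gammaSeq S 0 l k) ∩ S) := by
  simp [gammaSeq, closingQuot]

/-- A union of balls of radius `l` contained in an iterate survives the opening, and if it is also
contained in the hull of its part in `S`, it survives the intersection followed by the hull. -/
lemma subset_gammaSeq (h1 : X ⊆ opening l X) (h2 : X ⊆ convexHull ℝ (X ∩ S)) (k : ℕ) :
    X ⊆ gammaSeq S 0 l k := by
  induction k with
  | zero =>
    rw [gammaSeq_zero_zero]
    exact h2.trans (convexHull_mono inter_subset_right)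
  | succ k ih =>
    rw [gammaSeq_zero_succ]
    exact h2.trans (convexHull_mono (inter_subset_inter_left _ (h1.trans (opening_mono ih))))

lemma subset_gammaSet (h1 : X ⊆ opening l X) (h2 : X ⊆ convexHull ℝ (X ∩ S)) :
    X ⊆ gammaSet S 0 l := subset_iInter fun k => subset_gammaSeq h1 h2 k

lemma gammaSet_subset_succ (k : ℕ) :
    gammaSet S 0 l ⊆ convexHull ℝ (opening l (gammaSeq S 0 l k) ∩ S) := by
  rw [← gammaSeq_zero_succ]
  exact iInter_subset _ _

/-- The frontier of a convex set is a null set. -/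
lemma ae_eq_of_between_convex {X Y : Set Plane} (hX : Convex ℝ X) (h1 : X ⊆ Y)
    (h2 : Y ⊆ closure X) : Y =ᵐ[volume] X := by
  refine (ae_le_set.2 ?_).antisymm (Eventually.of_forall h1)
  refine measure_mono_null (fun w hw => ?_) (hX.addHaar_frontier volume)
  exact ⟨h2 hw.1, fun h => hw.2 (interior_subset h)⟩

end GammaGeneral

/-! ### Pushing the iterates through the wedges -/

section Wedge

variable {r₁ r₂ D l θ : ℝ}

/-- The region between two lines symmetric with respect to the axis. -/
def wedge (r θ : ℝ) : Set Plane := {w | w 0 * Real.sin θ + |w 1| * Real.cos θ < r}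

lemma mem_wedge_iff {r : ℝ} {w : Plane} :
    w ∈ wedge r θ ↔ w 0 * Real.sin θ + |w 1| * Real.cos θ < r := Iff.rfl

lemma convex_wedge {r : ℝ} (hc : 0 ≤ Real.cos θ) : Convex ℝ (wedge r θ) := by
  intro v hv w hw p q hp hq hpq
  rw [mem_wedge_iff] at hv hw ⊢
  have h1 : |p * v 1 + q * w 1| ≤ p * |v 1| + q * |w 1| := by
    refine (abs_add_le _ _).trans_eq ?_
    rw [abs_mul, abs_mul, abs_of_nonneg hp, abs_of_nonneg hq]
  have h2 := mul_le_mul_of_nonneg_right h1 hc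
  have h3 : p * (v 0 * Real.sin θ + |v 1| * Real.cos θ)
      + q * (w 0 * Real.sin θ + |w 1| * Real.cos θ) < r := by
    rcases hp.eq_or_lt with h | h
    · rw [← h] at hpq ⊢
      have : q = 1 := by linarith
      rw [this]
      linarith
    · have h4 := mul_lt_mul_of_pos_left hv h
      have h5 := mul_le_mul_of_nonneg_left hw.le hq
      have : p * r + q * r = r := by rw [← add_mul, hpq, one_mul]
      linarith
  simp only [PiLp.add_apply, PiLp.smul_apply, smul_eq_mul]
  linarith

lemma ball_subset_wedge {r a : ℝ} (h : a * Real.sin θ + r₂ ≤ r) :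
    Metric.ball (pt a 0) r₂ ⊆ wedge r θ := by
  intro w hw
  have hr2 : 0 < r₂ := Metric.nonempty_ball.1 ⟨w, hw⟩
  rw [mem_ball_pt hr2.le, sub_zero] at hw
  rw [mem_wedge_iff]
  have h1 : (w 0 - a) * Real.sin θ + |w 1| * Real.cos θ < r₂ := by
    refine lt_of_pow_lt_pow_left₀ 2 hr2.le (lt_of_le_of_lt ?_ hw)
    have h2 := sq_nonneg ((w 0 - a) * Real.cos θ - |w 1| * Real.sin θ)
    have h3 := Real.sin_sq_add_cos_sq θ
    have h4 := sq_abs (w 1)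
    linear_combination h2 + ((w 0 - a) ^ 2 + |w 1| ^ 2) * h3 + h4
  linarith

lemma center_of_ball_subset_wedge {r : ℝ} {p : Plane} (hl : 0 < l)
    (hc : 0 ≤ Real.cos θ) (h : Metric.ball p l ⊆ wedge r θ) : p 0 * Real.sin θ + |p 1| * Real.cos θ ≤ r - l := by
  have hsq := Real.sin_sq_add_cos_sq θ
  obtain ⟨ε, hε, habs⟩ : ∃ ε : ℝ, ε ^ 2 = 1 ∧ ∀ t : ℝ, 0 ≤ t → |p 1 + ε * t| = |p 1| + t := by
    rcases le_total 0 (p 1) with h0 | h0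
    · refine ⟨1, by norm_num, fun t ht => ?_⟩
      rw [abs_of_nonneg h0, one_mul, abs_of_nonneg (by linarith)]
    · refine ⟨-1, by norm_num, fun t ht => ?_⟩
      rw [abs_of_nonpos h0, abs_of_nonpos (by linarith)]
      ring
  by_contra hcon
  push Not at hcon
  -- This is the distance from `p` to the side of the wedge along its outward normal, cut off at
  -- zero. If the claim failed, it would be less than `l`, and the point of the ball at this
  -- distance along the normal would lie outside the wedge.
  set τ := max 0 (r - (p 0 * Real.sin θ + |p 1| * Real.cos θ)) with hτ
  have hτ0 : 0 ≤ τ := le_max_left _ _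
  have hτl : τ < l := max_lt hl (by linarith)
  have hmem := h (show pt (p 0 + τ * Real.sin θ) (p 1 + ε * (τ * Real.cos θ)) ∈ Metric.ball p l by
    rw [Metric.mem_ball, dist_lt_iff_sq hl.le, pt_zero, pt_one]
    have : (p 0 + τ * Real.sin θ - p 0) ^ 2 + (p 1 + ε * (τ * Real.cos θ) - p 1) ^ 2 = τ ^ 2 := by
      linear_combination τ ^ 2 * hsq + (τ * Real.cos θ) ^ 2 * hε
    rw [this]
    exact pow_lt_pow_left₀ hτl hτ0 two_ne_zero)
  rw [mem_wedge_iff, pt_zero, pt_one, habs _ (mul_nonneg hτ0 hc)] at hmem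
  have h1 := le_max_right 0 (r - (p 0 * Real.sin θ + |p 1| * Real.cos θ))
  rw [← hτ] at h1
  have h3 : τ * (Real.sin θ ^ 2 + Real.cos θ ^ 2) = τ := by rw [hsq, mul_one]
  linarith

/-- Below the touching radius, the disks in the wedge do not touch its sides in the second disk. -/
lemma mem_wedge_of_hitRad_lt {w p : Plane} (hc : 0 < Real.cos θ)
    (hs : 0 < Real.sin θ) (hδ : offs r₁ D θ ^ 2 ≤ r₂ ^ 2) (hl0 : 0 < l)
    (hl : hitRad r₁ r₂ D θ < l)
    (hw : (w 0 - D) ^ 2 + w 1 ^ 2 ≤ r₂ ^ 2) (hd : (w 0 - p 0) ^ 2 + (w 1 - p 1) ^ 2 ≤ l ^ 2)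
    (hp : p 0 * Real.sin θ + |p 1| * Real.cos θ ≤ r₁ - l) : w ∈ wedge r₁ θ := by
  rw [mem_wedge_iff]
  -- If `w` were not inside, the ball of radius `l` around `p` would touch the side of the wedge
  -- exactly at `w`, so `|w 1| ≥ l cos θ`. But the points of the side in the closed second disk have
  -- ordinates at most `hitRad cos θ < l cos θ`.
  by_contra hcon
  push Not at hcon
  have hsq := Real.sin_sq_add_cos_sq θ
  set s := Real.sin θ
  set c := Real.cos θ
  obtain ⟨a, ha⟩ : ∃ a, a = w 0 - p 0 := ⟨_, rfl⟩
  obtain ⟨b, hb⟩ : ∃ b, b = |w 1| - |p 1| := ⟨_, rfl⟩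
  have hab : a ^ 2 + b ^ 2 ≤ l ^ 2 := by
    have h1 : b ^ 2 ≤ (w 1 - p 1) ^ 2 := by
      rw [hb, sq_le_sq]
      exact abs_abs_sub_abs_le _ _
    rw [ha]
    linarith
  have h1 : l ≤ a * s + b * c := by rw [ha, hb]; linarith
  have hrot : (a * s + b * c) ^ 2 + (a * c - b * s) ^ 2 = a ^ 2 + b ^ 2 := by
    linear_combination (a ^ 2 + b ^ 2) * hsq
  have h2 : a * s + b * c = l := by
    refine le_antisymm ?_ h1
    exact le_of_sq_le_sq (by linarith [sq_nonneg (a * c - b * s)]) hl0.le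
  have h3 : a * c - b * s = 0 := by
    have : (a * c - b * s) ^ 2 ≤ 0 := by
      rw [h2] at hrot
      linarith
    exact pow_eq_zero_iff two_ne_zero |>.1 (le_antisymm this (sq_nonneg _))
  have hbl : b = l * c := by linear_combination c * h2 - s * h3 - b * hsq
  have hy : l * c ≤ |w 1| := by linarith [abs_nonneg (p 1)]
  have hg : w 0 * s + |w 1| * c = r₁ := by
    refine le_antisymm ?_ hcon
    rw [ha, hb] at h2
    linarith
  have hchord : halfChord r₁ r₂ D θ ^ 2 = r₂ ^ 2 - offs r₁ D θ ^ 2 := Real.sq_sqrt (by linarith)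
  have ho : offs r₁ D θ = (w 0 - D) * s + |w 1| * c := by
    rw [offs, ← hg]
    ring
  have hτ : |w 1| * s - (w 0 - D) * c ≤ halfChord r₁ r₂ D θ := by
    refine le_of_sq_le_sq ?_ (Real.sqrt_nonneg _)
    rw [hchord, ho]
    have := sq_abs (w 1)
    linear_combination hw + this + ((w 0 - D) ^ 2 + |w 1| ^ 2) * hsq
  have hmul : hitRad r₁ r₂ D θ * c = offs r₁ D θ * c + s * halfChord r₁ r₂ D θ := by
    rw [hitRad]
    change (offs r₁ D θ + s / c * halfChord r₁ r₂ D θ) * c = _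
    field_simp
  have h5 := mul_le_mul_of_nonneg_left hτ hs.le
  have h6 := mul_lt_mul_of_pos_right hl hc
  have h7 : |w 1| = offs r₁ D θ * c + s * (|w 1| * s - (w 0 - D) * c) := by
    rw [ho]
    linear_combination -|w 1| * hsq
  linarith

/-- The pairs of a point of the second disk and a ball centre range over a compact set. The strict
inclusion therefore persists when the angle of the wedge containing the balls and the angle of the
wedge to be reached vary independently near `θ`. -/
lemma eventually_mem_wedge (hc : 0 < Real.cos θ) (hs : 0 < Real.sin θ)
    (hδ : offs r₁ D θ ^ 2 ≤ r₂ ^ 2) (hl0 : 0 < l) (hl : hitRad r₁ r₂ D θ < l) :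
    ∀ᶠ z : ℝ × ℝ in 𝓝 (θ, θ), ∀ y ∈ Metric.closedBall (pt D 0) r₂ ×ˢ
      Metric.closedBall (pt D 0) (r₂ + l), dist y.1 y.2 ≤ l →
      y.2 0 * Real.sin z.1 + |y.2 1| * Real.cos z.1 ≤ r₁ - l → y.1 ∈ wedge r₁ z.2 := by
  refine ((isCompact_closedBall _ _).prod
    (isCompact_closedBall _ _)).eventually_forall_of_forall_eventually fun y hy => ?_
  have hc0 : Continuous fun v : Plane => v 0 := by fun_prop
  have hc1 : Continuous fun v : Plane => v 1 := by fun_prop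
  by_cases h1 : dist y.1 y.2 ≤ l
  · by_cases h3 : y.2 0 * Real.sin θ + |y.2 1| * Real.cos θ ≤ r₁ - l
    · have hw : y.1 ∈ wedge r₁ θ := by
        refine mem_wedge_of_hitRad_lt hc hs hδ hl0 hl ?_ ?_ h3
        · have := pow_le_pow_left₀ dist_nonneg (Metric.mem_closedBall.1 hy.1) 2
          rwa [dist_pt_sq, sub_zero] at this
        · rw [← plane_dist_sq]
          exact pow_le_pow_left₀ dist_nonneg h1 2
      have hcont : Continuous fun z : (ℝ × ℝ) × (Plane × Plane) =>
          z.2.1 0 * Real.sin z.1.2 + |z.2.1 1| * Real.cos z.1.2 := by fun_prop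
      filter_upwards [(hcont.tendsto ((θ, θ), y)).eventually_lt_const (u := r₁) hw] with z hz _ _ using hz
    · have hcont : Continuous fun z : (ℝ × ℝ) × (Plane × Plane) =>
          z.2.2 0 * Real.sin z.1.1 + |z.2.2 1| * Real.cos z.1.1 := by fun_prop
      filter_upwards [(hcont.tendsto ((θ, θ), y)).eventually_const_lt (not_le.1 h3)]
        with z hz _ hz' using absurd hz' (not_le.2 hz)
  · have hcont : Continuous fun z : (ℝ × ℝ) × (Plane × Plane) => dist z.2.1 z.2.2 := by fun_prop
    filter_upwards [(hcont.tendsto ((θ, θ), y)).eventually_const_lt (not_le.1 h1)] with z hz hz' using absurd hz' (not_le.2 hz)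

/-- The sequence reaches every wedge before the first angle at which the touching radius is hit. -/
theorem exists_gammaSeq_subset_wedge (h2 : 0 < r₂) (hlt : r₂ < r₁) (hD : r₁ + r₂ ≤ D)
    (hl0 : 0 < l) {t : ℝ} (ht0 : angleStart r₁ r₂ D ≤ t) (ht : t < angleEnd r₁ r₂ D)
    (h : ∀ x ∈ Icc (angleStart r₁ r₂ D) t, hitRad r₁ r₂ D x < l) :
    ∃ k, gammaSeq (twoDisks r₁ r₂ D) 0 l k ⊆ wedge r₁ t := by
  set s := {θ | ∃ k, gammaSeq (twoDisks r₁ r₂ D) 0 l k ⊆ wedge r₁ θ} with hsdef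
  have hdom : ∀ x ∈ Icc (angleStart r₁ r₂ D) t, 0 < Real.cos x ∧ 0 < Real.sin x ∧
      offs r₁ D x ^ 2 ≤ r₂ ^ 2 := fun x hx => by
    obtain ⟨d1, d2, d3⟩ := hit_domain h2 hlt hD ⟨hx.1, hx.2.trans_lt ht⟩
    exact ⟨d1, Real.sin_pos_of_pos_of_lt_pi d3.1 (by linarith [d3.2, Real.pi_pos]), d2⟩
  -- Around each angle of the interval there is a neighbourhood in which one further iteration leads
  -- from any wedge to any other. The set of angles reached is thus open and closed in the interval,
  -- and it contains the initial angle, where the hull of the two disks lies in the wedge.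
  have step : ∀ x ∈ Icc (angleStart r₁ r₂ D) t, ∃ N ∈ 𝓝 x, ∀ y ∈ N, ∀ z ∈ N, y ∈ s → z ∈ s := by
    intro x hx
    obtain ⟨d1, d2, d3⟩ := hdom x hx
    have hev := eventually_mem_wedge d1 d2 d3 hl0 (h x hx)
    have hcos : ∀ᶠ z : ℝ × ℝ in 𝓝 (x, x), 0 < Real.cos z.1 ∧ 0 < Real.cos z.2 :=
      (((Real.continuous_cos.comp continuous_fst).tendsto (x, x)).eventually_const_lt d1).and
        (((Real.continuous_cos.comp continuous_snd).tendsto (x, x)).eventually_const_lt d1)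
    have hall := hev.and hcos
    rw [nhds_prod_eq, eventually_prod_self_iff'] at hall
    obtain ⟨N, hN, hN'⟩ := hall
    refine ⟨N, hN, fun y hy z hz hys => ?_⟩
    obtain ⟨k, hk⟩ := hys
    obtain ⟨e1, e2, e3⟩ := hN' y hy z hz
    refine ⟨k + 1, ?_⟩
    rw [gammaSeq_zero_succ]
    refine convexHull_min ?_ (convex_wedge e3.le)
    rintro w ⟨hw, hwS⟩
    rcases hwS with hwS | hwS
    · exact ball_subset_wedge (by linarith) hwS
    · obtain ⟨p, hp, hwp⟩ := mem_opening.1 hw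
      have hwS' := Metric.mem_ball.1 hwS
      refine e1 (w, p) ⟨Metric.ball_subset_closedBall hwS, ?_⟩ hwp.le
        (center_of_ball_subset_wedge hl0 e2.le (hp.trans hk))
      rw [Metric.mem_closedBall]
      have := dist_triangle p w (pt D 0)
      rw [dist_comm p w] at this
      linarith
  have hcl : IsClosed (s ∩ Icc (angleStart r₁ r₂ D) t) := by
    refine isClosed_of_closure_subset fun x hx => ?_
    have hxI : x ∈ Icc (angleStart r₁ r₂ D) t :=
      closure_minimal inter_subset_right isClosed_Icc hx
    obtain ⟨N, hN, hN'⟩ := step x hxI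
    obtain ⟨y, hyN, hys, -⟩ := mem_closure_iff_nhds.1 hx N hN
    exact ⟨hN' y hyN x (mem_of_mem_nhds hN) hys, hxI⟩
  have hbase : angleStart r₁ r₂ D ∈ s := by
    refine ⟨0, ?_⟩
    rw [gammaSeq_zero_zero]
    refine convexHull_min (union_subset (ball_subset_wedge (by linarith))
      (ball_subset_wedge ?_)) (convex_wedge (hdom _ ⟨le_rfl, ht0⟩).1.le)
    rw [sin_angleStart h2 hlt hD]
    linarith
  refine hcl.Icc_subset_of_forall_mem_nhdsWithin hbase (fun x hx => ?_) ⟨ht0, le_rfl⟩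
  obtain ⟨N, hN, hN'⟩ := step x ⟨hx.2.1, hx.2.2.le⟩
  exact mem_nhdsWithin_of_mem_nhds
    (mem_of_superset hN fun y hy => hN' x (mem_of_mem_nhds hN) y hy hx.1)

end Wedge

/-! ### Identification of the limit set -/

section GammaIdentification

variable {r₁ r₂ D l θ : ℝ}

lemma left_subset_gammaSet (hl0 : 0 < l) (hl : l ≤ r₁) :
    Metric.ball (pt 0 0) r₁ ⊆ gammaSet (twoDisks r₁ r₂ D) 0 l := by
  refine subset_gammaSet (ball_subset_opening hl0 hl subset_rfl) ?_
  have h : Metric.ball (pt 0 0) r₁ ∩ twoDisks r₁ r₂ D = Metric.ball (pt 0 0) r₁ :=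
    inter_eq_left.2 subset_union_left
  rw [h]
  exact subset_convexHull ℝ _

/-- An opening radius of at most `r₂` keeps both disks, so each iterate is again their convex hull.
-/
lemma gammaSet_eq_convexHull (hl0 : 0 < l) (hl : l ≤ r₂) (hle : r₂ ≤ r₁) :
    gammaSet (twoDisks r₁ r₂ D) 0 l = convexHull ℝ (twoDisks r₁ r₂ D) := by
  have hsub : twoDisks r₁ r₂ D ⊆ opening l (convexHull ℝ (twoDisks r₁ r₂ D)) :=
    union_subset
      (ball_subset_opening hl0 (hl.trans hle) (subset_union_left.trans (subset_convexHull ℝ _)))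
      (ball_subset_opening hl0 hl (subset_union_right.trans (subset_convexHull ℝ _)))
  refine Subset.antisymm ((iInter_subset _ 0).trans_eq gammaSeq_zero_zero) ?_
  refine subset_iInter fun k => ?_
  induction k with
  | zero => rw [gammaSeq_zero_zero]
  | succ k ih =>
    rw [gammaSeq_zero_succ]
    exact convexHull_mono (subset_inter (hsub.trans (opening_mono ih)) subset_rfl)

/-- The convex hull lies in the strip of half width `r₁`, the wedge of angle zero, which contains no
ball of larger radius. The first opening is already empty. -/
lemma gammaSet_eq_empty (hl0 : 0 < l) (hl : r₁ < l) (hle : r₂ ≤ r₁) :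
    gammaSet (twoDisks r₁ r₂ D) 0 l = ∅ := by
  have hw : convexHull ℝ (twoDisks r₁ r₂ D) ⊆ wedge r₁ 0 :=
    convexHull_min (union_subset (ball_subset_wedge (by simp)) (ball_subset_wedge (by simpa)))
      (convex_wedge (by simp))
  have ho : opening l (gammaSeq (twoDisks r₁ r₂ D) 0 l 0) = ∅ := by
    rw [gammaSeq_zero_zero]
    refine eq_empty_iff_forall_notMem.2 fun w hw' => ?_
    obtain ⟨p, hp, -⟩ := mem_opening.1 hw'
    have := center_of_ball_subset_wedge hl0 (by simp) (hp.trans hw)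
    simp only [Real.sin_zero, Real.cos_zero, mul_zero, mul_one, zero_add] at this
    linarith [abs_nonneg (p 1)]
  refine subset_empty_iff.1 ((gammaSet_subset_succ 0).trans ?_)
  rw [ho, empty_inter, convexHull_empty]

lemma hullData_wedge (hl0 : 0 < l) (hl : l < r₁) (hθ : θ ∈ Ioo 0 (Real.pi / 2)) :
    HullData r₁ ((r₁ - l) / Real.sin θ) l (Real.sin θ) (Real.cos θ) := by
  have hs := Real.sin_pos_of_pos_of_lt_pi hθ.1 (by linarith [hθ.2, Real.pi_pos])
  exact ⟨hl0, hl.le, div_pos (by linarith) hs, hs.le,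
    Real.cos_pos_of_mem_Ioo ⟨by linarith [hθ.1, Real.pi_pos], hθ.2⟩,
    Real.sin_sq_add_cos_sq θ, by field_simp⟩

/-- Opening a subset of a wedge rounds its tip. -/
lemma opening_inter_subset_profile (hl0 : 0 < l) (hl : l < r₁) (hD : r₁ + r₂ ≤ D)
    (hθ : θ ∈ Ioo 0 (Real.pi / 2)) {Y : Set Plane} (hY : Y ⊆ wedge r₁ θ) :
    opening l Y ∩ twoDisks r₁ r₂ D
      ⊆ profile (hullFun r₁ ((r₁ - l) / Real.sin θ) l (Real.sin θ) (Real.cos θ)) := by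
  have H := hullData_wedge hl0 hl hθ
  have hs := Real.sin_pos_of_pos_of_lt_pi hθ.1 (by linarith [hθ.2, Real.pi_pos])
  rintro w ⟨hw, hwS⟩
  rcases hwS with hwS | hwS
  · refine H.ball_subset_profile (t := 0) ⟨le_rfl, zero_le_one⟩ ?_
    rw [zero_mul, zero_mul, sub_zero]
    exact hwS
  obtain ⟨p, hp, hwp⟩ := mem_opening.1 hw
  have hpw := center_of_ball_subset_wedge hl0 H.c_pos.le (hp.trans hY)
  have hww : w ∈ wedge r₁ θ := hY (opening_subset _ _ hw)
  have hr2 : 0 < r₂ := Metric.nonempty_ball.1 ⟨w, hwS⟩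
  rw [mem_ball_pt hr2.le, sub_zero] at hwS
  have hw0 : D - r₂ < w 0 := by
    have := (abs_lt_of_sq_lt_sq' (by linarith [sq_nonneg (w 1)] : (w 0 - D) ^ 2 < r₂ ^ 2) hr2.le).1
    linarith
  rw [mem_wedge_iff] at hww
  rw [dist_lt_iff_sq hl0.le] at hwp
  have hr1 := mul_le_mul_of_nonneg_left (Real.sin_le_one θ) (hl0.trans hl).le
  rw [H.mem_profile_iff]
  refine ⟨fun h => by linarith, fun _ _ => hww, fun h => lt_of_le_of_lt ?_ hwp⟩
  have hc := H.c_pos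
  have hu := H.unit
  have hrel := H.rel
  set s := Real.sin θ
  set c := Real.cos θ
  set q := (r₁ - l) / s
  clear_value q
  have hsq := sq_abs (w 1)
  obtain ⟨b, hb⟩ : ∃ b, b = |w 1| := ⟨_, rfl⟩
  obtain ⟨p', hp'⟩ : ∃ p', p' = |p 1| := ⟨_, rfl⟩
  have hb0 : 0 ≤ b := hb ▸ abs_nonneg _
  have hp0 : 0 ≤ p' := hp' ▸ abs_nonneg _
  rw [← hb] at hww hsq
  rw [← hp'] at hpw
  have h1 : p' * c ≤ (q - p 0) * s := by linarith
  have h2 : b * c < l * c ^ 2 := by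
    have := mul_lt_mul_of_pos_right h hs
    linear_combination hww + this - hrel - l * hu
  have h3 : b < l * c := by
    refine lt_of_mul_lt_mul_right ?_ hc.le
    linarith
  have h4 : b * s ≤ (w 0 - q) * c := by
    have h5 := mul_lt_mul_of_pos_right h3 hs
    have h6 := mul_lt_mul_of_pos_right h hc
    linarith
  have hqp : 0 ≤ q - p 0 := by
    refine le_of_mul_le_mul_right ?_ hs
    linarith [mul_nonneg hp0 hc.le]
  -- The vectors from the centre `(q, 0)` of the tip to `w` and to `p` make an angle that is at
  -- least a right one. Hence `w` is no farther from `(q, 0)` than from `p`.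
  have h7 : b * p' ≤ (w 0 - q) * (q - p 0) := by
    refine le_of_mul_le_mul_right ?_ (mul_pos hs hc)
    have k1 := mul_le_mul_of_nonneg_left h1 (mul_nonneg hb0 hs.le)
    have k2 := mul_le_mul_of_nonneg_right h4 (mul_nonneg hqp hs.le)
    linarith
  have h8 : w 1 * p 1 ≤ b * p' := by
    rw [hb, hp', ← abs_mul]
    exact le_abs_self _
  have h9 := sq_nonneg (q - p 0)
  have h10 := sq_nonneg (p 1)
  linarith

lemma gammaSet_subset_profile (h2 : 0 < r₂) (hlt : r₂ < r₁) (hD : r₁ + r₂ ≤ D) (hl0 : 0 < l)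
    (hl : l < r₁) (hθ : θ ∈ Ico (angleStart r₁ r₂ D) (angleEnd r₁ r₂ D))
    (h : ∀ x ∈ Icc (angleStart r₁ r₂ D) θ, hitRad r₁ r₂ D x < l) :
    gammaSet (twoDisks r₁ r₂ D) 0 l
      ⊆ profile (hullFun r₁ ((r₁ - l) / Real.sin θ) l (Real.sin θ) (Real.cos θ)) := by
  have hm := (hit_domain h2 hlt hD hθ).2.2
  obtain ⟨k, hk⟩ := exists_gammaSeq_subset_wedge h2 hlt hD hl0 hθ.1 hθ.2 h
  exact (gammaSet_subset_succ k).trans (convexHull_min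
    (opening_inter_subset_profile hl0 hl hD hm hk) (hullData_wedge hl0 hl hm).convex_profile)

/-- At the angle of the hit itself the strict inequality fails, so the inclusion is used for smaller
angles; the corresponding hulls converge as the angle increases to `θ`. -/
lemma gammaSet_subset_closure (h2 : 0 < r₂) (hlt : r₂ < r₁) (hD : r₁ + r₂ ≤ D) (hl0 : 0 < l)
    (hl : l < r₁) (hθ : θ ∈ Ioo (angleStart r₁ r₂ D) (angleEnd r₁ r₂ D))
    (h : ∀ x ∈ Ico (angleStart r₁ r₂ D) θ, hitRad r₁ r₂ D x < l) :
    gammaSet (twoDisks r₁ r₂ D) 0 l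
      ⊆ closure (profile (hullFun r₁ ((r₁ - l) / Real.sin θ) l (Real.sin θ) (Real.cos θ))) := by
  have hm := (hit_domain h2 hlt hD ⟨hθ.1.le, hθ.2⟩).2.2
  have H := hullData_wedge hl0 hl hm
  have hs := Real.sin_pos_of_pos_of_lt_pi hm.1 (by linarith [hm.2, Real.pi_pos])
  intro w hw
  refine Metric.mem_closure_iff.2 fun ε hε => ?_
  have hcont : ContinuousAt (fun x => (r₁ - l) / Real.sin x) θ := by
    have := hs.ne'
    fun_prop (disch := assumption)
  have hev := (hcont.tendsto.mono_left (nhdsWithin_le_nhds (s := Iio θ))).eventually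
    (Metric.ball_mem_nhds _ hε)
  obtain ⟨x, hx1, hx2⟩ := (hev.and (Ioo_mem_nhdsLT hθ.1)).exists
  have hxm := (hit_domain h2 hlt hD ⟨hx2.1.le, hx2.2.trans hθ.2⟩).2.2
  obtain ⟨t, ht, hwt⟩ := (hullData_wedge hl0 hl hxm).exists_ball_of_mem
    (gammaSet_subset_profile h2 hlt hD hl0 hl ⟨hx2.1.le, hx2.2.trans hθ.2⟩
      (fun y hy => h y ⟨hy.1, hy.2.trans_lt hx2.2⟩) hw)
  set q := (r₁ - l) / Real.sin θ
  set q' := (r₁ - l) / Real.sin x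
  have hρ : 0 < r₁ - t * (r₁ - l) := by
    have := mul_le_mul_of_nonneg_right ht.2 (by linarith : 0 ≤ r₁ - l)
    linarith
  have hqq : dist (pt (t * q') 0) (pt (t * q) 0) < ε := by
    rw [dist_lt_iff_sq hε.le, pt_zero, pt_zero, pt_one, pt_one]
    have h3 : (q' - q) ^ 2 < ε ^ 2 := by
      rw [Real.dist_eq] at hx1
      rw [← sq_abs]
      exact pow_lt_pow_left₀ hx1 (abs_nonneg _) two_ne_zero
    have h4 : t ^ 2 * (q' - q) ^ 2 ≤ 1 * (q' - q) ^ 2 :=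
      mul_le_mul_of_nonneg_right (pow_le_one₀ ht.1 ht.2) (sq_nonneg _)
    linarith
  have hmem : w ∈ Metric.ball (pt (t * q) 0) (ε + (r₁ - t * (r₁ - l))) := by
    rw [Metric.mem_ball]
    have := dist_triangle w (pt (t * q') 0) (pt (t * q) 0)
    linarith
  rw [← thickening_ball hε hρ, Metric.mem_thickening_iff] at hmem
  obtain ⟨z, hz, hwz⟩ := hmem
  exact ⟨z, H.ball_subset_profile ht hz, hwz⟩

/-- The radical axis of the second disk and the tip of the hull at a hit. -/
lemma HitData.power (H : HitData r₁ r₂ D θ) (x : ℝ) :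
    (x - (r₁ - hitRad r₁ r₂ D θ) / Real.sin θ) ^ 2 - hitRad r₁ r₂ D θ ^ 2 - ((x - D) ^ 2 - r₂ ^ 2)
      = 2 * (halfChord r₁ r₂ D θ / Real.cos θ) * (x - ((r₁ - hitRad r₁ r₂ D θ) / Real.sin θ
        + hitRad r₁ r₂ D θ * Real.sin θ)) := by
  have hs := H.sin_pos
  have hc := H.cos_pos
  have hu := Real.sin_sq_add_cos_sq θ
  have hw := H.halfChord_sq
  obtain ⟨k, hk⟩ : ∃ k, k = halfChord r₁ r₂ D θ / Real.cos θ := ⟨_, rfl⟩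
  have hkw : halfChord r₁ r₂ D θ = k * Real.cos θ := by rw [hk]; field_simp
  have hq : (r₁ - hitRad r₁ r₂ D θ) / Real.sin θ = D - k := by
    rw [sub_hitRad, hk]
    field_simp
  have hl : hitRad r₁ r₂ D θ = offs r₁ D θ + Real.sin θ * k := by
    rw [hitRad, hk]
    ring
  rw [hkw] at hw
  rw [hq, ← hk, hl]
  linear_combination -hw + k ^ 2 * hu

/-- Both sides are the abscissa of the entrance point, seen from the tip disk and from the second
disk. -/
lemma HitData.tip (H : HitData r₁ r₂ D θ) :
    (r₁ - hitRad r₁ r₂ D θ) / Real.sin θ + hitRad r₁ r₂ D θ * Real.sin θ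
      = D - r₂ * Real.cos (hitAngle r₁ r₂ D θ) := by
  have hs := H.sin_pos
  have hc := H.cos_pos
  have hu := Real.sin_sq_add_cos_sq θ
  have e1 : (r₁ - hitRad r₁ r₂ D θ) / Real.sin θ = D - halfChord r₁ r₂ D θ / Real.cos θ := by
    rw [sub_hitRad]
    field_simp
  rw [e1, H.cos_hitAngle, hitRad]
  field_simp
  linear_combination halfChord r₁ r₂ D θ * hu

/-- The data of a convex set that contains the first disk: the excess of the perimeter and the area
of the part in the second disk. -/
structure ExcessData (r₁ r₂ D : ℝ) (X : Set Plane) (P A : ℝ) : Prop where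
  perimeter : perimeter X = ENNReal.ofReal (2 * (Real.pi * r₁) + P)
  P_nonneg : 0 ≤ P
  volume : volume X ≠ ⊤
  left : Metric.ball (pt 0 0) r₁ ⊆ X
  area : area (X ∩ Metric.ball (pt D 0) r₂) = A

lemma ExcessData.per {X : Set Plane} {P A : ℝ} (h : ExcessData r₁ r₂ D X P A) (h1 : 0 < r₁) :
    per X = 2 * (Real.pi * r₁) + P := by
  have := h.P_nonneg
  rw [_root_.per, h.perimeter, ENNReal.toReal_ofReal (by positivity)]

lemma disjoint_disks (h1 : 0 < r₁) (h2 : 0 < r₂) (hD : r₁ + r₂ ≤ D) :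
    Disjoint (Metric.ball (pt 0 0) r₁) (Metric.ball (pt D 0) r₂) := by
  refine Metric.ball_disjoint_ball ?_
  rw [le_dist_iff_sq (by linarith), pt_zero, pt_zero, pt_one, pt_one]
  have := pow_le_pow_left₀ (by linarith) hD 2
  linarith

lemma ExcessData.energy_eq {X : Set Plane} {P A : ℝ} (h : ExcessData r₁ r₂ D X P A) (h1 : 0 < r₁)
    (h2 : 0 < r₂) (hD : r₁ + r₂ ≤ D) (l : ℝ) : energy (twoDisks r₁ r₂ D) 0 l X
      = ((2 * (Real.pi * r₁) + P - 1 / l * (Real.pi * r₁ ^ 2 + A) : ℝ) : EReal) := by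
  have hP : _root_.perimeter X ≠ ⊤ := by rw [h.perimeter]; exact ENNReal.ofReal_ne_top
  have hv : _root_.area (X ∩ twoDisks r₁ r₂ D) = Real.pi * r₁ ^ 2 + A := by
    have e : X ∩ twoDisks r₁ r₂ D
        = Metric.ball (pt 0 0) r₁ ∪ X ∩ Metric.ball (pt D 0) r₂ := by
      rw [twoDisks, inter_union_distrib_left, inter_eq_right.2 h.left]
    rw [e, ← h.area, _root_.area, measure_union' ((disjoint_disks h1 h2 hD).mono_right
      inter_subset_right) measurableSet_ball, ENNReal.toReal_add measure_ball_lt_top.ne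
      (measure_ne_top_of_subset inter_subset_left h.volume)]
    congr 1
    exact area_ball h1
  rw [energy_eq_coe hP h.volume, hv, h.per h1]
  norm_num

/-- The energy of a set agrees with that of the first disk if and only if the excess balances. -/
lemma ExcessData.energy_eq_iff {X : Set Plane} {P A : ℝ} (h : ExcessData r₁ r₂ D X P A)
    (h2 : 0 < r₂) (hle : r₂ ≤ r₁) (hD : r₁ + r₂ ≤ D) (hl0 : 0 < l) :
    energy (twoDisks r₁ r₂ D) 0 l X = energy (twoDisks r₁ r₂ D) 0 l (Metric.ball (pt 0 0) r₁)
      ↔ l * P = A := by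
  rw [h.energy_eq (h2.trans_le hle) h2 hD, energy_left h2 hle, EReal.coe_eq_coe_iff]
  constructor
  · intro e
    field_simp at e
    linarith
  · intro e
    rw [← e]
    field_simp
    ring

lemma excessData_convexHull (h2 : 0 < r₂) (hle : r₂ ≤ r₁) (hD : r₁ + r₂ ≤ D)
    (hP : 2 * (Real.pi * r₁) ≤ hullPer r₁ r₂ D) :
    ExcessData r₁ r₂ D (convexHull ℝ (twoDisks r₁ r₂ D)) (hullPer r₁ r₂ D - 2 * (Real.pi * r₁))
      (Real.pi * r₂ ^ 2) where
  perimeter := by rw [convexHull_twoDisks_perimeter h2 hle hD]; congr 1; ring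
  P_nonneg := by linarith
  volume := (convexHull_finite h2 hle hD).2
  left := subset_union_left.trans (subset_convexHull ℝ _)
  area := by
    rw [inter_eq_right.2 (subset_union_right.trans (subset_convexHull ℝ (twoDisks r₁ r₂ D)))]
    exact area_ball h2

/-- The radical axis of the tip disk and the second disk is the vertical line through the entrance
points. To its left the second disk is contained in the tip disk and thus in the hull; to its right
the hull is the tip disk, which is there contained in the second disk. -/
lemma HitData.profile_inter (H : HitData r₁ r₂ D θ)
    (hH : HullData r₁ ((r₁ - hitRad r₁ r₂ D θ) / Real.sin θ) (hitRad r₁ r₂ D θ) (Real.sin θ)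
      (Real.cos θ)) :
    profile (hullFun r₁ ((r₁ - hitRad r₁ r₂ D θ) / Real.sin θ) (hitRad r₁ r₂ D θ) (Real.sin θ)
      (Real.cos θ)) ∩ Metric.ball (pt D 0) r₂
      = profile fun x => if x ≤ D - r₂ * Real.cos (hitAngle r₁ r₂ D θ) then arcFun r₂ D x
        else arcFun (hitRad r₁ r₂ D θ) ((r₁ - hitRad r₁ r₂ D θ) / Real.sin θ) x := by
  have hk : 0 < halfChord r₁ r₂ D θ / Real.cos θ := div_pos H.halfChord_pos H.cos_pos
  ext w
  have hpow := H.power (w 0)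
  rw [H.tip] at hpow
  have hknot := hH.knot_lt
  rw [mem_inter_iff, mem_ball_pt H.r₂_pos.le, sub_zero]
  rw [profile, profile, mem_ofPred_eq, mem_ofPred_eq]
  split_ifs with h
  · rw [abs_lt_arcFun]
    refine ⟨fun h' => h'.2, fun h' => ⟨?_, h'⟩⟩
    refine hH.ball_subset_profile (t := 1) ⟨zero_le_one, le_rfl⟩ ?_
    rw [one_mul, one_mul, dist_lt_iff_sq (by linarith [hH.ρ_pos]), pt_zero, pt_one, sub_zero]
    have := mul_nonpos_of_nonneg_of_nonpos hk.le (sub_nonpos.2 h)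
    linarith
  · push Not at h
    rw [abs_lt_arcFun]
    have hm := hH.mem_profile_iff (w := w)
    rw [H.tip] at hm hknot
    have := mul_pos hk (sub_pos.2 h)
    refine ⟨fun h' => (hm.1 h'.1).2.2 h, fun h' => ⟨hm.2 ⟨fun h3 => ?_, fun _ h3 => ?_,
      fun _ => h'⟩, by linarith⟩⟩ <;> linarith

/-- The intersection consists of a segment of the second disk and a segment of the tip disk on a
common chord; the chord terms combine through `sin_hitAngle`. -/
lemma HitData.area_inter (H : HitData r₁ r₂ D θ)
    (hH : HullData r₁ ((r₁ - hitRad r₁ r₂ D θ) / Real.sin θ) (hitRad r₁ r₂ D θ) (Real.sin θ)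
      (Real.cos θ)) :
    area (profile (hullFun r₁ ((r₁ - hitRad r₁ r₂ D θ) / Real.sin θ) (hitRad r₁ r₂ D θ)
      (Real.sin θ) (Real.cos θ)) ∩ Metric.ball (pt D 0) r₂) = hitArea r₁ r₂ D θ := by
  have h2 := H.r₂_pos
  have hb := H.hitAngle_mem
  have hsb := H.sin_hitAngle
  have hl := H.hitRad_pos
  have htip := H.tip
  have hA0 := hitArea_nonneg θ H
  have hm := H.mem
  have ls := mul_pos hl (sub_pos.2 H.sin_lt_one)
  have ls' := mul_pos hl H.sin_pos
  rw [H.profile_inter hH]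
  have hu := Real.sin_sq_add_cos_sq θ
  have hub := Real.sin_sq_add_cos_sq (hitAngle r₁ r₂ D θ)
  have hA : hitArea r₁ r₂ D θ = hitRad r₁ r₂ D θ ^ 2 * (Real.pi / 2 - θ - Real.sin θ * Real.cos θ)
    + r₂ ^ 2 * (hitAngle r₁ r₂ D θ
      - Real.sin (hitAngle r₁ r₂ D θ) * Real.cos (hitAngle r₁ r₂ D θ)) := rfl
  set b := hitAngle r₁ r₂ D θ
  set l := hitRad r₁ r₂ D θ
  set q := (r₁ - l) / Real.sin θ
  set x := D - r₂ * Real.cos b with hx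
  have hcos1 := mul_le_mul_of_nonneg_left (Real.cos_le_one b) h2.le
  have hcos2 := mul_le_mul_of_nonneg_left (Real.neg_one_le_cos b) h2.le
  have hy : 0 ≤ r₂ * Real.sin b := mul_nonneg h2.le (Real.sin_pos_of_mem_Ioo hb).le
  have y1 : arcFun r₂ D x = r₂ * Real.sin b := by
    rw [arcFun, hx, show r₂ ^ 2 - (D - r₂ * Real.cos b - D) ^ 2 = (r₂ * Real.sin b) ^ 2 by
      linear_combination -r₂ ^ 2 * hub, Real.sqrt_sq hy]
  have y2 : arcFun l q x = r₂ * Real.sin b := by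
    rw [arcFun, ← htip, show l ^ 2 - (q + l * Real.sin θ - q) ^ 2 = (r₂ * Real.sin b) ^ 2 by
      rw [hsb]; linear_combination -l ^ 2 * hu, Real.sqrt_sq hy]
  have p1 := (Piece.arcFun (c := D) (a := D - r₂) (b := x) h2 le_rfl (by linarith)
    (by linarith)).congr (g := fun t => if t ≤ x then arcFun r₂ D t else arcFun l q t)
    fun t ht => if_pos ht.2
  have p2 := (Piece.arcFun (c := q) (a := x) (b := q + l) hl (by linarith) (by linarith)
    le_rfl).congr (g := fun t => if t ≤ x then arcFun r₂ D t else arcFun l q t) fun t ht => by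
      rcases ht.1.eq_or_lt with h | h
      · rw [← h, if_pos le_rfl, y1, y2]
      · exact if_neg (not_le.2 h)
  have key := ((p1.append p2).perimeter_eq (fun t => ?_) fun t ht => ?_).2
  · rw [area, key, ENNReal.toReal_ofReal]
    all_goals
      rw [y1, y2, arcFun_eq_zero (x := D - r₂) h2 (by simp), arcFun_eq_zero (x := q + l) hl (by simp),
        show (x - D) / r₂ = -Real.cos b by rw [hx]; field_simp; ring,
        show (D - r₂ - D) / r₂ = -1 by field_simp; ring, show (q + l - q) / l = 1 by field_simp; ring,
        show (x - q) / l = Real.sin θ by rw [← htip]; field_simp; ring, Real.arcsin_neg,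
        ← Real.sin_pi_div_two_sub, Real.arcsin_sin (by linarith [hb.2]) (by linarith [hb.1]),
        Real.arcsin_sin (by linarith [hm.1, hm.2]) hm.2.le, Real.arcsin_one, Real.arcsin_neg_one]
    · rw [hA]
      have e1 : x - D = -(r₂ * Real.cos b) := by rw [hx]; ring
      have e2 : x - q = l * Real.sin θ := by rw [← htip]; ring
      rw [e1, e2]
      linear_combination -l * Real.sin θ * hsb
    · rw [hA] at hA0
      have e1 : x - D = -(r₂ * Real.cos b) := by rw [hx]; ring
      have e2 : x - q = l * Real.sin θ := by rw [← htip]; ring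
      rw [e1, e2]
      linear_combination hA0 + l * Real.sin θ * hsb
  · split_ifs <;> exact arcFun_nonneg _ _ _
  · split_ifs with h
    · exact arcFun_eq_zero h2 fun h' => ht ⟨h'.1, by linarith⟩
    · push Not at h
      exact arcFun_eq_zero hl fun h' => ht ⟨by linarith, h'.2⟩

/-- The set at the first angle where the touching radius is hit. -/
theorem excessData_gammaSet_of_hit (h2 : 0 < r₂) (hlt : r₂ < r₁) (hD : r₁ + r₂ ≤ D)
    (hθ : θ ∈ Ioo (angleStart r₁ r₂ D) (angleEnd r₁ r₂ D))
    (h : ∀ x ∈ Ico (angleStart r₁ r₂ D) θ, hitRad r₁ r₂ D x < hitRad r₁ r₂ D θ) :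
    ExcessData r₁ r₂ D (gammaSet (twoDisks r₁ r₂ D) 0 (hitRad r₁ r₂ D θ)) (hitPer r₁ r₂ D θ)
      (hitArea r₁ r₂ D θ) := by
  have H := hitData_of_mem h2 hlt hD hθ
  have hl0 := H.hitRad_pos
  have hH := hullData_wedge hl0 H.hitRad_lt H.mem
  have hs := H.sin_pos
  set l := hitRad r₁ r₂ D θ
  set q := (r₁ - l) / Real.sin θ with hq
  set X := profile (hullFun r₁ q l (Real.sin θ) (Real.cos θ))
  -- The hull of the first disk and the tip disk is a union of balls of radius `l`, and it is
  -- spanned by its part in the two disks: by the radical axis, the cap beyond the knot lies in the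
  -- second disk.
  have hsub : X ⊆ gammaSet (twoDisks r₁ r₂ D) 0 l := by
    refine subset_gammaSet (hH.subset_opening hl0 le_rfl) (hH.profile_subset (convex_convexHull ℝ _)
      (fun w hw0 hw => ?_) fun w hw0 hw => ?_)
    · have hw' : dist w (pt 0 0) < r₁ := by
        rw [dist_lt_iff_sq hH.r_pos.le, pt_zero, pt_one]
        linarith
      refine subset_convexHull ℝ _ ⟨hH.ball_subset_profile (t := 0) ⟨le_rfl, zero_le_one⟩ ?_,
        Or.inl hw'⟩
      rwa [zero_mul, zero_mul, sub_zero]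
    · refine subset_convexHull ℝ _ ⟨hH.ball_subset_profile (t := 1) ⟨zero_le_one, le_rfl⟩ ?_,
        Or.inr ?_⟩
      · rw [one_mul, one_mul, dist_lt_iff_sq (by linarith), pt_zero, pt_one, sub_zero]
        linarith
      · rw [mem_ball_pt h2.le, sub_zero]
        have hpow := H.power (w 0)
        have := mul_nonneg (div_pos H.halfChord_pos H.cos_pos).le (sub_nonneg.2 hw0)
        linarith
  have hae := ae_eq_of_between_convex hH.convex_profile hsub
    (gammaSet_subset_closure h2 hlt hD hl0 H.hitRad_lt hθ h)
  refine ⟨?_, H.hitPer_pos.le, ?_, left_subset_gammaSet hl0 H.hitRad_lt.le, ?_⟩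
  · rw [perimeter_congr hae, hH.profile_perimeter.1, hitPer,
      Real.arcsin_sin (by linarith [H.mem.1, H.mem.2]) H.mem.2.le]
    congr 1
    rw [hq]
    field_simp
    ring
  · rw [measure_congr hae]
    exact hH.profile_perimeter.2.ne
  · rw [← H.area_inter hH]
    exact congrArg ENNReal.toReal (measure_congr (hae.inter (ae_eq_refl _)))

/-- The set when the touching radius is never hit. -/
theorem excessData_gammaSet_of_no_hit (h2 : 0 < r₂) (hlt : r₂ < r₁) (hD : r₁ + r₂ ≤ D)
    (hl0 : 0 < l) (hl : l ≤ r₁)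
    (h : ∀ x ∈ Ico (angleStart r₁ r₂ D) (angleEnd r₁ r₂ D), hitRad r₁ r₂ D x < l) :
    ExcessData r₁ r₂ D (gammaSet (twoDisks r₁ r₂ D) 0 l) 0 0 := by
  obtain ⟨b1, b2, b3⟩ := angle_bounds h2 hlt hD
  have h1 : 0 < r₁ := h2.trans hlt
  have he := sin_angleEnd h2 hlt hD
  have hDr : 0 < D - r₂ := by linarith
  have hse : Real.sin (angleEnd r₁ r₂ D) = r₁ / (D - r₂) := by
    rw [eq_div_iff hDr.ne', mul_comm, he]
  -- The function is the abscissa of the rightmost point of the disk of radius `l` inscribed in the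
  -- wedge. At the final angle its limit is at most `D - r₂`, the leftmost abscissa of the second
  -- disk.
  have hlim : Tendsto (fun x => (r₁ - l) / Real.sin x + l) (𝓝[<] angleEnd r₁ r₂ D)
      (𝓝 ((r₁ - l) / (r₁ / (D - r₂)) + l)) := by
    rw [← hse]
    have : Real.sin (angleEnd r₁ r₂ D) ≠ 0 := by rw [hse]; positivity
    have hc : ContinuousAt (fun x => (r₁ - l) / Real.sin x + l) (angleEnd r₁ r₂ D) := by
      fun_prop (disch := assumption)
    exact hc.tendsto.mono_left nhdsWithin_le_nhds
  have hval0 : (r₁ - l) / (r₁ / (D - r₂)) + l = D - r₂ - l * (D - r₂ - r₁) / r₁ := by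
    field_simp
    ring
  rw [hval0] at hlim
  -- The points of the second disk that balls in a late wedge can reach lie within `ε` of the first
  -- disk if the disks are tangent, and do not exist if the disks are separated.
  have key : ∀ ε > 0, ∃ x ∈ Ico (angleStart r₁ r₂ D) (angleEnd r₁ r₂ D),
      ∀ z ∈ Metric.ball (pt D 0) r₂, z 0 < (r₁ - l) / Real.sin x + l →
        z ∈ Metric.closedBall (pt 0 0) (r₁ + ε) := by
    intro ε hε
    have hval : D - r₂ - l * (D - r₂ - r₁) / r₁ < D - r₂ + r₁ * ε / D := by
      have h4 : 0 ≤ l * (D - r₂ - r₁) / r₁ :=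
        div_nonneg (mul_nonneg hl0.le (by linarith)) h1.le
      have h5 : 0 < r₁ * ε / D := by
        have : 0 < D := by linarith
        positivity
      linarith
    rcases hD.eq_or_lt with hd | hd
    · obtain ⟨x, hx1, hx2⟩ := ((hlim.eventually_lt_const hval).and (Ico_mem_nhdsLT b2)).exists
      refine ⟨x, hx2, fun z hz hz0 => ?_⟩
      rw [mem_ball_pt h2.le, sub_zero] at hz
      refine Metric.mem_closedBall.2 (le_of_sq_le_sq ?_ (by linarith))
      rw [dist_pt_sq]
      have h3 : z 0 < D - r₂ + r₁ * ε / D := hz0.trans hx1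
      have hD0 : 0 < D := by linarith
      have h4 := mul_lt_mul_of_pos_left h3 hD0
      have h5 : D * (D - r₂ + r₁ * ε / D) = D * (D - r₂) + r₁ * ε := by field_simp
      rw [h5, ← hd] at h4
      rw [← hd] at hz
      linarith [sq_nonneg ε]
    · have hval2 : D - r₂ - l * (D - r₂ - r₁) / r₁ < D - r₂ := by
        have h4 : 0 < l * (D - r₂ - r₁) / r₁ := div_pos (mul_pos hl0 (by linarith)) h1
        linarith
      obtain ⟨x, hx1, hx2⟩ := ((hlim.eventually_lt_const hval2).and (Ico_mem_nhdsLT b2)).exists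
      refine ⟨x, hx2, fun z hz hz0 => ?_⟩
      rw [mem_ball_pt h2.le, sub_zero] at hz
      have := (abs_lt_of_sq_lt_sq' (by linarith [sq_nonneg (z 1)] :
        (z 0 - D) ^ 2 < r₂ ^ 2) h2.le).1
      have h3 : z 0 < D - r₂ := hz0.trans hx1
      linarith
  have hsub : gammaSet (twoDisks r₁ r₂ D) 0 l ⊆ Metric.closedBall (pt 0 0) r₁ := by
    intro w hw
    refine Metric.mem_closedBall.2 (le_of_forall_pos_le_add fun ε hε => ?_)
    obtain ⟨x, hx, hx'⟩ := key ε hε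
    obtain ⟨d1, -, d3⟩ := hit_domain h2 hlt hD hx
    have hs := Real.sin_pos_of_pos_of_lt_pi d3.1 (by linarith [d3.2, Real.pi_pos])
    obtain ⟨k, hk⟩ := exists_gammaSeq_subset_wedge h2 hlt hD hl0 hx.1 hx.2
      fun y hy => h y ⟨hy.1, hy.2.trans_lt hx.2⟩
    refine convexHull_min ?_ (convex_closedBall (pt 0 0) (r₁ + ε)) (gammaSet_subset_succ k hw)
    rintro z ⟨hz, hzS⟩
    rcases hzS with hzS | hzS
    · exact Metric.ball_subset_closedBall (Metric.ball_subset_ball (by linarith) hzS)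
    · refine hx' z hzS ?_
      obtain ⟨p, hp, hzp⟩ := mem_opening.1 hz
      have hpw := center_of_ball_subset_wedge hl0 d1.le (hp.trans hk)
      have hp0 : p 0 ≤ (r₁ - l) / Real.sin x := by
        rw [le_div_iff₀ hs]
        linarith [mul_nonneg (abs_nonneg (p 1)) d1.le]
      rw [dist_lt_iff_sq hl0.le] at hzp
      have := (abs_lt_of_sq_lt_sq' (by linarith [sq_nonneg (z 1 - p 1)] :
        (z 0 - p 0) ^ 2 < l ^ 2) hl0.le).2
      linarith
  have hleft := left_subset_gammaSet (r₂ := r₂) (D := D) hl0 hl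
  have hae := ae_eq_of_between_convex (convex_ball (pt 0 0) r₁) hleft
    (hsub.trans_eq (closure_ball _ h1.ne').symm)
  refine ⟨?_, le_rfl, ?_, hleft, ?_⟩
  · rw [perimeter_congr hae, (ball_pt_perimeter h1).1]
    ring_nf
  · rw [measure_congr hae]
    exact measure_ball_lt_top.ne
  · have e := measure_congr (hae.inter (ae_eq_refl (Metric.ball (pt D 0) r₂)))
    rw [(disjoint_disks h1 h2 hD).inter_eq, measure_empty] at e
    rw [area, e, ENNReal.toReal_zero]

end GammaIdentification

/-! ### The threshold without penalization outside -/

section GammaThreshold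

variable {r₁ r₂ D l θ : ℝ}

lemma lt_hullPer (h2 : 0 < r₂) (hle : r₂ ≤ r₁) (hD : r₁ + r₂ ≤ D) :
    2 * (Real.pi * r₁) < hullPer r₁ r₂ D := by
  rcases hle.eq_or_lt with h | h
  · rw [hullPer, h]
    simp
    linarith
  · have := hitPer_pos_of_mem h2 h hD ⟨le_rfl, (angle_bounds h2 h hD).2.1⟩
    rw [hitPer_angleStart h2 h hD] at this
    linarith

lemma hitEnergy_angleStart (h2 : 0 < r₂) (hlt : r₂ < r₁) (hD : r₁ + r₂ ≤ D) :
    hitEnergy r₁ r₂ D (angleStart r₁ r₂ D)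
      = r₂ * (hullPer r₁ r₂ D - 2 * (Real.pi * r₁)) - Real.pi * r₂ ^ 2 := by
  rw [hitEnergy, hitRad_angleStart h2 hlt hD, hitPer_angleStart h2 hlt hD,
    hitArea_angleStart h2 hlt hD]

/-- An angle at which the touching radius is larger than before. -/
def IsHit (r₁ r₂ D θ : ℝ) : Prop :=
  θ ∈ Ioo (angleStart r₁ r₂ D) (angleEnd r₁ r₂ D) ∧
    ∀ x ∈ Ico (angleStart r₁ r₂ D) θ, hitRad r₁ r₂ D x < hitRad r₁ r₂ D θ

lemma IsHit.le (h : IsHit r₁ r₂ D θ) :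
    ∀ x ∈ Icc (angleStart r₁ r₂ D) θ, hitRad r₁ r₂ D x ≤ hitRad r₁ r₂ D θ := fun x hx => by
  rcases hx.2.eq_or_lt with e | e
  · rw [e]
  · exact (h.2 x ⟨hx.1, e⟩).le

/-- The energy is strictly increasing up to the later of two hits, so different hits have different
energies. -/
lemma IsHit.eq_of_energy (h2 : 0 < r₂) (hlt : r₂ < r₁) (hD : r₁ + r₂ ≤ D) {θ' : ℝ}
    (h : IsHit r₁ r₂ D θ) (h' : IsHit r₁ r₂ D θ')
    (he : hitEnergy r₁ r₂ D θ = hitEnergy r₁ r₂ D θ') : θ = θ' := by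
  have key : ∀ {a b}, IsHit r₁ r₂ D a → IsHit r₁ r₂ D b → a < b →
      hitEnergy r₁ r₂ D a < hitEnergy r₁ r₂ D b := fun ha hb hab =>
    hitEnergy_strictMonoOn h2 hlt hD hb.1.2 hb.le ⟨ha.1.1.le, hab.le⟩ ⟨hb.1.1.le, le_rfl⟩ hab
  rcases lt_trichotomy θ θ' with e | e | e
  · exact absurd he (key h h' e).ne
  · exact e
  · exact absurd he (key h' h e).ne'

lemma hit_cases (h2 : 0 < r₂) (hlt : r₂ < r₁) (hD : r₁ + r₂ ≤ D) (hl : r₂ < l) :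
    (∃ θ, IsHit r₁ r₂ D θ ∧ hitRad r₁ r₂ D θ = l) ∨
      ∀ x ∈ Ico (angleStart r₁ r₂ D) (angleEnd r₁ r₂ D), hitRad r₁ r₂ D x < l := by
  by_cases h : ∀ x ∈ Ico (angleStart r₁ r₂ D) (angleEnd r₁ r₂ D), hitRad r₁ r₂ D x < l
  · exact Or.inr h
  · push Not at h
    obtain ⟨t, ht, hlt'⟩ := h
    obtain ⟨x, hx, ex, hx'⟩ := exists_first_hit h2 hlt hD hl ht.1 ht.2 hlt'
    refine Or.inl ⟨x, ⟨⟨hx.1, hx.2.trans_lt ht.2⟩, ?_⟩, ex⟩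
    rwa [ex]

/-- A solution of the threshold equation comes from the convex hull or from a hit with vanishing
energy. -/
lemma threshold_equation (h2 : 0 < r₂) (hle : r₂ ≤ r₁) (hD : r₁ + r₂ ≤ D) (hl0 : 0 < l)
    (h : l = area (gammaSet (twoDisks r₁ r₂ D) 0 l ∩ Metric.ball (pt D 0) r₂)
      / (per (gammaSet (twoDisks r₁ r₂ D) 0 l) - 2 * (Real.pi * r₁))) :
    (l ≤ r₂ ∧ l = Real.pi * r₂ ^ 2 / (hullPer r₁ r₂ D - 2 * (Real.pi * r₁))) ∨
      (r₂ < r₁ ∧ ∃ θ, IsHit r₁ r₂ D θ ∧ hitRad r₁ r₂ D θ = l ∧ hitEnergy r₁ r₂ D θ = 0) := by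
  have h1 : 0 < r₁ := h2.trans_le hle
  rcases le_or_gt l r₂ with hl2 | hl2
  · have E := excessData_convexHull h2 hle hD (lt_hullPer h2 hle hD).le
    rw [gammaSet_eq_convexHull hl0 hl2 hle, E.area, E.per h1, add_sub_cancel_left] at h
    exact Or.inl ⟨hl2, h⟩
  right
  rcases le_or_gt l r₁ with hl1 | hl1
  · have hlt := hl2.trans_le hl1
    refine ⟨hlt, ?_⟩
    rcases hit_cases h2 hlt hD hl2 with ⟨θ, hθ, e⟩ | hno
    · have E := excessData_gammaSet_of_hit h2 hlt hD hθ.1 hθ.2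
      rw [e] at E
      have hp := (hitData_of_mem h2 hlt hD hθ.1).hitPer_pos
      rw [E.area, E.per h1, add_sub_cancel_left, eq_div_iff hp.ne'] at h
      exact ⟨θ, hθ, e, by rw [hitEnergy, e, h, sub_self]⟩
    · rw [(excessData_gammaSet_of_no_hit h2 hlt hD hl0 hl1 hno).area, zero_div] at h
      exact absurd h hl0.ne'
  · rw [gammaSet_eq_empty hl0 hl1 hle, empty_inter, area, measure_empty, ENNReal.toReal_zero,
      zero_div] at h
    exact absurd h hl0.ne'

/-- A radius with balanced energy below `r₁` comes from the convex hull or from a hit with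
vanishing energy, or there is no hit. -/
lemma balanced_cases (h2 : 0 < r₂) (hle : r₂ ≤ r₁) (hD : r₁ + r₂ ≤ D) (hl0 : 0 < l) (hl1 : l ≤ r₁)
    (h : energy (twoDisks r₁ r₂ D) 0 l (gammaSet (twoDisks r₁ r₂ D) 0 l)
      = energy (twoDisks r₁ r₂ D) 0 l (Metric.ball (pt 0 0) r₁)) :
    (l ≤ r₂ ∧ l = Real.pi * r₂ ^ 2 / (hullPer r₁ r₂ D - 2 * (Real.pi * r₁))) ∨
      (r₂ < r₁ ∧ ∃ θ, IsHit r₁ r₂ D θ ∧ hitRad r₁ r₂ D θ = l ∧ hitEnergy r₁ r₂ D θ = 0) ∨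
      ∀ x ∈ Ico (angleStart r₁ r₂ D) (angleEnd r₁ r₂ D), hitRad r₁ r₂ D x < l := by
  rcases le_or_gt l r₂ with hl2 | hl2
  · have hlp := lt_hullPer h2 hle hD
    have E := excessData_convexHull h2 hle hD hlp.le
    rw [gammaSet_eq_convexHull hl0 hl2 hle, E.energy_eq_iff h2 hle hD hl0] at h
    refine Or.inl ⟨hl2, ?_⟩
    rw [eq_div_iff (by linarith), h]
  · have hlt := hl2.trans_le hl1
    refine Or.inr ((hit_cases h2 hlt hD hl2).imp ?_ id)
    rintro ⟨θ, hθ, e⟩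
    have E := excessData_gammaSet_of_hit h2 hlt hD hθ.1 hθ.2
    rw [e] at E
    rw [E.energy_eq_iff h2 hle hD hl0] at h
    exact ⟨hlt, θ, hθ, e, by rw [hitEnergy, e, h, sub_self]⟩

lemma continuousOn_hitEnergy (h2 : 0 < r₂) (hlt : r₂ < r₁) (hD : r₁ + r₂ ≤ D) {a b : ℝ}
    (ha : angleStart r₁ r₂ D ≤ a) (hb : b < angleEnd r₁ r₂ D) :
    ContinuousOn (hitEnergy r₁ r₂ D) (Icc a b) := by
  have hs := Icc_subset_hit h2 hlt hD ha hb
  have hs' := hs.trans (Ioo_subset_Ioo_left (by linarith [Real.pi_pos] : -(Real.pi / 2) ≤ 0))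
  exact ((continuousOn_hitRad.mono hs').mul (continuousOn_hitPer.mono hs)).sub
    (continuousOn_hitArea.mono hs')

/-- If the energy is nonnegative at some record, then it vanishes at some hit. -/
lemma exists_hit_energy_zero (h2 : 0 < r₂) (hlt : r₂ < r₁) (hD : r₁ + r₂ ≤ D)
    (hneg : hitEnergy r₁ r₂ D (angleStart r₁ r₂ D) < 0) {t : ℝ}
    (ht : t ∈ Ico (angleStart r₁ r₂ D) (angleEnd r₁ r₂ D))
    (hmax : ∀ x ∈ Icc (angleStart r₁ r₂ D) t, hitRad r₁ r₂ D x ≤ hitRad r₁ r₂ D t)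
    (hH : 0 ≤ hitEnergy r₁ r₂ D t) : ∃ θ, IsHit r₁ r₂ D θ ∧ hitEnergy r₁ r₂ D θ = 0 := by
  obtain ⟨θ, hθ, e⟩ := intermediate_value_Ioc ht.1
    (continuousOn_hitEnergy h2 hlt hD le_rfl ht.2) (⟨hneg, hH⟩ : (0 : ℝ) ∈ Ioc _ _)
  -- Every angle after the start and up to the record `t` is a hit, because the radius is strictly
  -- increasing up to `t`. This makes the zero given by the intermediate value theorem a hit.
  have hmono := hitRad_strictMonoOn h2 hlt hD ht.2 hmax
  exact ⟨θ, ⟨⟨hθ.1, hθ.2.trans_lt ht.2⟩, fun x hx => hmono ⟨hx.1, hx.2.le.trans hθ.2⟩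
    ⟨hθ.1.le, hθ.2⟩ hx.2⟩, e⟩

/-- If a balanced hit had a radius above `r₁ / 2`, this value would be taken at an earlier angle.
The energy is nonnegative there already and strictly increases up to the hit, so it could not vanish
at the hit. -/
lemma hitRad_le_half (h2 : 0 < r₂) (hlt : r₂ < r₁ / 2) (hD : r₁ + r₂ ≤ D) (hθ : IsHit r₁ r₂ D θ)
    (hH : hitEnergy r₁ r₂ D θ = 0) : hitRad r₁ r₂ D θ ≤ r₁ / 2 := by
  have hlt' : r₂ < r₁ := by linarith
  by_contra hcon
  push Not at hcon
  obtain ⟨x, hx, ex, -⟩ := exists_first_hit h2 hlt' hD hlt hθ.1.1.le hθ.1.2 hcon.le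
  have hxθ : x < θ := lt_of_le_of_ne hx.2 fun e => by rw [e] at ex; linarith
  have h1 := hitEnergy_strictMonoOn h2 hlt' hD hθ.1.2 hθ.le ⟨hx.1.le, hx.2⟩ ⟨hθ.1.1.le, le_rfl⟩ hxθ
  have h3 := hitEnergy_nonneg_of_half h2 hlt' hD ⟨hx.1, hxθ.trans hθ.1.2⟩ ex hlt
  linarith

/-- The threshold between the first disk and the set `Γ` without penalization outside. -/
theorem exists_gamma_threshold (h2 : 0 < r₂) (hle : r₂ ≤ r₁) (hD : r₁ + r₂ ≤ D)
    (hP : hullPer r₁ r₂ D < 2 * (Real.pi * (r₁ + r₂)))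
    (hii : Real.pi * (r₁ ^ 2 + r₂ ^ 2) ≤ r₁ / 2 * hullPer r₁ r₂ D) :
    ∃ lam : ℝ, r₂ / 2 ≤ lam ∧ lam ≤ r₁ / 2 ∧
      IsLeast {l : ℝ | 0 < l ∧ energy (twoDisks r₁ r₂ D) 0 l (gammaSet (twoDisks r₁ r₂ D) 0 l)
        = energy (twoDisks r₁ r₂ D) 0 l (Metric.ball (pt 0 0) r₁)} lam ∧
      (∀ l : ℝ, 0 < l →
        l = area (gammaSet (twoDisks r₁ r₂ D) 0 l ∩ Metric.ball (pt D 0) r₂)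
          / (per (gammaSet (twoDisks r₁ r₂ D) 0 l) - 2 * (Real.pi * r₁)) → l = lam) ∧
      ((r₁ + r₂ < D ∨ r₁ < 8 * r₂) →
        2 * (Real.pi * r₁) < per (gammaSet (twoDisks r₁ r₂ D) 0 lam) ∧
        lam = area (gammaSet (twoDisks r₁ r₂ D) 0 lam ∩ Metric.ball (pt D 0) r₂)
          / (per (gammaSet (twoDisks r₁ r₂ D) 0 lam) - 2 * (Real.pi * r₁))) ∧
      (Real.pi * r₂ ^ 2 / (hullPer r₁ r₂ D - 2 * (Real.pi * r₁)) ≤ r₂ →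
        lam = Real.pi * r₂ ^ 2 / (hullPer r₁ r₂ D - 2 * (Real.pi * r₁))) := by
  have h1 : 0 < r₁ := h2.trans_le hle
  have hlp := lt_hullPer h2 hle hD
  have hPe : 0 < hullPer r₁ r₂ D - 2 * (Real.pi * r₁) := by linarith
  have hA : 0 < Real.pi * r₂ ^ 2 := by positivity
  have hE := excessData_convexHull h2 hle hD hlp.le
  -- The value at which the convex hull and the first disk balance. The lower bound `r₂ / 2` comes
  -- from the hull having less perimeter than the disks, the upper bound `r₁ / 2` from the
  -- assumption of the second case.
  obtain ⟨lco, hlco⟩ : ∃ x, x = Real.pi * r₂ ^ 2 / (hullPer r₁ r₂ D - 2 * (Real.pi * r₁)) :=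
    ⟨_, rfl⟩
  have hmul : lco * (hullPer r₁ r₂ D - 2 * (Real.pi * r₁)) = Real.pi * r₂ ^ 2 := by
    rw [hlco, div_mul_cancel₀ _ hPe.ne']
  have hlow : r₂ / 2 ≤ lco := by
    rw [hlco, le_div_iff₀ hPe]
    have := mul_le_mul_of_nonneg_left hP.le h2.le
    linarith
  have hupp : lco ≤ r₁ / 2 := by
    rw [hlco, div_le_iff₀ hPe]
    linarith
  have hlco0 : 0 < lco := by linarith
  rw [← hlco]
  -- If `lco ≤ r₂`, then `Γ` is the convex hull at this value and `lco` is the threshold. No hit can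
  -- balance, since the energy is nonnegative at the start and then strictly increasing.
  rcases le_or_gt lco r₂ with hcase | hcase
  · have hΓ := gammaSet_eq_convexHull (D := D) hlco0 hcase hle
    refine ⟨lco, hlow, hupp, ⟨⟨hlco0, ?_⟩, fun l hl => ?_⟩, fun l hl0 hl => ?_, fun _ => ?_,
      fun _ => rfl⟩
    · rw [hΓ, hE.energy_eq_iff h2 hle hD hlco0, hmul]
    · by_contra hcon
      push Not at hcon
      have h3 := hl.2
      rw [gammaSet_eq_convexHull hl.1 (hcon.le.trans hcase) hle,
        hE.energy_eq_iff h2 hle hD hl.1, ← hmul] at h3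
      exact hcon.ne (mul_right_cancel₀ hPe.ne' h3)
    · rcases threshold_equation h2 hle hD hl0 hl with ⟨-, h⟩ | ⟨hlt, θ, hθ, -, e⟩
      · rw [h, hlco]
      · have h3 := hitEnergy_strictMonoOn h2 hlt hD hθ.1.2 hθ.le ⟨le_rfl, hθ.1.1.le⟩
          ⟨hθ.1.1.le, le_rfl⟩ hθ.1.1
        rw [hitEnergy_angleStart h2 hlt hD, e, ← hmul] at h3
        have := mul_le_mul_of_nonneg_right hcase hPe.le
        linarith
    · rw [hΓ, hE.area, hE.per h1, add_sub_cancel_left]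
      exact ⟨by linarith, hlco⟩
  -- In the remaining case the energy is negative at the initial angle, and the threshold is looked
  -- for among the hits.
  have hk : r₂ < r₁ / 2 := hcase.trans_le hupp
  have hlt : r₂ < r₁ := by linarith
  have hneg : hitEnergy r₁ r₂ D (angleStart r₁ r₂ D) < 0 := by
    rw [hitEnergy_angleStart h2 hlt hD, ← hmul]
    have := mul_lt_mul_of_pos_right hcase hPe
    linarith
  by_cases hz : ∃ θ, IsHit r₁ r₂ D θ ∧ hitEnergy r₁ r₂ D θ = 0
  · obtain ⟨θ, hθ, hH⟩ := hz
    have hdat := hitData_of_mem h2 hlt hD hθ.1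
    have hE' := excessData_gammaSet_of_hit h2 hlt hD hθ.1 hθ.2
    have hr := hθ.2 _ ⟨le_rfl, hθ.1.1⟩
    rw [hitRad_angleStart h2 hlt hD] at hr
    have hbal : hitRad r₁ r₂ D θ * hitPer r₁ r₂ D θ = hitArea r₁ r₂ D θ := by
      rw [hitEnergy] at hH
      linarith
    refine ⟨hitRad r₁ r₂ D θ, by linarith, hitRad_le_half h2 hk hD hθ hH,
      ⟨⟨hdat.hitRad_pos, (hE'.energy_eq_iff h2 hle hD hdat.hitRad_pos).2 hbal⟩, fun l hl => ?_⟩,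
      fun l hl0 hl => ?_, fun _ => ?_, fun h => absurd h (not_le.2 hcase)⟩
    · by_contra hcon
      push Not at hcon
      rcases balanced_cases h2 hle hD hl.1 (hcon.trans hdat.hitRad_lt).le hl.2 with
        ⟨h3, h4⟩ | ⟨-, θ', hθ', e, e'⟩ | h3
      · rw [← hlco] at h4
        linarith
      · have := hθ'.eq_of_energy h2 hlt hD hθ (e'.trans hH.symm)
        rw [this] at e
        exact hcon.ne e.symm
      · exact lt_asymm hcon (h3 θ ⟨hθ.1.1.le, hθ.1.2⟩)
    · rcases threshold_equation h2 hle hD hl0 hl with ⟨h3, h4⟩ | ⟨-, θ', hθ', e, e'⟩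
      · rw [← hlco] at h4
        linarith
      · rw [← e, hθ'.eq_of_energy h2 hlt hD hθ (e'.trans hH.symm)]
    · rw [hE'.area, hE'.per h1, add_sub_cancel_left]
      have := hdat.hitPer_pos
      exact ⟨by linarith, by rw [eq_div_iff this.ne', hbal]⟩
  -- Without a balanced hit the touching radius has no maximum, so the disks are tangent and `r₁ ≥ 8
  -- r₂`. At the limiting radius nothing is hit, `Γ` is the first disk up to a null set, and the
  -- energies agree trivially. Any smaller radius above `r₂` is hit, and not in a balanced way.
  · obtain ⟨hDe, h8, hbd⟩ := hitRad_lt_limitRad h2 hlt hD fun ⟨t, ht, hmax⟩ =>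
      hz (exists_hit_energy_zero h2 hlt hD hneg ht
        (fun x hx => hmax x ⟨hx.1, hx.2.trans_lt ht.2⟩) (hitEnergy_nonneg_of_max h2 hlt hD ht hmax))
    have hL := hbd _ ⟨le_rfl, (angle_bounds h2 hlt hD).2.1⟩
    rw [hitRad_angleStart h2 hlt hD] at hL
    have hL1 : limitRad r₁ r₂ ≤ r₁ / 2 := by
      -- The arithmetic–geometric mean inequality for `r₁ + r₂` and `r₂`.
      have : Real.sqrt ((r₁ + r₂) * r₂) ≤ (r₁ + r₂ + r₂) / 2 :=
        Real.sqrt_le_iff.2 ⟨by linarith, by linarith [sq_nonneg (r₁ + r₂ - r₂)]⟩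
      rw [limitRad]
      linarith
    have hL0 := h2.trans hL
    have hE' := excessData_gammaSet_of_no_hit h2 hlt hD hL0 (by linarith) hbd
    refine ⟨limitRad r₁ r₂, by linarith, hL1,
      ⟨⟨hL0, (hE'.energy_eq_iff h2 hle hD hL0).2 (mul_zero _)⟩, fun l hl => ?_⟩,
      fun l hl0 hl => ?_, fun h => absurd h ?_, fun h => absurd h (not_le.2 hcase)⟩
    · by_contra hcon
      push Not at hcon
      rcases balanced_cases h2 hle hD hl.1 (by linarith) hl.2 with
        ⟨h3, h4⟩ | ⟨-, θ', hθ', -, e'⟩ | h3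
      · rw [← hlco] at h4
        linarith
      · exact hz ⟨θ', hθ', e'⟩
      · subst hDe
        obtain ⟨x, hx1, hx2⟩ := (((tendsto_hitRad_tangent h2 hlt).eventually_const_lt hcon).and
          (Ico_mem_nhdsLT (angle_bounds h2 hlt hD).2.1)).exists
        exact lt_asymm hx1 (h3 x hx2)
    · rcases threshold_equation h2 hle hD hl0 hl with ⟨h3, h4⟩ | ⟨-, θ', hθ', -, e'⟩
      · rw [← hlco] at h4
        linarith
      · exact absurd ⟨θ', hθ', e'⟩ hz
    · rw [not_or, not_lt, not_lt]
      exact ⟨hDe.le, h8⟩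

end GammaThreshold

/-! ### The thresholds for disks centred on the axis -/

section Thresholds

variable {r₁ r₂ D : ℝ}

/-- The radius at which the energy of the closing takes the value `T`. -/
structure ClosingRadius (r₁ r₂ D T R : ℝ) : Prop where
  critical_le : criticalRadius (twoDisks r₁ r₂ D) ≤ R
  eq : closingEnergy (twoDisks r₁ r₂ D) R = ENNReal.ofReal T
  unique : ∀ r, criticalRadius (twoDisks r₁ r₂ D) ≤ r →
    closingEnergy (twoDisks r₁ r₂ D) r = ENNReal.ofReal T → r = R
  lt : ∀ r, R < r → closingEnergy (twoDisks r₁ r₂ D) r < ENNReal.ofReal T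
  ge : ∀ r, 0 < r → r < R → ENNReal.ofReal T ≤ closingEnergy (twoDisks r₁ r₂ D) r ∧
    (T < 2 * (Real.pi * (r₁ + r₂)) ∨ D < r₁ + r₂ + 2 * r →
      ENNReal.ofReal T < closingEnergy (twoDisks r₁ r₂ D) r)
  eq_zero_iff : R = 0 ↔ D = r₁ + r₂ ∧ T = 2 * (Real.pi * (r₁ + r₂))
  critical_lt : 0 < criticalRadius (twoDisks r₁ r₂ D) → criticalRadius (twoDisks r₁ r₂ D) < R

lemma exists_closingRadius (h2 : 0 < r₂) (hle : r₂ ≤ r₁) (hD : r₁ + r₂ ≤ D) {T : ℝ}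
    (hT1 : hullPer r₁ r₂ D < T) (hT2 : T ≤ 2 * (Real.pi * (r₁ + r₂))) :
    ∃ R, ClosingRadius r₁ r₂ D T R := by
  obtain ⟨R, a1, a2, a3, a4, a5, a6, a7⟩ := exists_closing_radius h2 hle hD hT1 hT2
  exact ⟨R, a1, a2, a3, a4, a5, a6, a7⟩

lemma ClosingRadius.nonneg {T R : ℝ} (h : ClosingRadius r₁ r₂ D T R) (h2 : 0 < r₂) (hle : r₂ ≤ r₁)
    (hD : r₁ + r₂ ≤ D) : 0 ≤ R :=
  (criticalRadius_spec h2 hle hD).1.trans h.critical_le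

/-- The comparison of the closing with a competitor along the line through the threshold. -/
lemma ClosingRadius.compare {T R P A : ℝ} (h : ClosingRadius r₁ r₂ D T R) (h2 : 0 < r₂)
    (hle : r₂ ≤ r₁) (hD : r₁ + r₂ ≤ D) (hT : hullPer r₁ r₂ D < T) (hP : 0 < P) (hA : 0 < A)
    {l s : ℝ} (hl : 0 < l) (hs : 0 ≤ s) (hsl : s = 1 - l * (P / A)) :
    ∃ V : ℝ, energy (twoDisks r₁ r₂ D) s l (closingQuot l s (twoDisks r₁ r₂ D))
        = ((V - (1 - s) / l * (Real.pi * (r₁ ^ 2 + r₂ ^ 2)) : ℝ) : EReal) ∧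
      (l < R * A / (R * P + A) → T ≤ V) ∧
      (l < R * A / (R * P + A) → (T < 2 * (Real.pi * (r₁ + r₂)) ∨ D < r₁ + r₂ + 2 * (l / s)) →
        T < V) ∧
      (l = R * A / (R * P + A) → V = T) ∧ (R * A / (R * P + A) < l → V < T) := by
  obtain ⟨-, -, -, -, -, tf⟩ := threshold_facts (h.nonneg h2 hle hD) hP hA
  obtain ⟨t1, t2, t3⟩ := tf l s hl hs hsl
  obtain ⟨V, e, V0, e0, e1⟩ := energy_closingQuot h2 hle hD hl hs
  have hT0 : 0 < T := (hullPer_pos h2 hle hD).trans hT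
  refine ⟨V, e, fun hlt => ?_, fun hlt ho => ?_, fun heq => ?_, fun hgt => ?_⟩
  · obtain ⟨s0, hr⟩ := t1 hlt
    have := (h.ge _ (div_pos hl s0) hr).1
    rwa [e1 s0, ENNReal.ofReal_le_ofReal_iff V0] at this
  · obtain ⟨s0, hr⟩ := t1 hlt
    have := (h.ge _ (div_pos hl s0) hr).2 ho
    rw [e1 s0] at this
    exact (ENNReal.ofReal_lt_ofReal_iff_of_nonneg hT0.le).1 this
  · obtain ⟨s0, hr⟩ := t2 heq
    have := e1 s0
    rw [hr, h.eq] at this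
    exact ((ENNReal.ofReal_eq_ofReal_iff hT0.le V0).1 this).symm
  · rcases t3 hgt with s0 | ⟨s0, hr⟩
    · rw [e0 s0]
      exact hT
    · have := h.lt _ hr
      rw [e1 s0] at this
      exact (ENNReal.ofReal_lt_ofReal_iff hT0).1 this

lemma ClosingRadius.mono {T T' R R' : ℝ} (h : ClosingRadius r₁ r₂ D T R)
    (h' : ClosingRadius r₁ r₂ D T' R') (h2 : 0 < r₂) (hle : r₂ ≤ r₁) (hD : r₁ + r₂ ≤ D)
    (hT : T' ≤ T) (hT' : 0 < T') (hmax : T ≤ 2 * (Real.pi * (r₁ + r₂))) : R ≤ R' := by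
  by_contra hcon
  push Not at hcon
  rcases (h'.nonneg h2 hle hD).eq_or_lt with h0 | h0
  · obtain ⟨e1, e2⟩ := h'.eq_zero_iff.1 h0.symm
    have := h.eq_zero_iff.2 ⟨e1, by linarith⟩
    linarith
  · have h3 := (h.ge _ h0 hcon).1
    rw [h'.eq, ENNReal.ofReal_le_ofReal_iff hT'.le] at h3
    have := h.unique _ h'.critical_le (by rw [h'.eq, le_antisymm hT h3])
    linarith

/-- The statement about the thresholds, for given disks. -/
def ThresholdStatement (r₁ r₂ d : ℝ) (S₁ S₂ S : Set Plane) : Prop :=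
    ∃ R₁ lam₁ lam₂ lam₃ : ℝ,
      -- part (a): the radius `R₁`
      (criticalRadius S ≤ R₁ ∧ closingEnergy S R₁ = perimeter S ∧
        ∀ R : ℝ, criticalRadius S ≤ R → closingEnergy S R = perimeter S → R = R₁) ∧
      -- the threshold `lam₁`
      lam₁ = R₁ * area S₂ / (R₁ * per S₂ + area S₂) ∧
      0 ≤ lam₁ ∧ lam₁ ≤ area S₂ / per S₂ ∧
      0 < 1 - lam₁ * (per S₂ / area S₂) ∧
      (∀ l : ℝ, 1 - l * (per S₂ / area S₂) ≠ 0 →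
        (l / (1 - l * (per S₂ / area S₂)) = R₁ ↔ l = lam₁)) ∧
      -- comparison of the closing with `S` along `s = 1 - l * P(S₂) / |S₂|`
      (∀ l s : ℝ, 0 < l → 0 ≤ s → s = 1 - l * (per S₂ / area S₂) →
        (l < lam₁ → energy S s l S ≤ energy S s l (closingQuot l s S)) ∧
        (l < lam₁ → d / 2 < l / s → energy S s l S < energy S s l (closingQuot l s S)) ∧
        (l = lam₁ → energy S s l (closingQuot l s S) = energy S s l S) ∧
        (lam₁ < l → energy S s l (closingQuot l s S) < energy S s l S)) ∧
      (lam₁ = 0 ↔ R₁ = 0) ∧ (R₁ = 0 ↔ criticalRadius S = 0) ∧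
      (criticalRadius S = 0 ↔ d = 0) ∧
      (0 < criticalRadius S → criticalRadius S < R₁) ∧
      -- part (b), first case
      (area S₁ / per S₁ < area S / per (convexHull ℝ S) →
        ∃ R₂ : ℝ,
          (criticalRadius S ≤ R₂ ∧
            closingEnergy S R₂ = perimeter S₁ * (volume S / volume S₁) ∧
            ∀ R : ℝ, criticalRadius S ≤ R →
              closingEnergy S R = perimeter S₁ * (volume S / volume S₁) → R = R₂) ∧
          lam₂ = R₂ * area S₁ / (R₂ * per S₁ + area S₁) ∧
          lam₁ ≤ lam₂ ∧ lam₂ ≤ area S₁ / per S₁ ∧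
          0 < 1 - lam₂ * (per S₁ / area S₁) ∧
          lam₂ / (1 - lam₂ * (per S₁ / area S₁)) = R₂ ∧
          -- comparison of the closing with `S₁` along `s = 1 - l * P(S₁) / |S₁|`
          (∀ l s : ℝ, 0 < l → 0 ≤ s → s = 1 - l * (per S₁ / area S₁) →
            (l < lam₂ → energy S s l S₁ ≤ energy S s l (closingQuot l s S)) ∧
            (l < lam₂ → (r₂ < r₁ ∨ d / 2 < l / s) →
              energy S s l S₁ < energy S s l (closingQuot l s S)) ∧
            (l = lam₂ → energy S s l (closingQuot l s S) = energy S s l S₁) ∧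
            (lam₂ < l → energy S s l (closingQuot l s S) < energy S s l S₁)) ∧
          (R₁ = R₂ ↔ per S₁ / area S₁ = per S₂ / area S₂) ∧
          (R₁ = R₂ ↔ lam₁ = lam₂) ∧
          (R₂ = 0 ↔ criticalRadius S = 0 ∧ per S₁ / area S₁ = per S₂ / area S₂) ∧
          (R₂ = 0 → R₁ = 0 ∧ lam₁ = 0 ∧ lam₂ = 0)) ∧
      -- part (b), second case
      (area S / per (convexHull ℝ S) ≤ area S₁ / per S₁ →
        IsLeast {l : ℝ | 0 < l ∧ energy S 0 l (gammaSet S 0 l) = energy S 0 l S₁} lam₂ ∧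
        (∀ l : ℝ, 0 < l →
          l = area (gammaSet S 0 l ∩ S₂) / (per (gammaSet S 0 l) - per S₁) → l = lam₂) ∧
        ((0 < d ∨ r₁ < 8 * r₂) →
          per S₁ < per (gammaSet S 0 lam₂) ∧
          lam₂ = area (gammaSet S 0 lam₂ ∩ S₂) / (per (gammaSet S 0 lam₂) - per S₁)) ∧
        (area S₂ / (per (convexHull ℝ S) - per S₁) ≤ r₂ →
          lam₂ = area S₂ / (per (convexHull ℝ S) - per S₁))) ∧
      -- part (c), and the order of the thresholds
      lam₃ = max (area S₁ / per S₁) (area S / per (convexHull ℝ S)) ∧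
      lam₁ ≤ lam₂ ∧ lam₂ ≤ lam₃

lemma ball_quotient {r c : ℝ} (hr : 0 < r) :
    per (Metric.ball (pt c 0) r) / area (Metric.ball (pt c 0) r) = 2 / r := by
  rw [per_ball hr, area_ball hr]
  field_simp

lemma ball_quotient' {r c : ℝ} (hr : 0 < r) :
    area (Metric.ball (pt c 0) r) / per (Metric.ball (pt c 0) r) = r / 2 := by
  rw [per_ball hr, area_ball hr]
  field_simp

lemma ball_threshold {r R : ℝ} (c : ℝ) (hr : 0 < r) (hR : 0 ≤ R) :
    R * area (Metric.ball (pt c 0) r) / (R * per (Metric.ball (pt c 0) r)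
      + area (Metric.ball (pt c 0) r)) = R * r / (2 * R + r) := by
  rw [per_ball hr, area_ball hr]
  have : 0 < 2 * R + r := by positivity
  field_simp

/-- The comparison of the thresholds of two disks. -/
lemma threshold_compare {r₁ r₂ R₁ R₂ : ℝ} (h2 : 0 < r₂) (hle : r₂ ≤ r₁) (hR : 0 ≤ R₁)
    (hRR : R₁ ≤ R₂) : R₁ * r₂ / (2 * R₁ + r₂) ≤ R₂ * r₁ / (2 * R₂ + r₁) ∧
      (R₁ * r₂ / (2 * R₁ + r₂) = R₂ * r₁ / (2 * R₂ + r₁) → R₁ = R₂) := by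
  have h1 : 0 < r₁ := h2.trans_le hle
  have hR2 : 0 ≤ R₂ := hR.trans hRR
  have d1 : 0 < 2 * R₁ + r₂ := by positivity
  have d2 : 0 < 2 * R₂ + r₁ := by positivity
  have k1 : 0 ≤ R₁ * R₂ * (r₁ - r₂) := mul_nonneg (mul_nonneg hR hR2) (by linarith)
  have k2 : 0 ≤ r₁ * r₂ * (R₂ - R₁) := mul_nonneg (by positivity) (by linarith)
  refine ⟨?_, fun h => ?_⟩
  · rw [div_le_div_iff₀ d1 d2]
    linarith
  · rw [div_eq_div_iff d1.ne' d2.ne'] at h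
    have : r₁ * r₂ * (R₂ - R₁) = 0 := by linarith
    rcases mul_eq_zero.1 this with h3 | h3
    · exact absurd h3 (by positivity)
    · linarith

/-- For the comparison with both disks the inner areas cancel and the level is `P(S)`. On the line
belonging to the first disk `(1 - s) / l = 2 / r₁`, so the energy of the first disk is zero and the
level is `2 |S| / r₁ = P(S₁) |S| / |S₁|`. Each comparison becomes one of the closing functional with
its level. -/
theorem thresholdStatement_twoDisks (h2 : 0 < r₂) (hle : r₂ ≤ r₁) (hD : r₁ + r₂ ≤ D)
    (hP : hullPer r₁ r₂ D < 2 * (Real.pi * (r₁ + r₂))) :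
    ThresholdStatement r₁ r₂ (D - (r₁ + r₂)) (Metric.ball (pt 0 0) r₁) (Metric.ball (pt D 0) r₂)
      (twoDisks r₁ r₂ D) := by
  have h1 : 0 < r₁ := h2.trans_le hle
  have hpi := Real.pi_pos
  obtain ⟨R₁, C₁⟩ := exists_closingRadius h2 hle hD hP le_rfl
  have hR₁ := C₁.nonneg h2 hle hD
  have hA2 : 0 < area (Metric.ball (pt D 0) r₂) := by rw [area_ball h2]; positivity
  have hA1 : 0 < area (Metric.ball (pt 0 0) r₁) := by rw [area_ball h1]; positivity
  have hP2 : 0 < per (Metric.ball (pt D 0) r₂) := by rw [per_ball h2]; positivity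
  have hP1 : 0 < per (Metric.ball (pt 0 0) r₁) := by rw [per_ball h1]; positivity
  obtain ⟨f1, f2, f3, f4, f5, -⟩ := threshold_facts hR₁ hP2 hA2
  obtain ⟨lam₁, hlam⟩ : ∃ x, x = R₁ * area (Metric.ball (pt D 0) r₂)
    / (R₁ * per (Metric.ball (pt D 0) r₂) + area (Metric.ball (pt D 0) r₂)) := ⟨_, rfl⟩
  rw [← hlam] at f1 f2 f3 f4 f5
  have hlam' := hlam.trans (ball_threshold D h2 hR₁)
  obtain ⟨c1, -, -, c4⟩ := criticalRadius_spec h2 hle hD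
  have hd : D = r₁ + r₂ ↔ D - (r₁ + r₂) = 0 := sub_eq_zero.symm
  have hR0 : R₁ = 0 ↔ D = r₁ + r₂ := by rw [C₁.eq_zero_iff, and_iff_left rfl]
  have hqS : area (twoDisks r₁ r₂ D) / per (convexHull ℝ (twoDisks r₁ r₂ D))
      = Real.pi * (r₁ ^ 2 + r₂ ^ 2) / hullPer r₁ r₂ D := by
    rw [area_twoDisks h2 hle hD, per_convexHull h2 hle hD]
  have hhp := hullPer_pos h2 hle hD
  have hcomp : ∀ l s : ℝ, 0 < l → 0 ≤ s → s = 1 - l * (per (Metric.ball (pt D 0) r₂)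
      / area (Metric.ball (pt D 0) r₂)) →
      (l < lam₁ → energy (twoDisks r₁ r₂ D) s l (twoDisks r₁ r₂ D)
          ≤ energy (twoDisks r₁ r₂ D) s l (closingQuot l s (twoDisks r₁ r₂ D))) ∧
      (l < lam₁ → (D - (r₁ + r₂)) / 2 < l / s →
        energy (twoDisks r₁ r₂ D) s l (twoDisks r₁ r₂ D)
          < energy (twoDisks r₁ r₂ D) s l (closingQuot l s (twoDisks r₁ r₂ D))) ∧
      (l = lam₁ → energy (twoDisks r₁ r₂ D) s l (closingQuot l s (twoDisks r₁ r₂ D))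
          = energy (twoDisks r₁ r₂ D) s l (twoDisks r₁ r₂ D)) ∧
      (lam₁ < l →
        energy (twoDisks r₁ r₂ D) s l (closingQuot l s (twoDisks r₁ r₂ D))
          < energy (twoDisks r₁ r₂ D) s l (twoDisks r₁ r₂ D)) := by
    intro l s hl hs hsl
    rw [hlam]
    obtain ⟨V, e, g1, g2, g3, g4⟩ := C₁.compare h2 hle hD hP hP2 hA2 hl hs hsl
    rw [e, energy_twoDisks h2 hle hD, EReal.coe_le_coe_iff, EReal.coe_lt_coe_iff,
      EReal.coe_lt_coe_iff, EReal.coe_eq_coe_iff]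
    refine ⟨fun h => ?_, fun h h' => ?_, fun h => ?_, fun h => ?_⟩
    · linarith [g1 h]
    · linarith [g2 h (Or.inr (by linarith))]
    · rw [g3 h]
    · linarith [g4 h]
  -- All that concerns `R₁` and the first threshold is independent of the case; only the second
  -- threshold and its properties are left open.
  have finish : ∀ lam₂, _ → _ → _ → _ → ThresholdStatement r₁ r₂ (D - (r₁ + r₂))
      (Metric.ball (pt 0 0) r₁) (Metric.ball (pt D 0) r₂) (twoDisks r₁ r₂ D) :=
    fun lam₂ k1 k2 k3 k4 => ⟨R₁, lam₁, lam₂, _,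
      ⟨C₁.critical_le, by rw [C₁.eq, twoDisks_perimeter h2 hle hD],
        by rw [twoDisks_perimeter h2 hle hD]; exact C₁.unique⟩,
      hlam, f1, f2.le, f3, f4, hcomp, f5, hR0.trans c4.symm, c4.trans hd, C₁.critical_lt,
      k1, k2, rfl, k3, k4⟩
  -- The first case says exactly that the level for `R₂` exceeds the perimeter of the hull. In the
  -- second case the first threshold is below `r₂ / 2`, and the new one lies between `r₂ / 2` and
  -- `r₁ / 2`, which yields the order of the thresholds.
  rcases lt_or_ge (r₁ / 2) (Real.pi * (r₁ ^ 2 + r₂ ^ 2) / hullPer r₁ r₂ D) with hi | hii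
  · have hT1 : hullPer r₁ r₂ D < 2 * (Real.pi * (r₁ ^ 2 + r₂ ^ 2)) / r₁ := by
      rw [lt_div_iff₀ hhp] at hi
      rw [lt_div_iff₀ h1]
      linarith
    have hr12 := mul_le_mul_of_nonneg_left hle h2.le
    have hT2 : 2 * (Real.pi * (r₁ ^ 2 + r₂ ^ 2)) / r₁ ≤ 2 * (Real.pi * (r₁ + r₂)) := by
      rw [div_le_iff₀ h1]
      have := mul_le_mul_of_nonneg_left hr12 hpi.le
      linarith
    have hTeq : 2 * (Real.pi * (r₁ ^ 2 + r₂ ^ 2)) / r₁ = 2 * (Real.pi * (r₁ + r₂)) ↔ r₁ = r₂ := by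
      rw [div_eq_iff h1.ne']
      refine ⟨fun h => ?_, fun h => by rw [h]; ring⟩
      have h3 : Real.pi * r₂ * (r₁ - r₂) = 0 := by linarith
      rcases mul_eq_zero.1 h3 with h4 | h4
      · exact absurd h4 (by positivity)
      · linarith
    obtain ⟨R₂, C₂⟩ := exists_closingRadius h2 hle hD hT1 hT2
    have hRR := C₁.mono C₂ h2 hle hD hT2 (hhp.trans hT1) le_rfl
    have hR₂ := hR₁.trans hRR
    obtain ⟨t1, t2⟩ := threshold_compare h2 hle hR₁ hRR
    obtain ⟨u1, u2, u3, u4, u5, -⟩ := threshold_facts hR₂ hP1 hA1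
    have hvol : perimeter (Metric.ball (pt 0 0) r₁)
        * (volume (twoDisks r₁ r₂ D) / volume (Metric.ball (pt 0 0) r₁))
        = ENNReal.ofReal (2 * (Real.pi * (r₁ ^ 2 + r₂ ^ 2)) / r₁) := by
      rw [(ball_pt_perimeter h1).1, (ball_pt_perimeter h1).2, twoDisks,
        (union_ball_perimeter h1 h2 hD).2, ← ENNReal.ofReal_div_of_pos (by positivity),
        ← ENNReal.ofReal_mul (by positivity)]
      congr 1
      field_simp
    have hquot : (2 / r₁ = 2 / r₂) ↔ r₁ = r₂ := by
      rw [div_eq_div_iff h1.ne' h2.ne']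
      constructor <;> intro h <;> linarith
    have hReq : R₁ = R₂ ↔ r₁ = r₂ := by
      rw [← hTeq]
      constructor
      · intro h
        have := C₂.eq
        rw [← h, C₁.eq] at this
        exact ((ENNReal.ofReal_eq_ofReal_iff (by positivity) (by positivity)).1 this).symm
      · intro h
        refine C₂.unique _ C₁.critical_le ?_
        rw [h, C₁.eq]
    refine finish (R₂ * area (Metric.ball (pt 0 0) r₁) / (R₂ * per (Metric.ball (pt 0 0) r₁)
      + area (Metric.ball (pt 0 0) r₁))) (fun _ => ⟨R₂, ⟨C₂.critical_le, ?_, ?_⟩, rfl, ?_, u2.le,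
      u3, ?_, fun l s hl hs hsl => ?_, ?_, ?_, ?_, fun h => ?_⟩) (fun h => ?_) ?_ ?_
    · rw [hvol, C₂.eq]
    · rw [hvol]
      exact C₂.unique
    · rw [hlam', ball_threshold 0 h1 hR₂]
      exact t1
    · exact (u4 _ u3.ne').2 rfl
    · obtain ⟨V, e, g1, g2, g3, g4⟩ := C₂.compare h2 hle hD hT1 hP1 hA1 hl hs hsl
      have hsv : (1 - s) / l = 2 / r₁ := by
        rw [hsl, ball_quotient h1]
        field_simp
        ring
      have e1 : 2 / r₁ * (Real.pi * (r₁ ^ 2 + r₂ ^ 2))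
          = 2 * (Real.pi * (r₁ ^ 2 + r₂ ^ 2)) / r₁ := by ring
      have e2 : 2 * (Real.pi * r₁) - 2 / r₁ * (Real.pi * r₁ ^ 2) = 0 := by
        field_simp
        ring
      rw [e, energy_left h2 hle, EReal.coe_le_coe_iff, EReal.coe_lt_coe_iff,
        EReal.coe_lt_coe_iff, EReal.coe_eq_coe_iff, hsv, e1, e2]
      refine ⟨fun h => ?_, fun h h' => ?_, fun h => ?_, fun h => ?_⟩
      · linarith [g1 h]
      · refine sub_pos.2 (g2 h (h'.imp (fun h3 => ?_) fun h3 => by linarith))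
        exact lt_of_le_of_ne hT2 fun h4 => h3.ne' (hTeq.1 h4)
      · rw [g3 h, sub_self]
      · linarith [g4 h]
    · rw [ball_quotient h1, ball_quotient h2, hquot, hReq]
    · rw [hlam', ball_threshold 0 h1 hR₂]
      refine ⟨fun h => ?_, t2⟩
      rw [← h, hReq.1 h]
    · rw [ball_quotient h1, ball_quotient h2, hquot, C₂.eq_zero_iff, c4, hTeq]
    · have h0 : R₁ = 0 := le_antisymm (hRR.trans h.le) hR₁
      rw [hlam, h0, h]
      simp
    · rw [hqS, ball_quotient' h1] at h
      exact absurd hi (not_lt.2 h)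
    · rw [hlam', ball_threshold 0 h1 hR₂]
      exact t1
    · exact u2.le.trans (le_max_left _ _)
  · have hii' : Real.pi * (r₁ ^ 2 + r₂ ^ 2) ≤ r₁ / 2 * hullPer r₁ r₂ D := by
      rwa [div_le_iff₀ hhp] at hii
    obtain ⟨lam, g1, g2, g3, g4, g5, g6⟩ := exists_gamma_threshold h2 hle hD hP hii'
    refine finish lam (fun h => ?_) (fun _ => ⟨g3, ?_, ?_, ?_⟩) ?_ ?_
    · rw [hqS, ball_quotient' h1] at h
      exact absurd h (not_lt.2 hii)
    · rw [per_ball h1]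
      exact g4
    · rw [per_ball h1]
      exact fun h => g5 (h.imp_left sub_pos.1)
    · rw [per_ball h1, area_ball h2, per_convexHull h2 hle hD]
      exact g6
    · refine f2.le.trans ?_
      rw [ball_quotient' h2]
      exact g1
    · refine le_trans ?_ (le_max_left _ _)
      rw [ball_quotient' h1]
      exact g2

end Thresholds

/-! ### Invariance under rigid motions -/

section RigidMotions

variable (e : Plane ≃ᵃⁱ[ℝ] Plane)

lemma apply_eq_add (x : Plane) : e x = e 0 + e.linearIsometryEquiv x := by
  have := e.map_vadd 0 x
  rw [vadd_eq_add, vadd_eq_add, add_zero] at this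
  rw [this, add_comm]

lemma measurePreserving_rigid : MeasurePreserving e volume volume := by
  have h := (measurePreserving_add_left volume (e 0)).comp e.linearIsometryEquiv.measurePreserving
  exact (funext fun x => apply_eq_add e x : (e : Plane → Plane) = _) ▸ h

lemma measurableEmbedding_rigid : MeasurableEmbedding e :=
  e.toHomeomorph.measurableEmbedding

lemma volume_image (X : Set Plane) : volume (e '' X) = volume X := by
  rw [← (measurePreserving_rigid e).measure_preimage_emb (measurableEmbedding_rigid e),
    preimage_image_eq _ e.injective]

lemma symm_image_image (X : Set Plane) : e.symm '' (e '' X) = X := by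
  rw [← image_comp]
  simp

lemma image_symm_image (X : Set Plane) : e '' (e.symm '' X) = X := by
  rw [← image_comp]
  simp

/-- The trace is independent of the basis, which makes the divergence invariant under conjugation
with an isometry. -/
lemma divergence_eq_trace (z : Plane → Plane) (x : Plane) :
    divergence z x = LinearMap.trace ℝ Plane (fderiv ℝ z x : Plane →ₗ[ℝ] Plane) := by
  rw [LinearMap.trace_eq_sum_inner _ (EuclideanSpace.basisFun (Fin 2) ℝ), divergence]
  refine Finset.sum_congr rfl fun i _ => ?_
  simp [EuclideanSpace.inner_single_left]

lemma divergence_conj {z : Plane → Plane} (hz : Differentiable ℝ z) (x : Plane) :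
    divergence (fun x => e.linearIsometryEquiv.symm (z (e x))) x = divergence z (e x) := by
  set L := e.linearIsometryEquiv
  have h1 : HasFDerivAt e (L : Plane →L[ℝ] Plane) x := by
    have := ((L : Plane →L[ℝ] Plane).hasFDerivAt (x := x)).const_add (e 0)
    exact this.congr_of_eventuallyEq (Eventually.of_forall fun y => apply_eq_add e y)
  have h2 : HasFDerivAt (fun x => L.symm (z (e x)))
      ((L.symm : Plane →L[ℝ] Plane).comp ((fderiv ℝ z (e x)).comp (L : Plane →L[ℝ] Plane))) x :=
    (L.symm : Plane →L[ℝ] Plane).hasFDerivAt.comp x ((hz (e x)).hasFDerivAt.comp x h1)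
  rw [divergence_eq_trace, divergence_eq_trace, h2.fderiv]
  exact LinearMap.trace_conj' (fderiv ℝ z (e x) : Plane →ₗ[ℝ] Plane) L.symm.toLinearEquiv

/-- A test field on the image is pulled back to the field obtained by composing with the motion and
undoing its linear part; norm bound, support and divergence are preserved. The reverse inequality
for the perimeter comes from the inverse motion. -/
lemma variationIndicator_image_le (E : Set Plane) :
    variationIndicator (e '' E) ≤ variationIndicator E := by
  refine iSup_le fun z => iSup_le fun hz => iSup_le fun hc => iSup_le fun hn => ?_
  have hcont : ContDiff ℝ ∞ e := by
    rw [(funext fun x => apply_eq_add e x : (e : Plane → Plane) = _)]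
    exact contDiff_const.add e.linearIsometryEquiv.contDiff
  rw [(measurePreserving_rigid e).setIntegral_image_emb (measurableEmbedding_rigid e)]
  simp_rw [← divergence_conj e (hz.differentiable (by simp))]
  refine le_iSup_of_le (fun x => e.linearIsometryEquiv.symm (z (e x)))
    (le_iSup_of_le (e.linearIsometryEquiv.symm.contDiff.comp (hz.comp hcont))
      (le_iSup_of_le ?_ (le_iSup_of_le (fun x => ?_) le_rfl)))
  · exact (hc.comp_homeomorph e.toHomeomorph).comp_left (map_zero e.linearIsometryEquiv.symm)
  · rw [LinearIsometryEquiv.norm_map]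
    exact hn _

lemma nullMeasurableSet_image {E : Set Plane} (h : NullMeasurableSet E (volume : Measure Plane)) :
    NullMeasurableSet (e '' E) (volume : Measure Plane) := by
  have : e '' E = e.symm ⁻¹' E := by
    ext x
    constructor
    · rintro ⟨y, hy, rfl⟩
      simpa using hy
    · intro hx
      exact ⟨e.symm x, hx, e.apply_symm_apply x⟩
  rw [this]
  exact h.preimage (measurePreserving_rigid e.symm).quasiMeasurePreserving

lemma perimeter_image_le (E : Set Plane) : perimeter (e '' E) ≤ perimeter E := by
  unfold perimeter
  by_cases h : NullMeasurableSet E (volume : Measure Plane) ∧ volume E < ⊤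
  · rw [if_pos h, if_pos ⟨nullMeasurableSet_image e h.1, by rw [volume_image]; exact h.2⟩]
    exact variationIndicator_image_le e E
  · rw [if_neg h]
    exact le_top

lemma perimeter_image (E : Set Plane) : perimeter (e '' E) = perimeter E := by
  refine (perimeter_image_le e E).antisymm ?_
  have := perimeter_image_le e.symm (e '' E)
  rwa [symm_image_image] at this

lemma per_image (E : Set Plane) : per (e '' E) = per E := by rw [per, per, perimeter_image]

lemma area_image (E : Set Plane) : area (e '' E) = area E := by rw [area, area, volume_image]

lemma image_opening_subset (l : ℝ) (X : Set Plane) : e '' opening l X ⊆ opening l (e '' X) := by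
  rintro _ ⟨w, hw, rfl⟩
  obtain ⟨p, hp, hwp⟩ := mem_opening.1 hw
  refine mem_opening.2 ⟨e p, fun v hv => ⟨e.symm v, hp ?_, e.apply_symm_apply v⟩, by
    rwa [e.dist_map]⟩
  rw [Metric.mem_ball] at hv ⊢
  rwa [← e.dist_map, e.apply_symm_apply]

lemma opening_image (l : ℝ) (X : Set Plane) : opening l (e '' X) = e '' opening l X := by
  refine Subset.antisymm ?_ (image_opening_subset e l X)
  have := image_mono (f := e) (image_opening_subset e.symm l (e '' X))
  rwa [symm_image_image, image_symm_image] at this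

lemma closing_image (l : ℝ) (X : Set Plane) : closing l (e '' X) = e '' closing l X := by
  unfold closing
  split_ifs
  · rw [← image_compl_eq e.bijective, opening_image, image_compl_eq e.bijective]
  · rfl

lemma convexHull_image (X : Set Plane) : convexHull ℝ (e '' X) = e '' convexHull ℝ X :=
  (e.toAffineEquiv.toAffineMap.image_convexHull X).symm

lemma closingQuot_image (l s : ℝ) (X : Set Plane) :
    closingQuot l s (e '' X) = e '' closingQuot l s X := by
  unfold closingQuot
  split_ifs
  · exact convexHull_image e X
  · exact closing_image e _ X

lemma gammaSeq_image (S : Set Plane) (s l : ℝ) (k : ℕ) :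
    gammaSeq (e '' S) s l k = e '' gammaSeq S s l k := by
  induction k with
  | zero => exact closingQuot_image e l s S
  | succ k ih =>
    rw [gammaSeq, gammaSeq, ih, opening_image, ← image_inter e.injective, closingQuot_image]

lemma gammaSet_image (S : Set Plane) (s l : ℝ) :
    gammaSet (e '' S) s l = e '' gammaSet S s l := by
  rw [gammaSet, gammaSet, image_iInter e.bijective]
  simp_rw [gammaSeq_image]

lemma criticalRadius_image (S : Set Plane) : criticalRadius (e '' S) = criticalRadius S := by
  unfold criticalRadius
  congr 1
  ext r
  simp only [mem_ofPred_eq, closing_image]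
  exact and_congr_right fun _ => e.toHomeomorph.isConnected_image

lemma closingEnergy_image (S : Set Plane) (r : ℝ) :
    closingEnergy (e '' S) r = closingEnergy S r := by
  rw [closingEnergy, closingEnergy, closing_image, perimeter_image, ← image_sdiff e.injective,
    volume_image]

lemma energy_image (S : Set Plane) (s l : ℝ) (X : Set Plane) :
    energy (e '' S) s l (e '' X) = energy S s l X := by
  rw [energy, energy, perimeter_image, ← image_sdiff e.injective, ← image_inter e.injective,
    volume_image, volume_image]

lemma thresholdStatement_image {r₁ r₂ d : ℝ} {S₁ S₂ S : Set Plane}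
    (h : ThresholdStatement r₁ r₂ d S₁ S₂ S) :
    ThresholdStatement r₁ r₂ d (e '' S₁) (e '' S₂) (e '' S) := by
  unfold ThresholdStatement at h ⊢
  simpa only [per_image, area_image, perimeter_image, volume_image, closingQuot_image,
    criticalRadius_image, closingEnergy_image, energy_image, convexHull_image, gammaSet_image,
    ← image_inter e.injective] using h

/-- A rigid motion that takes the axis to a given line. -/
lemma exists_rigid (c₁ c₂ : Plane) :
    ∃ e : Plane ≃ᵃⁱ[ℝ] Plane, e (pt 0 0) = c₁ ∧ e (pt (dist c₁ c₂) 0) = c₂ := by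
  have hn : ‖pt (dist c₁ c₂) 0‖ = ‖c₂ - c₁‖ := by
    rw [← dist_eq_norm, dist_comm c₂, EuclideanSpace.norm_eq, Fin.sum_univ_two, pt_zero, pt_one]
    simp
  have h0 : pt 0 0 = 0 := by
    ext i
    fin_cases i <;> rfl
  -- The reflection that exchanges the two vectors `pt (dist c₁ c₂) 0` and `c₂ - c₁` of equal norm,
  -- followed by the translation by `c₁`. If the vectors coincide, the reflection is the identity.
  refine ⟨(Submodule.reflection (Submodule.span ℝ {pt (dist c₁ c₂) 0 - (c₂ - c₁)})ᗮ
    ).toAffineIsometryEquiv.trans (AffineIsometryEquiv.constVAdd ℝ Plane c₁), ?_, ?_⟩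
  · rw [h0]
    simp
  · simp [Submodule.reflection_sub hn]

end RigidMotions

/-! ### The theorem for disks in arbitrary position -/

theorem mainTheorem4 (c₁ c₂ : Plane) (r₁ r₂ d : ℝ) (S₁ S₂ S : Set Plane)
    (hr₂ : 0 < r₂) (hr : r₂ ≤ r₁)
    (hd : d = dist c₁ c₂ - (r₁ + r₂)) (hd0 : 0 ≤ d)
    (hS₁ : S₁ = Metric.ball c₁ r₁) (hS₂ : S₂ = Metric.ball c₂ r₂) (hS : S = S₁ ∪ S₂)
    (hP : perimeter (convexHull ℝ S) < perimeter S) :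
    ∃ R₁ lam₁ lam₂ lam₃ : ℝ,
      -- part (a): the radius `R₁`
      (criticalRadius S ≤ R₁ ∧ closingEnergy S R₁ = perimeter S ∧
        ∀ R : ℝ, criticalRadius S ≤ R → closingEnergy S R = perimeter S → R = R₁) ∧
      -- the threshold `lam₁`
      lam₁ = R₁ * area S₂ / (R₁ * per S₂ + area S₂) ∧
      0 ≤ lam₁ ∧ lam₁ ≤ area S₂ / per S₂ ∧
      0 < 1 - lam₁ * (per S₂ / area S₂) ∧
      (∀ l : ℝ, 1 - l * (per S₂ / area S₂) ≠ 0 →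
        (l / (1 - l * (per S₂ / area S₂)) = R₁ ↔ l = lam₁)) ∧
      -- comparison of the closing with `S` along `s = 1 - l * P(S₂) / |S₂|`
      (∀ l s : ℝ, 0 < l → 0 ≤ s → s = 1 - l * (per S₂ / area S₂) →
        (l < lam₁ → energy S s l S ≤ energy S s l (closingQuot l s S)) ∧
        (l < lam₁ → d / 2 < l / s → energy S s l S < energy S s l (closingQuot l s S)) ∧
        (l = lam₁ → energy S s l (closingQuot l s S) = energy S s l S) ∧
        (lam₁ < l → energy S s l (closingQuot l s S) < energy S s l S)) ∧
      (lam₁ = 0 ↔ R₁ = 0) ∧ (R₁ = 0 ↔ criticalRadius S = 0) ∧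
      (criticalRadius S = 0 ↔ d = 0) ∧
      (0 < criticalRadius S → criticalRadius S < R₁) ∧
      -- part (b), first case
      (area S₁ / per S₁ < area S / per (convexHull ℝ S) →
        ∃ R₂ : ℝ,
          (criticalRadius S ≤ R₂ ∧
            closingEnergy S R₂ = perimeter S₁ * (volume S / volume S₁) ∧
            ∀ R : ℝ, criticalRadius S ≤ R →
              closingEnergy S R = perimeter S₁ * (volume S / volume S₁) → R = R₂) ∧
          lam₂ = R₂ * area S₁ / (R₂ * per S₁ + area S₁) ∧
          lam₁ ≤ lam₂ ∧ lam₂ ≤ area S₁ / per S₁ ∧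
          0 < 1 - lam₂ * (per S₁ / area S₁) ∧
          lam₂ / (1 - lam₂ * (per S₁ / area S₁)) = R₂ ∧
          -- comparison of the closing with `S₁` along `s = 1 - l * P(S₁) / |S₁|`
          (∀ l s : ℝ, 0 < l → 0 ≤ s → s = 1 - l * (per S₁ / area S₁) →
            (l < lam₂ → energy S s l S₁ ≤ energy S s l (closingQuot l s S)) ∧
            (l < lam₂ → (r₂ < r₁ ∨ d / 2 < l / s) →
              energy S s l S₁ < energy S s l (closingQuot l s S)) ∧
            (l = lam₂ → energy S s l (closingQuot l s S) = energy S s l S₁) ∧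
            (lam₂ < l → energy S s l (closingQuot l s S) < energy S s l S₁)) ∧
          (R₁ = R₂ ↔ per S₁ / area S₁ = per S₂ / area S₂) ∧
          (R₁ = R₂ ↔ lam₁ = lam₂) ∧
          (R₂ = 0 ↔ criticalRadius S = 0 ∧ per S₁ / area S₁ = per S₂ / area S₂) ∧
          (R₂ = 0 → R₁ = 0 ∧ lam₁ = 0 ∧ lam₂ = 0)) ∧
      -- part (b), second case
      (area S / per (convexHull ℝ S) ≤ area S₁ / per S₁ →
        IsLeast {l : ℝ | 0 < l ∧ energy S 0 l (gammaSet S 0 l) = energy S 0 l S₁} lam₂ ∧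
        (∀ l : ℝ, 0 < l →
          l = area (gammaSet S 0 l ∩ S₂) / (per (gammaSet S 0 l) - per S₁) → l = lam₂) ∧
        ((0 < d ∨ r₁ < 8 * r₂) →
          per S₁ < per (gammaSet S 0 lam₂) ∧
          lam₂ = area (gammaSet S 0 lam₂ ∩ S₂) / (per (gammaSet S 0 lam₂) - per S₁)) ∧
        (area S₂ / (per (convexHull ℝ S) - per S₁) ≤ r₂ →
          lam₂ = area S₂ / (per (convexHull ℝ S) - per S₁))) ∧
      -- part (c), and the order of the thresholds
      lam₃ = max (area S₁ / per S₁) (area S / per (convexHull ℝ S)) ∧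
      lam₁ ≤ lam₂ ∧ lam₂ ≤ lam₃ := by
  subst hS hS₁ hS₂ hd
  -- All quantities in the hypotheses and the conclusion are invariant under rigid motions, so the
  -- centres may be placed on the axis.
  obtain ⟨e, he1, he2⟩ := exists_rigid c₁ c₂
  have hD : r₁ + r₂ ≤ dist c₁ c₂ := by linarith
  have hb : ∀ (x : Plane) (r : ℝ), Metric.ball (e x) r = e '' Metric.ball x r := fun x r =>
    (e.toIsometryEquiv.image_ball x r).symm
  have e1 : Metric.ball c₁ r₁ = e '' Metric.ball (pt 0 0) r₁ := by rw [← hb, he1]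
  have e2 : Metric.ball c₂ r₂ = e '' Metric.ball (pt (dist c₁ c₂) 0) r₂ := by rw [← hb, he2]
  have e3 : Metric.ball c₁ r₁ ∪ Metric.ball c₂ r₂ = e '' twoDisks r₁ r₂ (dist c₁ c₂) := by
    rw [e1, e2, ← image_union, twoDisks]
  rw [e3, convexHull_image, perimeter_image, perimeter_image,
    convexHull_twoDisks_perimeter hr₂ hr hD, twoDisks_perimeter hr₂ hr hD] at hP
  have hP' := (ENNReal.ofReal_lt_ofReal_iff_of_nonneg (hullPer_pos hr₂ hr hD).le).1 hP
  have key := thresholdStatement_image e (thresholdStatement_twoDisks hr₂ hr hD hP')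
  rw [← e3, ← e1, ← e2] at key
  exact key
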